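/- **Setting.** Let $n\ge 0$ be the spacetime dimension and consider finitely many exterior form gauge fields $B^a=\sum_{\mu_1<\dots<\mu_{p_a}}B^a_{\mu_1\dots\mu_{p_a}}dx^{\mu_1}\cdots dx^{\mu_{p_a}}$ of degrees $p_a\ge 1$. Local forms are spacetime forms whose coefficients are polynomials in the independent components $B^a_{\mu_1\dots\mu_{p_a}}$ and their partial derivatives of all orders (commuting independent variables), with no explicit dependence on the coordinates $x^\mu$; the exterior derivative is $d=\sum_\mu dx^\mu\partial_\mu$ with $\partial_\mu$ the total derivative. The *small algebra* $\mathcal A$ (in ghost number zero) is the algebra generated, in the exterior product, by the forms $B^a$ and $dB^a$, with constant forms (exterior polynomials in the $dx^\mu$ with constant coefficients) as coefficients. Consider the following four models (products are exterior products): 1. a $p$-form $A$ and a $(p+1)$-form $B$ ($p\ge1$), with curvatures $F=dA+B$, $H=dB$; 2. a $1$-form $A$ and a $2r$-form $B$ ($r\ge1$), with $F=dA$, $H=dB+F^rA$; 3. a $1$-form $A$, a $2$-form $B$ and a $3$-form $C$, with $F=dA+B$, $H=dB$, $G=dC+A\,dB+\tfrac12B^2$; 4. an $SU(N)$ Yang–Mills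 connection $A=\sum_aA^aT_a$ ($N\ge2$, $(T_a)$ a basis of $\mathfrak{su}(N)$) and a $2$-form $B$, with $F=dA+A^2$, $H=dB+\tfrac12\operatorname{tr}\bigl(A\,dA+\tfrac23A^3\bigr)$. The coefficients of polynomials and of constant forms are taken in an arbitrary field of characteristic $0$ in models 1–3, and in $\mathbb C$ in model 4. A *gauge-invariant polynomial* is a local form whose components are, in models 1–3, polynomials in the components of the curvatures and their partial derivatives, and, in model 4, $SU(N)$-invariant polynomials in the components of $F$ and their iterated covariant derivatives ($D_\mu X=\partial_\mu X+[A_\mu,X]$) and in the components of $H$ and their partial derivatives. **Theorem.** In each of these four models, let $P$ be a gauge-invariant polynomial all of whose homogeneous parts have form degree strictly smaller than $n$. Then $dP=0$ if and only if $$P=Q+dR,\qquad dQ=0,$$ for some gauge-invariant polynomials $Q$ and $R$, where $Q$ belongs to $\mathcal A$ and has only parts of form degree smaller than $n$. Moreover, if a gauge-invariant polynomial $Q\in\mathcal A$ with only parts of form degree smaller than $n$ is of the form $Q=dS$ with $S$ a gauge-invariant polynomial, then $Q=dS'$ for some gauge-invariant polynomial $S'\in\mathcal A$. Thus, in form degree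 smaller than $n$, the invariant cohomology of $d$ can be computed in the small algebra. -/

import Mathlib

open scoped TensorProduct

noncomputable section

namespace ChaplineManton

/-! ### Local forms

Spacetime is `n`-dimensional and there is a family of exterior form fields, labelled by `ι`, the
field `a` being a form of degree `deg a`.  Gauge invariant polynomials have ghost number zero, so
only the fields of ghost number zero (the potentials) are needed; they commute. -/

section Forms

variable (K : Type*) [Field K] (n : ℕ) {ι : Type*} (deg : ι → ℕ)

/-- The independent components of the fields: the component of the field `a` with increasing
spacetime indices `μ₁ < ... < μ_{deg a}`, recorded as the set of these indices. -/
abbrev FieldComponent : Type _ := Σ a : ι, {S : Finset (Fin n) // S.card = deg a}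

/-- The jet variables: the partial derivatives `∂^α φ` of the field components `φ`,
where `α` is a multi-index (`α = 0` is `φ` itself). -/
abbrev JetVar : Type _ := FieldComponent n deg × (Fin n →₀ ℕ)

/-- Polynomials in the field components and their derivatives,
without explicit dependence on the spacetime coordinates. -/
abbrev JetPoly : Type _ := MvPolynomial (JetVar n deg) K

/-- The exterior algebra of constant forms, generated by `dx^1, ..., dx^n`. -/
abbrev ConstForm : Type _ := ExteriorAlgebra K (Fin n → K)

/-- Spacetime forms whose coefficients are polynomials in the field components and their
derivatives, with the exterior product as multiplication. -/
abbrev LocalForm : Type _ := ConstForm K n ⊗[K] JetPoly K n deg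

variable {n}

/-- The constant one-form `dx^μ`. -/
def dx (μ : Fin n) : ConstForm K n := ExteriorAlgebra.ι K (Pi.single μ 1)

/-- `dx^{μ₁} ∧ ... ∧ dx^{μ_k}` for `S = {μ₁ < ... < μ_k}`. -/
def dxSet (S : Finset (Fin n)) : ConstForm K n := ((S.sort (· ≤ ·)).map (dx K)).prod

/-- The total derivative `∂_μ`: the derivation with `∂_μ (∂^α φ) = ∂^(α + e_μ) φ`. -/
def totalDeriv (μ : Fin n) : Derivation K (JetPoly K n deg) (JetPoly K n deg) :=
  MvPolynomial.mkDerivation K fun v => MvPolynomial.X (v.1, v.2 + Finsupp.single μ 1)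

/-- The exterior derivative `d = ∑_μ dx^μ ∂_μ`. -/
def extD : LocalForm K n deg →ₗ[K] LocalForm K n deg :=
  ∑ μ : Fin n, TensorProduct.map (LinearMap.mulLeft K (dx K μ)) (totalDeriv K deg μ).toLinearMap

/-- The field `a` as a form, `∑_{μ₁ < ... < μ_p} φ_{μ₁...μ_p} dx^{μ₁} ∧ ... ∧ dx^{μ_p}`
with `p = deg a`. -/
def fieldForm (a : ι) : LocalForm K n deg :=
  ∑ S : {S : Finset (Fin n) // S.card = deg a},
    dxSet K S.1 ⊗ₜ[K] (MvPolynomial.X (⟨a, S⟩, 0) : JetPoly K n deg)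

/-- The component of a form along a linear functional `f` on the constant forms.  For `f` in the
basis dual to the `dx^{μ₁} ∧ ... ∧ dx^{μ_k}` these are the usual components, and the other ones
are linear combinations of these with coefficients in `K`. -/
def component (f : Module.Dual K (ConstForm K n)) :
    LocalForm K n deg →ₗ[K] JetPoly K n deg :=
  (TensorProduct.lid K (JetPoly K n deg)).toLinearMap ∘ₗ LinearMap.rTensor (JetPoly K n deg) f

/-- Local forms of form degree `k`. -/
def formsOfDegree (k : ℕ) : Submodule K (LocalForm K n deg) :=
  LinearMap.range (LinearMap.rTensor (JetPoly K n deg) (⋀[K]^k (Fin n → K)).subtype)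

/-- Local forms all of whose homogeneous parts have form degree smaller than the spacetime
dimension `n`. -/
def formsBelowTop : Submodule K (LocalForm K n deg) := ⨆ k : Fin n, formsOfDegree K deg k

/-- The part of ghost number zero of the small algebra: the algebra generated, in the exterior
product, by the potentials and their exterior derivatives, with constant forms as coefficients. -/
def smallAlgebra : Subalgebra K (LocalForm K n deg) :=
  Algebra.adjoin K
    (Set.range (fun μ : Fin n => dx K μ ⊗ₜ[K] (1 : JetPoly K n deg)) ∪
      Set.range (fieldForm K deg) ∪ Set.range fun a => extD K deg (fieldForm K deg a))

/-- The forms all of whose components belong to `I`. -/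
def formsWithCoeffs (I : Subalgebra K (JetPoly K n deg)) : Submodule K (LocalForm K n deg) where
  carrier := {ω | ∀ f, component K deg f ω ∈ I}
  add_mem' h₁ h₂ f := by simpa only [map_add] using I.add_mem (h₁ f) (h₂ f)
  zero_mem' f := by simpa only [map_zero] using I.zero_mem
  smul_mem' c ω h f := by simpa only [map_smul] using I.smul_mem (h f) c

/-- The polynomials in the components of the given forms (the curvatures) and their
derivatives. -/
def curvatureAlgebra (curv : Set (LocalForm K n deg)) : Subalgebra K (JetPoly K n deg) :=
  Algebra.adjoin K
    {x | ∃ H ∈ curv, ∃ (f : Module.Dual K (ConstForm K n)) (l : List (Fin n)),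
      x = l.foldr (fun μ y => totalDeriv K deg μ y) (component K deg f H)}

/-- The invariant cohomology of `d` below the top form degree is to be found in the small algebra;
`I` is the algebra of gauge invariant polynomials of form degree zero, so that
`formsWithCoeffs K deg I` is the space of all gauge invariant polynomials.

* A gauge invariant `P` is closed if and only if `P = Q + dR` with `R` gauge invariant and `Q`
  closed, gauge invariant and in the small algebra.
* If a (closed) gauge invariant `Q` in the small algebra is `dS` with `S` gauge invariant, then
  it is `dS'` with `S'` gauge invariant and in the small algebra. -/
def InvariantCohomologyInSmallAlgebra (I : Subalgebra K (JetPoly K n deg)) : Prop :=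
  (∀ P ∈ formsWithCoeffs K deg I, P ∈ formsBelowTop K deg →
    (extD K deg P = 0 ↔
      ∃ Q ∈ formsWithCoeffs K deg I, ∃ R ∈ formsWithCoeffs K deg I,
        Q ∈ smallAlgebra K deg ∧ Q ∈ formsBelowTop K deg ∧ extD K deg Q = 0 ∧
          P = Q + extD K deg R)) ∧
  (∀ Q ∈ formsWithCoeffs K deg I, Q ∈ smallAlgebra K deg → Q ∈ formsBelowTop K deg →
    (∃ S ∈ formsWithCoeffs K deg I, Q = extD K deg S) →
      ∃ S' ∈ formsWithCoeffs K deg I, S' ∈ smallAlgebra K deg ∧ Q = extD K deg S')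

end Forms

/-! ### Model 1: a `p`-form `A` and a `(p+1)`-form `B`, with `F = dA + B`, `H = dB` -/

section Model1

variable (K : Type*) [Field K] (n p : ℕ)

abbrev deg1 : Fin 2 → ℕ := ![p, p + 1]

def F1 : LocalForm K n (deg1 p) :=
  extD K (deg1 p) (fieldForm K (deg1 p) 0) + fieldForm K (deg1 p) 1

def H1 : LocalForm K n (deg1 p) := extD K (deg1 p) (fieldForm K (deg1 p) 1)

/-- The gauge invariant polynomials of form degree zero. -/
def inv1 : Subalgebra K (JetPoly K n (deg1 p)) :=
  curvatureAlgebra K (deg1 p) {F1 K n p, H1 K n p}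

end Model1

/-! ### Model 2: a one-form `A` and a `2r`-form `B`, with `F = dA`, `H = dB + F^r A` -/

section Model2

variable (K : Type*) [Field K] (n r : ℕ)

abbrev deg2 : Fin 2 → ℕ := ![1, 2 * r]

def F2 : LocalForm K n (deg2 r) := extD K (deg2 r) (fieldForm K (deg2 r) 0)

def H2 : LocalForm K n (deg2 r) :=
  extD K (deg2 r) (fieldForm K (deg2 r) 1) + F2 K n r ^ r * fieldForm K (deg2 r) 0

/-- The gauge invariant polynomials of form degree zero. -/
def inv2 : Subalgebra K (JetPoly K n (deg2 r)) :=
  curvatureAlgebra K (deg2 r) {F2 K n r, H2 K n r}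

end Model2

/-! ### Model 3: a one-form `A`, a two-form `B` and a three-form `C`, with
`F = dA + B`, `H = dB`, `G = dC + A dB + (1/2) B²` -/

section Model3

variable (K : Type*) [Field K] (n : ℕ)

abbrev deg3 : Fin 3 → ℕ := ![1, 2, 3]

def F3 : LocalForm K n deg3 := extD K deg3 (fieldForm K deg3 0) + fieldForm K deg3 1

def H3 : LocalForm K n deg3 := extD K deg3 (fieldForm K deg3 1)

def G3 : LocalForm K n deg3 :=
  extD K deg3 (fieldForm K deg3 2) +
    fieldForm K deg3 0 * extD K deg3 (fieldForm K deg3 1) +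
      (1 / 2 : K) • fieldForm K deg3 1 ^ 2

/-- The gauge invariant polynomials of form degree zero. -/
def inv3 : Subalgebra K (JetPoly K n deg3) :=
  curvatureAlgebra K deg3 {F3 K n, H3 K n, G3 K n}

end Model3

/-! ### Model 4: an `SU(N)` Yang-Mills connection `A` and a two-form `B`, with
`F = dA + A²`, `H = dB + (1/2) tr (A dA + (2/3) A³)` -/

section Model4

/-- The Lie algebra of `SU(N)`: traceless anti-Hermitian complex `N × N` matrices. -/
def su (N : ℕ) : Submodule ℝ (Matrix (Fin N) (Fin N) ℂ) where
  carrier := {X | X.conjTranspose = -X ∧ X.trace = 0}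
  add_mem' := by
    rintro X Y ⟨hX, hX'⟩ ⟨hY, hY'⟩
    refine ⟨?_, by simp [hX', hY']⟩
    rw [Matrix.conjTranspose_add, hX, hY, neg_add]
  zero_mem' := by simp
  smul_mem' := by
    rintro c X ⟨hX, hX'⟩
    refine ⟨?_, by simp [hX']⟩
    rw [Matrix.conjTranspose_smul, hX, smul_neg, star_trivial]

/-- The commutator `[X, Y]` in the Lie algebra `su N`. -/
def su.comm {N : ℕ} (X Y : su N) : su N :=
  ⟨X.1 * Y.1 - Y.1 * X.1, by
    have hX : X.1.conjTranspose = -X.1 := X.2.1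
    have hY : Y.1.conjTranspose = -Y.1 := Y.2.1
    refine ⟨?_, ?_⟩
    · rw [Matrix.conjTranspose_sub, Matrix.conjTranspose_mul,
        Matrix.conjTranspose_mul, hX, hY, neg_mul_neg, neg_mul_neg, neg_sub]
    · rw [Matrix.trace_sub, Matrix.trace_mul_comm, sub_self]⟩

variable (n : ℕ) {N : ℕ} {κ : Type*}

/-- The fields are the real one-forms `A^a`, `a : κ`, with `A = ∑ₐ A^a T_a` for a basis `T` of
`su N`, and the two-form `B`. -/
abbrev deg4 (κ : Type*) : κ ⊕ Unit → ℕ := Sum.elim (fun _ => 1) (fun _ => 2)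

variable [Fintype κ] (T : Module.Basis κ ℝ (su N))

/-- The matrix-valued one-form `A = ∑ₐ A^a T_a`. -/
def A4 : Matrix (Fin N) (Fin N) (LocalForm ℂ n (deg4 κ)) :=
  Matrix.of fun i j =>
    ∑ a, (T a : Matrix (Fin N) (Fin N) ℂ) i j • fieldForm ℂ (deg4 κ) (Sum.inl a)

/-- The curvature `F = dA + A²`. -/
def F4 : Matrix (Fin N) (Fin N) (LocalForm ℂ n (deg4 κ)) :=
  (A4 n T).map (extD ℂ (deg4 κ)) + A4 n T * A4 n T

/-- The Chern-Simons form `(1/2) tr (A dA + (2/3) A³)`. -/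
def chernSimons : LocalForm ℂ n (deg4 κ) :=
  (1 / 2 : ℂ) •
    (A4 n T * (A4 n T).map (extD ℂ (deg4 κ)) +
      (2 / 3 : ℂ) • (A4 n T * A4 n T * A4 n T)).trace

def H4 : LocalForm ℂ n (deg4 κ) :=
  extD ℂ (deg4 κ) (fieldForm ℂ (deg4 κ) (Sum.inr ())) + chernSimons n T

variable {n}

/-- The component `A_μ = ∑ₐ A^a_μ T_a` of the connection. -/
def gaugePotential (μ : Fin n) : Matrix (Fin N) (Fin N) (JetPoly ℂ n (deg4 κ)) :=
  Matrix.of fun i j =>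
    ∑ a, (T a : Matrix (Fin N) (Fin N) ℂ) i j •
      (MvPolynomial.X (⟨Sum.inl a, ⟨{μ}, Finset.card_singleton μ⟩⟩, 0) : JetPoly ℂ n (deg4 κ))

/-- The covariant derivative `D_μ X = ∂_μ X + [A_μ, X]`. -/
def covDeriv (μ : Fin n) (X : Matrix (Fin N) (Fin N) (JetPoly ℂ n (deg4 κ))) :
    Matrix (Fin N) (Fin N) (JetPoly ℂ n (deg4 κ)) :=
  X.map (totalDeriv ℂ (deg4 κ) μ) + (gaugePotential T μ * X - X * gaugePotential T μ)

/-- The action of `ε ∈ su N` by a constant infinitesimal gauge transformation, `A ↦ [A, ε]` and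
`B ↦ 0`, extended to all jet variables (it commutes with `∂_μ`) and to polynomials. -/
def adjointAction (n : ℕ) (ε : su N) :
    Derivation ℂ (JetPoly ℂ n (deg4 κ)) (JetPoly ℂ n (deg4 κ)) :=
  MvPolynomial.mkDerivation ℂ fun v =>
    match v with
    | (⟨Sum.inl a, S⟩, α) =>
        ∑ c, ((T.repr (su.comm (T c) ε) a : ℝ) : ℂ) •
          (MvPolynomial.X (⟨Sum.inl c, S⟩, α) : JetPoly ℂ n (deg4 κ))
    | (⟨Sum.inr _, _⟩, _) => 0

variable (n)

/-- The polynomials in the components of `F` and their covariant derivatives and in the components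
of `H` and their derivatives. -/
def curvatureAlgebra4 : Subalgebra ℂ (JetPoly ℂ n (deg4 κ)) :=
  Algebra.adjoin ℂ
      {x | ∃ (f : Module.Dual ℂ (ConstForm ℂ n)) (l : List (Fin n)) (i j : Fin N),
        x = l.foldr (fun μ Y => covDeriv T μ Y) ((F4 n T).map (component ℂ (deg4 κ) f)) i j} ⊔
    curvatureAlgebra ℂ (deg4 κ) {H4 n T}

/-- The gauge invariant polynomials of form degree zero: those of the above polynomials that are
invariant under `SU(N)`. -/
def inv4 : Subalgebra ℂ (JetPoly ℂ n (deg4 κ)) where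
  carrier := {x | x ∈ curvatureAlgebra4 n T ∧ ∀ ε : su N, adjointAction T n ε x = 0}
  add_mem' := by
    rintro x y ⟨hx, hx'⟩ ⟨hy, hy'⟩
    exact ⟨add_mem hx hy, fun ε => by rw [map_add, hx', hy', add_zero]⟩
  mul_mem' := by
    rintro x y ⟨hx, hx'⟩ ⟨hy, hy'⟩
    exact ⟨mul_mem hx hy, fun ε => by
      rw [Derivation.leibniz, hx', hy', smul_zero, smul_zero, add_zero]⟩
  algebraMap_mem' c :=
    ⟨Subalgebra.algebraMap_mem _ c, fun ε => Derivation.map_algebraMap _ c⟩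

end Model4

end ChaplineManton

end

/-!
In all four models the invariant polynomials are compared with *abelian* ones: polynomials in the
derivatives of some fields (`FieldKind.free`) and of the curvatures `dB` of some others
(`FieldKind.closed`), possibly invariant under constant rotations of the fields.

**Abelian invariants.** A closed abelian invariant form below top degree is `Q + dR` with `R`
invariant and `Q` a polynomial in the `dB` and the `dx` (`exists_abelian_representative`).
Polarize the form once: one factor, a jet of a field, is marked, and the other factors are
coefficients in a module with commuting operators `∂_μ`. The marked factor contributes a free
`K[∂]`-module, for which `d` is exact below top degree (`exists_koszulD_eq`). Hence free fields
contribute exact terms. For a closed field `B` of degree `p` the Bianchi identity says that the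
marked factor is annihilated by `fieldD`, the dual of the exterior derivative acting on `B` alone.
The descent in the double complex of `d` and `fieldD`, with rows exact below top degree and exact
columns, shows that modulo exact terms this part is `dB ∧ c`, with `c` closed and of one degree
less in the fields (`exists_descent`), so that induction applies. Putting the marked factor back
multiplies by the number of fields, which is invertible in characteristic zero. The primitives
used are linear and the statements are about families of forms transforming in a representation,
so that invariance under rotations survives.

**Models 2 and 4.** Their curvatures agree with abelian ones up to terms with more fields
(`CovariantCurvatures`). Replacing abelian curvatures by covariant ones, through a formula for the
jets of a field in terms of those of its curvature, is an algebra homomorphism which commutes with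
derivatives up to terms with more curvatures (`covariantize`). The leading part of a closed
invariant in the number of curvatures is a closed abelian invariant; subtracting the
covariantization of its representative and the differential of that of its primitive raises the
number of curvatures, which is bounded by the weight. This argument works for a form `P` for which
`dP` is only known to be in the small algebra, since the small algebra has at most one derivative
per field, so that the differential of the leading part vanishes (`exists_small_representative`).
This gives both halves of the theorem: if `dS` is in the small algebra, then `S = Q + dR` and `dS
= dQ`.

**Models 1 and 3.** Redefining `B` and `C` turns the curvatures into `B`, `dB` and, in model 3,
`dC` (`invariantCohomology_of_substField`), abelian invariants with one free field. The first half
is the abelian theorem. For the second half, `dS` is split by its degree in `B`: in degree zero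
counting derivatives shows that it vanishes, and in positive degree Euler's formula provides a
primitive in the small algebra (`exists_smallAlgebra_primitive`).
-/


noncomputable section

namespace ChaplineManton

open Finset (sum_congr sum_comm sum_add_distrib smul_sum mul_sum sum_mul sum_eq_zero sum_eq_single
  sum_neg_distrib sum_sub_distrib sum_smul sum_const_zero)

/-! ### The exterior algebra of constant forms -/

section ConstForms

variable {K : Type*} [Field K] {n : ℕ}

/-- Contraction of constant forms with the coordinate vector field of index `μ`. -/
def contract (μ : Fin n) : ConstForm K n →ₗ[K] ConstForm K n :=
  CliffordAlgebra.contractLeft (LinearMap.proj μ : (Fin n → K) →ₗ[K] K)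

theorem contract_dx_mul (μ ν : Fin n) (x : ConstForm K n) :
    contract μ (dx K ν * x) = (if μ = ν then x else 0) - dx K ν * contract μ x := by
  have h := CliffordAlgebra.contractLeft_ι_mul (Q := (0 : QuadraticForm K (Fin n → K)))
    (d := (LinearMap.proj μ : (Fin n → K) →ₗ[K] K)) (Pi.single ν 1) x
  refine h.trans ?_
  congr 1
  simp only [LinearMap.proj_apply, Pi.single_apply, ite_smul, one_smul, zero_smul]

theorem contract_one (μ : Fin n) : contract μ (1 : ConstForm K n) = 0 :=
  CliffordAlgebra.contractLeft_one (Q := (0 : QuadraticForm K (Fin n → K))) _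

theorem dx_mul_dx_add_swap (μ ν : Fin n) : dx K μ * dx K ν + dx K ν * dx K μ = 0 :=
  ExteriorAlgebra.ι_add_mul_swap _ _

theorem dx_mul_dx_swap (μ ν : Fin n) : dx K μ * dx K ν = -(dx K ν * dx K μ) :=
  eq_neg_of_add_eq_zero_left (dx_mul_dx_add_swap μ ν)

theorem dx_mul_dx_mul_swap (μ ν : Fin n) (x : ConstForm K n) :
    dx K μ * (dx K ν * x) = -(dx K ν * (dx K μ * x)) := by
  rw [← mul_assoc, dx_mul_dx_swap, neg_mul, mul_assoc]

theorem dx_mem (μ : Fin n) : dx K μ ∈ ⋀[K]^1 (Fin n → K) := by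
  rw [ExteriorAlgebra.exteriorPower, pow_one]
  exact LinearMap.mem_range_self _ _

theorem ι_eq_sum_dx (v : Fin n → K) : ExteriorAlgebra.ι K v = ∑ μ, v μ • dx K μ := by
  conv_lhs => rw [pi_eq_sum_univ' v]
  simp only [map_sum, map_smul, dx]

/-- Induction on constant forms: they are obtained from `1` by linear combinations and left
multiplications by the `dx μ`. -/
theorem constForm_induction {p : ConstForm K n → Prop} (one : p 1)
    (add : ∀ x y, p x → p y → p (x + y)) (smul : ∀ (c : K) x, p x → p (c • x))
    (dx_mul : ∀ μ x, p x → p (dx K μ * x)) (x : ConstForm K n) : p x := by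
  refine CliffordAlgebra.left_induction (Q := (0 : QuadraticForm K (Fin n → K)))
    (P := p) (fun r => ?_) add ?_ x
  · rw [Algebra.algebraMap_eq_smul_one]
    exact smul _ _ one
  · intro x v hx
    have h0 : p 0 := by simpa using smul 0 1 one
    have : ∀ s : Finset (Fin n), p (∑ μ ∈ s, v μ • (dx K μ * x)) := by
      intro s
      classical
      induction s using Finset.induction_on with
      | empty => simpa using h0
      | insert a s ha ih =>
        rw [Finset.sum_insert ha]
        exact add _ _ (smul _ _ (dx_mul _ _ hx)) ih
    have key := this Finset.univ
    have e : CliffordAlgebra.ι (0 : QuadraticForm K (Fin n → K)) v = ∑ μ, v μ • dx K μ :=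
      ι_eq_sum_dx v
    rw [e, sum_mul]
    simpa only [smul_mul_assoc] using key

variable (K n) in
/-- The constant forms `dx^{μ₁} ∧ ... ∧ dx^{μ_k}` are a basis of the exterior algebra. -/
def dxBasis : Module.Basis (Finset (Fin n)) K (ConstForm K n) :=
  (Pi.basisFun K (Fin n)).ExteriorAlgebra

theorem dxBasis_apply (S : Finset (Fin n)) : dxBasis K n S = dxSet K S := by
  rw [dxBasis, ExteriorAlgebra.basis_apply]
  refine (ExteriorAlgebra.ιMulti_apply _).trans ?_
  rw [dxSet]
  congr 1
  apply List.ext_getElem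
  · simp
  · intro i h1 h2
    simp only [List.getElem_ofFn, Function.comp_apply, List.getElem_map, dx, Pi.basisFun_apply]
    congr 2

theorem dxSet_mem (S : Finset (Fin n)) : dxSet K S ∈ ⋀[K]^(S.card) (Fin n → K) := by
  rw [← dxBasis_apply, dxBasis, ExteriorAlgebra.basis_apply]
  exact ExteriorAlgebra.ιMulti_range K _ (Set.mem_range_self _)

/-- The projection of constant forms to their part of form degree `k`. -/
def degProj (k : ℕ) : ConstForm K n →ₗ[K] ConstForm K n :=
  (dxBasis K n).constr K fun S => if S.card = k then dxSet K S else 0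

theorem degProj_dxSet (k : ℕ) (S : Finset (Fin n)) :
    degProj k (dxSet K S) = if S.card = k then dxSet K S else 0 := by
  rw [← dxBasis_apply, degProj, Module.Basis.constr_basis, dxBasis_apply]

theorem degProj_mem (k : ℕ) (x : ConstForm K n) : degProj k x ∈ ⋀[K]^k (Fin n → K) := by
  rw [degProj, Module.Basis.constr_apply_fintype]
  refine Submodule.sum_mem _ fun S _ => Submodule.smul_mem _ _ ?_
  split_ifs with h
  · exact h ▸ dxSet_mem S
  · exact zero_mem _

theorem sum_degProj (x : ConstForm K n) : ∑ k ∈ Finset.range (n + 1), degProj k x = x := by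
  rw [← LinearMap.sum_apply]
  refine LinearMap.congr_fun (f := ∑ k ∈ Finset.range (n + 1), degProj k) (g := LinearMap.id) ?_ x
  refine (dxBasis K n).ext fun S => ?_
  rw [dxBasis_apply, LinearMap.sum_apply]
  simp only [degProj_dxSet, LinearMap.id_apply]
  rw [Finset.sum_ite_eq, if_pos]
  have := Finset.card_le_univ S
  simp at this
  simpa using Nat.lt_succ_of_le this

theorem degProj_of_mem {k l : ℕ} {x : ConstForm K n} (hx : x ∈ ⋀[K]^k (Fin n → K)) :
    degProj l x = if k = l then x else 0 := by
  -- both sides are the graded components of `x` in the decomposition `x = ∑ degProj l x`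
  have hd : ∀ m, (DirectSum.decompose (fun i : ℕ => ⋀[K]^i (Fin n → K)) x m : ConstForm K n) =
      degProj m x := by
    intro m
    conv_lhs => rw [← sum_degProj x]
    rw [DirectSum.decompose_sum, DFinsupp.finsetSum_apply, AddSubmonoidClass.coe_finsetSum]
    have : ∀ j, ((DirectSum.decompose (fun i : ℕ => ⋀[K]^i (Fin n → K)) (degProj j x)) m :
        ConstForm K n) = if j = m then degProj j x else 0 := by
      intro j
      split_ifs with h
      · subst h
        exact DirectSum.decompose_of_mem_same _ (degProj_mem j x)
      · exact DirectSum.decompose_of_mem_ne _ (degProj_mem j x) h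
    simp only [this, Finset.sum_ite_eq']
    split_ifs with h
    · rfl
    · symm
      have hm : n < m := by simpa using h
      rw [degProj, Module.Basis.constr_apply_fintype]
      refine sum_eq_zero fun S _ => ?_
      have := Finset.card_le_univ S
      simp at this
      rw [if_neg (by omega), smul_zero]
  rw [← hd l]
  split_ifs with h
  · subst h
    exact DirectSum.decompose_of_mem_same _ hx
  · exact DirectSum.decompose_of_mem_ne _ hx h

theorem degProj_degProj (k l : ℕ) (x : ConstForm K n) :
    degProj l (degProj k x) = if k = l then degProj k x else 0 :=
  degProj_of_mem (degProj_mem k x)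

theorem degProj_eq_zero {k : ℕ} (h : n < k) (x : ConstForm K n) : degProj k x = 0 := by
  rw [degProj, Module.Basis.constr_apply_fintype]
  refine sum_eq_zero fun S _ => ?_
  have := Finset.card_le_univ S
  simp at this
  rw [if_neg (by omega), smul_zero]

theorem degProj_one (k : ℕ) : degProj k (1 : ConstForm K n) = if k = 0 then 1 else 0 := by
  have h : (1 : ConstForm K n) ∈ ⋀[K]^0 (Fin n → K) := by
    rw [ExteriorAlgebra.exteriorPower, pow_zero]; exact Submodule.one_le.mp le_rfl
  rw [degProj_of_mem h]
  simp [eq_comm]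

theorem dx_mul_mem {k : ℕ} (μ : Fin n) {x : ConstForm K n} (hx : x ∈ ⋀[K]^k (Fin n → K)) :
    dx K μ * x ∈ ⋀[K]^(k + 1) (Fin n → K) := by
  rw [add_comm]
  exact SetLike.GradedMul.mul_mem (A := fun i : ℕ => ⋀[K]^i (Fin n → K)) (dx_mem μ) hx

theorem degProj_succ_dx_mul (k : ℕ) (μ : Fin n) (x : ConstForm K n) :
    degProj (k + 1) (dx K μ * x) = dx K μ * degProj k x := by
  conv_lhs => rw [← sum_degProj x, mul_sum, map_sum]
  conv_rhs => rw [← sum_degProj x, map_sum, mul_sum]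
  refine sum_congr rfl fun j _ => ?_
  rw [degProj_of_mem (dx_mul_mem μ (degProj_mem j x)), degProj_degProj]
  simp only [add_left_inj]
  split_ifs <;> simp

theorem degProj_zero_dx_mul (μ : Fin n) (x : ConstForm K n) : degProj 0 (dx K μ * x) = 0 := by
  rw [← sum_degProj x, mul_sum, map_sum]
  refine sum_eq_zero fun j _ => ?_
  rw [degProj_of_mem (dx_mul_mem μ (degProj_mem j x)), if_neg (by omega)]

theorem contract_degProj_zero (μ : Fin n) (x : ConstForm K n) : contract μ (degProj 0 x) = 0 := by
  induction x using constForm_induction with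
  | one => simp [contract_one, degProj_one]
  | add x y hx hy => simp only [map_add, hx, hy, add_zero]
  | smul c x hx => simp only [map_smul, hx, smul_zero]
  | dx_mul ν x hx => simp [degProj_zero_dx_mul]

theorem degProj_contract (k : ℕ) (μ : Fin n) (x : ConstForm K n) :
    degProj k (contract μ x) = contract μ (degProj (k + 1) x) := by
  induction x using constForm_induction generalizing k with
  | one => simp [contract_one, degProj_one]
  | add x y hx hy => simp only [map_add, hx, hy]
  | smul c x hx => simp only [map_smul, hx]
  | dx_mul ν x hx =>
    rw [contract_dx_mul, degProj_succ_dx_mul, contract_dx_mul, map_sub]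
    cases k with
    | zero =>
      rw [degProj_zero_dx_mul]
      rw [contract_degProj_zero]
      split_ifs <;> simp
    | succ k =>
      rw [degProj_succ_dx_mul, hx]
      split_ifs <;> simp

/-- The number operator `∑_μ dx^μ ∧ i_μ`, which multiplies forms of degree `k` by `k`. -/
def numberOp : ConstForm K n →ₗ[K] ConstForm K n :=
  ∑ μ : Fin n, LinearMap.mulLeft K (dx K μ) ∘ₗ contract μ

theorem numberOp_apply (x : ConstForm K n) : numberOp x = ∑ μ, dx K μ * contract μ x := by
  simp [numberOp]

theorem numberOp_dx_mul (ν : Fin n) (x : ConstForm K n) :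
    numberOp (dx K ν * x) = dx K ν * x + dx K ν * numberOp x := by
  simp only [numberOp_apply, contract_dx_mul, mul_sub, mul_ite, mul_zero, sum_sub_distrib,
    Finset.sum_ite_eq', Finset.mem_univ, if_true, mul_sum]
  rw [sub_eq_add_neg, ← sum_neg_distrib]
  congr 1
  exact sum_congr rfl fun μ _ => by rw [dx_mul_dx_mul_swap, neg_neg]

theorem numberOp_degProj (k : ℕ) (x : ConstForm K n) :
    numberOp (degProj k x) = (k : K) • degProj k x := by
  induction x using constForm_induction generalizing k with
  | one =>
    rw [degProj_one]
    split_ifs with h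
    · subst h; simp [numberOp_apply, contract_one]
    · simp
  | add x y hx hy => simp only [map_add, hx, hy, smul_add]
  | smul c x hx => simp only [map_smul, hx]; rw [smul_comm]
  | dx_mul ν x hx =>
    cases k with
    | zero => simp [degProj_zero_dx_mul]
    | succ k =>
      rw [degProj_succ_dx_mul, numberOp_dx_mul, hx]
      simp only [mul_smul_comm, Nat.cast_succ, add_smul, one_smul]
      rw [add_comm]

theorem dx_mul_comm_degProj (k : ℕ) (μ : Fin n) (x : ConstForm K n) :
    dx K μ * degProj k x = (-1 : K) ^ k • (degProj k x * dx K μ) := by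
  induction x using constForm_induction generalizing k with
  | one =>
    rw [degProj_one]
    split_ifs with h
    · subst h; simp
    · simp
  | add x y hx hy => simp only [map_add, mul_add, add_mul, hx, hy, smul_add]
  | smul c x hx => simp only [map_smul, mul_smul_comm, hx, smul_mul_assoc]; rw [smul_comm]
  | dx_mul ν x hx =>
    cases k with
    | zero => simp [degProj_zero_dx_mul]
    | succ k =>
      rw [degProj_succ_dx_mul, dx_mul_dx_mul_swap, hx, pow_succ, mul_neg_one, neg_smul,
        mul_smul_comm, mul_assoc]

end ConstForms

/-! ### Forms with coefficients in a module -/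

section ModuleForms

variable {K : Type*} [Field K] {n : ℕ} {M M' M'' : Type*} [AddCommGroup M] [Module K M]
  [AddCommGroup M'] [Module K M'] [AddCommGroup M''] [Module K M'']

variable (M) in
/-- The component of a form with coefficients in the module `M` along a linear functional on the
constant forms. -/
def compAt (f : Module.Dual K (ConstForm K n)) : ConstForm K n ⊗[K] M →ₗ[K] M :=
  (TensorProduct.lid K M).toLinearMap ∘ₗ LinearMap.rTensor M f

@[simp]
theorem compAt_tmul (f : Module.Dual K (ConstForm K n)) (x : ConstForm K n) (m : M) :
    compAt M f (x ⊗ₜ m) = f x • m := by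
  simp [compAt]

theorem compAt_map (f : Module.Dual K (ConstForm K n)) (g : ConstForm K n →ₗ[K] ConstForm K n)
    (φ : M →ₗ[K] M') (ω : ConstForm K n ⊗[K] M) :
    compAt M' f (TensorProduct.map g φ ω) = φ (compAt M (f ∘ₗ g) ω) := by
  induction ω using TensorProduct.induction_on with
  | zero => simp
  | tmul x m => simp
  | add x y hx hy => simp only [map_add, hx, hy]

theorem sum_dxSet_tmul_compAt (ω : ConstForm K n ⊗[K] M) :
    ∑ S, dxSet K S ⊗ₜ[K] compAt M ((dxBasis K n).coord S) ω = ω := by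
  induction ω using TensorProduct.induction_on with
  | zero => simp
  | tmul x m =>
    conv_rhs => rw [← (dxBasis K n).sum_repr x]
    simp [dxBasis_apply, TensorProduct.sum_tmul, TensorProduct.smul_tmul']
  | add x y hx hy => simp only [map_add, TensorProduct.tmul_add, sum_add_distrib, hx, hy]

theorem form_ext {ω ω' : ConstForm K n ⊗[K] M} (h : ∀ f, compAt M f ω = compAt M f ω') :
    ω = ω' := by
  rw [← sum_dxSet_tmul_compAt ω, ← sum_dxSet_tmul_compAt ω']
  simp only [h]

theorem compAt_eq_sum (f : Module.Dual K (ConstForm K n)) (ω : ConstForm K n ⊗[K] M) :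
    compAt M f ω = ∑ S, f (dxSet K S) • compAt M ((dxBasis K n).coord S) ω := by
  conv_lhs => rw [← sum_dxSet_tmul_compAt ω]
  simp

/-- The forms with coefficients in the submodule `N`. -/
def FormsIn (N : Submodule K M) : Submodule K (ConstForm K n ⊗[K] M) where
  carrier := {ω | ∀ f, compAt M f ω ∈ N}
  add_mem' h₁ h₂ f := by simpa only [map_add] using N.add_mem (h₁ f) (h₂ f)
  zero_mem' f := by simp only [map_zero, N.zero_mem]
  smul_mem' c ω h f := by simpa only [map_smul] using N.smul_mem c (h f)

theorem map_mem_formsIn {N : Submodule K M} {N' : Submodule K M'}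
    (g : ConstForm K n →ₗ[K] ConstForm K n) {φ : M →ₗ[K] M'} (h : ∀ m ∈ N, φ m ∈ N')
    {ω : ConstForm K n ⊗[K] M} (hω : ω ∈ FormsIn N) : TensorProduct.map g φ ω ∈ FormsIn N' := by
  intro f
  rw [compAt_map]
  exact h _ (hω _)

theorem tmul_mem_formsIn {N : Submodule K M} (x : ConstForm K n) {m : M} (hm : m ∈ N) :
    x ⊗ₜ[K] m ∈ FormsIn N := fun f => by
  rw [compAt_tmul]; exact N.smul_mem _ hm

theorem formsIn_mono {N N' : Submodule K M} (h : N ≤ N') :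
    (FormsIn N : Submodule K (ConstForm K n ⊗[K] M)) ≤ FormsIn N' := fun _ hω f => h (hω f)

theorem map_congr_of_mem_formsIn {N : Submodule K M} (g : ConstForm K n →ₗ[K] ConstForm K n)
    {φ ψ : M →ₗ[K] M'} (h : ∀ m ∈ N, φ m = ψ m) {ω : ConstForm K n ⊗[K] M}
    (hω : ω ∈ FormsIn N) : TensorProduct.map g φ ω = TensorProduct.map g ψ ω :=
  form_ext fun f => by rw [compAt_map, compAt_map, h _ (hω _)]

theorem map_map_apply (g g' : ConstForm K n →ₗ[K] ConstForm K n) (φ : M →ₗ[K] M')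
    (ψ : M' →ₗ[K] M'') (ω : ConstForm K n ⊗[K] M) :
    TensorProduct.map g' ψ (TensorProduct.map g φ ω) =
      TensorProduct.map (g' ∘ₗ g) (ψ ∘ₗ φ) ω := by
  rw [TensorProduct.map_comp]; rfl

theorem map_sub_right_apply (g : ConstForm K n →ₗ[K] ConstForm K n) (φ ψ : M →ₗ[K] M')
    (ω : ConstForm K n ⊗[K] M) :
    TensorProduct.map g (φ - ψ) ω = TensorProduct.map g φ ω - TensorProduct.map g ψ ω :=
  form_ext fun f => by simp only [map_sub, compAt_map, LinearMap.sub_apply]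

variable (M) in
/-- The part of form degree `k`. -/
def formProj (k : ℕ) : ConstForm K n ⊗[K] M →ₗ[K] ConstForm K n ⊗[K] M :=
  TensorProduct.map (degProj k) LinearMap.id

theorem sum_formProj (ω : ConstForm K n ⊗[K] M) :
    ∑ k ∈ Finset.range (n + 1), formProj M k ω = ω := by
  induction ω using TensorProduct.induction_on with
  | zero => simp
  | tmul x m => simp [formProj, ← TensorProduct.sum_tmul, sum_degProj]
  | add x y hx hy => simp only [map_add, sum_add_distrib, hx, hy]

theorem formProj_formProj (k l : ℕ) (ω : ConstForm K n ⊗[K] M) :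
    formProj M l (formProj M k ω) = if k = l then formProj M k ω else 0 := by
  induction ω using TensorProduct.induction_on with
  | zero => simp
  | tmul x m =>
    simp only [formProj, TensorProduct.map_tmul, degProj_degProj, LinearMap.id_apply]
    split_ifs <;> simp
  | add x y hx hy => simp only [map_add, hx, hy]; split_ifs <;> simp

theorem formProj_mem_formsIn {N : Submodule K M} (k : ℕ) {ω : ConstForm K n ⊗[K] M}
    (hω : ω ∈ FormsIn N) : formProj M k ω ∈ FormsIn N :=
  map_mem_formsIn _ (fun _ hm => hm) hω

variable (K n M) in
/-- The forms without a part of top form degree `n`. -/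
def belowTop : Submodule K (ConstForm K n ⊗[K] M) := LinearMap.ker (formProj M n)

theorem mem_belowTop {ω : ConstForm K n ⊗[K] M} :
    ω ∈ belowTop K n M ↔ formProj M n ω = 0 := Iff.rfl

theorem sum_formProj_of_mem_belowTop {ω : ConstForm K n ⊗[K] M} (h : ω ∈ belowTop K n M) :
    ∑ k ∈ Finset.range n, formProj M k ω = ω := by
  conv_rhs => rw [← sum_formProj ω, Finset.sum_range_succ, mem_belowTop.mp h, add_zero]

theorem map_id_mem_belowTop (φ : M →ₗ[K] M') {ω : ConstForm K n ⊗[K] M}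
    (h : ω ∈ belowTop K n M) : TensorProduct.map LinearMap.id φ ω ∈ belowTop K n M' := by
  have h' := congrArg (TensorProduct.map LinearMap.id φ) (mem_belowTop.mp h)
  rw [mem_belowTop]
  rw [formProj, map_map_apply, map_zero] at h'
  rw [formProj, map_map_apply]
  exact h'

/-- The exterior derivative `∑_μ dx^μ ∂_μ` on forms with coefficients in a module `M` with
operators `∂_μ`. -/
def koszulD (D : Fin n → M →ₗ[K] M) : ConstForm K n ⊗[K] M →ₗ[K] ConstForm K n ⊗[K] M :=
  ∑ μ : Fin n, TensorProduct.map (LinearMap.mulLeft K (dx K μ)) (D μ)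

theorem koszulD_apply (D : Fin n → M →ₗ[K] M) (ω : ConstForm K n ⊗[K] M) :
    koszulD D ω = ∑ μ : Fin n, TensorProduct.map (LinearMap.mulLeft K (dx K μ)) (D μ) ω := by
  simp [koszulD]

theorem koszulD_tmul (D : Fin n → M →ₗ[K] M) (x : ConstForm K n) (m : M) :
    koszulD D (x ⊗ₜ m) = ∑ μ : Fin n, (dx K μ * x) ⊗ₜ D μ m := by
  simp [koszulD_apply]

theorem koszulD_mem_formsIn {D : Fin n → M →ₗ[K] M} {N : Submodule K M}
    (hN : ∀ μ, ∀ m ∈ N, D μ m ∈ N) {ω : ConstForm K n ⊗[K] M} (hω : ω ∈ FormsIn N) :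
    koszulD D ω ∈ FormsIn N := by
  rw [koszulD_apply]
  exact Submodule.sum_mem _ fun μ _ => map_mem_formsIn _ (hN μ) hω

theorem map_koszulD {D : Fin n → M →ₗ[K] M} {D' : Fin n → M' →ₗ[K] M'} {φ : M →ₗ[K] M'}
    (h : ∀ μ m, φ (D μ m) = D' μ (φ m)) (ω : ConstForm K n ⊗[K] M) :
    TensorProduct.map LinearMap.id φ (koszulD D ω) =
      koszulD D' (TensorProduct.map LinearMap.id φ ω) := by
  induction ω using TensorProduct.induction_on with
  | zero => simp
  | tmul x m => simp [koszulD_tmul, h]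
  | add x y hx hy => simp only [map_add, hx, hy]

theorem formProj_succ_koszulD (D : Fin n → M →ₗ[K] M) (k : ℕ) (ω : ConstForm K n ⊗[K] M) :
    formProj M (k + 1) (koszulD D ω) = koszulD D (formProj M k ω) := by
  induction ω using TensorProduct.induction_on with
  | zero => simp
  | tmul x m => simp [koszulD_tmul, formProj, degProj_succ_dx_mul]
  | add x y hx hy => simp only [map_add, hx, hy]

theorem formProj_zero_koszulD (D : Fin n → M →ₗ[K] M) (ω : ConstForm K n ⊗[K] M) :
    formProj M 0 (koszulD D ω) = 0 := by
  induction ω using TensorProduct.induction_on with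
  | zero => simp
  | tmul x m => simp [koszulD_tmul, formProj, degProj_zero_dx_mul]
  | add x y hx hy => simp only [map_add, hx, hy, add_zero]

theorem koszulD_koszulD {D : Fin n → M →ₗ[K] M} (hD : ∀ μ ν m, D μ (D ν m) = D ν (D μ m))
    (h2 : (2 : K) ≠ 0) (ω : ConstForm K n ⊗[K] M) : koszulD D (koszulD D ω) = 0 := by
  induction ω using TensorProduct.induction_on with
  | zero => simp
  | tmul x m =>
    simp only [koszulD_tmul, map_sum]
    have h : ∑ μ, ∑ ν, (dx K ν * (dx K μ * x)) ⊗ₜ[K] D ν (D μ m) =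
        -∑ μ, ∑ ν, (dx K ν * (dx K μ * x)) ⊗ₜ[K] D ν (D μ m) := by
      conv_lhs => rw [sum_comm]
      rw [← sum_neg_distrib]
      refine sum_congr rfl fun μ _ => ?_
      rw [← sum_neg_distrib]
      refine sum_congr rfl fun ν _ => ?_
      rw [dx_mul_dx_mul_swap, hD, TensorProduct.neg_tmul]
    have h' := add_eq_zero_iff_eq_neg.mpr h
    rw [← two_smul K] at h'
    exact (smul_eq_zero.mp h').resolve_left h2
  | add x y hx hy => simp only [map_add, hx, hy, add_zero]

theorem koszulD_mulLeft_degProj {D : Fin n → M →ₗ[K] M} (k : ℕ) (x : ConstForm K n)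
    (ω : ConstForm K n ⊗[K] M) :
    koszulD D (TensorProduct.map (LinearMap.mulLeft K (degProj k x)) LinearMap.id ω) =
      (-1 : K) ^ k • TensorProduct.map (LinearMap.mulLeft K (degProj k x)) LinearMap.id
        (koszulD D ω) := by
  induction ω using TensorProduct.induction_on with
  | zero => simp
  | tmul y m =>
    simp only [TensorProduct.map_tmul, LinearMap.mulLeft_apply, LinearMap.id_apply, koszulD_tmul,
      map_sum, smul_sum]
    refine sum_congr rfl fun μ _ => ?_
    rw [← mul_assoc, dx_mul_comm_degProj, smul_mul_assoc, mul_assoc, TensorProduct.smul_tmul']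
  | add x y hx hy => simp only [map_add, hx, hy, smul_add]

/-- The Koszul homotopy: if the operators `low μ` satisfy the canonical commutation relations
with the `D ν`, then `∑_μ i_μ ⊗ low μ` is a homotopy between `∑_μ low μ ∘ D μ` and the form
degree. -/
theorem koszul_homotopy {D low : Fin n → M →ₗ[K] M}
    (h : ∀ μ ν m, low μ (D ν m) = D ν (low μ m) + if μ = ν then m else 0)
    (ω : ConstForm K n ⊗[K] M) :
    koszulD D (∑ μ, TensorProduct.map (contract μ) (low μ) ω) +
      ∑ μ, TensorProduct.map (contract μ) (low μ) (koszulD D ω) =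
    TensorProduct.map LinearMap.id (∑ μ, low μ ∘ₗ D μ) ω -
      TensorProduct.map numberOp LinearMap.id ω := by
  induction ω using TensorProduct.induction_on with
  | zero => simp
  | tmul x m =>
    simp only [TensorProduct.map_tmul, koszulD_tmul, map_sum, contract_dx_mul,
      LinearMap.id_apply, LinearMap.sum_apply, LinearMap.comp_apply, numberOp_apply,
      TensorProduct.sub_tmul, sum_sub_distrib, TensorProduct.sum_tmul,
      TensorProduct.tmul_sum]
    have e1 : ∀ μ ν : Fin n, ((if μ = ν then x else 0) ⊗ₜ[K] low μ (D ν m) :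
        ConstForm K n ⊗[K] M) = if μ = ν then x ⊗ₜ[K] low μ (D ν m) else 0 := by
      intro μ ν; split_ifs <;> simp
    have e2 : ∀ μ ν : Fin n, (dx K ν * contract μ x) ⊗ₜ[K] low μ (D ν m) =
        (dx K ν * contract μ x) ⊗ₜ[K] D ν (low μ m) +
          if μ = ν then (dx K ν * contract μ x) ⊗ₜ[K] m else 0 := by
      intro μ ν; rw [h]; split_ifs <;> simp [TensorProduct.tmul_add]
    simp only [e1, e2, sum_add_distrib, Finset.sum_ite_eq,
      Finset.mem_univ, if_true]
    abel
  | add x y hx hy =>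
    simp only [map_add, sum_add_distrib]
    rw [add_add_add_comm, hx, hy]
    abel

end ModuleForms

/-! ### Free jets and the algebraic Poincaré lemma -/

section JetModules

variable {K : Type*} [Field K] {n : ℕ} {M : Type*} [AddCommGroup M] [Module K M]

variable (n M) in
/-- The module `K[∂_1, ..., ∂_n] ⊗ M`: the element `∂^α ⊗ m` is `Finsupp.single α m`. -/
abbrev JetModule : Type _ := (Fin n →₀ ℕ) →₀ M

/-- Multiplication by `∂_μ` on the first factor of `K[∂] ⊗ M`. -/
def shift (μ : Fin n) : JetModule n M →ₗ[K] JetModule n M :=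
  Finsupp.lmapDomain M K (· + Finsupp.single μ 1)

/-- The partial derivative with respect to `∂_μ` on the first factor of `K[∂] ⊗ M`. -/
def lower (μ : Fin n) : JetModule n M →ₗ[K] JetModule n M :=
  Finsupp.lsum K fun α => (α μ : K) • Finsupp.lsingle (α - Finsupp.single μ 1)

/-- The operators of a module `M`, acting on the second factor of `K[∂] ⊗ M`. -/
def coeffwise (D : M →ₗ[K] M) : JetModule n M →ₗ[K] JetModule n M :=
  Finsupp.mapRange.linearMap D

/-- The diagonal action of `∂_μ` on `K[∂] ⊗ M`. -/
def jetD (D : Fin n → M →ₗ[K] M) (μ : Fin n) : JetModule n M →ₗ[K] JetModule n M :=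
  shift μ + coeffwise (D μ)

@[simp]
theorem shift_single (μ : Fin n) (α : Fin n →₀ ℕ) (m : M) :
    shift (K := K) μ (Finsupp.single α m) = Finsupp.single (α + Finsupp.single μ 1) m := by
  simp [shift]

@[simp]
theorem lower_single (μ : Fin n) (α : Fin n →₀ ℕ) (m : M) :
    lower (K := K) μ (Finsupp.single α m) =
      (α μ : K) • Finsupp.single (α - Finsupp.single μ 1) m := by
  simp [lower]

@[simp]
theorem coeffwise_single (D : M →ₗ[K] M) (α : Fin n →₀ ℕ) (m : M) :
    coeffwise D (Finsupp.single α m) = Finsupp.single α (D m) := by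
  simp [coeffwise]

theorem jetModule_induction {p : JetModule n M → Prop} (y : JetModule n M)
    (single : ∀ α m, p (Finsupp.single α m)) (add : ∀ x y, p x → p y → p (x + y)) : p y := by
  induction y using Finsupp.induction_linear with
  | zero => simpa using single 0 0
  | add x y hx hy => exact add _ _ hx hy
  | single α m => exact single α m

theorem tsub_add_single {α : Fin n →₀ ℕ} {μ : Fin n} (h : α μ ≠ 0) :
    α - Finsupp.single μ 1 + Finsupp.single μ 1 = α := by
  ext ν
  by_cases hν : μ = ν
  · subst hν; simp; omega
  · simp [hν]

theorem add_single_tsub {α : Fin n →₀ ℕ} {μ ν : Fin n} (h : α μ ≠ 0) :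
    α + Finsupp.single ν 1 - Finsupp.single μ 1 = α - Finsupp.single μ 1 + Finsupp.single ν 1 := by
  ext j
  by_cases hj : μ = j
  · subst hj; simp; omega
  · simp [Finsupp.single_apply, hj]

theorem lower_shift (μ ν : Fin n) (y : JetModule n M) :
    lower (K := K) μ (shift (K := K) ν y) =
      shift (K := K) ν (lower (K := K) μ y) + if μ = ν then y else 0 := by
  induction y using jetModule_induction with
  | add x y hx hy => simp only [map_add, hx, hy]; split_ifs <;> abel
  | single α m =>
    simp only [shift_single, lower_single, map_smul]
    by_cases hμν : μ = ν
    · subst hμν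
      simp only [Finsupp.add_apply, Finsupp.single_eq_same, Nat.cast_add, Nat.cast_one,
        add_tsub_cancel_right, if_true, add_smul, one_smul]
      by_cases h : α μ = 0
      · simp [h]
      · rw [tsub_add_single h]
    · have h0 : (Finsupp.single ν 1 : Fin n →₀ ℕ) μ = 0 := by simp [Ne.symm hμν]
      simp only [Finsupp.add_apply, h0, add_zero, if_neg hμν]
      by_cases h : α μ = 0
      · simp [h]
      · rw [add_single_tsub h]

theorem shift_comm (μ ν : Fin n) (y : JetModule n M) :
    shift (K := K) μ (shift (K := K) ν y) = shift (K := K) ν (shift (K := K) μ y) := by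
  induction y using jetModule_induction with
  | add x y hx hy => simp only [map_add, hx, hy]
  | single α m => simp only [shift_single, add_right_comm]

theorem shift_coeffwise (D : M →ₗ[K] M) (ν : Fin n) (y : JetModule n M) :
    shift (K := K) ν (coeffwise D y) = coeffwise D (shift (K := K) ν y) := by
  induction y using jetModule_induction with
  | add x y hx hy => simp only [map_add, hx, hy]
  | single α m => simp

theorem lower_coeffwise (D : M →ₗ[K] M) (ν : Fin n) (y : JetModule n M) :
    lower (K := K) ν (coeffwise D y) = coeffwise D (lower (K := K) ν y) := by
  induction y using jetModule_induction with
  | add x y hx hy => simp only [map_add, hx, hy]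
  | single α m => simp only [coeffwise_single, lower_single, map_smul]

theorem jetD_single (D : Fin n → M →ₗ[K] M) (μ : Fin n) (α : Fin n →₀ ℕ) (m : M) :
    jetD D μ (Finsupp.single α m) =
      Finsupp.single (α + Finsupp.single μ 1) m + Finsupp.single α (D μ m) := by
  simp [jetD]

theorem lower_jetD (D : Fin n → M →ₗ[K] M) (μ ν : Fin n) (y : JetModule n M) :
    lower (K := K) μ (jetD D ν y) = jetD D ν (lower (K := K) μ y) + if μ = ν then y else 0 := by
  simp only [jetD, LinearMap.add_apply, map_add, lower_shift, lower_coeffwise]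
  abel

theorem shift_jetD (D : Fin n → M →ₗ[K] M) (μ ν : Fin n) (y : JetModule n M) :
    shift (K := K) μ (jetD D ν y) = jetD D ν (shift (K := K) μ y) := by
  simp only [jetD, LinearMap.add_apply, map_add, shift_comm μ ν, shift_coeffwise]

theorem jetD_comm {D : Fin n → M →ₗ[K] M} (hD : ∀ μ ν m, D μ (D ν m) = D ν (D μ m))
    (μ ν : Fin n) (y : JetModule n M) : jetD D μ (jetD D ν y) = jetD D ν (jetD D μ y) := by
  induction y using jetModule_induction with
  | add x y hx hy => simp only [map_add, hx, hy]
  | single α m =>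
    simp only [jetD_single, map_add, hD μ ν, add_right_comm α]
    abel

/-- The elements of `K[∂] ⊗ M` with coefficients in the submodule `N`. -/
def jetsIn (N : Submodule K M) : Submodule K (JetModule n M) where
  carrier := {y | ∀ α, y α ∈ N}
  add_mem' h₁ h₂ α := N.add_mem (h₁ α) (h₂ α)
  zero_mem' _ := N.zero_mem
  smul_mem' c _ h α := N.smul_mem c (h α)

/-- The elements of `K[∂] ⊗ M` with coefficients in the submodule `N` and of degree less than `a`
in the derivatives. -/
def jetsBelow (N : Submodule K M) (a : ℕ) : Submodule K (JetModule n M) where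
  carrier := {y | ∀ α, y α ∈ N ∧ (a ≤ α.degree → y α = 0)}
  add_mem' h₁ h₂ α := ⟨N.add_mem (h₁ α).1 (h₂ α).1, fun h => by
    rw [Finsupp.add_apply, (h₁ α).2 h, (h₂ α).2 h, add_zero]⟩
  zero_mem' _ := ⟨N.zero_mem, fun _ => rfl⟩
  smul_mem' c _ h α := ⟨N.smul_mem c (h α).1, fun h' => by
    rw [Finsupp.smul_apply, (h α).2 h', smul_zero]⟩

theorem single_mem_jetsIn {N : Submodule K M} (α : Fin n →₀ ℕ) {m : M} (hm : m ∈ N) :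
    Finsupp.single α m ∈ jetsIn N := fun β => by
  classical
  rw [Finsupp.single_apply]; split_ifs
  exacts [hm, N.zero_mem]

theorem single_mem_jetsBelow {N : Submodule K M} {a : ℕ} {α : Fin n →₀ ℕ} (hα : α.degree < a)
    {m : M} (hm : m ∈ N) : Finsupp.single α m ∈ jetsBelow N a := fun β => by
  classical
  rw [Finsupp.single_apply]; split_ifs with h
  · subst h; exact ⟨hm, fun h => absurd hα (not_lt.mpr h)⟩
  · exact ⟨N.zero_mem, fun _ => rfl⟩

theorem jetsIn_map {N : Submodule K M} {M' : Type*} [AddCommGroup M'] [Module K M']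
    {N' : Submodule K M'} {φ : JetModule n M →ₗ[K] M'}
    (h : ∀ α, ∀ m ∈ N, φ (Finsupp.single α m) ∈ N') {y : JetModule n M} (hy : y ∈ jetsIn N) :
    φ y ∈ N' := by
  rw [← Finsupp.sum_single y, Finsupp.sum, map_sum]
  exact Submodule.sum_mem _ fun α _ => h α _ (hy α)

theorem jetsBelow_map {N : Submodule K M} {M' : Type*} [AddCommGroup M'] [Module K M']
    {N' : Submodule K M'} {φ : JetModule n M →ₗ[K] M'} {a : ℕ}
    (h : ∀ α : Fin n →₀ ℕ, α.degree < a → ∀ m ∈ N, φ (Finsupp.single α m) ∈ N')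
    {y : JetModule n M} (hy : y ∈ jetsBelow N a) : φ y ∈ N' := by
  rw [← Finsupp.sum_single y, Finsupp.sum, map_sum]
  refine Submodule.sum_mem _ fun α hα => h α ?_ _ (hy α).1
  by_contra hlt
  exact Finsupp.mem_support_iff.mp hα ((hy α).2 (not_lt.mp hlt))

theorem shift_mem_jetsIn {N : Submodule K M} (μ : Fin n) {y : JetModule n M} (hy : y ∈ jetsIn N) :
    shift (K := K) μ y ∈ jetsIn N :=
  jetsIn_map (fun α m hm => by rw [shift_single]; exact single_mem_jetsIn _ hm) hy

theorem lower_mem_jetsIn {N : Submodule K M} (μ : Fin n) {y : JetModule n M} (hy : y ∈ jetsIn N) :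
    lower (K := K) μ y ∈ jetsIn N :=
  jetsIn_map (fun α m hm => by
    rw [lower_single]; exact Submodule.smul_mem _ _ (single_mem_jetsIn _ hm)) hy

theorem jetD_mem_jetsIn {D : Fin n → M →ₗ[K] M} {N : Submodule K M}
    (hN : ∀ μ, ∀ m ∈ N, D μ m ∈ N) (μ : Fin n) {y : JetModule n M} (hy : y ∈ jetsIn N) :
    jetD D μ y ∈ jetsIn N :=
  jetsIn_map (fun α m hm => by
    rw [jetD_single]
    exact add_mem (single_mem_jetsIn _ hm) (single_mem_jetsIn _ (hN μ m hm))) hy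

theorem jetsBelow_le_jetsIn (N : Submodule K M) (a : ℕ) :
    (jetsBelow N a : Submodule K (JetModule n M)) ≤ jetsIn N := fun _ h α => (h α).1

/-- Modulo terms of lower degree in `∂`, the operator `∑_μ lower_μ ∘ ∂_μ` on `K[∂] ⊗ M` multiplies
by `n` plus the degree in `∂`. -/
theorem sub_sum_lower_jetD_mem {D : Fin n → M →ₗ[K] M} {N : Submodule K M}
    (hN : ∀ μ, ∀ m ∈ N, D μ m ∈ N) {a : ℕ} {y : JetModule n M} (hy : y ∈ jetsBelow N (a + 1)) :
    (((n + a : ℕ) : K) • LinearMap.id - ∑ μ, lower (K := K) μ ∘ₗ jetD D μ :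
      JetModule n M →ₗ[K] JetModule n M) y ∈ jetsBelow N a := by
  refine jetsBelow_map (fun α hα m hm => ?_) hy
  have e : (((n + a : ℕ) : K) • LinearMap.id - ∑ μ, lower (K := K) μ ∘ₗ jetD D μ :
      JetModule n M →ₗ[K] JetModule n M) (Finsupp.single α m) =
      ((a : K) - (α.degree : K)) • Finsupp.single α m -
        ∑ μ, (α μ : K) • Finsupp.single (α - Finsupp.single μ 1) (D μ m) := by
    simp only [LinearMap.sub_apply, LinearMap.smul_apply, LinearMap.id_apply,
      LinearMap.sum_apply, LinearMap.comp_apply, jetD_single, map_add, lower_single,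
      Finsupp.add_apply, Finsupp.single_eq_same, add_tsub_cancel_right, sum_add_distrib,
      ← sum_smul, Nat.cast_add, Nat.cast_one, Finset.sum_const, Finset.card_univ,
      Fintype.card_fin, nsmul_eq_mul, mul_one, Finsupp.degree_eq_sum, Nat.cast_sum]
    rw [← sub_sub, ← sub_smul]
    congr 2
    ring
  rw [e]
  refine sub_mem ?_ (Submodule.sum_mem _ fun μ _ => ?_)
  · rcases Nat.lt_or_ge α.degree a with h | h
    · exact Submodule.smul_mem _ _ (single_mem_jetsBelow h hm)
    · have : α.degree = a := by omega
      rw [this, sub_self, zero_smul]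
      exact zero_mem _
  · by_cases h : α μ = 0
    · rw [h]; simp
    · refine Submodule.smul_mem _ _ (single_mem_jetsBelow ?_ (hN μ m hm))
      have := congrArg Finsupp.degree (tsub_add_single h)
      rw [map_add, Finsupp.degree_single] at this
      omega

theorem exists_mem_formsIn_jetsBelow {N : Submodule K M} {ω : ConstForm K n ⊗[K] JetModule n M}
    (hω : ω ∈ FormsIn (jetsIn N)) : ∃ a, ω ∈ FormsIn (jetsBelow N a) := by
  classical
  set B : Finset (Fin n →₀ ℕ) := Finset.univ.biUnion fun S =>
    (compAt _ ((dxBasis K n).coord S) ω).support with hB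
  refine ⟨B.sup Finsupp.degree + 1, fun f => ?_⟩
  rw [compAt_eq_sum]
  refine Submodule.sum_mem _ fun S _ => Submodule.smul_mem _ _ fun α => ⟨hω _ α, fun h => ?_⟩
  by_contra hne
  have hα : α ∈ B := by
    rw [hB]
    exact Finset.mem_biUnion.mpr ⟨S, Finset.mem_univ _, Finsupp.mem_support_iff.mpr hne⟩
  have := Finset.le_sup (f := Finsupp.degree) hα
  omega

variable [CharZero K]

/-- The algebraic Poincaré lemma in a fixed form degree `j < n`, by induction on the degree in `∂`:
`jetD` has the leading term `shift`, for which the derivations `lower` provide a homotopy, whose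
factors `n + a - j` are invertible. -/
theorem exists_koszulD_eq_of_homogeneous {D : Fin n → M →ₗ[K] M}
    (hD : ∀ μ ν m, D μ (D ν m) = D ν (D μ m)) {N : Submodule K M}
    (hN : ∀ μ, ∀ m ∈ N, D μ m ∈ N) {j : ℕ} (hj : j < n) (a : ℕ)
    {ω : ConstForm K n ⊗[K] JetModule n M} (hω : ω ∈ FormsIn (jetsBelow N a))
    (hdeg : formProj _ j ω = ω) (hclosed : koszulD (jetD D) ω = 0) :
    ∃ η ∈ FormsIn (jetsIn N), η ∈ belowTop K n (JetModule n M) ∧ koszulD (jetD D) η = ω := by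
  induction a generalizing ω with
  | zero =>
    refine ⟨0, zero_mem _, zero_mem _, ?_⟩
    rw [map_zero]
    refine form_ext fun f => ?_
    rw [map_zero]
    ext1 α
    exact ((hω f α).2 (Nat.zero_le _)).symm
  | succ a ih =>
    set h : ConstForm K n ⊗[K] JetModule n M :=
      ∑ μ, TensorProduct.map (contract μ) (lower (K := K) μ) ω with hh
    have hom := koszul_homotopy (fun μ ν m => lower_jetD D μ ν m) ω
    rw [hclosed] at hom
    simp only [map_zero, sum_const_zero, add_zero] at hom
    have hnum : TensorProduct.map numberOp LinearMap.id ω = (j : K) • ω := by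
      conv_lhs => rw [← hdeg]
      conv_rhs => rw [← hdeg]
      rw [formProj, map_map_apply, ← LinearMap.smul_apply, ← TensorProduct.map_smul_left]
      congr 2
      exact LinearMap.ext fun x => numberOp_degProj j x
    rw [hnum] at hom
    -- the remainder `ω'` has lower degree in `∂`, and `ω` is a multiple of it up to `d h`
    set ω' := TensorProduct.map LinearMap.id
      (((n + a : ℕ) : K) • LinearMap.id - ∑ μ, lower (K := K) μ ∘ₗ jetD D μ :
        JetModule n M →ₗ[K] JetModule n M) ω with hω'
    have e : ω' = ((n + a : ℕ) - j : K) • ω - koszulD (jetD D) h := by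
      rw [hω', map_sub_right_apply, hh, hom,
        TensorProduct.map_smul_right, LinearMap.smul_apply, TensorProduct.map_id,
        LinearMap.id_apply]
      refine form_ext fun f => ?_
      simp only [map_sub, map_smul, sub_smul]
      abel
    have h2 : (2 : K) ≠ 0 := two_ne_zero
    obtain ⟨η, hη, hη', hdη⟩ := ih (ω := ω')
      (map_mem_formsIn _ (fun y hy => sub_sum_lower_jetD_mem hN hy) hω)
      (by
        rw [hω', formProj, map_map_apply, LinearMap.id_comp, LinearMap.comp_id]
        conv_rhs => rw [← hdeg, formProj, map_map_apply, LinearMap.id_comp, LinearMap.comp_id])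
      (by
        rw [e, map_sub, map_smul, hclosed, smul_zero,
          koszulD_koszulD (jetD_comm hD) h2, sub_zero])
    have hne : ((n + a : ℕ) - j : K) ≠ 0 := by
      rw [sub_ne_zero]
      exact_mod_cast (by omega : n + a ≠ j)
    refine ⟨((n + a : ℕ) - j : K)⁻¹ • (η + h), Submodule.smul_mem _ _ (add_mem hη ?_),
      Submodule.smul_mem _ _ (add_mem hη' ?_), ?_⟩
    · refine Submodule.sum_mem _ fun μ _ => map_mem_formsIn _ (fun y hy => ?_) hω
      exact lower_mem_jetsIn μ (jetsBelow_le_jetsIn _ _ hy)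
    · rw [mem_belowTop, hh, map_sum]
      refine sum_eq_zero fun μ _ => ?_
      rw [formProj, map_map_apply]
      have : (degProj n ∘ₗ contract μ : ConstForm K n →ₗ[K] ConstForm K n) = 0 := by
        refine LinearMap.ext fun x => ?_
        rw [LinearMap.comp_apply, degProj_contract, degProj_eq_zero (Nat.lt_succ_self n), map_zero,
          LinearMap.zero_apply]
      rw [this, TensorProduct.map_zero_left, LinearMap.zero_apply]
    · rw [map_smul, map_add, hdη, e, sub_add_cancel, smul_smul, inv_mul_cancel₀ hne, one_smul]

/-- The algebraic Poincaré lemma for free jets: below the top degree, closed forms with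
coefficients in `K[∂] ⊗ N` are exact. -/
theorem exists_koszulD_eq {D : Fin n → M →ₗ[K] M}
    (hD : ∀ μ ν m, D μ (D ν m) = D ν (D μ m)) {N : Submodule K M}
    (hN : ∀ μ, ∀ m ∈ N, D μ m ∈ N) {ω : ConstForm K n ⊗[K] JetModule n M}
    (hω : ω ∈ FormsIn (jetsIn N)) (hbelow : ω ∈ belowTop K n (JetModule n M))
    (hclosed : koszulD (jetD D) ω = 0) :
    ∃ η ∈ FormsIn (jetsIn N), η ∈ belowTop K n (JetModule n M) ∧ koszulD (jetD D) η = ω := by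
  have key : ∀ j ∈ Finset.range n, ∃ η ∈ FormsIn (jetsIn N),
      η ∈ belowTop K n (JetModule n M) ∧ koszulD (jetD D) η = formProj _ j ω := by
    intro j hj
    obtain ⟨a, ha⟩ := exists_mem_formsIn_jetsBelow (formProj_mem_formsIn j hω)
    refine exists_koszulD_eq_of_homogeneous hD hN (Finset.mem_range.mp hj) a ha ?_ ?_
    · rw [formProj_formProj, if_pos rfl]
    · rw [← formProj_succ_koszulD, hclosed, map_zero]
  choose! η h1 h2 h3 using key
  refine ⟨∑ j ∈ Finset.range n, η j, Submodule.sum_mem _ h1, Submodule.sum_mem _ h2, ?_⟩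
  rw [map_sum, sum_congr rfl h3, sum_formProj_of_mem_belowTop hbelow]

/-- The primitives in the algebraic Poincaré lemma can be chosen linearly. -/
theorem exists_koszulD_comp_eq {D : Fin n → M →ₗ[K] M}
    (hD : ∀ μ ν m, D μ (D ν m) = D ν (D μ m)) {N : Submodule K M}
    (hN : ∀ μ, ∀ m ∈ N, D μ m ∈ N)
    (Φ : ConstForm K n →ₗ[K] ConstForm K n ⊗[K] JetModule n M)
    (hΦ : ∀ s, Φ s ∈ FormsIn (jetsIn N)) (hbelow : ∀ s, Φ s ∈ belowTop K n (JetModule n M))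
    (hclosed : ∀ s, koszulD (jetD D) (Φ s) = 0) :
    ∃ R : ConstForm K n →ₗ[K] ConstForm K n ⊗[K] JetModule n M,
      (∀ s, R s ∈ FormsIn (jetsIn N)) ∧
      (∀ s, R s ∈ belowTop K n (JetModule n M)) ∧ ∀ s, koszulD (jetD D) (R s) = Φ s := by
  choose η h1 h2 h3 using fun s => exists_koszulD_eq hD hN (hΦ s) (hbelow s) (hclosed s)
  have e : ∀ s, (dxBasis K n).constr K (fun S => η (dxSet K S)) s =
      ∑ S, (dxBasis K n).repr s S • η (dxSet K S) :=
    fun s => Module.Basis.constr_apply_fintype _ _ _ _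
  refine ⟨(dxBasis K n).constr K fun S => η (dxSet K S), fun s => ?_, fun s => ?_, fun s => ?_⟩
  · rw [e]
    exact Submodule.sum_mem _ fun S _ => Submodule.smul_mem _ _ (h1 _)
  · rw [e]
    exact Submodule.sum_mem _ fun S _ => Submodule.smul_mem _ _ (h2 _)
  · rw [e, map_sum]
    conv_rhs => rw [← (dxBasis K n).sum_repr s, map_sum]
    exact sum_congr rfl fun S _ => by rw [map_smul, map_smul, h3, dxBasis_apply]

end JetModules

/-! ### The descent -/

section Descent

variable {K : Type*} [Field K] {n : ℕ} {M : Type*} [AddCommGroup M] [Module K M]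

/-- A linear map `Φ` from the constant forms to `Λ ⊗ (K[∂] ⊗ M)` stands for an element of
`Λ ⊗ Λ* ⊗ K[∂] ⊗ M`.  The factors `Λ* ⊗ K[∂]` are the jets of the components of one field, and the
operator of this definition is dual to the exterior derivative of this field. -/
def fieldD (Φ : ConstForm K n →ₗ[K] ConstForm K n ⊗[K] JetModule n M) :
    ConstForm K n →ₗ[K] ConstForm K n ⊗[K] JetModule n M :=
  ∑ μ : Fin n, TensorProduct.map LinearMap.id (shift μ) ∘ₗ Φ ∘ₗ LinearMap.mulLeft K (dx K μ)

theorem fieldD_apply (Φ : ConstForm K n →ₗ[K] ConstForm K n ⊗[K] JetModule n M)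
    (s : ConstForm K n) :
    fieldD Φ s = ∑ μ, TensorProduct.map LinearMap.id (shift (K := K) μ) (Φ (dx K μ * s)) := by
  simp [fieldD]

theorem fieldD_sub (Φ Ψ : ConstForm K n →ₗ[K] ConstForm K n ⊗[K] JetModule n M) :
    fieldD (Φ - Ψ) = fieldD Φ - fieldD Ψ := by
  refine LinearMap.ext fun s => ?_
  simp only [fieldD_apply, LinearMap.sub_apply, map_sub, sum_sub_distrib]

theorem fieldD_fieldD (h2 : (2 : K) ≠ 0)
    (Φ : ConstForm K n →ₗ[K] ConstForm K n ⊗[K] JetModule n M) : fieldD (fieldD Φ) = 0 := by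
  refine LinearMap.ext fun s => ?_
  simp only [fieldD_apply, map_sum, map_map_apply, LinearMap.id_comp, LinearMap.zero_apply]
  have hs : ∀ μ ν : Fin n, (shift μ ∘ₗ shift ν : JetModule n M →ₗ[K] JetModule n M) =
      shift ν ∘ₗ shift μ := fun μ ν => LinearMap.ext fun y => shift_comm μ ν y
  have h : ∑ μ, ∑ ν, TensorProduct.map LinearMap.id (shift (K := K) μ ∘ₗ shift ν)
        (Φ (dx K ν * (dx K μ * s))) =
      -∑ μ, ∑ ν, TensorProduct.map LinearMap.id (shift (K := K) μ ∘ₗ shift ν)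
        (Φ (dx K ν * (dx K μ * s))) := by
    conv_lhs => rw [sum_comm]
    rw [← sum_neg_distrib]
    refine sum_congr rfl fun μ _ => ?_
    rw [← sum_neg_distrib]
    refine sum_congr rfl fun ν _ => ?_
    rw [dx_mul_dx_mul_swap, hs, map_neg, map_neg]
  have h' := add_eq_zero_iff_eq_neg.mpr h
  rw [← two_smul K] at h'
  exact (smul_eq_zero.mp h').resolve_left h2

theorem koszulD_fieldD (D : Fin n → M →ₗ[K] M)
    (Φ : ConstForm K n →ₗ[K] ConstForm K n ⊗[K] JetModule n M) (s : ConstForm K n) :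
    koszulD (jetD D) (fieldD Φ s) = fieldD (koszulD (jetD D) ∘ₗ Φ) s := by
  simp only [fieldD_apply, map_sum, LinearMap.comp_apply]
  refine sum_congr rfl fun μ _ => ?_
  rw [map_koszulD (fun ν y => shift_jetD D μ ν y)]

theorem fieldD_degProj {q : ℕ} {Φ : ConstForm K n →ₗ[K] ConstForm K n ⊗[K] JetModule n M}
    (h : ∀ s, Φ (degProj (q + 1) s) = Φ s) (s : ConstForm K n) :
    fieldD Φ (degProj q s) = fieldD Φ s := by
  simp only [fieldD_apply, ← degProj_succ_dx_mul, h]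

theorem fieldD_eq_zero {Φ : ConstForm K n →ₗ[K] ConstForm K n ⊗[K] JetModule n M}
    (h : ∀ s, Φ (degProj 0 s) = Φ s) : fieldD Φ = 0 := by
  refine LinearMap.ext fun s => ?_
  rw [fieldD_apply, LinearMap.zero_apply]
  exact sum_eq_zero fun μ _ => by rw [← h, degProj_zero_dx_mul, map_zero, map_zero]

theorem fieldD_mem_formsIn {N : Submodule K M}
    {Φ : ConstForm K n →ₗ[K] ConstForm K n ⊗[K] JetModule n M}
    (h : ∀ s, Φ s ∈ FormsIn (jetsIn N)) (s : ConstForm K n) :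
    fieldD Φ s ∈ FormsIn (jetsIn N) := by
  rw [fieldD_apply]
  exact Submodule.sum_mem _ fun μ _ => map_mem_formsIn _ (fun y => shift_mem_jetsIn μ) (h _)

/-- Division by the degree in `∂` plus `c`. -/
def divDegree (c : K) : JetModule n M →ₗ[K] JetModule n M :=
  Finsupp.lsum K fun α => ((α.degree : K) + c)⁻¹ • Finsupp.lsingle α

theorem divDegree_single (c : K) (α : Fin n →₀ ℕ) (m : M) :
    divDegree c (Finsupp.single α m) = ((α.degree : K) + c)⁻¹ • Finsupp.single α m := by
  simp [divDegree]

theorem shift_divDegree (c : K) (μ : Fin n) (y : JetModule n M) :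
    shift (K := K) μ (divDegree c y) = divDegree (c - 1) (shift (K := K) μ y) := by
  induction y using jetModule_induction with
  | add x y hx hy => simp only [map_add, hx, hy]
  | single α m =>
    rw [divDegree_single, map_smul, shift_single, divDegree_single, map_add,
      Finsupp.degree_single]
    congr 2
    push_cast
    ring

theorem sum_shift_lower_single (α : Fin n →₀ ℕ) (m : M) :
    ∑ μ, shift (K := K) μ (lower (K := K) μ (Finsupp.single α m)) =
      (α.degree : K) • Finsupp.single α m := by
  rw [Finsupp.degree_eq_sum, Nat.cast_sum, sum_smul]
  refine sum_congr rfl fun μ _ => ?_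
  rw [lower_single, map_smul, shift_single]
  by_cases h : α μ = 0
  · simp [h]
  · rw [tsub_add_single h]

variable (M) in
/-- The augmentation `K[∂] ⊗ M → M`. -/
def constCoeff : JetModule n M →ₗ[K] M := Finsupp.lapply 0

theorem constCoeff_shift (μ : Fin n) (y : JetModule n M) :
    constCoeff (K := K) M (shift (K := K) μ y) = 0 := by
  induction y using jetModule_induction with
  | add x y hx hy => simp only [map_add, hx, hy, add_zero]
  | single α m =>
    rw [shift_single, constCoeff, Finsupp.lapply_apply, Finsupp.single_eq_of_ne]
    intro h
    have := congrArg Finsupp.degree h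
    simp at this

theorem constCoeff_jetD (D : Fin n → M →ₗ[K] M) (μ : Fin n) (y : JetModule n M) :
    constCoeff (K := K) M (jetD D μ y) = D μ (constCoeff (K := K) M y) := by
  rw [jetD, LinearMap.add_apply, map_add, constCoeff_shift, zero_add]
  simp [constCoeff, coeffwise]

/-- For closed `c`, only the part of `d` acting on the marked factor contributes to the differential
of the product of `c` with the marked field. -/
theorem koszulD_canonical {D : Fin n → M →ₗ[K] M} (q : ℕ) (s : ConstForm K n)
    {c : ConstForm K n ⊗[K] M} (hc : koszulD D c = 0) :
    koszulD (jetD D) (TensorProduct.map (LinearMap.mulLeft K (degProj q s))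
      (Finsupp.lsingle 0) c) =
    ∑ μ, TensorProduct.map LinearMap.id (shift (K := K) μ)
      (TensorProduct.map (LinearMap.mulLeft K (degProj (q + 1) (dx K μ * s)))
        (Finsupp.lsingle 0) c) := by
  have h0 : ∑ μ, TensorProduct.map (LinearMap.mulLeft K (dx K μ * degProj q s))
      ((Finsupp.lsingle 0 : M →ₗ[K] JetModule n M) ∘ₗ D μ) c = 0 := by
    have h1 := koszulD_mulLeft_degProj (D := D) q s c
    rw [hc, map_zero, smul_zero, koszulD_apply] at h1
    have h2 := congrArg (TensorProduct.map LinearMap.id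
      (Finsupp.lsingle 0 : M →ₗ[K] JetModule n M)) h1
    rw [map_sum, map_zero] at h2
    rw [← h2]
    refine sum_congr rfl fun μ _ => ?_
    rw [map_map_apply, map_map_apply]
    congr 2
    exact LinearMap.ext fun y => by simp
  rw [koszulD_apply, ← add_zero (∑ μ, TensorProduct.map LinearMap.id _ _), ← h0,
    ← sum_add_distrib]
  refine sum_congr rfl fun μ _ => ?_
  rw [map_map_apply, map_map_apply, degProj_succ_dx_mul]
  refine form_ext fun f => ?_
  rw [map_add, compAt_map, compAt_map, compAt_map]
  have e : LinearMap.mulLeft K (dx K μ) ∘ₗ LinearMap.mulLeft K (degProj q s) =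
      LinearMap.mulLeft K (dx K μ * degProj q s) :=
    LinearMap.ext fun y => by simp
  rw [e, LinearMap.id_comp]
  simp [jetD]

variable [CharZero K]

theorem sum_shift_lower_divDegree {q : ℕ} (y : JetModule n M) :
    ∑ μ, shift (K := K) μ (lower (K := K) μ (divDegree (q : K) y)) +
      (q : K) • divDegree (q : K) y =
      if q = 0 then y - Finsupp.single 0 (constCoeff (K := K) M y) else y := by
  induction y using jetModule_induction with
  | add x y hx hy =>
    simp only [map_add, smul_add, sum_add_distrib, Finsupp.single_add]
    rw [add_add_add_comm, hx, hy]
    split_ifs <;> abel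
  | single α m =>
    simp only [divDegree_single, map_smul, ← smul_sum, sum_shift_lower_single, smul_smul,
      ← add_smul, constCoeff, Finsupp.lapply_apply]
    by_cases hα : α = 0
    · subst hα
      by_cases hq : q = 0
      · subst hq; simp
      · have : (q : K) ≠ 0 := Nat.cast_ne_zero.mpr hq
        simp [hq, this]
    · have h1 : ((α.degree : K) + q) ≠ 0 := by
        have : α.degree ≠ 0 := fun h => hα ((Finsupp.degree_eq_zero_iff α).mp h)
        exact_mod_cast (by omega : α.degree + q ≠ 0)
      rw [show ((α.degree : K) + q)⁻¹ * α.degree + q * ((α.degree : K) + q)⁻¹ = 1 by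
        field_simp, one_smul, Finsupp.single_eq_of_ne (Ne.symm hα), Finsupp.single_zero, sub_zero,
        ite_self]

/-- Exactness of the jets of fields of all degrees under the exterior derivative, on the dual
side, with the augmentation in degree zero. -/
theorem exists_fieldD_eq {N : Submodule K M} {q : ℕ}
    {Φ : ConstForm K n →ₗ[K] ConstForm K n ⊗[K] JetModule n M}
    (hΦ : ∀ s, Φ s ∈ FormsIn (jetsIn N)) (hq : ∀ s, Φ (degProj q s) = Φ s)
    (hδ : fieldD Φ = 0)
    (hε : q = 0 → TensorProduct.map LinearMap.id (constCoeff (K := K) M) (Φ 1) = 0) :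
    ∃ w : ConstForm K n →ₗ[K] ConstForm K n ⊗[K] JetModule n M,
      (∀ s, w s ∈ FormsIn (jetsIn N)) ∧ (∀ s, w (degProj (q + 1) s) = w s) ∧ fieldD w = Φ := by
  refine ⟨∑ μ, TensorProduct.map LinearMap.id (lower (K := K) μ ∘ₗ divDegree (q : K)) ∘ₗ Φ ∘ₗ
    contract μ, fun s => ?_, fun s => ?_, LinearMap.ext fun s => ?_⟩
  · rw [LinearMap.sum_apply]
    refine Submodule.sum_mem _ fun μ _ => map_mem_formsIn _ (fun y hy => ?_) (hΦ _)
    refine lower_mem_jetsIn μ (jetsIn_map (fun α m hm => ?_) hy)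
    rw [divDegree_single]
    exact Submodule.smul_mem _ _ (single_mem_jetsIn _ hm)
  · simp only [LinearMap.sum_apply, LinearMap.comp_apply, ← degProj_contract, hq]
  · -- the anticommutator of `fieldD` and the homotopy is the total degree
    set mp : (JetModule n M →ₗ[K] JetModule n M) →
      ConstForm K n ⊗[K] JetModule n M →ₗ[K] ConstForm K n ⊗[K] JetModule n M :=
      TensorProduct.map LinearMap.id with hmp
    have e1 : ∀ μ ν : Fin n, mp (shift ν) (mp (lower (K := K) μ ∘ₗ divDegree (q : K))
        (Φ (contract μ (dx K ν * s)))) =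
        (if μ = ν then mp (shift ν ∘ₗ lower (K := K) ν ∘ₗ divDegree (q : K)) (Φ s) else 0) -
        (mp (lower (K := K) μ ∘ₗ divDegree ((q : K) - 1) ∘ₗ shift ν)
            (Φ (dx K ν * contract μ s)) -
          if μ = ν then mp (divDegree (q : K)) (Φ (dx K μ * contract μ s)) else 0) := by
      intro μ ν
      have hs : mp (shift ν ∘ₗ lower (K := K) μ ∘ₗ divDegree (q : K))
          (Φ (dx K ν * contract μ s)) =
          mp (lower (K := K) μ ∘ₗ divDegree ((q : K) - 1) ∘ₗ shift ν)
            (Φ (dx K ν * contract μ s)) -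
          if μ = ν then mp (divDegree (q : K)) (Φ (dx K μ * contract μ s)) else 0 := by
        refine form_ext fun f => ?_
        simp only [hmp, map_sub, compAt_map, LinearMap.comp_id, apply_ite (compAt (K := K) _ f),
          map_zero, LinearMap.comp_apply, ← shift_divDegree, lower_shift]
        split_ifs with h
        · subst h; simp
        · simp
      rw [contract_dx_mul, hmp, map_map_apply, ← hmp, LinearMap.id_comp, map_sub, map_sub, hs]
      split_ifs with h
      · subst h; rfl
      · simp
    have e2 : ∀ μ : Fin n, ∑ ν, mp (lower (K := K) μ ∘ₗ divDegree ((q : K) - 1) ∘ₗ shift ν)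
        (Φ (dx K ν * contract μ s)) = 0 := by
      intro μ
      have h := congrArg (mp (lower (K := K) μ ∘ₗ divDegree ((q : K) - 1)))
        (LinearMap.congr_fun hδ (contract μ s))
      rw [fieldD_apply, map_sum, LinearMap.zero_apply, map_zero] at h
      rw [← h]
      refine sum_congr rfl fun ν _ => ?_
      rw [hmp, map_map_apply]; rfl
    rw [fieldD_apply]
    simp only [LinearMap.sum_apply, LinearMap.comp_apply, map_sum]
    rw [sum_comm]
    change ∑ μ, ∑ ν, mp (shift ν) (mp (lower (K := K) μ ∘ₗ divDegree (q : K))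
        (Φ (contract μ (dx K ν * s)))) = Φ s
    simp only [e1, sum_sub_distrib, e2, Finset.sum_ite_eq, Finset.mem_univ, if_true]
    rw [sum_const_zero, zero_sub, sub_neg_eq_add, ← map_sum, ← map_sum, ← numberOp_apply]
    have e3 : Φ (numberOp s) = (q : K) • Φ s := by
      have : Φ (numberOp s) = Φ (numberOp (degProj q s)) := by
        rw [← hq (numberOp s)]
        congr 1
        simp only [numberOp_apply, map_sum]
        refine sum_congr rfl fun μ _ => ?_
        cases q with
        | zero => rw [degProj_zero_dx_mul, contract_degProj_zero, mul_zero]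
        | succ q => rw [degProj_succ_dx_mul, degProj_contract]
      rw [this, numberOp_degProj, map_smul, hq]
    rw [e3]
    have hsplit : mp (if q = 0 then LinearMap.id - Finsupp.lsingle 0 ∘ₗ constCoeff (K := K) M
        else LinearMap.id) (Φ s) = Φ s := by
      split_ifs with h0
      · rw [hmp, map_sub_right_apply, ← hmp, hmp, TensorProduct.map_id, LinearMap.id_apply,
          sub_eq_self]
        -- in degree zero, `Φ s` is a multiple of `Φ 1`
        have : ∀ t : ConstForm K n, TensorProduct.map LinearMap.id (constCoeff (K := K) M)
            (Φ (degProj 0 t)) = 0 := by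
          intro t
          induction t using constForm_induction with
          | one => rw [degProj_one, if_pos rfl, hε h0]
          | add x y hx hy => simp only [map_add, hx, hy, add_zero]
          | smul c x hx => simp only [map_smul, hx, smul_zero]
          | dx_mul μ x hx => rw [degProj_zero_dx_mul, map_zero, map_zero]
        have h := this s
        subst h0
        rw [hq] at h
        have h' := congrArg (TensorProduct.map LinearMap.id
          (Finsupp.lsingle (0 : Fin n →₀ ℕ) : M →ₗ[K] JetModule n M)) h
        rw [map_map_apply, map_zero] at h'
        exact h'
      · rw [hmp, TensorProduct.map_id, LinearMap.id_apply]
    conv_rhs => rw [← hsplit]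
    refine form_ext fun f => ?_
    simp only [hmp, map_add, map_sum, map_smul, compAt_map, LinearMap.comp_id,
      LinearMap.comp_apply]
    rw [sum_shift_lower_divDegree]
    split_ifs <;> rfl

/-- The descent: a closed form with one marked factor from the jets of the curvature of a
`q`-form field (described by the kernel of `fieldD`) is, up to an exact form, the curvature form of
that field times a closed form `c` in the remaining factors. -/
theorem exists_descent {D : Fin n → M →ₗ[K] M}
    (hD : ∀ μ ν m, D μ (D ν m) = D ν (D μ m)) {N : Submodule K M}
    (hN : ∀ μ, ∀ m ∈ N, D μ m ∈ N) (q : ℕ)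
    (Φ : ConstForm K n →ₗ[K] ConstForm K n ⊗[K] JetModule n M)
    (hΦ : ∀ s, Φ s ∈ FormsIn (jetsIn N)) (hq : ∀ s, Φ (degProj q s) = Φ s)
    (hbelow : ∀ s, Φ s ∈ belowTop K n (JetModule n M))
    (hclosed : ∀ s, koszulD (jetD D) (Φ s) = 0) (hδ : fieldD Φ = 0)
    (hε : q = 0 → TensorProduct.map LinearMap.id (constCoeff (K := K) M) (Φ 1) = 0) :
    ∃ c ∈ FormsIn (n := n) N, c ∈ belowTop K n M ∧ koszulD D c = 0 ∧
      ∃ w : ConstForm K n →ₗ[K] ConstForm K n ⊗[K] JetModule n M,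
        (∀ s, w s ∈ FormsIn (jetsIn N)) ∧ (∀ s, w (degProj (q + 1) s) = w s) ∧
        ∀ s, Φ s = koszulD (jetD D) (TensorProduct.map (LinearMap.mulLeft K (degProj q s))
          (Finsupp.lsingle 0) c) + koszulD (jetD D) (fieldD w s) := by
  have h2 : (2 : K) ≠ 0 := two_ne_zero
  have hBN : ∀ (q : ℕ) (s : ConstForm K n) {c : ConstForm K n ⊗[K] M}, c ∈ FormsIn N →
      TensorProduct.map (LinearMap.mulLeft K (degProj q s)) (Finsupp.lsingle 0) c ∈
        FormsIn (jetsIn N) := fun q s c hc =>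
    map_mem_formsIn _ (fun m hm => single_mem_jetsIn (n := n) 0 hm) hc
  have hBadd : ∀ (q : ℕ) (c : ConstForm K n ⊗[K] M),
      ∃ B : ConstForm K n →ₗ[K] ConstForm K n ⊗[K] JetModule n M, ∀ s, B s =
        TensorProduct.map (LinearMap.mulLeft K (degProj q s)) (Finsupp.lsingle 0) c := by
    intro q c
    refine ⟨LinearMap.applyₗ c ∘ₗ (TensorProduct.mapBilinear (RingHom.id K) _ _ _ _).flip
      (Finsupp.lsingle 0) ∘ₗ (LinearMap.mul K (ConstForm K n)) ∘ₗ degProj q, fun s => rfl⟩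
  induction q generalizing Φ with
  | zero =>
    obtain ⟨R, hR1, hR2, hR3⟩ := exists_koszulD_comp_eq hD hN Φ hΦ hbelow hclosed
    set c := TensorProduct.map LinearMap.id (constCoeff (K := K) M) (R 1) with hc
    have hcN : c ∈ FormsIn N := map_mem_formsIn (N := jetsIn N) _ (fun y hy => hy 0) (hR1 1)
    have hdc : koszulD D c = 0 := by
      rw [hc, ← map_koszulD (fun μ y => constCoeff_jetD D μ y), hR3, hε rfl]
    obtain ⟨B, hB⟩ := hBadd 0 c
    set v := R ∘ₗ degProj 0 - B with hv
    obtain ⟨w, hw1, hw2, hw3⟩ := exists_fieldD_eq (N := N) (q := 0) (Φ := v)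
      (fun s => sub_mem (hR1 _) (by rw [hB]; exact hBN _ _ hcN))
      (fun s => by simp [hv, hB, degProj_degProj])
      (fieldD_eq_zero fun s => by simp [hv, hB, degProj_degProj])
      (fun _ => by
        rw [hv, LinearMap.sub_apply, LinearMap.comp_apply, map_sub, hB, degProj_one, if_pos rfl,
          map_map_apply, ← hc, sub_eq_zero]
        have : (constCoeff M ∘ₗ Finsupp.lsingle (0 : Fin n →₀ ℕ) : M →ₗ[K] M) = LinearMap.id :=
          LinearMap.ext fun m => by simp [constCoeff]
        rw [this, LinearMap.mulLeft_one, LinearMap.id_comp, TensorProduct.map_id,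
          LinearMap.id_apply])
    refine ⟨c, hcN, map_id_mem_belowTop _ (hR2 1), hdc, w, hw1, hw2, fun s => ?_⟩
    rw [hw3, ← hB, ← map_add, hv, LinearMap.sub_apply, add_sub_cancel, LinearMap.comp_apply, hR3,
      hq]
  | succ q ih =>
    obtain ⟨R', hR1', hR2', hR3'⟩ := exists_koszulD_comp_eq hD hN Φ hΦ hbelow hclosed
    set R := R' ∘ₗ degProj (q + 1) with hR
    have hR1 : ∀ s, R s ∈ FormsIn (jetsIn N) := fun s => hR1' _
    have hR3 : ∀ s, koszulD (jetD D) (R s) = Φ s := fun s => by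
      rw [hR, LinearMap.comp_apply, hR3', hq]
    have hRq : ∀ s, R (degProj (q + 1) s) = R s := fun s => by simp [hR, degProj_degProj]
    obtain ⟨c, hc1, hc2, hc3, w, hw1, hw2, hw3⟩ := ih (fieldD R) (fieldD_mem_formsIn hR1)
      (fieldD_degProj hRq)
      (fun s => by
        rw [fieldD_apply]
        exact Submodule.sum_mem _ fun μ _ => map_id_mem_belowTop _ (hR2' _))
      (fun s => by
        rw [koszulD_fieldD, show koszulD (jetD D) ∘ₗ R = Φ from LinearMap.ext hR3, hδ,
          LinearMap.zero_apply])
      (fieldD_fieldD h2 R)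
      (fun _ => by
        rw [fieldD_apply, map_sum]
        refine sum_eq_zero fun μ _ => ?_
        rw [map_map_apply]
        refine form_ext fun f => ?_
        rw [compAt_map, LinearMap.comp_apply, constCoeff_shift, map_zero])
    obtain ⟨B, hB⟩ := hBadd (q + 1) c
    set v := R - B - koszulD (jetD D) ∘ₗ w with hv
    have hδv : fieldD v = 0 := by
      refine LinearMap.ext fun s => ?_
      rw [hv, fieldD_sub, fieldD_sub, LinearMap.sub_apply, LinearMap.sub_apply, hw3,
        koszulD_canonical q s hc3, ← koszulD_fieldD, fieldD_apply B]
      simp only [hB, LinearMap.zero_apply]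
      abel
    obtain ⟨w', hw1', hw2', hw3'⟩ := exists_fieldD_eq (N := N) (q := q + 1) (Φ := v)
      (fun s => sub_mem (sub_mem (hR1 _) (by rw [hB]; exact hBN _ _ hc1))
        (koszulD_mem_formsIn (fun μ y hy => jetD_mem_jetsIn hN μ hy) (hw1 s)))
      (fun s => by simp [hv, hB, degProj_degProj, hRq, hw2]) hδv (by simp)
    refine ⟨c, hc1, hc2, hc3, w', hw1', hw2', fun s => ?_⟩
    rw [hw3', ← hB, hv, LinearMap.sub_apply, LinearMap.sub_apply, map_sub, map_sub, hR3,
      LinearMap.comp_apply, koszulD_koszulD (jetD_comm hD) h2]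
    abel

end Descent

/-! ### Jet polynomials: weights, total derivatives and polarization -/

section Weights

open MvPolynomial

variable {K : Type*} [Field K] {σ : Type*}

theorem derivation_sum_apply {A M J : Type*} [CommRing A] [Algebra K A] [AddCommGroup M]
    [Module A M] [Module K M] (s : Finset J) (D : J → Derivation K A M) (x : A) :
    (∑ j ∈ s, D j) x = ∑ j ∈ s, D j x := by
  have h := map_sum (Derivation.coeFnAddMonoidHom (R := K) (A := A) (M := M)) D s
  exact (congrFun h x).trans (Finset.sum_apply _ _ _)

/-- A derivation mapping each variable `X v` to a weighted homogeneous element shifts weights. -/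
theorem mkDerivation_isWeightedHomogeneous {w : σ → ℕ} {f : σ → MvPolynomial σ K} {d : σ → ℕ}
    {e : ℕ} (hf : ∀ v, (f v).IsWeightedHomogeneous w (d v)) (hd : ∀ v, d v = w v + e)
    {x : MvPolynomial σ K} {m : ℕ} (hx : x.IsWeightedHomogeneous w m) :
    (mkDerivation K f x).IsWeightedHomogeneous w (m + e) := by
  rw [← mem_weightedHomogeneousSubmodule, x.as_sum, map_sum]
  refine Submodule.sum_mem _ fun s hs => ?_
  have hsm : Finsupp.weight w s = m := hx (mem_support_iff.mp hs)
  rw [mkDerivation_monomial, Finsupp.sum, smul_sum]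
  refine Submodule.sum_mem _ fun v hv => ?_
  refine Submodule.smul_mem _ _ ?_
  rw [smul_eq_mul, mem_weightedHomogeneousSubmodule]
  have hv1 : (Finsupp.single v 1 : σ →₀ ℕ) ≤ s := by
    rw [Finsupp.single_le_iff]
    exact Nat.one_le_iff_ne_zero.mpr (Finsupp.mem_support_iff.mp hv)
  have h1 : Finsupp.weight w (s - Finsupp.single v 1) + w v = m := by
    rw [← hsm]
    conv_rhs => rw [← tsub_add_cancel_of_le hv1, map_add, Finsupp.weight_single, one_smul]
  have := (isWeightedHomogeneous_monomial w (s - Finsupp.single v 1) ((s v : ℕ) : K) rfl).mul (hf v)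
  rwa [hd, ← add_assoc, h1] at this

/-- Euler's identity for weights: the derivation `X v ↦ w v • X v` multiplies weighted homogeneous
polynomials by their weight. -/
theorem mkDerivation_weight_smul {w : σ → ℕ} {x : MvPolynomial σ K} {m : ℕ}
    (hx : x.IsWeightedHomogeneous w m) :
    mkDerivation K (fun v => (w v : K) • (X v : MvPolynomial σ K)) x = (m : K) • x := by
  conv_lhs => rw [x.as_sum]
  conv_rhs => rw [x.as_sum]
  rw [map_sum, smul_sum]
  refine sum_congr rfl fun s hs => ?_
  have hsm : Finsupp.weight w s = m := hx (mem_support_iff.mp hs)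
  rw [mkDerivation_monomial, ← hsm, Finsupp.weight_apply, Finsupp.sum, Finsupp.sum,
    Nat.cast_sum, sum_smul, smul_sum]
  refine sum_congr rfl fun v hv => ?_
  have hv1 : (Finsupp.single v 1 : σ →₀ ℕ) ≤ s := by
    rw [Finsupp.single_le_iff]
    exact Nat.one_le_iff_ne_zero.mpr (Finsupp.mem_support_iff.mp hv)
  rw [smul_eq_mul, mul_smul_comm, X, monomial_mul, tsub_add_cancel_of_le hv1]
  simp only [smul_monomial, smul_eq_mul, mul_one, Nat.cast_mul]
  congr 1
  ring

theorem weightedHomogeneousComponent_derivation {w : σ → ℕ} {f : σ → MvPolynomial σ K} {d : σ → ℕ}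
    {e : ℕ} (hf : ∀ v, (f v).IsWeightedHomogeneous w (d v)) (hd : ∀ v, d v = w v + e)
    (x : MvPolynomial σ K) (m : ℕ) :
    weightedHomogeneousComponent w (m + e) (mkDerivation K f x) =
      mkDerivation K f (weightedHomogeneousComponent w m x) := by
  induction x using MvPolynomial.induction_on' with
  | add p q hp hq => simp only [map_add, hp, hq]
  | monomial s c =>
    have h := isWeightedHomogeneous_monomial w s c rfl
    rw [weightedHomogeneousComponent_of_mem (mkDerivation_isWeightedHomogeneous hf hd h),
      weightedHomogeneousComponent_of_mem h]
    simp only [add_left_inj]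
    split_ifs <;> simp

theorem weightedHomogeneousComponent_derivation_of_lt {w : σ → ℕ} {f : σ → MvPolynomial σ K}
    {d : σ → ℕ} {e : ℕ} (hf : ∀ v, (f v).IsWeightedHomogeneous w (d v))
    (hd : ∀ v, d v = w v + e) (x : MvPolynomial σ K) {m : ℕ} (hm : m < e) :
    weightedHomogeneousComponent w m (mkDerivation K f x) = 0 := by
  induction x using MvPolynomial.induction_on' with
  | add p q hp hq => simp only [map_add, hp, hq, add_zero]
  | monomial s c =>
    have h := isWeightedHomogeneous_monomial w s c rfl
    rw [weightedHomogeneousComponent_of_mem (mkDerivation_isWeightedHomogeneous hf hd h),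
      if_neg (by omega)]

/-- Every polynomial is the sum of its weighted homogeneous components. -/
theorem exists_sum_weightedHomogeneousComponent (w : σ → ℕ) (x : MvPolynomial σ K) :
    ∃ B : ℕ, ∀ C, B ≤ C → ∑ m ∈ Finset.range C, weightedHomogeneousComponent w m x = x := by
  refine ⟨weightedTotalDegree w x + 1, fun C hC => ?_⟩
  ext s
  rw [coeff_sum]
  simp only [coeff_weightedHomogeneousComponent]
  rw [Finset.sum_ite_eq]
  split_ifs with h
  · rfl
  · by_contra hne
    have := le_weightedTotalDegree w (mem_support_iff.mpr (Ne.symm hne))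
    simp at h
    omega

end Weights

section Jets

open MvPolynomial

variable {K : Type*} [Field K] {n : ℕ} {ι : Type*} {deg : ι → ℕ}

theorem component_eq_compAt (f : Module.Dual K (ConstForm K n)) :
    component K deg f = compAt (JetPoly K n deg) f := rfl

/-- The weight on jet variables which counts `u a` for the field `a` and `e` for each
derivative. -/
def jetWeight (u : ι → ℕ) (e : ℕ) (v : JetVar n deg) : ℕ := u v.1.1 + e * v.2.degree

theorem totalDeriv_X (μ : Fin n) (v : JetVar n deg) :
    totalDeriv K deg μ (X v) = X (v.1, v.2 + Finsupp.single μ 1) := by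
  rw [totalDeriv, mkDerivation_X]

theorem isWeightedHomogeneous_totalDeriv (u : ι → ℕ) (e : ℕ) (μ : Fin n) {x : JetPoly K n deg}
    {m : ℕ} (hx : x.IsWeightedHomogeneous (jetWeight u e) m) :
    (totalDeriv K deg μ x).IsWeightedHomogeneous (jetWeight u e) (m + e) :=
  mkDerivation_isWeightedHomogeneous (fun _ => isWeightedHomogeneous_X K _ _)
    (fun v => by simp [jetWeight]; ring) hx

theorem weightedHomogeneousComponent_totalDeriv (u : ι → ℕ) (e : ℕ) (μ : Fin n)
    (x : JetPoly K n deg) (m : ℕ) :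
    weightedHomogeneousComponent (jetWeight u e) (m + e) (totalDeriv K deg μ x) =
      totalDeriv K deg μ (weightedHomogeneousComponent (jetWeight u e) m x) :=
  weightedHomogeneousComponent_derivation (fun _ => isWeightedHomogeneous_X K _ _)
    (fun v => by simp [jetWeight]; ring) x m

theorem weightedHomogeneousComponent_totalDeriv_of_lt (u : ι → ℕ) {e : ℕ} (μ : Fin n)
    (x : JetPoly K n deg) {m : ℕ} (hm : m < e) :
    weightedHomogeneousComponent (jetWeight u e) m (totalDeriv K deg μ x) = 0 :=
  weightedHomogeneousComponent_derivation_of_lt (fun _ => isWeightedHomogeneous_X K _ _)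
    (fun v => by simp [jetWeight]; ring) x hm

theorem totalDeriv_comm (μ ν : Fin n) (x : JetPoly K n deg) :
    totalDeriv K deg μ (totalDeriv K deg ν x) = totalDeriv K deg ν (totalDeriv K deg μ x) := by
  have h : ⁅totalDeriv K deg μ, totalDeriv K deg ν⁆ = (0 : Derivation K _ _) := by
    refine MvPolynomial.derivation_ext fun v => ?_
    rw [Derivation.commutator_apply]
    simp only [totalDeriv_X, Derivation.zero_apply]
    rw [add_right_comm, sub_self]
  have h' := Derivation.congr_fun h x
  rwa [Derivation.commutator_apply, Derivation.zero_apply, sub_eq_zero] at h'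

open Classical in
/-- The jet variable `∂^α φ` for the component `φ` of the field `a` with index set `T`; it is zero
if `T` has the wrong cardinality. -/
def jetVar (a : ι) (T : Finset (Fin n)) (α : Fin n →₀ ℕ) : JetPoly K n deg :=
  if h : T.card = deg a then X (⟨a, ⟨T, h⟩⟩, α) else 0

theorem jetVar_of_card {a : ι} {T : Finset (Fin n)} (h : T.card = deg a) (α : Fin n →₀ ℕ) :
    (jetVar a T α : JetPoly K n deg) = X (⟨a, ⟨T, h⟩⟩, α) := dif_pos h

theorem X_eq_jetVar (v : JetVar n deg) :
    (X v : JetPoly K n deg) = jetVar v.1.1 v.1.2.1 v.2 :=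
  (jetVar_of_card v.1.2.2 v.2).symm

theorem totalDeriv_jetVar (μ : Fin n) (a : ι) (T : Finset (Fin n)) (α : Fin n →₀ ℕ) :
    totalDeriv K deg μ (jetVar a T α) = jetVar a T (α + Finsupp.single μ 1) := by
  unfold jetVar
  split_ifs
  · rw [totalDeriv_X]
  · exact map_zero _

theorem isWeightedHomogeneous_jetVar (u : ι → ℕ) (e : ℕ) (a : ι) (T : Finset (Fin n))
    (α : Fin n →₀ ℕ) :
    (jetVar a T α : JetPoly K n deg).IsWeightedHomogeneous (jetWeight u e)
      (u a + e * α.degree) := by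
  unfold jetVar
  split_ifs
  · exact isWeightedHomogeneous_X K _ _
  · exact isWeightedHomogeneous_zero K _ _

theorem fieldForm_eq_sum (a : ι) :
    fieldForm K deg a = ∑ T : Finset (Fin n), dxSet K T ⊗ₜ[K] (jetVar a T 0 : JetPoly K n deg) := by
  classical
  rw [fieldForm]
  have h : ∀ S : {S : Finset (Fin n) // S.card = deg a},
      dxSet K S.1 ⊗ₜ[K] (X (⟨a, S⟩, 0) : JetPoly K n deg) =
      dxSet K S.1 ⊗ₜ[K] (jetVar a S.1 0 : JetPoly K n deg) := fun S => by
    rw [jetVar_of_card S.2]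
  simp only [h]
  rw [← Finset.sum_subtype (Finset.univ.filter fun S : Finset (Fin n) => S.card = deg a)
    (by simp) (fun S => dxSet K S ⊗ₜ[K] (jetVar a S 0 : JetPoly K n deg)), Finset.sum_filter]
  refine sum_congr rfl fun T _ => ?_
  split_ifs with hT
  · rfl
  · rw [jetVar, dif_neg hT, TensorProduct.tmul_zero]

theorem compAt_fieldForm (f : Module.Dual K (ConstForm K n)) (a : ι) :
    compAt _ f (fieldForm K deg a) =
      ∑ T : Finset (Fin n), f (dxSet K T) • (jetVar a T 0 : JetPoly K n deg) := by
  rw [fieldForm_eq_sum, map_sum]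
  simp only [compAt_tmul]

/-- The total derivatives as linear maps. -/
abbrev totalD (K : Type*) [Field K] (deg : ι → ℕ) (μ : Fin n) :
    JetPoly K n deg →ₗ[K] JetPoly K n deg := (totalDeriv K deg μ).toLinearMap

theorem extD_eq_koszulD (ω : LocalForm K n deg) : extD K deg ω = koszulD (totalD K deg) ω := rfl

theorem compAt_extD (f : Module.Dual K (ConstForm K n)) (ω : LocalForm K n deg) :
    compAt _ f (extD K deg ω) =
      ∑ μ, totalDeriv K deg μ (compAt _ (f ∘ₗ LinearMap.mulLeft K (dx K μ)) ω) := by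
  rw [extD_eq_koszulD, koszulD_apply, map_sum]
  simp only [compAt_map]
  rfl

theorem extD_extD [CharZero K] (ω : LocalForm K n deg) : extD K deg (extD K deg ω) = 0 :=
  koszulD_koszulD (fun μ ν x => totalDeriv_comm μ ν x) two_ne_zero ω

theorem formProj_fieldForm (a : ι) :
    formProj _ (deg a) (fieldForm K deg a : LocalForm K n deg) = fieldForm K deg a := by
  rw [fieldForm, map_sum]
  refine sum_congr rfl fun S _ => ?_
  rw [formProj, TensorProduct.map_tmul, degProj_dxSet, if_pos S.2]
  rfl

theorem formProj_extD_fieldForm (a : ι) :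
    formProj _ (deg a + 1) (extD K deg (fieldForm K deg a : LocalForm K n deg)) =
      extD K deg (fieldForm K deg a) := by
  rw [extD_eq_koszulD, formProj_succ_koszulD, formProj_fieldForm]

/-- The graded Leibniz rule. -/
theorem extD_formProj_mul (k : ℕ) (b y : LocalForm K n deg) :
    extD K deg (formProj _ k b * y) =
      extD K deg (formProj _ k b) * y + (-1 : K) ^ k • (formProj _ k b * extD K deg y) := by
  simp only [extD_eq_koszulD]
  induction b using TensorProduct.induction_on with
  | zero => simp
  | add b b' hb hb' => simp only [map_add, add_mul, hb, hb', smul_add]; abel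
  | tmul x p =>
    induction y using TensorProduct.induction_on with
    | zero => simp
    | add y y' hy hy' => simp only [map_add, mul_add, hy, hy', smul_add]; abel
    | tmul y q =>
      simp only [formProj, TensorProduct.map_tmul, LinearMap.id_apply,
        Algebra.TensorProduct.tmul_mul_tmul, koszulD_tmul, sum_mul, mul_sum,
        smul_sum, ← sum_add_distrib]
      refine sum_congr rfl fun μ _ => ?_
      rw [← mul_assoc (degProj k x), TensorProduct.smul_tmul', ← smul_mul_assoc,
        ← dx_mul_comm_degProj, ← mul_assoc, ← TensorProduct.tmul_add]
      congr 1
      change totalDeriv K deg μ (p * q) = totalDeriv K deg μ p * q + p * totalDeriv K deg μ q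
      rw [Derivation.leibniz, smul_eq_mul, smul_eq_mul]
      ring

theorem extD_mul {k : ℕ} {b : LocalForm K n deg} (hb : formProj _ k b = b)
    (y : LocalForm K n deg) :
    extD K deg (b * y) = extD K deg b * y + (-1 : K) ^ k • (b * extD K deg y) := by
  conv_lhs => rw [← hb, extD_formProj_mul, hb]

/-- The polarization of jet polynomials with respect to the component `T` of the field `a`: it
maps `x` to `∑_α ∂^α ⊗ ∂x/∂(∂^α φ)`. -/
def polar (a : ι) (T : Finset (Fin n)) :
    Derivation K (JetPoly K n deg) (JetModule n (JetPoly K n deg)) :=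
  open Classical in
  mkDerivation K fun v => if v.1.1 = a ∧ v.1.2.1 = T then Finsupp.single v.2 1 else 0

open Classical in
theorem polar_jetVar (a b : ι) (T S : Finset (Fin n)) (α : Fin n →₀ ℕ) :
    polar (K := K) (deg := deg) a T (jetVar b S α) =
      if b = a ∧ S = T ∧ S.card = deg b then Finsupp.single α 1 else 0 := by
  unfold jetVar
  split_ifs with h1 h2 h2
  · rw [polar, mkDerivation_X, if_pos ⟨h2.1, h2.2.1⟩]
  · rw [polar, mkDerivation_X, if_neg fun h => h2 ⟨h.1, h.2, h1⟩]
  · exact absurd h2.2.2 h1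
  · exact map_zero _

theorem jetD_smul (μ : Fin n) (p : JetPoly K n deg) (y : JetModule n (JetPoly K n deg)) :
    jetD (totalD K deg) μ (p • y) = p • jetD (totalD K deg) μ y + totalDeriv K deg μ p • y := by
  induction y using jetModule_induction with
  | add x y hx hy => simp only [map_add, smul_add, hx, hy]; abel
  | single α m =>
    simp only [Finsupp.smul_single, jetD_single, smul_add, smul_eq_mul]
    rw [add_assoc, ← Finsupp.single_add]
    congr 2
    change totalDeriv K deg μ (p * m) = p * totalDeriv K deg μ m + totalDeriv K deg μ p * m
    rw [Derivation.leibniz, smul_eq_mul, smul_eq_mul, mul_comm m]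

theorem shift_smul (μ : Fin n) (p : JetPoly K n deg) (y : JetModule n (JetPoly K n deg)) :
    shift (K := K) μ (p • y) = p • shift (K := K) μ y := by
  induction y using jetModule_induction with
  | add x y hx hy => simp only [map_add, smul_add, hx, hy]
  | single α m => simp only [Finsupp.smul_single, shift_single]

theorem polar_totalDeriv (a : ι) (T : Finset (Fin n)) (μ : Fin n) (x : JetPoly K n deg) :
    polar a T (totalDeriv K deg μ x) = jetD (totalD K deg) μ (polar a T x) := by
  classical
  induction x using MvPolynomial.induction_on with
  | C c => rw [derivation_C, derivation_C, map_zero, map_zero]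
  | add p q hp hq => simp only [map_add, hp, hq]
  | mul_X p v hp =>
    have hX : polar a T (totalDeriv K deg μ (X v)) = jetD (totalD K deg) μ (polar a T (X v)) := by
      rw [totalDeriv_X, polar, mkDerivation_X, mkDerivation_X]
      split_ifs
      · rw [jetD_single]
        simp
      · simp
    simp only [Derivation.leibniz, smul_eq_mul, map_add, jetD_smul, hX, hp]
    abel

end Jets

/-! ### The algebra of abelian curvatures -/

section AbelianCurvatures

open MvPolynomial

variable {K : Type*} [Field K] {n : ℕ} {ι : Type*} {deg : ι → ℕ}

theorem derivation_mem_adjoin {A : Type*} [CommRing A] [Algebra K A] {s : Set A}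
    {D : Derivation K A A} (h : ∀ x ∈ s, D x ∈ Algebra.adjoin K s) {x : A}
    (hx : x ∈ Algebra.adjoin K s) : D x ∈ Algebra.adjoin K s := by
  induction hx using Algebra.adjoin_induction with
  | mem x hx => exact h x hx
  | algebraMap r => rw [Derivation.map_algebraMap]; exact zero_mem _
  | add x y _ _ hx hy => rw [map_add]; exact add_mem hx hy
  | mul x y hx' hy' hx hy =>
    rw [Derivation.leibniz]
    exact add_mem (mul_mem hx' hy) (mul_mem hy' hx)

theorem foldr_mem_curvatureAlgebra {curv : Set (LocalForm K n deg)} {H : LocalForm K n deg}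
    (hH : H ∈ curv) (f : Module.Dual K (ConstForm K n)) (l : List (Fin n)) :
    l.foldr (fun μ y => totalDeriv K deg μ y) (compAt _ f H) ∈ curvatureAlgebra K deg curv :=
  Algebra.subset_adjoin ⟨H, hH, f, l, rfl⟩

theorem totalDeriv_mem_curvatureAlgebra {curv : Set (LocalForm K n deg)} (μ : Fin n)
    {x : JetPoly K n deg} (hx : x ∈ curvatureAlgebra K deg curv) :
    totalDeriv K deg μ x ∈ curvatureAlgebra K deg curv := by
  refine derivation_mem_adjoin ?_ hx
  rintro _ ⟨H, hH, f, l, rfl⟩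
  exact Algebra.subset_adjoin ⟨H, hH, f, μ :: l, rfl⟩

/-- The multi-index with one derivative for each entry of a list. -/
def multiIndex (l : List (Fin n)) : Fin n →₀ ℕ := (l.map fun μ => Finsupp.single μ 1).sum

theorem multiIndex_cons (μ : Fin n) (l : List (Fin n)) :
    multiIndex (μ :: l) = Finsupp.single μ 1 + multiIndex l := by simp [multiIndex]

theorem exists_multiIndex_eq (α : Fin n →₀ ℕ) : ∃ l : List (Fin n), multiIndex l = α := by
  induction α using Finsupp.induction_linear with
  | zero => exact ⟨[], rfl⟩
  | add α β hα hβ =>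
    obtain ⟨l, rfl⟩ := hα
    obtain ⟨l', rfl⟩ := hβ
    exact ⟨l ++ l', by simp [multiIndex]⟩
  | single μ k => exact ⟨List.replicate k μ, by simp [multiIndex]⟩

theorem foldr_totalDeriv_jetVar (l : List (Fin n)) (a : ι) (T : Finset (Fin n))
    (α : Fin n →₀ ℕ) :
    l.foldr (fun μ y => totalDeriv K deg μ y) (jetVar a T α) = jetVar a T (α + multiIndex l) := by
  induction l with
  | nil => simp [multiIndex]
  | cons μ l ih => rw [List.foldr_cons, ih, totalDeriv_jetVar, multiIndex_cons]; congr 1; abel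

theorem foldr_totalDeriv_sum {J : Type*} (l : List (Fin n)) (s : Finset J) (c : J → K)
    (x : J → JetPoly K n deg) :
    l.foldr (fun μ y => totalDeriv K deg μ y) (∑ j ∈ s, c j • x j) =
      ∑ j ∈ s, c j • l.foldr (fun μ y => totalDeriv K deg μ y) (x j) := by
  induction l with
  | nil => rfl
  | cons μ l ih => simp only [List.foldr_cons, ih, map_sum, Derivation.map_smul]

theorem compAt_extD_fieldForm (f : Module.Dual K (ConstForm K n)) (a : ι) :
    compAt _ f (extD K deg (fieldForm K deg a)) =
      ∑ p : Fin n × Finset (Fin n), f (dx K p.1 * dxSet K p.2) •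
        (jetVar a p.2 (Finsupp.single p.1 1) : JetPoly K n deg) := by
  rw [compAt_extD, Fintype.sum_prod_type]
  refine sum_congr rfl fun μ _ => ?_
  rw [compAt_fieldForm, map_sum]
  refine sum_congr rfl fun T _ => ?_
  rw [Derivation.map_smul, totalDeriv_jetVar, zero_add]
  rfl

theorem foldr_compAt_extD_fieldForm (f : Module.Dual K (ConstForm K n)) (a : ι)
    (l : List (Fin n)) :
    l.foldr (fun μ y => totalDeriv K deg μ y) (compAt _ f (extD K deg (fieldForm K deg a))) =
      ∑ p : Fin n × Finset (Fin n), f (dx K p.1 * dxSet K p.2) •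
        (jetVar a p.2 (Finsupp.single p.1 1 + multiIndex l) : JetPoly K n deg) := by
  rw [compAt_extD_fieldForm, foldr_totalDeriv_sum]
  simp only [foldr_totalDeriv_jetVar]

/-- How a field enters the algebra of invariants: not at all, through all its derivatives, or
through the derivatives of its curvature. -/
inductive FieldKind
  | absent
  | free
  | closed

variable (K n deg) in
/-- The forms from which the abelian invariants are built: the free fields and the abelian
curvatures of the closed ones. -/
def abelianCurvatures (kind : ι → FieldKind) : Set (LocalForm K n deg) :=
  {H | ∃ a, (kind a = .free ∧ H = fieldForm K deg a) ∨
    (kind a = .closed ∧ H = extD K deg (fieldForm K deg a))}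

variable (K n deg) in
/-- The polynomials in the derivatives of the free fields and of the abelian curvatures of the
closed fields. -/
abbrev abelianInv (kind : ι → FieldKind) : Subalgebra K (JetPoly K n deg) :=
  curvatureAlgebra K deg (abelianCurvatures K n deg kind)

variable {kind : ι → FieldKind}

theorem jetVar_mem_abelianInv {a : ι} (ha : kind a = .free) (T : Finset (Fin n))
    (α : Fin n →₀ ℕ) : jetVar a T α ∈ abelianInv K n deg kind := by
  by_cases hT : T.card = deg a
  · obtain ⟨l, rfl⟩ := exists_multiIndex_eq α
    have h := foldr_mem_curvatureAlgebra
      (show fieldForm K deg a ∈ abelianCurvatures K n deg kind from ⟨a, Or.inl ⟨ha, rfl⟩⟩)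
      ((dxBasis K n).coord T) l
    have e : compAt _ ((dxBasis K n).coord T) (fieldForm K deg a) = jetVar a T 0 := by
      rw [compAt_fieldForm, sum_eq_single T]
      · rw [← dxBasis_apply, Module.Basis.coord_apply, Module.Basis.repr_self,
          Finsupp.single_eq_same, one_smul]
      · intro S _ hS
        rw [← dxBasis_apply, Module.Basis.coord_apply, Module.Basis.repr_self,
          Finsupp.single_eq_of_ne (Ne.symm hS), zero_smul]
      · simp
    rwa [e, foldr_totalDeriv_jetVar, zero_add] at h
  · rw [jetVar, dif_neg hT]; exact zero_mem _

theorem foldr_mem_abelianInv {a : ι} (ha : kind a = .closed)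
    (f : Module.Dual K (ConstForm K n)) (l : List (Fin n)) :
    l.foldr (fun μ y => totalDeriv K deg μ y) (compAt _ f (extD K deg (fieldForm K deg a))) ∈
      abelianInv K n deg kind :=
  foldr_mem_curvatureAlgebra
    (show extD K deg (fieldForm K deg a) ∈ abelianCurvatures K n deg kind from
      ⟨a, Or.inr ⟨ha, rfl⟩⟩) f l

/-- The polarization with respect to the field `a` along a constant form `s`, which stands for an
index set. -/
def polarAt (a : ι) (s : ConstForm K n) :
    Derivation K (JetPoly K n deg) (JetModule n (JetPoly K n deg)) :=
  ∑ T, (dxBasis K n).coord T s • polar a T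

theorem polarAt_apply (a : ι) (s : ConstForm K n) (x : JetPoly K n deg) :
    polarAt a s x = ∑ T, (dxBasis K n).coord T s • polar a T x := by
  rw [polarAt, derivation_sum_apply]
  rfl

theorem coord_dxSet (S T : Finset (Fin n)) :
    (dxBasis K n).coord T (dxSet K S) = if S = T then 1 else 0 := by
  classical
  rw [← dxBasis_apply, Module.Basis.coord_apply, Module.Basis.repr_self, Finsupp.single_apply]

theorem polarAt_dxSet (a : ι) (T : Finset (Fin n)) (x : JetPoly K n deg) :
    polarAt a (dxSet K T) x = polar a T x := by
  rw [polarAt_apply, sum_eq_single T]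
  · rw [coord_dxSet, if_pos rfl, one_smul]
  · intro S _ hS
    rw [coord_dxSet, if_neg (Ne.symm hS), zero_smul]
  · simp

theorem polarAt_totalDeriv (a : ι) (s : ConstForm K n) (μ : Fin n) (x : JetPoly K n deg) :
    polarAt a s (totalDeriv K deg μ x) = jetD (totalD K deg) μ (polarAt a s x) := by
  simp only [polarAt_apply, map_sum, map_smul, polar_totalDeriv]

theorem polarAt_compAt_fieldForm_of_ne {a b : ι} (h : b ≠ a) (s : ConstForm K n)
    (f : Module.Dual K (ConstForm K n)) :
    polarAt a s (compAt _ f (fieldForm K deg b)) = 0 := by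
  classical
  rw [polarAt_apply]
  refine sum_eq_zero fun T _ => ?_
  rw [compAt_fieldForm, map_sum, sum_eq_zero, smul_zero]
  intro S _
  rw [Derivation.map_smul, polar_jetVar, if_neg fun h' => h h'.1, smul_zero]

theorem polarAt_compAt_fieldForm (a : ι) (s : ConstForm K n)
    (f : Module.Dual K (ConstForm K n)) :
    polarAt a s (compAt _ f (fieldForm K deg a)) =
      f (degProj (deg a) s) • Finsupp.single 0 1 := by
  classical
  have e : f (degProj (deg a) s) = ∑ T, (dxBasis K n).coord T s *
      if T.card = deg a then f (dxSet K T) else 0 := by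
    conv_lhs => rw [← (dxBasis K n).sum_repr s]
    rw [map_sum, map_sum]
    refine sum_congr rfl fun T _ => ?_
    rw [map_smul, map_smul, dxBasis_apply, degProj_dxSet, Module.Basis.coord_apply, smul_eq_mul]
    split_ifs <;> simp
  rw [e, sum_smul, polarAt_apply]
  refine sum_congr rfl fun T _ => ?_
  rw [mul_smul]
  congr 1
  rw [compAt_fieldForm, map_sum, sum_eq_single T]
  · rw [Derivation.map_smul, polar_jetVar]
    split_ifs with h1 h2 h2
    · rfl
    · exact absurd h1.2.2 h2
    · exact absurd ⟨rfl, rfl, h2⟩ h1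
    · rw [smul_zero, zero_smul]
  · intro S _ hS
    rw [Derivation.map_smul, polar_jetVar, if_neg fun h => hS h.2.1, smul_zero]
  · simp

theorem polarAt_foldr (a : ι) (s : ConstForm K n) (l : List (Fin n)) (x : JetPoly K n deg) :
    polarAt a s (l.foldr (fun μ y => totalDeriv K deg μ y) x) =
      l.foldr (fun μ y => jetD (totalD K deg) μ y) (polarAt a s x) := by
  induction l with
  | nil => rfl
  | cons μ l ih => rw [List.foldr_cons, List.foldr_cons, polarAt_totalDeriv, ih]

theorem polarAt_compAt_extD (a b : ι) (s : ConstForm K n) (f : Module.Dual K (ConstForm K n)) :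
    polarAt a s (compAt _ f (extD K deg (fieldForm K deg b))) =
      ∑ μ, jetD (totalD K deg) μ
        (polarAt a s (compAt _ (f ∘ₗ LinearMap.mulLeft K (dx K μ)) (fieldForm K deg b))) := by
  rw [compAt_extD, map_sum]
  simp only [polarAt_totalDeriv]

theorem polarAt_abelianInv_eq_zero {a : ι} (ha : kind a = .absent) (s : ConstForm K n)
    {x : JetPoly K n deg} (hx : x ∈ abelianInv K n deg kind) : polarAt a s x = 0 := by
  have h0 : ∀ l : List (Fin n), l.foldr (fun μ y => jetD (totalD K deg) μ y)
      (0 : JetModule n (JetPoly K n deg)) = 0 := by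
    intro l
    induction l with
    | nil => rfl
    | cons μ l ih => rw [List.foldr_cons, ih, map_zero]
  induction hx using Algebra.adjoin_induction with
  | mem x hx =>
    obtain ⟨H, ⟨b, hb⟩, f, l, rfl⟩ := hx
    rw [component_eq_compAt, polarAt_foldr]
    have hba : b ≠ a := by
      rintro rfl
      simp [ha] at hb
    rcases hb with ⟨-, rfl⟩ | ⟨-, rfl⟩
    · rw [polarAt_compAt_fieldForm_of_ne hba, h0]
    · rw [polarAt_compAt_extD, sum_eq_zero, h0]
      exact fun μ _ => by rw [polarAt_compAt_fieldForm_of_ne hba, map_zero]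
  | algebraMap r => exact Derivation.map_algebraMap _ _
  | add x y _ _ hx hy => rw [map_add, hx, hy, add_zero]
  | mul x y _ _ hx hy => rw [Derivation.leibniz, hx, hy, smul_zero, smul_zero, add_zero]

/-- The polarizations of abelian invariants have abelian invariants as coefficients. -/
theorem polarAt_mem_jetsIn (a : ι) (s : ConstForm K n) {x : JetPoly K n deg}
    (hx : x ∈ abelianInv K n deg kind) :
    polarAt a s x ∈ jetsIn (Subalgebra.toSubmodule (abelianInv K n deg kind)) := by
  set I := Subalgebra.toSubmodule (abelianInv K n deg kind)
  have hD : ∀ (μ : Fin n), ∀ m ∈ I, totalD K deg μ m ∈ I :=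
    fun μ m hm => totalDeriv_mem_curvatureAlgebra μ hm
  have hl : ∀ (l : List (Fin n)) (y : JetModule n (JetPoly K n deg)), y ∈ jetsIn I →
      l.foldr (fun μ y => jetD (totalD K deg) μ y) y ∈ jetsIn I := by
    intro l y hy
    induction l with
    | nil => exact hy
    | cons μ l ih => exact jetD_mem_jetsIn hD μ ih
  have hf : ∀ b f, polarAt a s (compAt _ f (fieldForm K deg b)) ∈ jetsIn I := by
    intro b f
    by_cases hb : b = a
    · subst hb
      rw [polarAt_compAt_fieldForm]
      exact Submodule.smul_mem _ _ (single_mem_jetsIn _ (one_mem (abelianInv K n deg kind)))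
    · rw [polarAt_compAt_fieldForm_of_ne hb]; exact zero_mem _
  have hsmul : ∀ p ∈ abelianInv K n deg kind, ∀ y ∈ jetsIn I, p • y ∈ jetsIn (n := n) I :=
    fun p hp y hy α => (abelianInv K n deg kind).mul_mem hp (hy α)
  induction hx using Algebra.adjoin_induction with
  | mem x hx =>
    obtain ⟨H, ⟨b, hb⟩, f, l, rfl⟩ := hx
    rw [component_eq_compAt, polarAt_foldr]
    refine hl l _ ?_
    rcases hb with ⟨-, rfl⟩ | ⟨-, rfl⟩
    · exact hf b f
    · rw [polarAt_compAt_extD]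
      exact Submodule.sum_mem _ fun μ _ => jetD_mem_jetsIn hD μ (hf b _)
  | algebraMap r => rw [Derivation.map_algebraMap]; exact zero_mem _
  | add x y _ _ hx hy => rw [map_add]; exact add_mem hx hy
  | mul x y hx' hy' hx hy =>
    rw [Derivation.leibniz]
    exact add_mem (hsmul x hx' _ hy) (hsmul y hy' _ hx)

theorem sum_antisymm_eq_zero [CharZero K] {V : Type*} [AddCommGroup V] [Module K V]
    {J : Type*} [Fintype J] {g : J → J → V} (h : ∀ i j, g i j = -g j i) : ∑ i, ∑ j, g i j = 0 := by
  have h' : ∑ i, ∑ j, g i j = -∑ i, ∑ j, g i j := by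
    conv_lhs => rw [sum_comm]
    rw [← sum_neg_distrib]
    refine sum_congr rfl fun i _ => ?_
    rw [← sum_neg_distrib]
    exact sum_congr rfl fun j _ => h _ _
  have h2 := add_eq_zero_iff_eq_neg.mpr h'
  rw [← two_smul K] at h2
  exact (smul_eq_zero.mp h2).resolve_left two_ne_zero

/-- The Bianchi identity in polarized form: abelian invariants depend on a closed field only
through its curvature. -/
theorem sum_shift_polarAt_eq_zero [CharZero K] {a : ι} (ha : kind a = .closed)
    (s : ConstForm K n) {x : JetPoly K n deg} (hx : x ∈ abelianInv K n deg kind) :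
    ∑ μ, shift (K := K) μ (polarAt a (dx K μ * s) x) = 0 := by
  induction hx using Algebra.adjoin_induction with
  | mem x hx =>
    obtain ⟨H, ⟨b, hb⟩, f, l, rfl⟩ := hx
    simp only [component_eq_compAt, polarAt_foldr]
    have hl : ∀ (l : List (Fin n)) (y : Fin n → JetModule n (JetPoly K n deg)),
        ∑ μ, shift (K := K) μ (y μ) = 0 →
        ∑ μ, shift (K := K) μ (l.foldr (fun μ y => jetD (totalD K deg) μ y) (y μ)) = 0 := by
      intro l y hy
      induction l with
      | nil => exact hy
      | cons ν l ih => simp only [List.foldr_cons, shift_jetD, ← map_sum, ih, map_zero]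
    refine hl l _ ?_
    by_cases hba : b = a
    · subst hba
      rcases hb with ⟨h, -⟩ | ⟨-, rfl⟩
      · rw [ha] at h; cases h
      · have e : ∀ μ, shift (K := K) μ
            (polarAt b (dx K μ * s) (compAt _ f (extD K deg (fieldForm K deg b)))) =
            ∑ ν, (f (dx K ν * degProj (deg b) (dx K μ * s))) •
              Finsupp.single (Finsupp.single ν 1 + Finsupp.single μ 1) (1 : JetPoly K n deg) := by
          intro μ
          rw [polarAt_compAt_extD, map_sum]
          refine sum_congr rfl fun ν _ => ?_
          rw [polarAt_compAt_fieldForm, map_smul, map_smul, jetD_single]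
          simp
        simp only [e]
        refine sum_antisymm_eq_zero (K := K) fun μ ν => ?_
        rw [add_comm (Finsupp.single ν 1), ← neg_smul]
        congr 1
        cases h : deg b with
        | zero => simp [degProj_zero_dx_mul]
        | succ k =>
          rw [degProj_succ_dx_mul, degProj_succ_dx_mul, dx_mul_dx_mul_swap, map_neg]
    · refine sum_eq_zero fun μ _ => ?_
      rcases hb with ⟨-, rfl⟩ | ⟨-, rfl⟩
      · rw [polarAt_compAt_fieldForm_of_ne hba, map_zero]
      · rw [polarAt_compAt_extD, sum_eq_zero, map_zero]
        exact fun μ _ => by rw [polarAt_compAt_fieldForm_of_ne hba, map_zero]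
  | algebraMap r => simp
  | add x y _ _ hx hy => simp only [map_add, sum_add_distrib, hx, hy, add_zero]
  | mul x y _ _ hx hy =>
    simp only [Derivation.leibniz, map_add, shift_smul, sum_add_distrib, ← smul_sum,
      hx, hy, smul_zero, add_zero]

theorem coeffwise_smul (D : Derivation K (JetPoly K n deg) (JetPoly K n deg))
    (p : JetPoly K n deg) (y : JetModule n (JetPoly K n deg)) :
    coeffwise D.toLinearMap (p • y) = p • coeffwise D.toLinearMap y + D p • y := by
  induction y using jetModule_induction with
  | add x y hx hy => simp only [map_add, smul_add, hx, hy]; abel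
  | single α m =>
    simp only [Finsupp.smul_single, coeffwise_single, smul_eq_mul]
    rw [← Finsupp.single_add]
    congr 1
    change D (p * m) = p * D m + D p * m
    rw [Derivation.leibniz, smul_eq_mul, smul_eq_mul, mul_comm m]

/-- A family of infinitesimal linear transformations, with constant coefficients, which mix fields
of the same degree and kind. -/
structure FieldRotations (K : Type*) [Field K] (n : ℕ) {ι : Type*} [Fintype ι] (deg : ι → ℕ)
    (kind : ι → FieldKind) (E : Type*) where
  /-- The action on jet polynomials. -/
  act : E → Derivation K (JetPoly K n deg) (JetPoly K n deg)
  /-- The matrices of the transformations. -/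
  coeff : E → ι → ι → K
  act_jetVar : ∀ ε a T α, act ε (jetVar a T α) = ∑ c, coeff ε a c • jetVar c T α
  deg_eq : ∀ ε a c, coeff ε a c ≠ 0 → deg a = deg c
  kind_eq : ∀ ε a c, coeff ε a c ≠ 0 → kind a = kind c

variable [Fintype ι] {E : Type*} (G : FieldRotations K n deg kind E)

theorem FieldRotations.act_totalDeriv (ε : E) (μ : Fin n) (x : JetPoly K n deg) :
    G.act ε (totalDeriv K deg μ x) = totalDeriv K deg μ (G.act ε x) := by
  have h : ⁅G.act ε, totalDeriv K deg μ⁆ = (0 : Derivation K _ _) := by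
    refine MvPolynomial.derivation_ext fun v => ?_
    rw [Derivation.commutator_apply, X_eq_jetVar, totalDeriv_jetVar, G.act_jetVar, G.act_jetVar,
      map_sum]
    simp only [Derivation.map_smul, totalDeriv_jetVar, Derivation.zero_apply, sub_self]
  have h' := Derivation.congr_fun h x
  rwa [Derivation.commutator_apply, Derivation.zero_apply, sub_eq_zero] at h'

/-- The polarizations transform under the rotations like the polarized polynomial, with the marked
field in the dual representation. -/
theorem FieldRotations.act_polar (ε : E) (a : ι) (T : Finset (Fin n)) (x : JetPoly K n deg) :
    coeffwise (G.act ε).toLinearMap (polar a T x) =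
      polar a T (G.act ε x) - ∑ c, G.coeff ε c a • polar c T x := by
  classical
  induction x using MvPolynomial.induction_on with
  | C c => simp [derivation_C]
  | add p q hp hq =>
    simp only [map_add, hp, hq, smul_add, sum_add_distrib]
    abel
  | mul_X p v hp =>
    have hX : coeffwise (G.act ε).toLinearMap (polar a T (X v : JetPoly K n deg)) =
        polar a T (G.act ε (X v)) - ∑ c, G.coeff ε c a • polar c T (X v : JetPoly K n deg) := by
      rw [X_eq_jetVar, G.act_jetVar, map_sum]
      simp only [Derivation.map_smul, polar_jetVar]
      have h1 : coeffwise (G.act ε).toLinearMap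
          (if v.1.1 = a ∧ v.1.2.1 = T ∧ v.1.2.1.card = deg v.1.1 then
            Finsupp.single v.2 (1 : JetPoly K n deg) else 0) = 0 := by
        split_ifs
        · rw [coeffwise_single]
          change Finsupp.single _ (G.act ε 1) = 0
          rw [Derivation.map_one_eq_zero, Finsupp.single_zero]
        · exact map_zero _
      rw [h1, eq_comm, sub_eq_zero, sum_eq_single a, sum_eq_single v.1.1]
      · by_cases h : G.coeff ε v.1.1 a = 0
        · simp [h]
        · have hd := G.deg_eq ε _ _ h
          simp [hd]
      · intro c _ hc
        rw [if_neg fun h => hc h.1.symm, smul_zero]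
      · simp
      · intro c _ hc
        rw [if_neg fun h => hc h.1, smul_zero]
      · simp
    simp only [Derivation.leibniz, map_add, coeffwise_smul, hX, hp, smul_add, smul_sub,
      sum_add_distrib, smul_comm _ p, smul_comm _ (X v : JetPoly K n deg), smul_sum,
      smul_eq_mul]
    simp only [← smul_sum]
    abel

end AbelianCurvatures

/-! ### Families of abelian invariants -/

section AbelianCohomology

open MvPolynomial

variable {K : Type*} [Field K] {n : ℕ} {ι : Type*} {deg : ι → ℕ} {kind : ι → FieldKind}

variable (K deg) in
/-- The total derivatives of families of jet polynomials. -/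
def famD (Θ : Type*) (μ : Fin n) : (Θ → JetPoly K n deg) →ₗ[K] (Θ → JetPoly K n deg) :=
  (totalD K deg μ).compLeft Θ

theorem famD_apply (Θ : Type*) (μ : Fin n) (x : Θ → JetPoly K n deg) (θ : Θ) :
    famD K deg Θ μ x θ = totalDeriv K deg μ (x θ) := rfl

theorem famD_comm (Θ : Type*) (μ ν : Fin n) (x : Θ → JetPoly K n deg) :
    famD K deg Θ μ (famD K deg Θ ν x) = famD K deg Θ ν (famD K deg Θ μ x) :=
  funext fun _ => totalDeriv_comm _ _ _

/-- The member `θ` of a family of forms. -/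
def evFam {Θ : Type*} (θ : Θ) :
    ConstForm K n ⊗[K] (Θ → JetPoly K n deg) →ₗ[K] LocalForm K n deg :=
  TensorProduct.map LinearMap.id (LinearMap.proj θ)

theorem compAt_evFam {Θ : Type*} (θ : Θ) (f : Module.Dual K (ConstForm K n))
    (ω : ConstForm K n ⊗[K] (Θ → JetPoly K n deg)) :
    compAt _ f (evFam θ ω) = compAt _ f ω θ := by
  rw [evFam, compAt_map]; rfl

theorem evFam_ext {Θ : Type*} {ω ω' : ConstForm K n ⊗[K] (Θ → JetPoly K n deg)}
    (h : ∀ θ, evFam θ ω = evFam θ ω') : ω = ω' := by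
  refine form_ext fun f => funext fun θ => ?_
  rw [← compAt_evFam, ← compAt_evFam, h]

theorem evFam_koszulD {Θ : Type*} (θ : Θ) (ω : ConstForm K n ⊗[K] (Θ → JetPoly K n deg)) :
    evFam θ (koszulD (famD K deg Θ) ω) = extD K deg (evFam θ ω) := by
  have h : ∀ (μ : Fin n) (m : Θ → JetPoly K n deg),
      (LinearMap.proj θ : (Θ → JetPoly K n deg) →ₗ[K] JetPoly K n deg) (famD K deg Θ μ m) =
        totalD K deg μ ((LinearMap.proj θ : (Θ → JetPoly K n deg) →ₗ[K] JetPoly K n deg) m) :=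
    fun _ _ => rfl
  have h' := map_koszulD h ω
  rw [extD_eq_koszulD, evFam, h']

theorem mapRange_jetD {M M' : Type*} [AddCommGroup M] [Module K M] [AddCommGroup M']
    [Module K M'] {D : Fin n → M →ₗ[K] M} {D' : Fin n → M' →ₗ[K] M'} {φ : M →ₗ[K] M'}
    (h : ∀ μ m, φ (D μ m) = D' μ (φ m)) (μ : Fin n) (y : JetModule n M) :
    Finsupp.mapRange.linearMap φ (jetD D μ y) = jetD D' μ (Finsupp.mapRange.linearMap φ y) := by
  induction y using jetModule_induction with
  | add x y hx hy => simp only [map_add, hx, hy]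
  | single α m =>
    rw [jetD_single, map_add]
    simp only [Finsupp.mapRange.linearMap_apply, Finsupp.mapRange_single, jetD_single, h]

theorem mapRange_shift {M M' : Type*} [AddCommGroup M] [Module K M] [AddCommGroup M']
    [Module K M'] (φ : M →ₗ[K] M') (μ : Fin n) (y : JetModule n M) :
    Finsupp.mapRange.linearMap φ (shift (K := K) μ y) =
      shift (K := K) μ (Finsupp.mapRange.linearMap φ y) := by
  induction y using jetModule_induction with
  | add x y hx hy => simp only [map_add, hx, hy]
  | single α m => simp

theorem isWeightedHomogeneous_polar_apply {k : ℕ} (a : ι) (T : Finset (Fin n))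
    {x : JetPoly K n deg} (hx : x.IsWeightedHomogeneous (jetWeight (fun _ => 1) 0) (k + 1))
    (α : Fin n →₀ ℕ) :
    (polar a T x α).IsWeightedHomogeneous (jetWeight (fun _ => 1) 0) k := by
  classical
  rw [← mem_weightedHomogeneousSubmodule, x.as_sum, map_sum, Finsupp.finsetSum_apply]
  refine Submodule.sum_mem _ fun s hs => ?_
  have hsm := hx (mem_support_iff.mp hs)
  rw [polar, mkDerivation_monomial, Finsupp.smul_apply]
  refine Submodule.smul_mem _ _ ?_
  rw [Finsupp.sum, Finsupp.finsetSum_apply]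
  refine Submodule.sum_mem _ fun v hv => ?_
  have hv1 : (Finsupp.single v 1 : JetVar n deg →₀ ℕ) ≤ s := by
    rw [Finsupp.single_le_iff]
    exact Nat.one_le_iff_ne_zero.mpr (Finsupp.mem_support_iff.mp hv)
  have h1 : Finsupp.weight (jetWeight (fun _ => 1) 0) (s - Finsupp.single v 1) = k := by
    have h2 : Finsupp.weight (jetWeight (fun _ => 1) 0) s =
        Finsupp.weight (jetWeight (fun _ => 1) 0) (s - Finsupp.single v 1) + 1 := by
      conv_lhs => rw [← tsub_add_cancel_of_le hv1, map_add, Finsupp.weight_single, one_smul]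
      simp [jetWeight]
    omega
  have hmon := isWeightedHomogeneous_monomial (jetWeight (fun _ => 1) 0)
    (s - Finsupp.single v 1) ((s v : ℕ) : K) h1
  rw [Finsupp.smul_apply]
  split_ifs
  · rw [Finsupp.single_apply]
    split_ifs
    · rw [smul_eq_mul, mul_one]; exact hmon
    · rw [smul_zero]; exact Submodule.zero_mem _
  · rw [Finsupp.coe_zero, Pi.zero_apply, smul_zero]; exact Submodule.zero_mem _

variable [Fintype ι]

/-- Contraction of a family indexed by `Θ × ι` with a family indexed by `ι`. -/
def mulFam {Θ : Type*} (β : ι → JetPoly K n deg) :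
    (Θ × ι → JetPoly K n deg) →ₗ[K] (Θ → JetPoly K n deg) :=
  LinearMap.pi fun θ => ∑ a, LinearMap.mulLeft K (β a) ∘ₗ LinearMap.proj (θ, a)

theorem mulFam_apply {Θ : Type*} (β : ι → JetPoly K n deg) (m : Θ × ι → JetPoly K n deg) (θ : Θ) :
    mulFam β m θ = ∑ a, β a * m (θ, a) := by
  simp [mulFam]

/-- The exterior product of a family of forms indexed by `ι` with one indexed by `Θ × ι`, summed
over `ι`. -/
def wedgeFam {Θ : Type*} (b : ι → LocalForm K n deg)
    (y : ConstForm K n ⊗[K] (Θ × ι → JetPoly K n deg)) :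
    ConstForm K n ⊗[K] (Θ → JetPoly K n deg) :=
  ∑ U, TensorProduct.map (LinearMap.mulLeft K (dxSet K U))
    (mulFam fun a => compAt _ ((dxBasis K n).coord U) (b a)) y

theorem evFam_wedgeFam {Θ : Type*} (b : ι → LocalForm K n deg)
    (y : ConstForm K n ⊗[K] (Θ × ι → JetPoly K n deg)) (θ : Θ) :
    evFam θ (wedgeFam b y) = ∑ a, b a * evFam (θ, a) y := by
  have h : ∀ a, b a * evFam (θ, a) y = ∑ U, (dxSet K U ⊗ₜ[K]
      compAt _ ((dxBasis K n).coord U) (b a)) * evFam (θ, a) y := by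
    intro a
    rw [← sum_mul, sum_dxSet_tmul_compAt]
  simp only [h]
  rw [sum_comm, wedgeFam, map_sum]
  refine sum_congr rfl fun U _ => ?_
  clear h
  induction y using TensorProduct.induction_on with
  | zero => simp
  | add y y' hy hy' => simp only [map_add, mul_add, sum_add_distrib, hy, hy']
  | tmul x m =>
    simp only [evFam, TensorProduct.map_tmul, LinearMap.id_apply, LinearMap.proj_apply,
      LinearMap.mulLeft_apply, Algebra.TensorProduct.tmul_mul_tmul, mulFam_apply,
      TensorProduct.tmul_sum]

variable {E : Type*} (G : FieldRotations K n deg kind E)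

/-- The families of abelian invariants which are homogeneous of degree `k` in the fields and are
invariant under the rotations, acting on the index of the family by the matrices `ρ`. -/
def invFam (k : ℕ) {Θ : Type*} [Fintype Θ] (ρ : E → Θ → Θ → K) :
    Submodule K (Θ → JetPoly K n deg) where
  carrier := {x | ∀ θ, x θ ∈ abelianInv K n deg kind ∧
    (x θ).IsWeightedHomogeneous (jetWeight (fun _ => 1) 0) k ∧
    ∀ ε, G.act ε (x θ) + ∑ θ', ρ ε θ θ' • x θ' = 0}
  add_mem' {x y} hx hy θ := ⟨add_mem (hx θ).1 (hy θ).1, (hx θ).2.1.add (hy θ).2.1, fun ε => by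
    have h := congrArg₂ (· + ·) ((hx θ).2.2 ε) ((hy θ).2.2 ε)
    simp only [add_zero] at h
    rw [← h]
    simp only [Pi.add_apply, map_add, smul_add, sum_add_distrib]
    abel⟩
  zero_mem' θ := ⟨zero_mem _, isWeightedHomogeneous_zero K _ _, fun ε => by simp⟩
  smul_mem' c x hx θ := ⟨Subalgebra.smul_mem _ (hx θ).1 c,
    (weightedHomogeneousSubmodule K _ k).smul_mem c (hx θ).2.1, fun ε => by
    have h := congrArg (c • ·) ((hx θ).2.2 ε)
    simp only [smul_zero] at h
    rw [← h]
    simp only [Pi.smul_apply, Derivation.map_smul, smul_add, smul_sum, smul_comm c]⟩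

theorem famD_mem_invFam {k : ℕ} {Θ : Type*} [Fintype Θ] {ρ : E → Θ → Θ → K} (μ : Fin n)
    {x : Θ → JetPoly K n deg} (hx : x ∈ invFam G k ρ) : famD K deg Θ μ x ∈ invFam G k ρ := by
  intro θ
  refine ⟨totalDeriv_mem_curvatureAlgebra μ (hx θ).1, ?_, fun ε => ?_⟩
  · exact isWeightedHomogeneous_totalDeriv _ 0 μ (hx θ).2.1
  · have h := congrArg (totalDeriv K deg μ) ((hx θ).2.2 ε)
    simp only [map_add, map_sum, Derivation.map_smul, map_zero] at h
    simp only [famD_apply, G.act_totalDeriv, h]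

open Classical in
/-- The matrices by which the rotations act on the additional index of a polarized family. -/
def liftRep {Θ : Type*} (ρ : E → Θ → Θ → K) : E → Θ × ι → Θ × ι → K := fun ε p q =>
  (if p.2 = q.2 then ρ ε p.1 q.1 else 0) + if p.1 = q.1 then G.coeff ε q.2 p.2 else 0

theorem sum_liftRep {Θ : Type*} [Fintype Θ] (ρ : E → Θ → Θ → K) (ε : E) (θ : Θ) (a : ι)
    (m : Θ × ι → JetPoly K n deg) :
    ∑ q, liftRep G ρ ε (θ, a) q • m q =
      ∑ θ', ρ ε θ θ' • m (θ', a) + ∑ c, G.coeff ε c a • m (θ, c) := by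
  classical
  simp only [liftRep, add_smul, sum_add_distrib, Fintype.sum_prod_type, ite_smul, zero_smul,
    Finset.sum_ite_eq, Finset.mem_univ, if_true]
  congr 1
  rw [sum_comm]
  simp

/-- The families of abelian invariants, of degree one in the fields, which transform like the
fields. -/
structure IsCurvatureFamily (β : ι → JetPoly K n deg) : Prop where
  mem : ∀ a, β a ∈ abelianInv K n deg kind
  homogeneous : ∀ a, (β a).IsWeightedHomogeneous (jetWeight (fun _ => 1) 0) 1
  act : ∀ ε a, G.act ε (β a) = ∑ c, G.coeff ε a c • β c

theorem mulFam_mem_invFam {k : ℕ} {Θ : Type*} [Fintype Θ] {ρ : E → Θ → Θ → K}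
    {β : ι → JetPoly K n deg} (hβ : IsCurvatureFamily G β) {m : Θ × ι → JetPoly K n deg}
    (hm : m ∈ invFam G k (liftRep G ρ)) : mulFam β m ∈ invFam G (k + 1) ρ := by
  intro θ
  rw [mulFam_apply]
  refine ⟨sum_mem fun a _ => mul_mem (hβ.mem a) (hm _).1,
    IsWeightedHomogeneous.sum _ _ _ fun a _ => ?_, fun ε => ?_⟩
  · rw [add_comm]
    exact (hβ.homogeneous a).mul (hm _).2.1
  · have hact : ∀ a, G.act ε (m (θ, a)) =
        -(∑ θ', ρ ε θ θ' • m (θ', a) + ∑ c, G.coeff ε c a • m (θ, c)) := by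
      intro a
      rw [← sum_liftRep]
      exact eq_neg_of_add_eq_zero_left ((hm (θ, a)).2.2 ε)
    simp only [mulFam_apply, map_sum, Derivation.leibniz, hact, hβ.act, smul_neg, smul_add,
      sum_add_distrib, sum_neg_distrib, smul_sum, neg_add]
    have e1 : ∑ a, ∑ c, m (θ, a) • G.coeff ε a c • β c =
        ∑ a, ∑ c, β a • G.coeff ε c a • m (θ, c) := by
      rw [sum_comm]
      refine sum_congr rfl fun c _ => sum_congr rfl fun a _ => ?_
      rw [smul_comm, smul_comm (β c), smul_eq_mul, smul_eq_mul, mul_comm]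
    have e2 : ∑ θ', ∑ a, ρ ε θ θ' • (β a * m (θ', a)) =
        ∑ a, ∑ θ', β a • ρ ε θ θ' • m (θ', a) := by
      rw [sum_comm]
      refine sum_congr rfl fun c _ => sum_congr rfl fun a _ => ?_
      rw [smul_comm, smul_eq_mul]
    rw [e1, e2]
    abel

theorem wedgeFam_mem_formsIn {k : ℕ} {Θ : Type*} [Fintype Θ] {ρ : E → Θ → Θ → K}
    {b : ι → LocalForm K n deg}
    (hb : ∀ f, IsCurvatureFamily G fun a => compAt _ f (b a))
    {y : ConstForm K n ⊗[K] (Θ × ι → JetPoly K n deg)}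
    (hy : y ∈ FormsIn (invFam G k (liftRep G ρ))) :
    wedgeFam b y ∈ FormsIn (invFam G (k + 1) ρ) :=
  Submodule.sum_mem _ fun _ _ => map_mem_formsIn _ (fun _ => mulFam_mem_invFam G (hb _)) hy

open Classical in
theorem sum_smul_ite {sel : ι → Prop} {a : ι} {g : ι → K} (h : ∀ c, g c ≠ 0 → (sel a ↔ sel c))
    (β : ι → JetPoly K n deg) :
    ∑ c, g c • (if sel c then β c else 0) = if sel a then ∑ c, g c • β c else 0 := by
  have h' : ∀ c, g c • (if sel c then β c else 0) = if sel a then g c • β c else 0 := by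
    intro c
    by_cases hc : g c = 0
    · simp [hc]
    · simp [h c hc]
  simp only [h']
  split_ifs <;> simp

open Classical in
theorem isCurvatureFamily_free (T : Finset (Fin n)) (α : Fin n →₀ ℕ) :
    IsCurvatureFamily G fun a => if kind a = .free then jetVar a T α else 0 where
  mem a := by
    split_ifs with h
    · exact jetVar_mem_abelianInv h T α
    · exact zero_mem _
  homogeneous a := by
    split_ifs
    · simpa using isWeightedHomogeneous_jetVar (fun _ => 1) 0 a T α
    · exact isWeightedHomogeneous_zero K _ _
  act ε a := by
    rw [sum_smul_ite fun c h => by rw [G.kind_eq ε a c h], ← G.act_jetVar]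
    split_ifs
    · rfl
    · exact map_zero _

open Classical in
theorem isCurvatureFamily_closed (p : ℕ) (f : Module.Dual K (ConstForm K n)) (l : List (Fin n)) :
    IsCurvatureFamily G fun a => if kind a = .closed ∧ deg a = p then
      l.foldr (fun μ y => totalDeriv K deg μ y) (compAt _ f (extD K deg (fieldForm K deg a)))
      else 0 where
  mem a := by
    split_ifs with h
    · exact foldr_mem_abelianInv h.1 f l
    · exact zero_mem _
  homogeneous a := by
    split_ifs
    · rw [foldr_compAt_extD_fieldForm]
      refine IsWeightedHomogeneous.sum _ _ _ fun p _ => ?_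
      refine (weightedHomogeneousSubmodule K _ 1).smul_mem _ ?_
      simpa using isWeightedHomogeneous_jetVar (fun _ => 1) 0 a _ _
    · exact isWeightedHomogeneous_zero K _ _
  act ε a := by
    refine Eq.trans ?_ (Eq.trans
      (sum_smul_ite (sel := fun a => kind a = .closed ∧ deg a = p)
      (fun c h => by rw [G.deg_eq ε a c h, G.kind_eq ε a c h]) fun a => l.foldr (fun μ y => totalDeriv K deg μ y)
        (compAt _ f (extD K deg (fieldForm K deg a)))).symm ?_)
    swap
    · exact sum_congr rfl fun c _ => by congr
    split_ifs
    · simp only [foldr_compAt_extD_fieldForm, map_sum, Derivation.map_smul, G.act_jetVar,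
        smul_sum]
      rw [sum_comm]
      exact sum_congr rfl fun c _ => sum_congr rfl fun p _ => smul_comm _ _ _
    · exact map_zero _

open Classical in
/-- The polarization of families with respect to the selected fields. -/
def polFam {Θ : Type*} [Fintype Θ] (sel : ι → Prop) (T : Finset (Fin n)) :
    (Θ → JetPoly K n deg) →ₗ[K] JetModule n (Θ × ι → JetPoly K n deg) :=
  ∑ θ, ∑ a, if sel a then Finsupp.mapRange.linearMap (LinearMap.single K _ (θ, a)) ∘ₗ
    (polar a T).toLinearMap ∘ₗ LinearMap.proj θ else 0

open Classical in
theorem polFam_eq {Θ : Type*} [Fintype Θ] (sel : ι → Prop) (T : Finset (Fin n))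
    (x : Θ → JetPoly K n deg) :
    polFam sel T x = ∑ θ, ∑ a, if sel a then Finsupp.mapRange.linearMap
      (LinearMap.single K (fun _ : Θ × ι => JetPoly K n deg) (θ, a)) (polar a T (x θ))
      else 0 := by
  simp only [polFam, LinearMap.sum_apply]
  refine sum_congr rfl fun θ _ => sum_congr rfl fun a _ => ?_
  split_ifs <;> rfl

open Classical in
theorem polFam_apply {Θ : Type*} [Fintype Θ] (sel : ι → Prop) (T : Finset (Fin n))
    (x : Θ → JetPoly K n deg) (α : Fin n →₀ ℕ) (θ : Θ) (a : ι) :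
    polFam sel T x α (θ, a) = if sel a then polar a T (x θ) α else 0 := by
  rw [polFam_eq]
  simp only [Finsupp.finsetSum_apply, Finset.sum_apply]
  rw [sum_eq_single θ, sum_eq_single a]
  · split_ifs <;> simp
  · intro c _ hc
    split_ifs
    · simp [Ne.symm hc]
    · rfl
  · simp
  · intro θ' _ hθ
    refine sum_eq_zero fun c _ => ?_
    split_ifs
    · simp [Ne.symm hθ]
    · rfl
  · simp

theorem polFam_famD {Θ : Type*} [Fintype Θ] (sel : ι → Prop) (T : Finset (Fin n)) (μ : Fin n)
    (x : Θ → JetPoly K n deg) :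
    polFam sel T (famD K deg Θ μ x) = jetD (famD K deg (Θ × ι)) μ (polFam sel T x) := by
  classical
  simp only [polFam_eq, map_sum]
  refine sum_congr rfl fun θ _ => sum_congr rfl fun a _ => ?_
  split_ifs
  · rw [famD_apply, polar_totalDeriv]
    refine mapRange_jetD (fun ν m => ?_) μ _
    ext q
    simp only [LinearMap.single_apply, famD_apply]
    by_cases hq : q = (θ, a)
    · subst hq; simp
    · simp [Pi.single_eq_of_ne hq]
  · exact (map_zero _).symm

theorem polFam_mem_jetsIn {k : ℕ} {Θ : Type*} [Fintype Θ] {ρ : E → Θ → Θ → K} {sel : ι → Prop}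
    (hsel : ∀ a c, deg a = deg c → kind a = kind c → (sel a ↔ sel c)) (T : Finset (Fin n))
    {x : Θ → JetPoly K n deg} (hx : x ∈ invFam G (k + 1) ρ) :
    polFam sel T x ∈ jetsIn (invFam G k (liftRep G ρ)) := by
  classical
  rintro α ⟨θ, a⟩
  simp only [sum_liftRep, polFam_apply]
  refine ⟨?_, ?_, fun ε => ?_⟩
  · split_ifs
    · rw [← polarAt_dxSet]
      exact polarAt_mem_jetsIn a _ (hx θ).1 α
    · exact zero_mem _
  · split_ifs
    · exact isWeightedHomogeneous_polar_apply a T (hx θ).2.1 α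
    · exact isWeightedHomogeneous_zero K _ _
  · rw [sum_smul_ite fun c h => (hsel c a (G.deg_eq ε c a h) (G.kind_eq ε c a h)).symm]
    split_ifs with ha
    · have h2 := DFunLike.congr_fun (G.act_polar ε a T (x θ)) α
      have h3 : G.act ε (x θ) = -∑ θ', ρ ε θ θ' • x θ' :=
        eq_neg_of_add_eq_zero_left ((hx θ).2.2 ε)
      rw [h3] at h2
      simp only [coeffwise, Finsupp.mapRange.linearMap_apply, Finsupp.mapRange_apply,
        Derivation.coeFn_coe, Finsupp.sub_apply, map_neg, map_sum, Derivation.map_smul,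
        Finsupp.neg_apply, Finsupp.finsetSum_apply, Finsupp.smul_apply] at h2
      rw [h2]
      abel
    · simp

open Classical in
/-- Multiplication of the marked factor back into the family: the partial inverse of the
polarization. -/
def contrFam {Θ : Type*} (sel : ι → Prop) (T : Finset (Fin n)) :
    JetModule n (Θ × ι → JetPoly K n deg) →ₗ[K] (Θ → JetPoly K n deg) :=
  Finsupp.lsum K fun α => mulFam fun a => if sel a then jetVar a T α else 0

open Classical in
theorem contrFam_single {Θ : Type*} (sel : ι → Prop) (T : Finset (Fin n)) (α : Fin n →₀ ℕ)
    (m : Θ × ι → JetPoly K n deg) :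
    contrFam sel T (Finsupp.single α m) =
      mulFam (fun a => if sel a then jetVar a T α else 0) m := by
  simp [contrFam]

theorem contrFam_jetD {Θ : Type*} (sel : ι → Prop) (T : Finset (Fin n)) (μ : Fin n)
    (y : JetModule n (Θ × ι → JetPoly K n deg)) :
    contrFam sel T (jetD (famD K deg (Θ × ι)) μ y) = famD K deg Θ μ (contrFam sel T y) := by
  classical
  induction y using jetModule_induction with
  | add x y hx hy => simp only [map_add, hx, hy]
  | single α m =>
    rw [jetD_single, map_add, contrFam_single, contrFam_single, contrFam_single]
    ext1 θ
    rw [Pi.add_apply, famD_apply, mulFam_apply, mulFam_apply, mulFam_apply, map_sum,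
      ← sum_add_distrib]
    refine sum_congr rfl fun a _ => ?_
    rw [Derivation.leibniz, famD_apply, smul_eq_mul, smul_eq_mul]
    split_ifs
    · rw [totalDeriv_jetVar]; ring
    · simp

open Classical in
/-- The derivation which counts the selected fields. -/
def countDeriv (sel : ι → Prop) : Derivation K (JetPoly K n deg) (JetPoly K n deg) :=
  mkDerivation K fun v => if sel v.1.1 then X v else 0

open Classical in
/-- Euler's formula: polarizing and putting the marked factor back counts the selected fields. -/
theorem sum_contrFam_polFam {Θ : Type*} [Fintype Θ] (sel : ι → Prop) (x : Θ → JetPoly K n deg)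
    (θ : Θ) : (∑ T, contrFam sel T (polFam sel T x)) θ = countDeriv sel (x θ) := by
  -- contraction of one polarized factor, as a linear map over the jet polynomials
  set ctr : ι → Finset (Fin n) → JetModule n (JetPoly K n deg) →ₗ[JetPoly K n deg] JetPoly K n deg :=
    fun a T => Finsupp.linearCombination (JetPoly K n deg) (fun α => jetVar a T α) with hctr
  have h1 : ∀ (a : ι) (T : Finset (Fin n)) (θ' : Θ), sel a →
      ∀ y : JetModule n (JetPoly K n deg), contrFam sel T (Finsupp.mapRange.linearMap
        (LinearMap.single K (fun _ : Θ × ι => JetPoly K n deg) (θ', a)) y) θ =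
        if θ' = θ then ctr a T y else 0 := by
    intro a T θ' ha y
    induction y using jetModule_induction with
    | add x y hx hy => simp only [map_add, Pi.add_apply, hx, hy]; split_ifs <;> simp
    | single α m =>
      rw [Finsupp.mapRange.linearMap_apply, Finsupp.mapRange_single, contrFam_single,
        mulFam_apply, sum_eq_single a]
      · rw [if_pos ha, hctr]
        simp only [Finsupp.linearCombination_single, smul_eq_mul]
        split_ifs with h
        · subst h; simp [mul_comm]
        · have : (θ, a) ≠ (θ', a) := fun h' => h (congrArg Prod.fst h').symm
          simp [Pi.single_eq_of_ne this]
      · intro c _ hc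
        have : (θ, c) ≠ (θ', a) := fun h' => hc (congrArg Prod.snd h')
        simp [Pi.single_eq_of_ne this]
      · simp
  have h2 : (∑ T, contrFam sel T (polFam sel T x)) θ =
      ∑ T, ∑ a, if sel a then ctr a T (polar a T (x θ)) else 0 := by
    rw [Finset.sum_apply]
    refine sum_congr rfl fun T _ => ?_
    rw [polFam_eq]
    simp only [map_sum, Finset.sum_apply]
    rw [sum_comm]
    refine sum_congr rfl fun a _ => ?_
    split_ifs with ha
    · simp only [h1 a T _ ha]
      simp
    · simp
  have h3 : (∑ T, ∑ a, if sel a then (ctr a T).compDer (polar a T) else 0 :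
      Derivation K (JetPoly K n deg) (JetPoly K n deg)) = countDeriv sel := by
    refine MvPolynomial.derivation_ext fun v => ?_
    rw [derivation_sum_apply, countDeriv, mkDerivation_X, sum_eq_single v.1.2.1]
    · rw [derivation_sum_apply, sum_eq_single v.1.1]
      · split_ifs with h
        · change ctr v.1.1 v.1.2.1 (polar v.1.1 v.1.2.1 (X v)) = X v
          rw [polar, mkDerivation_X, if_pos ⟨rfl, rfl⟩, hctr]
          simp only [Finsupp.linearCombination_single, one_smul]
          exact (X_eq_jetVar v).symm
        · rfl
      · intro c _ hc
        split_ifs with h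
        · change ctr c v.1.2.1 (polar c v.1.2.1 (X v)) = 0
          rw [polar, mkDerivation_X, if_neg fun h' => hc h'.1.symm, map_zero]
        · rfl
      · simp
    · intro T _ hT
      rw [derivation_sum_apply]
      refine sum_eq_zero fun c _ => ?_
      split_ifs with h
      · change ctr c T (polar c T (X v)) = 0
        rw [polar, mkDerivation_X, if_neg fun h' => hT h'.2.symm, map_zero]
      · rfl
    · simp
  rw [h2, ← h3, derivation_sum_apply]
  refine sum_congr rfl fun T _ => ?_
  rw [derivation_sum_apply]
  refine sum_congr rfl fun a _ => ?_
  split_ifs <;> rfl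

end AbelianCohomology

/-! ### Polarization of forms -/

section AbelianTheorem

open MvPolynomial

variable {K : Type*} [Field K] {n : ℕ} {ι : Type*} {deg : ι → ℕ} {kind : ι → FieldKind}

variable (K n deg kind) in
/-- The algebra generated by the constant forms and the abelian curvatures of the closed fields. -/
def closedAlgebra : Subalgebra K (LocalForm K n deg) :=
  Algebra.adjoin K (Set.range (fun μ : Fin n => dx K μ ⊗ₜ[K] (1 : JetPoly K n deg)) ∪
    {ω | ∃ a, kind a = .closed ∧ ω = extD K deg (fieldForm K deg a)})

theorem tmul_one_mem_of_dx {A : Subalgebra K (LocalForm K n deg)}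
    (h : ∀ μ : Fin n, dx K μ ⊗ₜ[K] (1 : JetPoly K n deg) ∈ A) (x : ConstForm K n) :
    x ⊗ₜ[K] (1 : JetPoly K n deg) ∈ A := by
  induction x using constForm_induction with
  | one => exact one_mem A
  | add x y hx hy => rw [TensorProduct.add_tmul]; exact add_mem hx hy
  | smul c x hx => rw [← TensorProduct.smul_tmul']; exact Subalgebra.smul_mem A hx c
  | dx_mul μ x hx =>
    have := A.mul_mem (h μ) hx
    rwa [Algebra.TensorProduct.tmul_mul_tmul, one_mul] at this

theorem tmul_one_mem_closedAlgebra (x : ConstForm K n) :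
    x ⊗ₜ[K] (1 : JetPoly K n deg) ∈ closedAlgebra K n deg kind :=
  tmul_one_mem_of_dx (A := closedAlgebra K n deg kind)
    (fun μ => Algebra.subset_adjoin (Or.inl ⟨μ, rfl⟩)) x

theorem mem_of_homogeneous_zero {A : Subalgebra K (LocalForm K n deg)}
    (h : ∀ x : ConstForm K n, x ⊗ₜ[K] (1 : JetPoly K n deg) ∈ A) {w : JetVar n deg → ℕ}
    (hw : ∀ v, w v ≠ 0) {ω : LocalForm K n deg}
    (hω : ω ∈ FormsIn (weightedHomogeneousSubmodule K w 0)) : ω ∈ A := by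
  rw [← sum_dxSet_tmul_compAt ω]
  refine sum_mem fun S _ => ?_
  have h0 := hω ((dxBasis K n).coord S)
  rw [mem_weightedHomogeneousSubmodule] at h0
  have h1 := weightedHomogeneousComponent_of_mem (m := 0) h0
  rw [if_pos rfl, weightedHomogeneousComponent_zero _ hw] at h1
  rw [← h1, C_eq_smul_one, TensorProduct.tmul_smul]
  exact Subalgebra.smul_mem A (h _) _

variable [Fintype ι]

/-- The polarization of a family of forms, as a linear map on the constant forms which label the
components of the marked field. -/
def polForm {Θ : Type*} [Fintype Θ] (sel : ι → Prop)
    (P : ConstForm K n ⊗[K] (Θ → JetPoly K n deg)) :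
    ConstForm K n →ₗ[K] ConstForm K n ⊗[K] JetModule n (Θ × ι → JetPoly K n deg) :=
  ∑ T, ((dxBasis K n).coord T).smulRight (TensorProduct.map LinearMap.id (polFam sel T) P)

theorem polForm_apply {Θ : Type*} [Fintype Θ] (sel : ι → Prop)
    (P : ConstForm K n ⊗[K] (Θ → JetPoly K n deg)) (s : ConstForm K n) :
    polForm sel P s = ∑ T, (dxBasis K n).coord T s •
      TensorProduct.map LinearMap.id (polFam sel T) P := by
  simp [polForm]

theorem polForm_dxSet {Θ : Type*} [Fintype Θ] (sel : ι → Prop)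
    (P : ConstForm K n ⊗[K] (Θ → JetPoly K n deg)) (S : Finset (Fin n)) :
    polForm sel P (dxSet K S) = TensorProduct.map LinearMap.id (polFam sel S) P := by
  rw [polForm_apply, sum_eq_single S]
  · rw [coord_dxSet, if_pos rfl, one_smul]
  · intro T _ hT
    rw [coord_dxSet, if_neg (Ne.symm hT), zero_smul]
  · simp

theorem constForm_linearMap_ext {V : Type*} [AddCommGroup V] [Module K V]
    {f g : ConstForm K n →ₗ[K] V} (h : ∀ S, f (dxSet K S) = g (dxSet K S)) : f = g :=
  (dxBasis K n).ext fun S => by rw [dxBasis_apply, h]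

/-- Multiplication of the marked factor back into a polarized family of forms. -/
def contrForm {Θ : Type*} (sel : ι → Prop) :
    (ConstForm K n →ₗ[K] ConstForm K n ⊗[K] JetModule n (Θ × ι → JetPoly K n deg)) →ₗ[K]
      ConstForm K n ⊗[K] (Θ → JetPoly K n deg) :=
  ∑ T, TensorProduct.map LinearMap.id (contrFam sel T) ∘ₗ LinearMap.applyₗ (dxSet K T)

theorem contrForm_apply {Θ : Type*} (sel : ι → Prop)
    (v : ConstForm K n →ₗ[K] ConstForm K n ⊗[K] JetModule n (Θ × ι → JetPoly K n deg)) :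
    contrForm sel v =
      ∑ T, TensorProduct.map LinearMap.id (contrFam sel T) (v (dxSet K T)) := by
  simp [contrForm]

theorem contrForm_koszulD {Θ : Type*} (sel : ι → Prop)
    (v : ConstForm K n →ₗ[K] ConstForm K n ⊗[K] JetModule n (Θ × ι → JetPoly K n deg)) :
    contrForm sel (koszulD (jetD (famD K deg (Θ × ι))) ∘ₗ v) =
      koszulD (famD K deg Θ) (contrForm sel v) := by
  rw [contrForm_apply, contrForm_apply, map_sum]
  refine sum_congr rfl fun T _ => ?_
  rw [LinearMap.comp_apply]
  exact map_koszulD (fun μ y => contrFam_jetD sel T μ y) _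

theorem map_sum_right_apply {M M' J : Type*} [AddCommGroup M] [Module K M] [AddCommGroup M']
    [Module K M'] (s : Finset J) (φ : J → M →ₗ[K] M') (ω : ConstForm K n ⊗[K] M) :
    TensorProduct.map LinearMap.id (∑ j ∈ s, φ j) ω =
      ∑ j ∈ s, TensorProduct.map LinearMap.id (φ j) ω :=
  form_ext fun f => by simp only [map_sum, compAt_map, LinearMap.sum_apply]

theorem map_smul_right_apply' {M M' : Type*} [AddCommGroup M] [Module K M] [AddCommGroup M']
    [Module K M'] (c : K) (φ : M →ₗ[K] M') (ω : ConstForm K n ⊗[K] M) :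
    TensorProduct.map LinearMap.id (c • φ) ω = c • TensorProduct.map LinearMap.id φ ω :=
  form_ext fun f => by simp only [map_smul, compAt_map, LinearMap.smul_apply]

theorem contrForm_polForm {Θ : Type*} [Fintype Θ] (sel : ι → Prop)
    (P : ConstForm K n ⊗[K] (Θ → JetPoly K n deg)) :
    contrForm sel (polForm sel P) =
      TensorProduct.map LinearMap.id ((countDeriv sel).toLinearMap.compLeft Θ) P := by
  rw [contrForm_apply]
  simp only [polForm_dxSet, map_map_apply, LinearMap.id_comp]
  rw [← map_sum_right_apply]
  congr 2
  refine LinearMap.ext fun x => funext fun θ => ?_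
  have := sum_contrFam_polFam sel x θ
  simp only [LinearMap.sum_apply, LinearMap.comp_apply]
  rw [this]
  rfl

open Classical in
/-- Total contraction counts fields: on abelian invariants of field degree `k` only the free and
closed fields contribute. -/
theorem sum_contrForm_polForm {Θ : Type*} [Fintype Θ] {E : Type*} (G : FieldRotations K n deg kind E)
    {k D : ℕ} {ρ : E → Θ → Θ → K} (hD : ∀ a, deg a < D)
    {P : ConstForm K n ⊗[K] (Θ → JetPoly K n deg)} (hP : P ∈ FormsIn (invFam G k ρ)) :
    contrForm (fun a => kind a = .free) (polForm (fun a => kind a = .free) P) +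
      ∑ p ∈ Finset.range D, contrForm (fun a => kind a = .closed ∧ deg a = p)
        (polForm (fun a => kind a = .closed ∧ deg a = p) P) = (k : K) • P := by
  simp only [contrForm_polForm]
  rw [← map_sum_right_apply]
  have e : P = TensorProduct.map LinearMap.id LinearMap.id P := by
    rw [TensorProduct.map_id]; rfl
  conv_rhs => rw [e, ← map_smul_right_apply']
  refine form_ext fun f => ?_
  rw [map_add, compAt_map, compAt_map, compAt_map]
  have hx := hP f
  rw [LinearMap.comp_id]
  set x := compAt _ f P with hxdef
  refine funext fun θ => ?_
  obtain ⟨h1, h2, -⟩ := hx θ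
  have h3 := mkDerivation_weight_smul h2
  rw [LinearMap.smul_apply, LinearMap.id_apply, Pi.smul_apply, ← h3]
  have habs : (countDeriv fun a => kind a = .absent) (x θ) = 0 := by
    have := sum_contrFam_polFam (fun a => kind a = .absent) (fun _ : Unit => x θ) ()
    rw [← this, Finset.sum_apply]
    refine sum_eq_zero fun T _ => ?_
    have h0 : polFam (fun a => kind a = .absent) T (fun _ : Unit => x θ) = 0 := by
      refine Finsupp.ext fun α => funext fun q => ?_
      rw [polFam_apply]
      split_ifs with ha
      · rw [← polarAt_dxSet, polarAt_abelianInv_eq_zero ha _ h1]; rfl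
      · rfl
    rw [h0, map_zero]; rfl
  have hder : (countDeriv (fun a => kind a = .free) +
      ∑ p ∈ Finset.range D, countDeriv (fun a => kind a = .closed ∧ deg a = p) +
      countDeriv (fun a => kind a = .absent) : Derivation K (JetPoly K n deg) (JetPoly K n deg)) =
      mkDerivation K fun v =>
        (jetWeight (fun _ => 1) 0 v : K) • (X v : JetPoly K n deg) := by
    refine MvPolynomial.derivation_ext fun v => ?_
    rw [Derivation.add_apply, Derivation.add_apply, derivation_sum_apply]
    simp only [countDeriv, mkDerivation_X, jetWeight]
    have hk : kind v.1.1 = .absent ∨ kind v.1.1 = .free ∨ kind v.1.1 = .closed := by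
      cases kind v.1.1 <;> simp
    rcases hk with hk | hk | hk <;> simp [hk, hD]
  rw [← hder, Derivation.add_apply, habs, add_zero, Derivation.add_apply,
    derivation_sum_apply, Pi.add_apply, LinearMap.sum_apply, Finset.sum_apply]
  rfl

theorem polForm_mem_formsIn {Θ : Type*} [Fintype Θ] {E : Type*} (G : FieldRotations K n deg kind E)
    {k : ℕ} {ρ : E → Θ → Θ → K} {sel : ι → Prop}
    (hsel : ∀ a c, deg a = deg c → kind a = kind c → (sel a ↔ sel c))
    {P : ConstForm K n ⊗[K] (Θ → JetPoly K n deg)} (hP : P ∈ FormsIn (invFam G (k + 1) ρ))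
    (s : ConstForm K n) : polForm sel P s ∈ FormsIn (jetsIn (invFam G k (liftRep G ρ))) := by
  rw [polForm_apply]
  exact Submodule.sum_mem _ fun T _ => Submodule.smul_mem _ _
    (map_mem_formsIn _ (fun x hx => polFam_mem_jetsIn G hsel T hx) hP)

theorem polForm_mem_belowTop {Θ : Type*} [Fintype Θ] (sel : ι → Prop)
    {P : ConstForm K n ⊗[K] (Θ → JetPoly K n deg)} (hP : P ∈ belowTop K n _)
    (s : ConstForm K n) : polForm sel P s ∈ belowTop K n _ := by
  rw [polForm_apply]
  exact Submodule.sum_mem _ fun T _ => Submodule.smul_mem _ _ (map_id_mem_belowTop _ hP)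

theorem koszulD_polForm {Θ : Type*} [Fintype Θ] (sel : ι → Prop)
    {P : ConstForm K n ⊗[K] (Θ → JetPoly K n deg)} (hP : koszulD (famD K deg Θ) P = 0)
    (s : ConstForm K n) : koszulD (jetD (famD K deg (Θ × ι))) (polForm sel P s) = 0 := by
  rw [polForm_apply, map_sum]
  refine sum_eq_zero fun T _ => ?_
  rw [map_smul, ← map_koszulD (fun μ x => polFam_famD sel T μ x), hP, map_zero, smul_zero]

theorem contrFam_eq_sum {Θ : Type*} (sel : ι → Prop) (T : Finset (Fin n))
    (y : JetModule n (Θ × ι → JetPoly K n deg)) :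
    contrFam sel T y = y.sum fun α m => contrFam sel T (Finsupp.single α m) := by
  conv_lhs => rw [← y.sum_single]
  rw [Finsupp.sum, map_sum]
  rfl

/-- The free fields contribute an exact term, by the algebraic Poincaré lemma. -/
theorem exists_free_contribution {Θ : Type*} [Fintype Θ] {E : Type*}
    (G : FieldRotations K n deg kind E) [CharZero K] {k : ℕ} {ρ : E → Θ → Θ → K}
    {P : ConstForm K n ⊗[K] (Θ → JetPoly K n deg)} (hP : P ∈ FormsIn (invFam G (k + 1) ρ))
    (hbelow : P ∈ belowTop K n _) (hclosed : koszulD (famD K deg Θ) P = 0) :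
    ∃ R ∈ FormsIn (invFam G (k + 1) ρ),
      contrForm (fun a => kind a = .free) (polForm (fun a => kind a = .free) P) =
        koszulD (famD K deg Θ) R := by
  obtain ⟨R, h1, -, h3⟩ := exists_koszulD_comp_eq (famD_comm (K := K) (deg := deg) (Θ × ι))
    (fun μ m hm => famD_mem_invFam G μ hm) (polForm (fun a => kind a = .free) P)
    (polForm_mem_formsIn G (fun a c _ h => by rw [h]) hP) (polForm_mem_belowTop _ hbelow)
    (koszulD_polForm _ hclosed)
  refine ⟨contrForm (fun a => kind a = .free) R, ?_, ?_⟩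
  · rw [contrForm_apply]
    refine Submodule.sum_mem _ fun T _ => map_mem_formsIn _ (fun y hy => ?_) (h1 _)
    rw [contrFam_eq_sum]
    refine Submodule.sum_mem _ fun α _ => ?_
    dsimp only
    rw [contrFam_single]
    exact mulFam_mem_invFam G (isCurvatureFamily_free G T α) (hy α)
  · rw [← contrForm_koszulD]
    congr 1
    exact LinearMap.ext fun s => (h3 s).symm

open Classical in
theorem sum_coord_polFam {Θ : Type*} [Fintype Θ] {sel : ι → Prop}
    (s : ConstForm K n) (x : Θ → JetPoly K n deg) :
    ∑ T, (dxBasis K n).coord T s • polFam sel T x =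
      ∑ θ, ∑ a, if sel a then Finsupp.mapRange.linearMap
        (LinearMap.single K (fun _ : Θ × ι => JetPoly K n deg) (θ, a)) (polarAt a s (x θ))
        else 0 := by
  simp only [polFam_eq, smul_sum]
  rw [sum_comm]
  refine sum_congr rfl fun θ _ => ?_
  rw [sum_comm]
  refine sum_congr rfl fun a _ => ?_
  by_cases h : sel a
  · simp only [h, if_true, polarAt_apply, map_sum, map_smul]
  · simp only [h, if_false, smul_zero, sum_const_zero]

/-- The Bianchi identity for the polarization with respect to closed fields. -/
theorem fieldD_polForm [CharZero K] {Θ : Type*} [Fintype Θ] {E : Type*}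
    (G : FieldRotations K n deg kind E)
    {k : ℕ} {ρ : E → Θ → Θ → K} {sel : ι → Prop} (hsel : ∀ a, sel a → kind a = .closed)
    {P : ConstForm K n ⊗[K] (Θ → JetPoly K n deg)} (hP : P ∈ FormsIn (invFam G k ρ)) :
    fieldD (polForm sel P) = 0 := by
  classical
  refine LinearMap.ext fun s => ?_
  have e : ∀ t, polForm sel P t = TensorProduct.map LinearMap.id
      (∑ T, (dxBasis K n).coord T t • polFam sel T) P := by
    intro t
    rw [polForm_apply, map_sum_right_apply]
    simp only [map_smul_right_apply']
  rw [fieldD_apply]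
  simp only [e, map_map_apply, LinearMap.id_comp]
  rw [← map_sum_right_apply, map_congr_of_mem_formsIn (ψ := 0) _ ?_ hP, TensorProduct.map_zero_right]
  · rfl
  · intro x hx
    simp only [LinearMap.sum_apply, LinearMap.comp_apply, LinearMap.smul_apply, sum_coord_polFam,
      map_sum, LinearMap.zero_apply]
    rw [sum_comm]
    refine sum_eq_zero fun θ _ => ?_
    rw [sum_comm]
    refine sum_eq_zero fun a _ => ?_
    by_cases ha : sel a
    · simp only [ha, if_true, ← mapRange_shift]
      rw [← map_sum, sum_shift_polarAt_eq_zero (hsel a ha) s (hx θ).1, map_zero]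
    · simp only [ha, if_false, map_zero, sum_const_zero]

theorem polFam_eq_zero {Θ : Type*} [Fintype Θ] {sel : ι → Prop} {T : Finset (Fin n)}
    (h : ∀ a, sel a → T.card ≠ deg a) :
    (polFam sel T : (Θ → JetPoly K n deg) →ₗ[K] _) = 0 := by
  classical
  refine LinearMap.ext fun x => Finsupp.ext fun α => funext fun q => ?_
  rw [polFam_apply]
  split_ifs with ha
  · have : polar (K := K) (deg := deg) q.2 T = 0 := by
      refine MvPolynomial.derivation_ext fun v => ?_
      rw [X_eq_jetVar, polar_jetVar, if_neg]
      · rfl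
      · rintro ⟨h1, h2, h3⟩
        rw [h2, h1] at h3
        exact h _ ha h3
    rw [this]; rfl
  · rfl

theorem polForm_degProj {Θ : Type*} [Fintype Θ] {sel : ι → Prop} {p : ℕ}
    (hsel : ∀ a, sel a → deg a = p) (P : ConstForm K n ⊗[K] (Θ → JetPoly K n deg))
    (s : ConstForm K n) : polForm sel P (degProj p s) = polForm sel P s := by
  have h : polForm sel P ∘ₗ degProj p = polForm sel P := by
    refine constForm_linearMap_ext fun S => ?_
    rw [LinearMap.comp_apply, degProj_dxSet]
    split_ifs with hS
    · rfl
    · rw [map_zero, polForm_dxSet, polFam_eq_zero fun a ha h => hS (h.trans (hsel a ha)),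
        TensorProduct.map_zero_right]
      rfl
  exact LinearMap.congr_fun h s

open Classical in
/-- The selected fields, as forms. -/
def selForm (sel : ι → Prop) (a : ι) : LocalForm K n deg := if sel a then fieldForm K deg a else 0

open Classical in
/-- Putting the field back into the product of the marked field with `c` gives the exterior product
of the selected fields with `c`. -/
theorem contrForm_const {Θ : Type*} {sel : ι → Prop} {p : ℕ} (hsel : ∀ a, sel a → deg a = p)
    {c : ConstForm K n ⊗[K] (Θ × ι → JetPoly K n deg)}
    {v : ConstForm K n →ₗ[K] ConstForm K n ⊗[K] JetModule n (Θ × ι → JetPoly K n deg)}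
    (hv : ∀ s, v s = TensorProduct.map (LinearMap.mulLeft K (degProj p s)) (Finsupp.lsingle 0) c) :
    contrForm sel v = wedgeFam (selForm sel) c := by
  rw [contrForm_apply, wedgeFam]
  refine sum_congr rfl fun T _ => ?_
  have e : (fun a => compAt _ ((dxBasis K n).coord T) (selForm sel a : LocalForm K n deg)) =
      fun a => if sel a then jetVar a T 0 else 0 := by
    funext a
    rw [selForm]
    split_ifs
    · rw [compAt_fieldForm, sum_eq_single T]
      · rw [coord_dxSet, if_pos rfl, one_smul]
      · intro S _ hS
        rw [coord_dxSet, if_neg hS, zero_smul]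
      · simp
    · exact map_zero _
  rw [hv, e, map_map_apply, LinearMap.id_comp, degProj_dxSet]
  have e2 : contrFam sel T ∘ₗ Finsupp.lsingle 0 =
      (mulFam fun a => if sel a then jetVar a T 0 else 0 :
        (Θ × ι → JetPoly K n deg) →ₗ[K] _) :=
    LinearMap.ext fun m => contrFam_single sel T 0 m
  rw [e2]
  split_ifs with hT
  · rfl
  · have e3 : (mulFam fun a => if sel a then jetVar a T 0 else 0 :
        (Θ × ι → JetPoly K n deg) →ₗ[K] (Θ → JetPoly K n deg)) = 0 := by
      refine LinearMap.ext fun m => funext fun θ => ?_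
      rw [mulFam_apply]
      refine sum_eq_zero fun a _ => ?_
      split_ifs with ha
      · rw [jetVar, dif_neg fun h => hT (h.trans (hsel a ha)), zero_mul]
      · rw [zero_mul]
    rw [e3, TensorProduct.map_zero_right, TensorProduct.map_zero_right]

/-- Contraction of `fieldD w` combines the fields to their curvatures, so that the result is again
an abelian invariant. -/
theorem contrForm_fieldD_mem {Θ : Type*} [Fintype Θ] {E : Type*}
    (G : FieldRotations K n deg kind E) {k p : ℕ} {ρ : E → Θ → Θ → K}
    {w : ConstForm K n →ₗ[K] ConstForm K n ⊗[K] JetModule n (Θ × ι → JetPoly K n deg)}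
    (hw : ∀ s, w s ∈ FormsIn (jetsIn (invFam G k (liftRep G ρ)))) :
    contrForm (fun a => kind a = .closed ∧ deg a = p) (fieldD w) ∈
      FormsIn (invFam G (k + 1) ρ) := by
  classical
  set sel : ι → Prop := fun a => kind a = .closed ∧ deg a = p with hsel
  have h1 : ∀ s, w s = ∑ U, (dxBasis K n).coord U s • w (dxSet K U) := by
    intro s
    conv_lhs => rw [← (dxBasis K n).sum_repr s]
    simp only [map_sum, map_smul, dxBasis_apply]
    rfl
  have h2 : contrForm sel (fieldD w) = ∑ U, TensorProduct.map LinearMap.id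
      (∑ q : Fin n × Finset (Fin n), (dxBasis K n).coord U (dx K q.1 * dxSet K q.2) •
        (contrFam sel q.2 ∘ₗ shift q.1)) (w (dxSet K U)) := by
    rw [contrForm_apply]
    simp only [fieldD_apply, map_sum, map_map_apply, LinearMap.id_comp, map_sum_right_apply,
      map_smul_right_apply']
    rw [Finset.sum_comm' (t' := Finset.univ) (s' := fun _ => Finset.univ) (by simp)]
    conv_rhs => rw [sum_comm, Fintype.sum_prod_type]
    refine sum_congr rfl fun μ _ => sum_congr rfl fun T _ => ?_
    conv_lhs => rw [h1]
    simp only [map_sum, map_smul]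
  rw [h2]
  refine Submodule.sum_mem _ fun U _ => map_mem_formsIn _ (fun y hy => ?_) (hw _)
  rw [← y.sum_single, Finsupp.sum, map_sum]
  refine Submodule.sum_mem _ fun α _ => ?_
  obtain ⟨l, rfl⟩ := exists_multiIndex_eq α
  have h3 := mulFam_mem_invFam G (isCurvatureFamily_closed G p ((dxBasis K n).coord U) l)
    (hy (multiIndex l))
  convert h3 using 1
  refine funext fun θ => ?_
  simp only [LinearMap.sum_apply, LinearMap.smul_apply, LinearMap.comp_apply, shift_single,
    contrFam_single, Finset.sum_apply, Pi.smul_apply, mulFam_apply, smul_sum]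
  rw [sum_comm]
  refine sum_congr rfl fun a _ => ?_
  by_cases ha : kind a = .closed ∧ deg a = p
  · simp only [hsel, ha, and_self, if_true, foldr_compAt_extD_fieldForm, sum_mul, smul_mul_assoc,
      add_comm (multiIndex l)]
  · simp only [hsel, ha, if_false, zero_mul, smul_zero, sum_const_zero]

end AbelianTheorem

/-! ### Closed abelian invariants -/

section AbelianTheorem

open MvPolynomial

universe v

variable {K : Type*} [Field K] {n : ℕ} {ι : Type*} {deg : ι → ℕ} {kind : ι → FieldKind}

theorem selForm_of_pos {sel : ι → Prop} {a : ι} (h : sel a) :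
    (selForm sel a : LocalForm K n deg) = fieldForm K deg a := if_pos h

theorem selForm_of_neg {sel : ι → Prop} {a : ι} (h : ¬sel a) :
    (selForm sel a : LocalForm K n deg) = 0 := if_neg h

theorem formProj_selForm {sel : ι → Prop} {p : ℕ} (hsel : ∀ a, sel a → deg a = p) (a : ι) :
    formProj _ p (selForm sel a : LocalForm K n deg) = selForm sel a := by
  by_cases h : sel a
  · rw [selForm_of_pos h, ← hsel a h, formProj_fieldForm]
  · rw [selForm_of_neg h, map_zero]

variable [Fintype ι]

/-- The graded Leibniz rule for exterior products with the selected fields. -/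
theorem koszulD_wedgeFam_selForm {Θ : Type*} {sel : ι → Prop} {p : ℕ}
    (hsel : ∀ a, sel a → deg a = p) (y : ConstForm K n ⊗[K] (Θ × ι → JetPoly K n deg)) :
    koszulD (famD K deg Θ) (wedgeFam (selForm sel) y) =
      wedgeFam (fun a => extD K deg (selForm sel a)) y +
        (-1 : K) ^ p • wedgeFam (selForm sel) (koszulD (famD K deg _) y) := by
  refine evFam_ext fun θ => ?_
  rw [evFam_koszulD, evFam_wedgeFam, map_add, map_smul, evFam_wedgeFam, evFam_wedgeFam,
    map_sum, smul_sum, ← sum_add_distrib]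
  refine sum_congr rfl fun a _ => ?_
  rw [extD_mul (formProj_selForm hsel a), evFam_koszulD]

variable [CharZero K]

theorem koszulD_wedgeFam_extD_selForm {Θ : Type*} {sel : ι → Prop} {p : ℕ}
    (hsel : ∀ a, sel a → deg a = p) (y : ConstForm K n ⊗[K] (Θ × ι → JetPoly K n deg)) :
    koszulD (famD K deg Θ) (wedgeFam (fun a => extD K deg (selForm sel a)) y) =
      (-1 : K) ^ (p + 1) •
        wedgeFam (fun a => extD K deg (selForm sel a)) (koszulD (famD K deg _) y) := by
  refine evFam_ext fun θ => ?_
  rw [evFam_koszulD, evFam_wedgeFam, map_smul, evFam_wedgeFam, map_sum, smul_sum]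
  refine sum_congr rfl fun a _ => ?_
  have h : formProj _ (p + 1) (extD K deg (selForm sel a : LocalForm K n deg)) =
      extD K deg (selForm sel a) := by
    rw [extD_eq_koszulD, formProj_succ_koszulD, formProj_selForm hsel]
  rw [extD_mul h, extD_extD, zero_mul, zero_add, evFam_koszulD]

/-- The closed fields of degree `p` contribute, modulo exact terms, exterior products of the
curvatures with closed families of lower field degree, by the descent. -/
theorem exists_closed_contribution {Θ : Type*} [Fintype Θ] {E : Type*}
    (G : FieldRotations K n deg kind E) {k p : ℕ} (hp : 1 ≤ p) {ρ : E → Θ → Θ → K}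
    {P : ConstForm K n ⊗[K] (Θ → JetPoly K n deg)} (hP : P ∈ FormsIn (invFam G (k + 1) ρ))
    (hbelow : P ∈ belowTop K n _) (hclosed : koszulD (famD K deg Θ) P = 0)
    (ih : ∀ c ∈ FormsIn (invFam G k (liftRep G ρ)), c ∈ belowTop K n _ →
      koszulD (famD K deg (Θ × ι)) c = 0 → ∃ Q ∈ FormsIn (invFam G k (liftRep G ρ)),
        ∃ R ∈ FormsIn (invFam G k (liftRep G ρ)), (∀ θ, evFam θ Q ∈ closedAlgebra K n deg kind) ∧
          c = Q + koszulD (famD K deg (Θ × ι)) R) :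
    ∃ Q ∈ FormsIn (invFam G (k + 1) ρ), ∃ R ∈ FormsIn (invFam G (k + 1) ρ),
      (∀ θ, evFam θ Q ∈ closedAlgebra K n deg kind) ∧
      contrForm (fun a => kind a = .closed ∧ deg a = p)
        (polForm (fun a => kind a = .closed ∧ deg a = p) P) =
        Q + koszulD (famD K deg Θ) R := by
  set sel : ι → Prop := fun a => kind a = .closed ∧ deg a = p with hsel
  have hselp : ∀ a, sel a → deg a = p := fun a h => h.2
  obtain ⟨c, hc, hcb, hcd, w, hw, -, hΦ⟩ := exists_descent
    (famD_comm (K := K) (deg := deg) (Θ × ι)) (fun μ m hm => famD_mem_invFam G μ hm) p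
    (polForm sel P) (polForm_mem_formsIn G (fun a c h h' => by simp only [hsel, h, h']) hP)
    (polForm_degProj hselp P) (polForm_mem_belowTop _ hbelow)
    (koszulD_polForm _ hclosed) (fieldD_polForm G (fun a h => h.1) hP) (fun h => by omega)
  obtain ⟨Q, hQ, R, hR, hQA, hcQR⟩ := ih c hc hcb hcd
  have hb : ∀ f, IsCurvatureFamily G fun a =>
      compAt _ f (extD K deg (selForm sel a : LocalForm K n deg)) := by
    intro f
    convert isCurvatureFamily_closed G p f [] using 2 with a
    by_cases h : sel a
    · rw [selForm_of_pos h, if_pos h]; rfl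
    · rw [selForm_of_neg h, if_neg h, map_zero, map_zero]
  set B : ConstForm K n →ₗ[K] ConstForm K n ⊗[K] JetModule n (Θ × ι → JetPoly K n deg) :=
    LinearMap.applyₗ c ∘ₗ (TensorProduct.mapBilinear (RingHom.id K) _ _ _ _).flip
      (Finsupp.lsingle 0) ∘ₗ (LinearMap.mul K (ConstForm K n)) ∘ₗ degProj p with hBdef
  have hB : ∀ s, B s = TensorProduct.map (LinearMap.mulLeft K (degProj p s))
    (Finsupp.lsingle 0) c := fun s => rfl
  have hsplit : polForm sel P = koszulD (jetD (famD K deg (Θ × ι))) ∘ₗ B +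
      koszulD (jetD (famD K deg (Θ × ι))) ∘ₗ fieldD w := by
    refine LinearMap.ext fun s => ?_
    rw [hΦ s, ← hB s]
    rfl
  refine ⟨wedgeFam (fun a => extD K deg (selForm sel a)) Q, wedgeFam_mem_formsIn G hb hQ,
    (-1 : K) ^ (p + 1) • wedgeFam (fun a => extD K deg (selForm sel a)) R + contrForm sel (fieldD w),
    Submodule.add_mem _ (Submodule.smul_mem _ _ (wedgeFam_mem_formsIn G hb hR))
      (contrForm_fieldD_mem G hw), fun θ => ?_, ?_⟩
  · rw [evFam_wedgeFam]
    refine sum_mem fun a _ => mul_mem ?_ (hQA _)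
    by_cases h : sel a
    · rw [selForm_of_pos h]
      exact Algebra.subset_adjoin (Or.inr ⟨a, h.1, rfl⟩)
    · rw [selForm_of_neg h, map_zero]
      exact zero_mem _
  · have hadd : ∀ y y', wedgeFam (fun a => extD K deg (selForm sel a : LocalForm K n deg)) (y + y') =
        wedgeFam (Θ := Θ) (fun a => extD K deg (selForm sel a)) y +
          wedgeFam (fun a => extD K deg (selForm sel a)) y' := fun y y' => by
      simp only [wedgeFam, map_add, sum_add_distrib]
    have hzero : wedgeFam (Θ := Θ) (selForm sel : ι → LocalForm K n deg) 0 = 0 := by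
      simp only [wedgeFam, map_zero, sum_const_zero]
    rw [hsplit, map_add, contrForm_koszulD, contrForm_koszulD, contrForm_const hselp hB,
      koszulD_wedgeFam_selForm hselp, hcd, hzero, smul_zero, add_zero, hcQR, hadd, map_add,
      map_smul, koszulD_wedgeFam_extD_selForm hselp, smul_smul, ← mul_pow, neg_one_mul, neg_neg,
      one_pow, one_smul, add_assoc]

/-- Closed families of abelian invariants below top degree are, modulo the differentials of
families of abelian invariants, polynomials in the curvatures of the closed fields. -/
theorem exists_abelian_representative {ι : Type v} [Fintype ι] {deg : ι → ℕ}
    {kind : ι → FieldKind} {E : Type*} (G : FieldRotations K n deg kind E)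
    (hdeg : ∀ a, 1 ≤ deg a) (k : ℕ) : ∀ {Θ : Type v} [Fintype Θ] {ρ : E → Θ → Θ → K},
    ∀ P ∈ FormsIn (n := n) (invFam G k ρ), P ∈ belowTop K n _ → koszulD (famD K deg Θ) P = 0 →
      ∃ Q ∈ FormsIn (n := n) (invFam G k ρ), ∃ R ∈ FormsIn (n := n) (invFam G k ρ),
        (∀ θ, evFam θ Q ∈ closedAlgebra K n deg kind) ∧ P = Q + koszulD (famD K deg Θ) R := by
  induction k with
  | zero =>
    intro Θ _ ρ P hP _ _
    refine ⟨P, hP, 0, zero_mem _, fun θ => ?_, by rw [map_zero, add_zero]⟩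
    refine mem_of_homogeneous_zero (w := jetWeight (fun _ => 1) 0) tmul_one_mem_closedAlgebra
      (fun v => by simp [jetWeight]) fun f => ?_
    rw [compAt_evFam]
    exact (hP f θ).2.1
  | succ k ih =>
    intro Θ _ ρ P hP hbelow hclosed
    obtain ⟨R₀, hR₀, e₀⟩ := exists_free_contribution G hP hbelow hclosed
    have hD : ∀ a, deg a < ∑ a, deg a + 1 := fun a =>
      Nat.lt_succ_of_le (Finset.single_le_sum (f := deg) (fun _ _ => Nat.zero_le _) (Finset.mem_univ a))
    have hcl : ∀ p : ℕ, ∃ Q ∈ FormsIn (n := n) (invFam G (k + 1) ρ),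
        ∃ R ∈ FormsIn (n := n) (invFam G (k + 1) ρ),
        (∀ θ, evFam θ Q ∈ closedAlgebra K n deg kind) ∧
        contrForm (fun a => kind a = .closed ∧ deg a = p)
          (polForm (fun a => kind a = .closed ∧ deg a = p) P) =
          Q + koszulD (famD K deg Θ) R := by
      intro p
      rcases Nat.eq_zero_or_pos p with rfl | hp
      · have h0 : ∀ a, ¬(kind a = .closed ∧ deg a = 0) := fun a h => by
          have := hdeg a; omega
        refine ⟨0, zero_mem _, 0, zero_mem _, fun θ => by rw [map_zero]; exact zero_mem _, ?_⟩
        rw [contrForm_apply, map_zero, add_zero]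
        refine sum_eq_zero fun T _ => ?_
        rw [polForm_dxSet, polFam_eq_zero fun a ha => absurd ha (h0 a),
          TensorProduct.map_zero_right, LinearMap.zero_apply, map_zero]
      · exact exists_closed_contribution G hp hP hbelow hclosed fun c hc hcb hcd => ih c hc hcb hcd
    choose Q hQ R hR hQA e using hcl
    have hk : ((k + 1 : ℕ) : K) ≠ 0 := Nat.cast_ne_zero.mpr (Nat.succ_ne_zero k)
    have htot := sum_contrForm_polForm G hD hP
    simp only [e₀, e, sum_add_distrib, ← map_sum] at htot
    refine ⟨((k + 1 : ℕ) : K)⁻¹ • ∑ p ∈ Finset.range (∑ a, deg a + 1), Q p,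
      Submodule.smul_mem _ _ (Submodule.sum_mem _ fun p _ => hQ p),
      ((k + 1 : ℕ) : K)⁻¹ • (R₀ + ∑ p ∈ Finset.range (∑ a, deg a + 1), R p),
      Submodule.smul_mem _ _ (Submodule.add_mem _ hR₀ (Submodule.sum_mem _ fun p _ => hR p)),
      fun θ => ?_, ?_⟩
    · rw [map_smul, map_sum]
      exact Subalgebra.smul_mem _ (sum_mem fun p _ => hQA p θ) _
    · rw [← inv_smul_smul₀ hk P, ← htot, map_smul, ← smul_add, map_add]
      congr 1
      abel

end AbelianTheorem

/-! ### Filtrations of polynomial rings by weights -/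

section OrderFiltration

open MvPolynomial

variable {K : Type*} [Field K] {σ τ : Type*}

/-- The polynomials all of whose monomials have weight at least `m`, for integral weights `u` of the
variables. -/
def orderGE (u : σ → ℤ) (m : ℤ) : Submodule K (MvPolynomial σ K) where
  carrier := {x | ∀ s ∈ x.support, m ≤ Finsupp.weight u s}
  add_mem' {x y} hx hy s hs := by
    classical
    rcases Finset.mem_union.mp (support_add hs) with h | h
    exacts [hx s h, hy s h]
  zero_mem' s hs := by simp at hs
  smul_mem' c x hx s hs := hx s (support_smul hs)

theorem orderGE_mono {u : σ → ℤ} {m m' : ℤ} (h : m' ≤ m) {x : MvPolynomial σ K}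
    (hx : x ∈ orderGE u m) : x ∈ orderGE u m' := fun s hs => h.trans (hx s hs)

theorem monomial_mem_orderGE {u : σ → ℤ} {s : σ →₀ ℕ} {m : ℤ} (h : m ≤ Finsupp.weight u s) (c : K) :
    monomial s c ∈ orderGE u m := fun t ht => by
  rw [Finset.mem_singleton.mp (support_monomial_subset ht)]
  exact h

theorem X_mem_orderGE {u : σ → ℤ} {v : σ} {m : ℤ} (h : m ≤ u v) :
    (X v : MvPolynomial σ K) ∈ orderGE u m :=
  monomial_mem_orderGE (by rwa [Finsupp.weight_single, one_smul]) 1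

theorem one_mem_orderGE (u : σ → ℤ) : (1 : MvPolynomial σ K) ∈ orderGE u 0 :=
  monomial_mem_orderGE (by rw [map_zero]) 1

theorem mul_mem_orderGE {u : σ → ℤ} {m m' : ℤ} {x y : MvPolynomial σ K} (hx : x ∈ orderGE u m)
    (hy : y ∈ orderGE u m') : x * y ∈ orderGE u (m + m') := fun s hs => by
  classical
  obtain ⟨a, ha, b, hb, rfl⟩ := Finset.mem_add.mp (support_mul x y hs)
  rw [map_add]
  exact add_le_add (hx a ha) (hy b hb)

theorem prod_mem_orderGE {u : σ → ℤ} {J : Type*} (s : Finset J) {x : J → MvPolynomial σ K}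
    {m : J → ℤ} (h : ∀ j ∈ s, x j ∈ orderGE u (m j)) : ∏ j ∈ s, x j ∈ orderGE u (∑ j ∈ s, m j) := by
  classical
  induction s using Finset.induction_on with
  | empty => exact one_mem_orderGE u
  | insert a s ha ih =>
    rw [Finset.prod_insert ha, Finset.sum_insert ha]
    exact mul_mem_orderGE (h a (Finset.mem_insert_self a s))
      (ih fun j hj => h j (Finset.mem_insert_of_mem hj))

theorem pow_mem_orderGE {u : σ → ℤ} {x : MvPolynomial σ K} {m : ℤ} (h : x ∈ orderGE u m) (k : ℕ) :
    x ^ k ∈ orderGE u (k * m) := by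
  induction k with
  | zero => simpa using one_mem_orderGE u
  | succ k ih =>
    rw [pow_succ, Nat.cast_succ, add_mul, one_mul]
    exact mul_mem_orderGE ih h

theorem derivation_mem_orderGE {u : σ → ℤ} {D : Derivation K (MvPolynomial σ K) (MvPolynomial σ K)}
    {e : ℤ} (hD : ∀ v, D (X v) ∈ orderGE u (u v + e)) {m : ℤ} {x : MvPolynomial σ K}
    (hx : x ∈ orderGE u m) : D x ∈ orderGE u (m + e) := by
  have hDm : D = mkDerivation K fun v => D (X v) :=
    derivation_ext fun v => by rw [mkDerivation_X]
  rw [x.as_sum, map_sum]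
  refine Submodule.sum_mem _ fun s hs => ?_
  rw [hDm, mkDerivation_monomial]
  refine Submodule.smul_mem _ _ (Submodule.sum_mem _ fun v hv => ?_)
  have hv1 : (Finsupp.single v 1 : σ →₀ ℕ) ≤ s := by
    rw [Finsupp.single_le_iff]
    exact Nat.one_le_iff_ne_zero.mpr (Finsupp.mem_support_iff.mp hv)
  have h1 : Finsupp.weight u (s - Finsupp.single v 1) + u v = Finsupp.weight u s := by
    conv_rhs => rw [← tsub_add_cancel_of_le hv1, map_add, Finsupp.weight_single, one_smul]
  refine orderGE_mono ?_ (mul_mem_orderGE (monomial_mem_orderGE (u := u) le_rfl _) (hD v))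
  have := hx s hs
  omega

theorem algHom_mem_orderGE {u : σ → ℤ} {u' : τ → ℤ} {φ : MvPolynomial σ K →ₐ[K] MvPolynomial τ K}
    (hφ : ∀ v, φ (X v) ∈ orderGE u' (u v)) {m : ℤ} {x : MvPolynomial σ K}
    (hx : x ∈ orderGE u m) : φ x ∈ orderGE u' m := by
  rw [x.as_sum, map_sum]
  refine Submodule.sum_mem _ fun s hs => orderGE_mono (hx s hs) ?_
  rw [← mul_one (coeff s x), ← smul_eq_mul, ← smul_monomial, map_smul, monomial_eq, C_1, one_mul,
    Finsupp.prod, map_prod]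
  refine Submodule.smul_mem _ _ ?_
  rw [Finsupp.weight_apply, Finsupp.sum]
  refine prod_mem_orderGE _ fun v _ => ?_
  rw [map_pow, nsmul_eq_mul]
  exact pow_mem_orderGE (hφ v) _

theorem eq_zero_of_mem_orderGE {u u' : σ → ℤ} (h : ∀ v, u v + u' v ≤ 0) {m m' : ℤ}
    (hm : 0 < m + m') {x : MvPolynomial σ K} (hx : x ∈ orderGE u m) (hx' : x ∈ orderGE u' m') :
    x = 0 := by
  by_contra hne
  obtain ⟨s, hs⟩ := Finset.nonempty_iff_ne_empty.mpr fun h' => hne (support_eq_empty.mp h')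
  have h1 := hx s hs
  have h2 := hx' s hs
  have h3 : Finsupp.weight u s + Finsupp.weight u' s ≤ 0 := by
    rw [Finsupp.weight_apply, Finsupp.weight_apply, Finsupp.sum, Finsupp.sum,
      ← sum_add_distrib]
    refine Finset.sum_nonpos fun v _ => ?_
    rw [← nsmul_add]
    exact nsmul_nonpos (h v) _
  omega

theorem weightedHomogeneousComponent_mem_orderGE {u : σ → ℤ} {m : ℤ} {x : MvPolynomial σ K}
    (hx : x ∈ orderGE u m) (w : σ → ℕ) (k : ℕ) :
    weightedHomogeneousComponent w k x ∈ orderGE u m := fun s hs => by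
  classical
  rw [mem_support_iff, coeff_weightedHomogeneousComponent] at hs
  refine hx s (mem_support_iff.mpr fun h => hs ?_)
  rw [h, ite_self]

theorem weight_intCast (w : σ → ℕ) (s : σ →₀ ℕ) :
    Finsupp.weight (fun v => (w v : ℤ)) s = (Finsupp.weight w s : ℤ) := by
  simp [Finsupp.weight_apply, Finsupp.sum]

theorem weight_neg_intCast (w : σ → ℕ) (s : σ →₀ ℕ) :
    Finsupp.weight (fun v => -(w v : ℤ)) s = -(Finsupp.weight w s : ℤ) := by
  simp [Finsupp.weight_apply, Finsupp.sum]

theorem mem_orderGE_of_isWeightedHomogeneous {w : σ → ℕ} {k : ℕ} {x : MvPolynomial σ K}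
    (hx : x.IsWeightedHomogeneous w k) : x ∈ orderGE (fun v => (w v : ℤ)) k := fun s hs => by
  rw [weight_intCast, hx (mem_support_iff.mp hs)]

theorem mem_orderGE_neg_of_isWeightedHomogeneous {w : σ → ℕ} {k : ℕ} {x : MvPolynomial σ K}
    (hx : x.IsWeightedHomogeneous w k) : x ∈ orderGE (fun v => -(w v : ℤ)) (-k) := fun s hs => by
  rw [weight_neg_intCast, hx (mem_support_iff.mp hs)]

theorem weightedHomogeneousComponent_eq_zero_of_mem_orderGE {w : σ → ℕ} {k : ℕ} {m : ℤ}
    (h : (k : ℤ) < m) {x : MvPolynomial σ K} (hx : x ∈ orderGE (fun v => (w v : ℤ)) m) :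
    weightedHomogeneousComponent w k x = 0 := by
  classical
  ext s
  rw [coeff_weightedHomogeneousComponent, coeff_zero]
  split_ifs with hs
  · by_contra hne
    have := hx s (mem_support_iff.mpr hne)
    rw [weight_intCast, hs] at this
    omega
  · rfl

theorem sub_weightedHomogeneousComponent_mem_orderGE {w : σ → ℕ} {k : ℕ} {x : MvPolynomial σ K}
    (hx : x ∈ orderGE (fun v => (w v : ℤ)) k) :
    x - weightedHomogeneousComponent w k x ∈ orderGE (fun v => (w v : ℤ)) (k + 1) := fun s hs => by
  classical
  rw [mem_support_iff, coeff_sub, coeff_weightedHomogeneousComponent] at hs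
  have h1 : coeff s x ≠ 0 := by
    intro h
    rw [h, ite_self, sub_zero] at hs
    exact hs rfl
  have h2 := hx s (mem_support_iff.mpr h1)
  have h3 : Finsupp.weight w s ≠ k := by
    intro h
    rw [if_pos h, sub_self] at hs
    exact hs rfl
  rw [weight_intCast] at h2 ⊢
  omega

/-- The lowest part of a product is the product of the lowest parts. -/
theorem weightedHomogeneousComponent_mul_of_mem_orderGE {w : σ → ℕ} {k l : ℕ}
    {x y : MvPolynomial σ K} (hx : x ∈ orderGE (fun v => (w v : ℤ)) k)
    (hy : y ∈ orderGE (fun v => (w v : ℤ)) l) :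
    weightedHomogeneousComponent w (k + l) (x * y) =
      weightedHomogeneousComponent w k x * weightedHomogeneousComponent w l y := by
  classical
  set x₀ := weightedHomogeneousComponent w k x
  set y₀ := weightedHomogeneousComponent w l y
  have hx₀ : x₀.IsWeightedHomogeneous w k :=
    weightedHomogeneousComponent_isWeightedHomogeneous _ _
  have hy₀ : y₀.IsWeightedHomogeneous w l :=
    weightedHomogeneousComponent_isWeightedHomogeneous _ _
  have h1 : x * y - x₀ * y₀ ∈ orderGE (fun v => (w v : ℤ)) ((k : ℤ) + l + 1) := by
    have e : x * y - x₀ * y₀ = (x - x₀) * y + x₀ * (y - y₀) := by ring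
    rw [e]
    refine Submodule.add_mem _ ?_ ?_
    · exact orderGE_mono (by omega)
        (mul_mem_orderGE (sub_weightedHomogeneousComponent_mem_orderGE hx) hy)
    · exact orderGE_mono (by omega) (mul_mem_orderGE (mem_orderGE_of_isWeightedHomogeneous hx₀)
        (sub_weightedHomogeneousComponent_mem_orderGE hy))
  have h2 := weightedHomogeneousComponent_eq_zero_of_mem_orderGE (k := k + l)
    (by push_cast; omega) h1
  rw [map_sub, sub_eq_zero] at h2
  rw [h2]
  exact weightedHomogeneousComponent_eq_self (hx₀.mul hy₀)

theorem weightedHomogeneousComponent_mul (w : σ → ℕ) (x y : MvPolynomial σ K) (k : ℕ) :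
    weightedHomogeneousComponent w k (x * y) = ∑ p ∈ Finset.HasAntidiagonal.antidiagonal k,
      weightedHomogeneousComponent w p.1 x * weightedHomogeneousComponent w p.2 y := by
  classical
  induction x using MvPolynomial.induction_on' with
  | add x x' hx hx' => simp only [add_mul, map_add, hx, hx', sum_add_distrib]
  | monomial s c =>
    induction y using MvPolynomial.induction_on' with
    | add x x' hx hx' => simp only [mul_add, map_add, hx, hx', sum_add_distrib]
    | monomial t d =>
      have hs := isWeightedHomogeneous_monomial w s c rfl
      have ht := isWeightedHomogeneous_monomial w t d rfl
      simp only [weightedHomogeneousComponent_of_mem hs, weightedHomogeneousComponent_of_mem ht,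
        weightedHomogeneousComponent_of_mem (hs.mul ht)]
      split_ifs with h
      · rw [sum_eq_single (Finsupp.weight w s, Finsupp.weight w t)]
        · simp
        · rintro ⟨i, j⟩ _ hne
          split_ifs with h1 h2
          · exact absurd (Prod.ext h1 h2) hne
          all_goals simp
        · intro h'
          exact absurd (Finset.HasAntidiagonal.mem_antidiagonal.mpr h.symm) h'
      · refine (sum_eq_zero ?_).symm
        rintro ⟨i, j⟩ hij
        have := Finset.HasAntidiagonal.mem_antidiagonal.mp hij
        dsimp only at this ⊢
        split_ifs with h1 h2
        · omega
        all_goals simp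

end OrderFiltration

/-- A subalgebra generated by homogeneous elements is closed under homogeneous parts. -/
theorem adjoin_closed_of_graded {K A : Type*} [Field K] [Ring A] [Algebra K A] {S : Set A}
    {pr : ℕ → A →ₗ[K] A}
    (hmul : ∀ x y k, pr k (x * y) = ∑ p ∈ Finset.HasAntidiagonal.antidiagonal k, pr p.1 x * pr p.2 y)
    (hone : ∀ k, pr k 1 = 1 ∨ pr k 1 = 0) (hS : ∀ x ∈ S, ∀ k, pr k x = x ∨ pr k x = 0)
    {x : A} (hx : x ∈ Algebra.adjoin K S) (k : ℕ) : pr k x ∈ Algebra.adjoin K S := by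
  induction hx using Algebra.adjoin_induction generalizing k with
  | mem x hx =>
    rcases hS x hx k with h | h <;> rw [h]
    exacts [Algebra.subset_adjoin hx, zero_mem _]
  | algebraMap r =>
    rw [Algebra.algebraMap_eq_smul_one, map_smul]
    refine Subalgebra.smul_mem _ ?_ r
    rcases hone k with h | h <;> rw [h]
    exacts [one_mem _, zero_mem _]
  | add x y _ _ hx hy => rw [map_add]; exact add_mem (hx k) (hy k)
  | mul x y _ _ hx hy =>
    rw [hmul]
    exact sum_mem fun p _ => mul_mem (hx _) (hy _)

/-! ### Gradings of forms -/

section GradedForms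

open MvPolynomial

variable {K : Type*} [Field K] {n : ℕ} {ι : Type*} {deg : ι → ℕ}

theorem degProj_mul (k : ℕ) (x y : ConstForm K n) :
    degProj k (x * y) = ∑ p ∈ Finset.HasAntidiagonal.antidiagonal k, degProj p.1 x * degProj p.2 y := by
  have h : ∀ i j, ∀ x ∈ ⋀[K]^i (Fin n → K), ∀ y ∈ ⋀[K]^j (Fin n → K), degProj k (x * y) =
      ∑ p ∈ Finset.HasAntidiagonal.antidiagonal k, degProj p.1 x * degProj p.2 y := by
    intro i j x hx y hy
    have hxy : x * y ∈ ⋀[K]^(i + j) (Fin n → K) :=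
      SetLike.GradedMul.mul_mem (A := fun i : ℕ => ⋀[K]^i (Fin n → K)) hx hy
    rw [degProj_of_mem hxy]
    simp only [degProj_of_mem hx, degProj_of_mem hy]
    split_ifs with h
    · rw [sum_eq_single (i, j)]
      · simp
      · rintro ⟨i', j'⟩ _ hne
        split_ifs with h1 h2
        · exact absurd (Prod.ext h1.symm h2.symm) hne
        all_goals simp
      · intro h'
        exact absurd (Finset.HasAntidiagonal.mem_antidiagonal.mpr h) h'
    · refine (sum_eq_zero ?_).symm
      rintro ⟨i', j'⟩ hij
      have := Finset.HasAntidiagonal.mem_antidiagonal.mp hij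
      dsimp only at this ⊢
      split_ifs with h1 h2
      · omega
      all_goals simp
  rw [← sum_degProj x, ← sum_degProj y]
  simp only [sum_mul, mul_sum, map_sum, h _ _ _ (degProj_mem _ _) _ (degProj_mem _ _)]
  rw [sum_comm]
  simp only [sum_comm (s := Finset.range (n + 1)) (t := Finset.HasAntidiagonal.antidiagonal k)]
  refine sum_congr rfl fun p _ => ?_
  rw [sum_comm]

theorem formProj_mul (k : ℕ) (x y : LocalForm K n deg) :
    formProj _ k (x * y) = ∑ p ∈ Finset.HasAntidiagonal.antidiagonal k, formProj _ p.1 x * formProj _ p.2 y := by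
  induction x using TensorProduct.induction_on with
  | zero => simp
  | add x x' hx hx' => simp only [add_mul, map_add, hx, hx', sum_add_distrib]
  | tmul x p =>
    induction y using TensorProduct.induction_on with
    | zero => simp
    | add x x' hx hx' => simp only [mul_add, map_add, hx, hx', sum_add_distrib]
    | tmul y q =>
      simp only [formProj, Algebra.TensorProduct.tmul_mul_tmul, TensorProduct.map_tmul,
        degProj_mul, LinearMap.id_apply, TensorProduct.sum_tmul]

/-- The part of weight `k` of a form. -/
def weightProj (w : JetVar n deg → ℕ) (k : ℕ) : LocalForm K n deg →ₗ[K] LocalForm K n deg :=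
  TensorProduct.map LinearMap.id (weightedHomogeneousComponent w k)

theorem compAt_weightProj (w : JetVar n deg → ℕ) (k : ℕ) (f : Module.Dual K (ConstForm K n))
    (ω : LocalForm K n deg) :
    compAt _ f (weightProj w k ω) = weightedHomogeneousComponent w k (compAt _ f ω) := by
  rw [weightProj, compAt_map, LinearMap.comp_id]

theorem weightProj_tmul (w : JetVar n deg → ℕ) (k : ℕ) (x : ConstForm K n) (p : JetPoly K n deg) :
    weightProj w k (x ⊗ₜ[K] p) = x ⊗ₜ[K] weightedHomogeneousComponent w k p := rfl

theorem weightProj_mul (w : JetVar n deg → ℕ) (k : ℕ) (x y : LocalForm K n deg) :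
    weightProj w k (x * y) =
      ∑ p ∈ Finset.HasAntidiagonal.antidiagonal k, weightProj w p.1 x * weightProj w p.2 y := by
  induction x using TensorProduct.induction_on with
  | zero => simp
  | add x x' hx hx' => simp only [add_mul, map_add, hx, hx', sum_add_distrib]
  | tmul x p =>
    induction y using TensorProduct.induction_on with
    | zero => simp
    | add x x' hx hx' => simp only [mul_add, map_add, hx, hx', sum_add_distrib]
    | tmul y q =>
      simp only [weightProj_tmul, Algebra.TensorProduct.tmul_mul_tmul,
        weightedHomogeneousComponent_mul, TensorProduct.tmul_sum]

theorem weightProj_of_mem {w : JetVar n deg → ℕ} {j : ℕ} {ω : LocalForm K n deg}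
    (h : ω ∈ FormsIn (weightedHomogeneousSubmodule K w j)) (k : ℕ) :
    weightProj w k ω = if k = j then ω else 0 := by
  refine form_ext fun f => ?_
  rw [compAt_weightProj, weightedHomogeneousComponent_of_mem (h f)]
  split_ifs <;> simp

theorem weightProj_formProj (w : JetVar n deg → ℕ) (k l : ℕ) (ω : LocalForm K n deg) :
    weightProj w k (formProj _ l ω) = formProj _ l (weightProj w k ω) := by
  rw [weightProj, formProj, map_map_apply, map_map_apply]
  rfl

theorem formProj_one_form (k : ℕ) (ω : LocalForm K n deg) {j : ℕ} (h : formProj _ j ω = ω) :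
    formProj _ k ω = if j = k then ω else 0 := by
  conv_lhs => rw [← h, formProj_formProj, h]

/-- The weight of forms with the given weights of the fields and derivatives. -/
theorem weightProj_extD (u : ι → ℕ) (e k : ℕ) (ω : LocalForm K n deg) :
    weightProj (jetWeight u e) (k + e) (extD K deg ω) =
      extD K deg (weightProj (jetWeight u e) k ω) := by
  refine form_ext fun f => ?_
  rw [compAt_weightProj, compAt_extD, compAt_extD, map_sum]
  refine sum_congr rfl fun μ _ => ?_
  rw [weightedHomogeneousComponent_totalDeriv, compAt_weightProj]

theorem weightProj_extD_of_lt (u : ι → ℕ) {e k : ℕ} (h : k < e) (ω : LocalForm K n deg) :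
    weightProj (jetWeight u e) k (extD K deg ω) = 0 := by
  refine form_ext fun f => ?_
  rw [compAt_weightProj, compAt_extD, map_sum, map_zero]
  exact sum_eq_zero fun μ _ => weightedHomogeneousComponent_totalDeriv_of_lt u μ _ h

/-- Finitely many weights occur in a form. -/
theorem exists_sum_weightProj (w : JetVar n deg → ℕ) (ω : LocalForm K n deg) :
    ∃ B : ℕ, ∀ C, B ≤ C → ∑ k ∈ Finset.range C, weightProj w k ω = ω := by
  induction ω using TensorProduct.induction_on with
  | zero => exact ⟨0, fun C _ => by simp⟩
  | tmul x p =>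
    obtain ⟨B, hB⟩ := exists_sum_weightedHomogeneousComponent w p
    refine ⟨B, fun C hC => ?_⟩
    simp only [weightProj_tmul]
    rw [← TensorProduct.tmul_sum, hB C hC]
  | add x y hx hy =>
    obtain ⟨B, hB⟩ := hx
    obtain ⟨B', hB'⟩ := hy
    refine ⟨max B B', fun C hC => ?_⟩
    simp only [map_add, sum_add_distrib]
    rw [hB C (le_trans (le_max_left _ _) hC), hB' C (le_trans (le_max_right _ _) hC)]

theorem fieldForm_mem_homogeneous (u : ι → ℕ) (e : ℕ) (a : ι) :
    (fieldForm K deg a : LocalForm K n deg) ∈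
      FormsIn (weightedHomogeneousSubmodule K (jetWeight u e) (u a)) := fun f => by
  rw [compAt_fieldForm]
  refine Submodule.sum_mem _ fun T _ => Submodule.smul_mem _ _ ?_
  simpa using isWeightedHomogeneous_jetVar u e a T 0

theorem extD_mem_homogeneous {u : ι → ℕ} {e k : ℕ} {ω : LocalForm K n deg}
    (h : ω ∈ FormsIn (weightedHomogeneousSubmodule K (jetWeight u e) k)) :
    extD K deg ω ∈ FormsIn (weightedHomogeneousSubmodule K (jetWeight u e) (k + e)) := fun f => by
  rw [compAt_extD]
  exact Submodule.sum_mem _ fun μ _ => isWeightedHomogeneous_totalDeriv u e μ (h _)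

theorem one_mem_homogeneous (u : ι → ℕ) (e : ℕ) (x : ConstForm K n) :
    (x ⊗ₜ[K] (1 : JetPoly K n deg)) ∈
      FormsIn (weightedHomogeneousSubmodule K (jetWeight u e) 0) :=
  tmul_mem_formsIn _ (isWeightedHomogeneous_one K _)

theorem weightProj_mem_closedAlgebra {kind : ι → FieldKind} (u : ι → ℕ) (e k : ℕ)
    {ω : LocalForm K n deg} (h : ω ∈ closedAlgebra K n deg kind) :
    weightProj (jetWeight u e) k ω ∈ closedAlgebra K n deg kind := by
  refine adjoin_closed_of_graded (fun x y k => weightProj_mul _ k x y) (fun k => ?_)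
    (fun x hx k => ?_) h k
  · rw [Algebra.TensorProduct.one_def, weightProj_of_mem (one_mem_homogeneous u e 1)]
    exact ite_eq_or_eq _ _ _
  · rcases hx with ⟨μ, rfl⟩ | ⟨a, -, rfl⟩
    · rw [weightProj_of_mem (one_mem_homogeneous u e _)]
      exact ite_eq_or_eq _ _ _
    · rw [weightProj_of_mem (extD_mem_homogeneous (fieldForm_mem_homogeneous u e a))]
      exact ite_eq_or_eq _ _ _

theorem weightProj_mem_smallAlgebra (u : ι → ℕ) (e k : ℕ)
    {ω : LocalForm K n deg} (h : ω ∈ smallAlgebra K deg) :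
    weightProj (jetWeight u e) k ω ∈ smallAlgebra K deg := by
  refine adjoin_closed_of_graded (fun x y k => weightProj_mul _ k x y) (fun k => ?_)
    (fun x hx k => ?_) h k
  · rw [Algebra.TensorProduct.one_def, weightProj_of_mem (one_mem_homogeneous u e 1)]
    exact ite_eq_or_eq _ _ _
  · rcases hx with (⟨μ, rfl⟩ | ⟨a, rfl⟩) | ⟨a, rfl⟩
    · rw [weightProj_of_mem (one_mem_homogeneous u e _)]
      exact ite_eq_or_eq _ _ _
    · rw [weightProj_of_mem (fieldForm_mem_homogeneous u e a)]
      exact ite_eq_or_eq _ _ _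
    · rw [weightProj_of_mem (extD_mem_homogeneous (fieldForm_mem_homogeneous u e a))]
      exact ite_eq_or_eq _ _ _

theorem formProj_dx_tmul (μ : Fin n) (p : JetPoly K n deg) :
    formProj _ 1 (dx K μ ⊗ₜ[K] p) = dx K μ ⊗ₜ[K] p := by
  rw [formProj, TensorProduct.map_tmul, degProj_of_mem (dx_mem μ), if_pos rfl]; rfl

theorem formProj_one (k : ℕ) :
    formProj _ k (1 : LocalForm K n deg) = if k = 0 then 1 else 0 := by
  rw [Algebra.TensorProduct.one_def, formProj, TensorProduct.map_tmul, degProj_one]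
  split_ifs <;> simp

theorem formProj_mem_closedAlgebra {kind : ι → FieldKind} (k : ℕ)
    {ω : LocalForm K n deg} (h : ω ∈ closedAlgebra K n deg kind) :
    formProj _ k ω ∈ closedAlgebra K n deg kind := by
  refine adjoin_closed_of_graded (fun x y k => formProj_mul k x y) (fun k => ?_)
    (fun x hx k => ?_) h k
  · rw [formProj_one]
    exact ite_eq_or_eq _ _ _
  · rcases hx with ⟨μ, rfl⟩ | ⟨a, -, rfl⟩
    · rw [formProj_one_form k _ (formProj_dx_tmul μ 1)]
      exact ite_eq_or_eq _ _ _
    · rw [formProj_one_form k _ (formProj_extD_fieldForm a)]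
      exact ite_eq_or_eq _ _ _

theorem formProj_mem_smallAlgebra (k : ℕ) {ω : LocalForm K n deg} (h : ω ∈ smallAlgebra K deg) :
    formProj _ k ω ∈ smallAlgebra K deg := by
  refine adjoin_closed_of_graded (fun x y k => formProj_mul k x y) (fun k => ?_)
    (fun x hx k => ?_) h k
  · rw [formProj_one]
    exact ite_eq_or_eq _ _ _
  · rcases hx with (⟨μ, rfl⟩ | ⟨a, rfl⟩) | ⟨a, rfl⟩
    · rw [formProj_one_form k _ (formProj_dx_tmul μ 1)]
      exact ite_eq_or_eq _ _ _
    · rw [formProj_one_form k _ (formProj_fieldForm a)]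
      exact ite_eq_or_eq _ _ _
    · rw [formProj_one_form k _ (formProj_extD_fieldForm a)]
      exact ite_eq_or_eq _ _ _

theorem mem_formsBelowTop_iff {ω : LocalForm K n deg} :
    ω ∈ formsBelowTop K deg ↔ ω ∈ belowTop K n _ := by
  constructor
  · intro h
    refine (iSup_le (a := belowTop K n (JetPoly K n deg)) ?_ : formsBelowTop K deg ≤ _) h
    rintro k _ ⟨x, rfl⟩
    rw [mem_belowTop]
    induction x using TensorProduct.induction_on with
    | zero => simp
    | add x y hx hy => simp only [map_add, hx, hy, add_zero]
    | tmul x p =>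
      rw [LinearMap.rTensor_tmul, formProj, TensorProduct.map_tmul, Submodule.subtype_apply,
        degProj_of_mem x.2, if_neg k.2.ne, TensorProduct.zero_tmul]
  · intro h
    rw [← sum_formProj_of_mem_belowTop h]
    refine Submodule.sum_mem _ fun k hk => ?_
    refine Submodule.mem_iSup_of_mem ⟨k, Finset.mem_range.mp hk⟩ ?_
    clear h
    induction ω using TensorProduct.induction_on with
    | zero => rw [map_zero]; exact zero_mem _
    | add x y hx hy => rw [map_add]; exact add_mem hx hy
    | tmul x p =>
      exact ⟨⟨degProj k x, degProj_mem k x⟩ ⊗ₜ p, rfl⟩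

end GradedForms

/-! ### Closed abelian forms and weights -/

section AbelianForms

open MvPolynomial

variable {K : Type*} [Field K] {n : ℕ} {ι : Type*} {deg : ι → ℕ} {kind : ι → FieldKind}

theorem foldr_totalDeriv_homogeneous {u : ι → ℕ} {e k : ℕ} {x : JetPoly K n deg}
    (h : x.IsWeightedHomogeneous (jetWeight u e) k) (l : List (Fin n)) :
    (l.foldr (fun μ y => totalDeriv K deg μ y) x).IsWeightedHomogeneous (jetWeight u e)
      (k + e * l.length) := by
  induction l with
  | nil => simpa using h
  | cons μ l ih =>
    rw [List.foldr_cons, List.length_cons, mul_add, mul_one, ← add_assoc]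
    exact isWeightedHomogeneous_totalDeriv u e μ ih

theorem weightedHomogeneousComponent_mem_abelianInv (u : ι → ℕ) (e k : ℕ) {x : JetPoly K n deg}
    (h : x ∈ abelianInv K n deg kind) :
    weightedHomogeneousComponent (jetWeight u e) k x ∈ abelianInv K n deg kind := by
  classical
  refine adjoin_closed_of_graded (fun x y k => weightedHomogeneousComponent_mul _ x y k)
    (fun k => ?_) (fun x hx k => ?_) h k
  · rw [weightedHomogeneousComponent_of_mem (isWeightedHomogeneous_one K _)]
    exact ite_eq_or_eq _ _ _
  · simp only [component_eq_compAt] at hx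
    obtain ⟨H, ⟨a, ⟨-, rfl⟩ | ⟨-, rfl⟩⟩, f, l, rfl⟩ := hx
    · rw [weightedHomogeneousComponent_of_mem
        (foldr_totalDeriv_homogeneous (fieldForm_mem_homogeneous u e a f) l)]
      exact ite_eq_or_eq _ _ _
    · rw [weightedHomogeneousComponent_of_mem (foldr_totalDeriv_homogeneous
        (extD_mem_homogeneous (fieldForm_mem_homogeneous u e a) f) l)]
      exact ite_eq_or_eq _ _ _

theorem isWeightedHomogeneous_weightedHomogeneousComponent {σ : Type*} {w : σ → ℕ} {j : ℕ}
    {x : MvPolynomial σ K} (h : x.IsWeightedHomogeneous w j) (w' : σ → ℕ) (k : ℕ) :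
    (weightedHomogeneousComponent w' k x).IsWeightedHomogeneous w j := fun s hs => by
  classical
  rw [coeff_weightedHomogeneousComponent] at hs
  refine h fun h0 => hs ?_
  rw [h0, ite_self]

theorem sum_weightedHomogeneousComponent_of_mem_orderGE {σ : Type*} {w : σ → ℕ} {m : ℕ}
    {x : MvPolynomial σ K} (h : x ∈ orderGE (fun v => -(w v : ℤ)) (-m)) :
    ∑ k ∈ Finset.range (m + 1), weightedHomogeneousComponent w k x = x := by
  classical
  ext s
  rw [coeff_sum]
  simp only [coeff_weightedHomogeneousComponent, Finset.sum_ite_eq]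
  split_ifs with hs
  · rfl
  · by_contra hne
    have := h s (mem_support_iff.mpr (Ne.symm hne))
    rw [weight_neg_intCast] at this
    simp at hs
    omega

variable [Fintype ι] {E : Type*} (G : FieldRotations K n deg kind E)

theorem FieldRotations.act_eq (ε : E) : G.act ε = mkDerivation K fun v => ∑ c,
    G.coeff ε v.1.1 c • (jetVar c v.1.2.1 v.2 : JetPoly K n deg) :=
  derivation_ext fun v => by rw [mkDerivation_X, X_eq_jetVar, G.act_jetVar]

/-- The rotations preserve weights which are the same for fields of the same degree. -/
theorem FieldRotations.weightedHomogeneousComponent_act {u : ι → ℕ}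
    (hu : ∀ a c, deg a = deg c → u a = u c) (e : ℕ) (ε : E) (k : ℕ) (x : JetPoly K n deg) :
    weightedHomogeneousComponent (jetWeight u e) k (G.act ε x) =
      G.act ε (weightedHomogeneousComponent (jetWeight u e) k x) := by
  rw [G.act_eq]
  refine weightedHomogeneousComponent_derivation (e := 0) (d := jetWeight u e) (fun v => ?_)
    (fun v => rfl) x k
  refine IsWeightedHomogeneous.sum _ _ _ fun c _ => ?_
  by_cases h : G.coeff ε v.1.1 c = 0
  · rw [h, zero_smul]; exact isWeightedHomogeneous_zero K _ _
  · refine (weightedHomogeneousSubmodule K _ _).smul_mem _ ?_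
    have := isWeightedHomogeneous_jetVar (K := K) (deg := deg) u e c v.1.2.1 v.2
    rwa [← hu _ _ (G.deg_eq ε _ _ h)] at this

/-- The jet polynomials invariant under the rotations. -/
def FieldRotations.invariants : Submodule K (JetPoly K n deg) where
  carrier := {x | ∀ ε, G.act ε x = 0}
  add_mem' hx hy ε := by rw [map_add, hx, hy, add_zero]
  zero_mem' ε := map_zero _
  smul_mem' c x hx ε := by rw [Derivation.map_smul, hx, smul_zero]

/-- The abelian invariants of degree `k` in the fields which are also invariant under the
rotations. -/
def abelianPart (k : ℕ) : Submodule K (JetPoly K n deg) :=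
  Subalgebra.toSubmodule (abelianInv K n deg kind) ⊓
    weightedHomogeneousSubmodule K (jetWeight (fun _ => 1) 0) k ⊓ G.invariants

theorem weightedHomogeneousComponent_mem_abelianPart {u : ι → ℕ}
    (hu : ∀ a c, deg a = deg c → u a = u c) (e k j : ℕ) {x : JetPoly K n deg}
    (hx : x ∈ abelianPart G k) :
    weightedHomogeneousComponent (jetWeight u e) j x ∈ abelianPart G k :=
  ⟨⟨weightedHomogeneousComponent_mem_abelianInv u e j hx.1.1,
    isWeightedHomogeneous_weightedHomogeneousComponent hx.1.2 _ _⟩, fun ε => by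
      rw [← G.weightedHomogeneousComponent_act hu, hx.2 ε, map_zero]⟩

theorem formProj_zero_of_belowTop {M : Type*} [AddCommGroup M] [Module K M]
    {ω : ConstForm K 0 ⊗[K] M} (h : ω ∈ belowTop K 0 M) : ω = 0 := by
  rw [← sum_formProj_of_mem_belowTop h, Finset.range_zero, Finset.sum_empty]

theorem formProj_sub_self {M : Type*} [AddCommGroup M] [Module K M] (k : ℕ)
    (ω : ConstForm K n ⊗[K] M) : formProj M k (ω - formProj M k ω) = 0 := by
  rw [map_sub, formProj_formProj, if_pos rfl, sub_self]

variable [CharZero K]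

/-- The result on families applied to a single form. The representative has no part of form degree
`n` and the primitive none of form degree `n - 1`, since these parts cancel each other. -/
theorem exists_abelian_representative_of_form (hdeg : ∀ a, 1 ≤ deg a) {k : ℕ}
    {P : LocalForm K n deg} (hP : P ∈ FormsIn (abelianPart G k)) (hbelow : P ∈ belowTop K n _)
    (hclosed : extD K deg P = 0) :
    ∃ Q ∈ FormsIn (abelianPart G k), ∃ R ∈ FormsIn (abelianPart G k),
      Q ∈ closedAlgebra K n deg kind ∧ Q ∈ belowTop K n _ ∧
      (∀ m, n = m + 1 → formProj _ m R = 0) ∧ P = Q + extD K deg R := by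
  set ρ : E → PUnit → PUnit → K := fun _ _ _ => 0 with hρ
  have hinv : ∀ x : PUnit → JetPoly K n deg, x ∈ invFam G k ρ ↔ x PUnit.unit ∈ abelianPart G k := by
    intro x
    constructor
    · intro h
      obtain ⟨h1, h2, h3⟩ := h PUnit.unit
      exact ⟨⟨h1, h2⟩, fun ε => by simpa [hρ] using h3 ε⟩
    · rintro ⟨⟨h1, h2⟩, h3⟩ ⟨⟩
      exact ⟨h1, h2, fun ε => by simpa [hρ] using h3 ε⟩
  set fam : JetPoly K n deg →ₗ[K] (PUnit → JetPoly K n deg) :=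
    LinearMap.pi fun _ => LinearMap.id with hfam
  have hev : ∀ ω : LocalForm K n deg, evFam PUnit.unit (TensorProduct.map LinearMap.id fam ω) = ω := by
    intro ω
    refine form_ext fun f => ?_
    rw [compAt_evFam, compAt_map]
    rfl
  have hcomm : ∀ μ x, fam (totalD K deg μ x) = famD K deg PUnit μ (fam x) := fun μ x => rfl
  obtain ⟨Q, hQ, R, hR, hQA, e⟩ := exists_abelian_representative G hdeg k (Θ := PUnit) (ρ := ρ)
    (TensorProduct.map LinearMap.id fam P)
    (map_mem_formsIn _ (fun x hx => (hinv _).mpr hx) hP) (map_id_mem_belowTop _ hbelow)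
    (by rw [← map_koszulD hcomm, ← extD_eq_koszulD, hclosed, map_zero])
  have hmem : ∀ ω : ConstForm K n ⊗[K] (PUnit → JetPoly K n deg), ω ∈ FormsIn (invFam G k ρ) →
      evFam PUnit.unit ω ∈ FormsIn (abelianPart G k) := by
    intro ω hω f
    rw [compAt_evFam]
    exact (hinv _).mp (hω f)
  have e' : P = evFam PUnit.unit Q + extD K deg (evFam PUnit.unit R) := by
    rw [← evFam_koszulD, ← map_add, ← e, hev]
  cases n with
  | zero =>
    refine ⟨0, zero_mem _, 0, zero_mem _, zero_mem _, zero_mem _, fun _ _ => map_zero _, ?_⟩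
    rw [map_zero, add_zero]
    exact formProj_zero_of_belowTop hbelow
  | succ m =>
    set Q' := evFam PUnit.unit Q
    set R' := evFam PUnit.unit R
    refine ⟨Q' - formProj _ (m + 1) Q',
      Submodule.sub_mem _ (hmem Q hQ) (formProj_mem_formsIn _ (hmem Q hQ)),
      R' - formProj _ m R',
      Submodule.sub_mem _ (hmem R hR) (formProj_mem_formsIn _ (hmem R hR)),
      sub_mem (hQA _) (formProj_mem_closedAlgebra _ (hQA _)), formProj_sub_self _ _, ?_, ?_⟩
    · intro m' hm
      obtain rfl : m = m' := Nat.succ_injective hm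
      exact formProj_sub_self _ _
    · have h := mem_belowTop.mp hbelow
      rw [e', map_add, extD_eq_koszulD, formProj_succ_koszulD] at h
      rw [map_sub, e', extD_eq_koszulD, extD_eq_koszulD]
      rw [sub_add_sub_comm, h, sub_zero]

/-- The representative and the primitive may be chosen to have the same weights as the given
form. -/
theorem exists_abelian_representative_of_weight (hdeg : ∀ a, 1 ≤ deg a) {k w : ℕ}
    {P : LocalForm K n deg} (hP : P ∈ FormsIn (abelianPart G k)) (hbelow : P ∈ belowTop K n _)
    (hclosed : extD K deg P = 0)
    (hw : P ∈ FormsIn (orderGE (fun v => -(jetWeight deg 1 v : ℤ)) (-w))) :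
    ∃ Q ∈ FormsIn (abelianPart G k), ∃ R ∈ FormsIn (abelianPart G k),
      Q ∈ closedAlgebra K n deg kind ∧ Q ∈ belowTop K n _ ∧
      Q ∈ FormsIn (orderGE (fun v => -(jetWeight deg 1 v : ℤ)) (-w)) ∧
      R ∈ FormsIn (orderGE (fun v => -(jetWeight deg 1 v : ℤ)) (-w + 1)) ∧
      (∀ m, n = m + 1 → formProj _ m R = 0) ∧ P = Q + extD K deg R := by
  obtain ⟨Q, hQ, R, hR, hQA, hQb, hRt, e⟩ :=
    exists_abelian_representative_of_form G hdeg hP hbelow hclosed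
  have hpart : ∀ (m : ℕ) (ω : LocalForm K n deg), ω ∈ FormsIn (abelianPart G k) →
      weightProj (jetWeight deg 1) m ω ∈ FormsIn (abelianPart G k) := fun m ω hω =>
    map_mem_formsIn _ (fun x hx =>
      weightedHomogeneousComponent_mem_abelianPart G (fun _ _ h => h) 1 k m hx) hω
  have hord : ∀ (m : ℕ) (ω : LocalForm K n deg), weightProj (jetWeight deg 1) m ω ∈
      FormsIn (orderGE (fun v => -(jetWeight deg 1 v : ℤ)) (-m)) := fun m ω f => by
    rw [compAt_weightProj]
    exact mem_orderGE_neg_of_isWeightedHomogeneous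
      (weightedHomogeneousComponent_isWeightedHomogeneous _ _)
  refine ⟨∑ m ∈ Finset.range (w + 1), weightProj (jetWeight deg 1) m Q,
    Submodule.sum_mem _ fun m _ => hpart m Q hQ,
    ∑ m ∈ Finset.range w, weightProj (jetWeight deg 1) m R,
    Submodule.sum_mem _ fun m _ => hpart m R hR,
    sum_mem fun m _ => weightProj_mem_closedAlgebra deg 1 m hQA,
    Submodule.sum_mem _ fun m _ => map_id_mem_belowTop _ hQb,
    Submodule.sum_mem _ fun m hm => ?_, Submodule.sum_mem _ fun m hm => ?_, fun m hm => ?_, ?_⟩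
  · have := Finset.mem_range.mp hm
    exact formsIn_mono (fun x hx => orderGE_mono (by omega) hx) (hord m Q)
  · have := Finset.mem_range.mp hm
    exact formsIn_mono (fun x hx => orderGE_mono (by omega) hx) (hord m R)
  · rw [map_sum]
    refine sum_eq_zero fun j _ => ?_
    rw [← weightProj_formProj, hRt m hm, map_zero]
  · have h1 : P = ∑ m ∈ Finset.range (w + 1), weightProj (jetWeight deg 1) m P := by
      refine form_ext fun f => ?_
      rw [map_sum]
      simp only [compAt_weightProj]
      exact (sum_weightedHomogeneousComponent_of_mem_orderGE (hw f)).symm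
    rw [h1, e, map_sum]
    simp only [map_add, sum_add_distrib]
    congr 1
    rw [Finset.sum_range_succ', weightProj_extD_of_lt deg Nat.zero_lt_one, add_zero]
    exact sum_congr rfl fun m _ => weightProj_extD deg 1 m R

end AbelianForms

/-! ### Covariant curvatures -/

section Lists

variable {n : ℕ}

theorem multiIndex_apply (l : List (Fin n)) (μ : Fin n) : multiIndex l μ = l.count μ := by
  classical
  induction l with
  | nil => rfl
  | cons ν l ih =>
    rw [multiIndex_cons, Finsupp.add_apply, ih, List.count_cons, Finsupp.single_apply, add_comm]
    simp

theorem perm_of_multiIndex_eq {l l' : List (Fin n)} (h : multiIndex l = multiIndex l') :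
    l.Perm l' :=
  List.perm_iff_count.mpr fun μ => by rw [← multiIndex_apply, ← multiIndex_apply, h]

theorem degree_multiIndex (l : List (Fin n)) : (multiIndex l).degree = l.length := by
  induction l with
  | nil => rfl
  | cons ν l ih =>
    rw [multiIndex_cons, map_add, ih, Finsupp.degree_single, List.length_cons, add_comm]

/-- A list of indices with the given multiplicities. -/
def multiList (α : Fin n →₀ ℕ) : List (Fin n) := (exists_multiIndex_eq α).choose

theorem multiIndex_multiList (α : Fin n →₀ ℕ) : multiIndex (multiList α) = α :=
  (exists_multiIndex_eq α).choose_spec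

theorem foldr_perm_congr {K M : Type*} [Field K] [AddCommGroup M] [Module K M]
    {D : Fin n → M →ₗ[K] M} {N N' : Submodule K M} (hN : ∀ μ, ∀ x ∈ N, D μ x ∈ N)
    (hN' : ∀ μ, ∀ x ∈ N', D μ x ∈ N')
    (hc : ∀ μ ν, ∀ x ∈ N, D μ (D ν x) - D ν (D μ x) ∈ N') {l l' : List (Fin n)} (h : l.Perm l')
    {x : M} (hx : x ∈ N) :
    l.foldr (fun μ y => D μ y) x - l'.foldr (fun μ y => D μ y) x ∈ N' := by
  have hl : ∀ l : List (Fin n), l.foldr (fun μ y => D μ y) x ∈ N := by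
    intro l
    induction l with
    | nil => exact hx
    | cons μ l ih => exact hN μ _ ih
  induction h with
  | nil => rw [sub_self]; exact zero_mem _
  | cons μ _ ih =>
    rw [List.foldr_cons, List.foldr_cons, ← map_sub]
    exact hN' μ _ ih
  | swap μ ν l => exact hc _ _ _ (hl l)
  | trans _ _ ih ih' =>
    have := N'.add_mem ih ih'
    rwa [sub_add_sub_cancel] at this

end Lists

section SubmodulePowers

variable {K A : Type*} [Field K] [CommRing A] [Algebra K A]

theorem mul_mem_of_derivation {D : Derivation K A A} {N M : Submodule K A}
    (hN : ∀ x ∈ N, D x ∈ N) (hM : ∀ x ∈ M, D x ∈ M) : ∀ x ∈ N * M, D x ∈ N * M := by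
  intro x hx
  induction hx using Submodule.mul_induction_on' with
  | mem_mul_mem x hx y hy =>
    rw [Derivation.leibniz, smul_eq_mul, smul_eq_mul, mul_comm y]
    exact Submodule.add_mem _ (Submodule.mul_mem_mul hx (hM y hy))
      (Submodule.mul_mem_mul (hN x hx) hy)
  | add x _ y _ hx hy => rw [map_add]; exact Submodule.add_mem _ hx hy

theorem pow_mem_of_derivation {D : Derivation K A A} {N : Submodule K A}
    (hN : ∀ x ∈ N, D x ∈ N) (k : ℕ) : ∀ x ∈ N ^ k, D x ∈ N ^ k := by
  induction k with
  | zero =>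
    intro x hx
    rw [pow_zero] at hx
    obtain ⟨c, rfl⟩ := Submodule.mem_one.mp hx
    rw [Derivation.map_algebraMap]
    exact zero_mem _
  | succ k ih =>
    rw [pow_succ]
    exact mul_mem_of_derivation ih hN

end SubmodulePowers

section CovariantCurvatures

open MvPolynomial

variable {K : Type*} [Field K] {n : ℕ} {ι : Type*} {deg : ι → ℕ}

/-- The number of fields in a monomial, as a weight. -/
abbrev fieldCount : JetVar n deg → ℕ := jetWeight (fun _ => 1) 0

/-- The number of derivatives in a monomial plus the form degrees of its fields, as a weight. -/
abbrev totalWeight : JetVar n deg → ℕ := jetWeight deg 1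

/-- The components of the forms `curv a` and their iterated derivatives with respect to `cov`. -/
def covGens (cov : Fin n → Derivation K (JetPoly K n deg) (JetPoly K n deg))
    (curv : ι → LocalForm K n deg) : Set (JetPoly K n deg) :=
  {x | ∃ (a : ι) (f : Module.Dual K (ConstForm K n)) (l : List (Fin n)),
    x = l.foldr (fun μ y => cov μ y) (compAt _ f (curv a))}

/-- The polynomials in covariant derivatives of curvatures all of whose terms have at least `k`
factors. -/
def covFiltration (cov : Fin n → Derivation K (JetPoly K n deg) (JetPoly K n deg))
    (curv : ι → LocalForm K n deg) (k : ℕ) : Submodule K (JetPoly K n deg) :=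
  Submodule.span K (covGens cov curv) ^ k *
    Subalgebra.toSubmodule (Algebra.adjoin K (covGens cov curv))

variable [Fintype ι] {E : Type*}

/-- Derivations `cov μ` and forms `curv a` with the formal properties of the covariant derivatives
and of the curvatures of gauge fields: they agree with the total derivatives and the abelian
curvatures up to terms with more fields, and the identities which hold for the latter hold up to
terms with more curvatures. On polynomials in the curvatures which are invariant under the
rotations, the covariant derivatives agree with the total derivatives. -/
structure CovariantCurvatures (G : FieldRotations K n deg (fun _ => FieldKind.closed) E) where
  /-- The covariant derivatives. -/
  cov : Fin n → Derivation K (JetPoly K n deg) (JetPoly K n deg)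
  /-- The curvatures. -/
  curv : ι → LocalForm K n deg
  formProj_curv : ∀ a, formProj _ (deg a + 1) (curv a) = curv a
  curv_mem : ∀ a, curv a ∈ smallAlgebra K deg
  curv_lead : ∀ a f, compAt _ f (curv a) - compAt _ f (extD K deg (fieldForm K deg a)) ∈
    orderGE (fun v => (fieldCount v : ℤ)) 2
  curv_weight : ∀ a f, compAt _ f (curv a) ∈
    orderGE (fun v => -(totalWeight v : ℤ)) (-(deg a + 1))
  cov_lead : ∀ μ v, cov μ (X v) - totalDeriv K deg μ (X v) ∈
    orderGE (fun v => (fieldCount v : ℤ)) 2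
  cov_weight : ∀ μ v, cov μ (X v) ∈
    orderGE (fun v => -(totalWeight v : ℤ)) (-(totalWeight v : ℤ) - 1)
  bianchi : ∀ a (f : Module.Dual K (ConstForm K n)),
    ∑ ν, cov ν (compAt _ (f ∘ₗ LinearMap.mulLeft K (dx K ν)) (curv a)) ∈ covFiltration cov curv 2
  cov_comm : ∀ μ ν, ∀ x ∈ covGens cov curv, cov μ (cov ν x) - cov ν (cov μ x) ∈
    covFiltration cov curv 2
  cov_invariant : ∀ μ, ∀ x ∈ Algebra.adjoin K (covGens cov curv), x ∈ G.invariants →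
    cov μ x = totalDeriv K deg μ x
  act_curv : ∀ ε a f, G.act ε (compAt _ f (curv a)) = ∑ c, G.coeff ε a c • compAt _ f (curv c)
  act_cov : ∀ ε μ x, G.act ε (cov μ x) = cov μ (G.act ε x)

namespace CovariantCurvatures

variable {G : FieldRotations K n deg (fun _ => FieldKind.closed) E} (C : CovariantCurvatures G)

/-- The linear span of the covariant derivatives of the curvatures. -/
def genSpan : Submodule K (JetPoly K n deg) := Submodule.span K (covGens C.cov C.curv)

/-- The algebra of polynomials in the covariant derivatives of the curvatures. -/
def alg : Subalgebra K (JetPoly K n deg) := Algebra.adjoin K (covGens C.cov C.curv)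

/-- The filtration by the number of curvatures. -/
def filt (k : ℕ) : Submodule K (JetPoly K n deg) := C.genSpan ^ k * Subalgebra.toSubmodule C.alg

theorem gen_mem_genSpan (a : ι) (f : Module.Dual K (ConstForm K n)) (l : List (Fin n)) :
    l.foldr (fun μ y => C.cov μ y) (compAt _ f (C.curv a)) ∈ C.genSpan :=
  Submodule.subset_span ⟨a, f, l, rfl⟩

theorem genSpan_le_alg : C.genSpan ≤ Subalgebra.toSubmodule C.alg :=
  Submodule.span_le.mpr Algebra.subset_adjoin

theorem alg_mul_alg : Subalgebra.toSubmodule C.alg * Subalgebra.toSubmodule C.alg =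
    Subalgebra.toSubmodule C.alg := (Subalgebra.isIdempotentElem_toSubmodule _)

theorem filt_zero : C.filt 0 = Subalgebra.toSubmodule C.alg := by
  rw [filt, pow_zero, one_mul]

theorem filt_succ (k : ℕ) : C.filt (k + 1) = C.genSpan * C.filt k := by
  rw [filt, filt, pow_succ', mul_assoc]

theorem genSpan_le_filt : C.genSpan ≤ C.filt 1 := fun x hx => by
  rw [filt_succ, filt_zero, ← mul_one x]
  exact Submodule.mul_mem_mul hx (one_mem C.alg)

theorem filt_mul (k l : ℕ) : C.filt k * C.filt l = C.filt (k + l) := by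
  rw [filt, filt, filt, mul_mul_mul_comm, ← pow_add, alg_mul_alg]

theorem mul_mem_filt {k l : ℕ} {x y : JetPoly K n deg} (hx : x ∈ C.filt k) (hy : y ∈ C.filt l) :
    x * y ∈ C.filt (k + l) := by
  rw [← filt_mul]
  exact Submodule.mul_mem_mul hx hy

theorem filt_succ_le (k : ℕ) : C.filt (k + 1) ≤ C.filt k := by
  rw [filt, pow_succ, mul_assoc]
  calc C.genSpan ^ k * (C.genSpan * Subalgebra.toSubmodule C.alg)
      ≤ C.genSpan ^ k * (Subalgebra.toSubmodule C.alg * Subalgebra.toSubmodule C.alg) := by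
        gcongr; exact C.genSpan_le_alg
    _ = C.filt k := by rw [alg_mul_alg, filt]

theorem filt_le_alg (k : ℕ) : C.filt k ≤ Subalgebra.toSubmodule C.alg := by
  induction k with
  | zero => rw [filt_zero]
  | succ k ih => exact (C.filt_succ_le k).trans ih

theorem cov_mem_genSpan (μ : Fin n) : ∀ x ∈ C.genSpan, C.cov μ x ∈ C.genSpan := by
  intro x hx
  induction hx using Submodule.span_induction with
  | mem x hx =>
    obtain ⟨a, f, l, rfl⟩ := hx
    exact C.gen_mem_genSpan a f (μ :: l)
  | zero => rw [map_zero]; exact zero_mem _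
  | add x y _ _ hx hy => rw [map_add]; exact add_mem hx hy
  | smul c x _ hx => rw [Derivation.map_smul]; exact Submodule.smul_mem _ _ hx

theorem cov_mem_alg (μ : Fin n) : ∀ x ∈ C.alg, C.cov μ x ∈ C.alg := fun _ hx =>
  derivation_mem_adjoin (fun y hy => C.genSpan_le_alg
    (C.cov_mem_genSpan μ y (Submodule.subset_span hy))) hx

theorem cov_mem_filt (μ : Fin n) (k : ℕ) : ∀ x ∈ C.filt k, C.cov μ x ∈ C.filt k :=
  mul_mem_of_derivation (pow_mem_of_derivation (C.cov_mem_genSpan μ) k) (C.cov_mem_alg μ)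

theorem cov_comm_genSpan (μ ν : Fin n) : ∀ x ∈ C.genSpan,
    C.cov μ (C.cov ν x) - C.cov ν (C.cov μ x) ∈ C.filt 2 := by
  intro x hx
  induction hx using Submodule.span_induction with
  | mem x hx => exact C.cov_comm μ ν x hx
  | zero => simp
  | add x y _ _ hx hy =>
    simp only [map_add]
    rw [add_sub_add_comm]
    exact add_mem hx hy
  | smul c x _ hx =>
    simp only [Derivation.map_smul]
    rw [← smul_sub]
    exact Submodule.smul_mem _ _ hx

/-- Iterated covariant derivatives for a multi-index. -/
def covIter (α : Fin n →₀ ℕ) : JetPoly K n deg →ₗ[K] JetPoly K n deg :=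
  (multiList α).foldr (fun μ φ => (C.cov μ).toLinearMap ∘ₗ φ) LinearMap.id

theorem covIter_apply (α : Fin n →₀ ℕ) (x : JetPoly K n deg) :
    C.covIter α x = (multiList α).foldr (fun μ y => C.cov μ y) x := by
  rw [covIter]
  induction multiList α with
  | nil => rfl
  | cons μ l ih => rw [List.foldr_cons, List.foldr_cons, LinearMap.comp_apply, ih]; rfl

theorem covIter_mem_filt (α : Fin n →₀ ℕ) {k : ℕ} {x : JetPoly K n deg} (hx : x ∈ C.filt k) :
    C.covIter α x ∈ C.filt k := by
  rw [covIter_apply]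
  induction multiList α with
  | nil => exact hx
  | cons μ l ih => exact C.cov_mem_filt μ k _ ih

theorem foldr_sub_covIter_mem (l : List (Fin n)) {x : JetPoly K n deg} (hx : x ∈ C.genSpan) :
    l.foldr (fun μ y => C.cov μ y) x - C.covIter (multiIndex l) x ∈ C.filt 2 := by
  rw [covIter_apply]
  exact foldr_perm_congr (D := fun μ => (C.cov μ).toLinearMap) (fun μ => C.cov_mem_genSpan μ)
    (fun μ => C.cov_mem_filt μ 2) (fun μ ν => C.cov_comm_genSpan μ ν)
    (perm_of_multiIndex_eq (multiIndex_multiList _).symm) hx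

theorem covIter_zero (x : JetPoly K n deg) : C.covIter 0 x = x := by
  have h : multiList (0 : Fin n →₀ ℕ) = [] :=
    (perm_of_multiIndex_eq (l' := []) (multiIndex_multiList 0)).eq_nil
  rw [covIter_apply, h]
  rfl

theorem covIter_cov_sub_mem (α : Fin n →₀ ℕ) (ν : Fin n) {x : JetPoly K n deg}
    (hx : x ∈ C.genSpan) :
    C.covIter α (C.cov ν x) - C.covIter (α + Finsupp.single ν 1) x ∈ C.filt 2 := by
  have h := C.foldr_sub_covIter_mem (multiList α ++ [ν]) hx
  have e : multiIndex (multiList α ++ [ν]) = α + Finsupp.single ν 1 := by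
    conv_rhs => rw [← multiIndex_multiList α]
    simp [multiIndex]
  rwa [e, List.foldr_append, List.foldr_cons, List.foldr_nil, ← covIter_apply] at h

theorem compAt_mem_genSpan (a : ι) (f : Module.Dual K (ConstForm K n)) :
    compAt _ f (C.curv a) ∈ C.genSpan := C.gen_mem_genSpan a f []

/-- The image of a jet variable under the covariantization: the standard homotopy expresses the
derivatives of a field, modulo gauge transformations, through those of its curvature. -/
def covVar (a : ι) (T : Finset (Fin n)) (α : Fin n →₀ ℕ) : JetPoly K n deg :=
  ((α.degree + deg a : ℕ) : K)⁻¹ • ∑ μ, (α μ : K) • C.covIter (α - Finsupp.single μ 1)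
    (compAt _ ((dxBasis K n).coord T ∘ₗ contract μ) (C.curv a))

/-- The covariantization: the algebra homomorphism which replaces abelian curvatures by covariant
ones. -/
def covariantize : JetPoly K n deg →ₐ[K] JetPoly K n deg :=
  aeval fun v => C.covVar v.1.1 v.1.2.1 v.2

theorem compAt_curv_eq (a : ι) (f : Module.Dual K (ConstForm K n)) :
    compAt _ f (C.curv a) = compAt _ (f ∘ₗ degProj (deg a + 1)) (C.curv a) := by
  conv_lhs => rw [← C.formProj_curv a, formProj, compAt_map]
  rfl

theorem covVar_of_card_ne {a : ι} {T : Finset (Fin n)} (hT : T.card ≠ deg a)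
    (α : Fin n →₀ ℕ) : C.covVar a T α = 0 := by
  rw [covVar, sum_eq_zero, smul_zero]
  intro μ _
  have h : ((dxBasis K n).coord T ∘ₗ contract μ) ∘ₗ degProj (deg a + 1) = 0 := by
    refine LinearMap.ext fun x => ?_
    rw [LinearMap.comp_apply, LinearMap.comp_apply, ← degProj_contract]
    have : (dxBasis K n).coord T ∘ₗ degProj (deg a) = 0 := by
      refine constForm_linearMap_ext fun S => ?_
      rw [LinearMap.comp_apply, degProj_dxSet, LinearMap.zero_apply]
      split_ifs with hS
      · rw [coord_dxSet, if_neg]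
        rintro rfl
        exact hT hS
      · exact map_zero _
    exact LinearMap.congr_fun this _
  rw [compAt_curv_eq, h]
  have : compAt (JetPoly K n deg) (0 : Module.Dual K (ConstForm K n)) = 0 := by
    rw [compAt, LinearMap.rTensor_zero, LinearMap.comp_zero]
  rw [this, LinearMap.zero_apply, map_zero, smul_zero]

theorem covariantize_jetVar (a : ι) (T : Finset (Fin n)) (α : Fin n →₀ ℕ) :
    C.covariantize (jetVar a T α) = C.covVar a T α := by
  by_cases hT : T.card = deg a
  · rw [jetVar_of_card hT, covariantize, aeval_X]
  · rw [jetVar, dif_neg hT, map_zero, covVar_of_card_ne C hT]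

theorem compAt_add_left {M : Type*} [AddCommGroup M] [Module K M]
    (f g : Module.Dual K (ConstForm K n)) : compAt M (f + g) = compAt M f + compAt M g := by
  rw [compAt, LinearMap.rTensor_add, LinearMap.comp_add]; rfl

theorem compAt_smul_left {M : Type*} [AddCommGroup M] [Module K M] (c : K)
    (f : Module.Dual K (ConstForm K n)) : compAt M (c • f) = c • compAt M f := by
  rw [compAt, LinearMap.rTensor_smul, LinearMap.comp_smul]; rfl

theorem compAt_sum_left {M J : Type*} [AddCommGroup M] [Module K M] (s : Finset J)
    (f : J → Module.Dual K (ConstForm K n)) : compAt M (∑ j ∈ s, f j) = ∑ j ∈ s, compAt M (f j) := by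
  classical
  induction s using Finset.induction_on with
  | empty => rw [Finset.sum_empty, Finset.sum_empty, compAt, LinearMap.rTensor_zero,
      LinearMap.comp_zero]
  | insert a s ha ih => rw [Finset.sum_insert ha, Finset.sum_insert ha, compAt_add_left, ih]

end CovariantCurvatures

end CovariantCurvatures

/-! ### Covariantization -/

section Covariantization

open MvPolynomial

variable {K : Type*} [Field K] {n : ℕ} {ι : Type*} {deg : ι → ℕ} [Fintype ι]
  {E : Type*}

namespace CovariantCurvatures

variable {G : FieldRotations K n deg (fun _ => FieldKind.closed) E} (C : CovariantCurvatures G)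

/-- The Bianchi identity, in the form needed for the covariantization: contracting a differential
out of a curvature and differentiating again yields the curvature, up to quadratic terms. -/
theorem sum_covIter_sub_mem (a : ι) (f : Module.Dual K (ConstForm K n)) (β : Fin n →₀ ℕ)
    (μ : Fin n) (hμ : β μ ≠ 0) :
    ∑ ν, C.covIter (β + Finsupp.single ν 1 - Finsupp.single μ 1)
        (compAt _ (f ∘ₗ LinearMap.mulLeft K (dx K ν) ∘ₗ contract μ) (C.curv a)) -
      C.covIter β (compAt _ f (C.curv a)) ∈ C.filt 2 := by
  set γ := β - Finsupp.single μ 1 with hγ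
  have hβγ : β = γ + Finsupp.single μ 1 := (tsub_add_single hμ).symm
  have hsub : ∀ ν : Fin n, β + Finsupp.single ν 1 - Finsupp.single μ 1 =
      γ + Finsupp.single ν 1 := by
    intro ν
    rw [hβγ, add_right_comm, add_tsub_cancel_right]
  simp only [hsub]
  have h1 : ∀ ν : Fin n, C.covIter γ (C.cov ν (compAt _
        (f ∘ₗ LinearMap.mulLeft K (dx K ν) ∘ₗ contract μ) (C.curv a))) -
      C.covIter (γ + Finsupp.single ν 1) (compAt _
        (f ∘ₗ LinearMap.mulLeft K (dx K ν) ∘ₗ contract μ) (C.curv a)) ∈ C.filt 2 := fun ν =>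
    C.covIter_cov_sub_mem γ ν (C.compAt_mem_genSpan a _)
  have h2 := Submodule.sum_mem _ fun ν (_ : ν ∈ Finset.univ) => h1 ν
  rw [sum_sub_distrib, ← map_sum] at h2
  have h3 : ∑ ν, C.cov ν (compAt _ (f ∘ₗ LinearMap.mulLeft K (dx K ν) ∘ₗ contract μ) (C.curv a)) =
      C.cov μ (compAt _ f (C.curv a)) - ∑ ν, C.cov ν (compAt _
        ((f ∘ₗ contract μ) ∘ₗ LinearMap.mulLeft K (dx K ν)) (C.curv a)) := by
    have e : ∀ ν : Fin n, f ∘ₗ LinearMap.mulLeft K (dx K ν) ∘ₗ contract μ =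
        (if μ = ν then f else 0) +
          (-1 : K) • ((f ∘ₗ contract μ) ∘ₗ LinearMap.mulLeft K (dx K ν)) := by
      intro ν
      refine LinearMap.ext fun x => ?_
      simp only [LinearMap.comp_apply, LinearMap.mulLeft_apply, LinearMap.add_apply,
        LinearMap.smul_apply, contract_dx_mul, map_sub]
      split_ifs <;> simp
    simp only [e, compAt_add_left, compAt_smul_left, LinearMap.add_apply, LinearMap.smul_apply,
      map_add, map_neg, sum_add_distrib, neg_smul, one_smul, sum_neg_distrib]
    rw [← sub_eq_add_neg]
    congr 1
    rw [sum_eq_single μ]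
    · rw [if_pos rfl]
    · intro ν _ hν
      rw [if_neg (Ne.symm hν), compAt, LinearMap.rTensor_zero, LinearMap.comp_zero,
        LinearMap.zero_apply, map_zero]
    · simp
  rw [h3, map_sub] at h2
  have h4 := C.covIter_mem_filt γ (C.bianchi a (f ∘ₗ contract μ))
  have h5 := C.covIter_cov_sub_mem γ μ (C.compAt_mem_genSpan a f)
  rw [← hβγ] at h5
  have h6 := Submodule.add_mem _ (Submodule.sub_mem _ h5 h2) (Submodule.neg_mem _ h4)
  convert h6 using 1
  abel

variable [CharZero K]

/-- Before division by the number of derivatives plus the form degree, the covariantization of a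
derivative of the abelian curvature splits into the number operator on forms and the number operator
on derivatives. -/
theorem covariantize_foldr_eq (a : ι) (f : Module.Dual K (ConstForm K n)) (l : List (Fin n)) :
    ((l.length + 1 + deg a : ℕ) : K) • C.covariantize (l.foldr (fun μ y => totalDeriv K deg μ y)
        (compAt _ f (extD K deg (fieldForm K deg a)))) =
      ((deg a + 1 : ℕ) : K) • C.covIter (multiIndex l) (compAt _ f (C.curv a)) +
        ∑ μ, (multiIndex l μ : K) • ∑ ν, C.covIter (multiIndex l + Finsupp.single ν 1 -
          Finsupp.single μ 1) (compAt _ (f ∘ₗ LinearMap.mulLeft K (dx K ν) ∘ₗ contract μ)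
            (C.curv a)) := by
  set β := multiIndex l with hβ
  have hne : ((l.length + 1 + deg a : ℕ) : K) ≠ 0 := Nat.cast_ne_zero.mpr (by omega)
  have hsum : ∀ μ ν : Fin n, ∑ T, f (dx K ν * dxSet K T) •
      compAt _ ((dxBasis K n).coord T ∘ₗ contract μ) (C.curv a) =
      compAt _ (f ∘ₗ LinearMap.mulLeft K (dx K ν) ∘ₗ contract μ) (C.curv a) := by
    intro μ ν
    simp only [← LinearMap.smul_apply, ← compAt_smul_left]
    rw [← LinearMap.sum_apply, ← compAt_sum_left]
    congr 2
    refine LinearMap.ext fun x => ?_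
    simp only [LinearMap.sum_apply, LinearMap.smul_apply, LinearMap.comp_apply,
      LinearMap.mulLeft_apply]
    conv_rhs => rw [← (dxBasis K n).sum_repr (contract μ x)]
    simp only [mul_sum, map_sum, mul_smul_comm, map_smul, dxBasis_apply, smul_eq_mul,
      Module.Basis.coord_apply]
    exact sum_congr rfl fun T _ => mul_comm _ _
  have hdegree : ∀ ν : Fin n, (Finsupp.single ν 1 + β).degree + deg a = l.length + 1 + deg a := by
    intro ν
    rw [map_add, hβ, degree_multiIndex, Finsupp.degree_single]; omega
  rw [foldr_compAt_extD_fieldForm, map_sum]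
  simp only [map_smul, covariantize_jetVar, covVar, ← hβ, hdegree, smul_comm _ (_⁻¹ : K)]
  rw [← smul_sum, smul_inv_smul₀ hne, Fintype.sum_prod_type]
  simp only [smul_sum]
  have h1 : ∀ ν : Fin n, ∑ T, ∑ μ, f (dx K ν * dxSet K T) • (((Finsupp.single ν 1 + β : Fin n →₀ ℕ) μ : ℕ) : K) •
      C.covIter (Finsupp.single ν 1 + β - Finsupp.single μ 1)
        (compAt _ ((dxBasis K n).coord T ∘ₗ contract μ) (C.curv a)) =
      ∑ μ, (((Finsupp.single ν 1 + β : Fin n →₀ ℕ) μ : ℕ) : K) •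
        C.covIter (Finsupp.single ν 1 + β - Finsupp.single μ 1)
          (compAt _ (f ∘ₗ LinearMap.mulLeft K (dx K ν) ∘ₗ contract μ) (C.curv a)) := by
    intro ν
    rw [sum_comm]
    refine sum_congr rfl fun μ _ => ?_
    rw [← hsum, map_sum, smul_sum]
    refine sum_congr rfl fun T _ => ?_
    rw [map_smul, smul_comm]
  rw [sum_congr rfl fun ν _ => h1 ν]
  simp only [Finsupp.add_apply, Nat.cast_add, add_smul, sum_add_distrib]
  congr 1
  · -- the form number operator acts on the curvature as multiplication by its form degree
    have h2 : ∀ ν : Fin n, ∑ μ, ((Finsupp.single ν 1 μ : ℕ) : K) •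
        C.covIter (Finsupp.single ν 1 + β - Finsupp.single μ 1)
          (compAt _ (f ∘ₗ LinearMap.mulLeft K (dx K ν) ∘ₗ contract μ) (C.curv a)) =
        C.covIter β (compAt _ (f ∘ₗ LinearMap.mulLeft K (dx K ν) ∘ₗ contract ν) (C.curv a)) := by
      intro ν
      rw [sum_eq_single ν]
      · rw [Finsupp.single_eq_same, Nat.cast_one, one_smul, add_tsub_cancel_left]
      · intro μ _ hμ
        rw [Finsupp.single_eq_of_ne hμ, Nat.cast_zero, zero_smul]
      · simp
    simp only [h2]
    rw [← map_sum, ← LinearMap.sum_apply, ← compAt_sum_left, compAt_curv_eq, ← add_smul,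
      ← map_smul, compAt_curv_eq C a f, ← LinearMap.smul_apply, ← compAt_smul_left]
    congr 3
    refine LinearMap.ext fun x => ?_
    rw [LinearMap.comp_apply, LinearMap.sum_apply]
    simp only [LinearMap.comp_apply, LinearMap.mulLeft_apply, LinearMap.smul_apply]
    rw [← map_sum, ← numberOp_apply, numberOp_degProj, map_smul]
    push_cast
    rfl
  · rw [sum_comm]
    simp only [add_comm (Finsupp.single _ 1) β]

/-- The covariantization replaces derivatives of abelian curvatures by covariant derivatives of
the curvatures, up to terms with more curvatures. -/
theorem covariantize_foldr_sub_mem (a : ι) (f : Module.Dual K (ConstForm K n))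
    (l : List (Fin n)) :
    C.covariantize (l.foldr (fun μ y => totalDeriv K deg μ y)
        (compAt _ f (extD K deg (fieldForm K deg a)))) -
      l.foldr (fun μ y => C.cov μ y) (compAt _ f (C.curv a)) ∈ C.filt 2 := by
  have hne : ((l.length + 1 + deg a : ℕ) : K) ≠ 0 := Nat.cast_ne_zero.mpr (by omega)
  set β := multiIndex l with hβ
  have h1 : ∑ μ, (β μ : K) • (∑ ν, C.covIter (β + Finsupp.single ν 1 -
          Finsupp.single μ 1) (compAt _ (f ∘ₗ LinearMap.mulLeft K (dx K ν) ∘ₗ contract μ)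
            (C.curv a)) - C.covIter β (compAt _ f (C.curv a))) ∈ C.filt 2 := by
    refine Submodule.sum_mem _ fun μ _ => ?_
    by_cases hμ : β μ = 0
    · rw [hμ, Nat.cast_zero, zero_smul]; exact zero_mem _
    · exact Submodule.smul_mem _ _ (C.sum_covIter_sub_mem a f β μ hμ)
  have hlen : (l.length : K) = ∑ μ, (β μ : K) := by
    rw [← Nat.cast_sum, ← Finsupp.degree_eq_sum, hβ, degree_multiIndex]
  have h2 : C.covariantize (l.foldr (fun μ y => totalDeriv K deg μ y)
        (compAt _ f (extD K deg (fieldForm K deg a)))) -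
      C.covIter β (compAt _ f (C.curv a)) ∈ C.filt 2 := by
    rw [← Submodule.smul_mem_iff _ hne, smul_sub, covariantize_foldr_eq]
    convert h1 using 1
    simp only [smul_sub, sum_sub_distrib]
    rw [← sum_smul, ← hlen]
    push_cast
    simp only [add_smul]
    abel
  have h3 := C.foldr_sub_covIter_mem l (C.compAt_mem_genSpan a f)
  have := Submodule.sub_mem _ h2 h3
  rwa [sub_sub_sub_cancel_right] at this

/-- The covariantization of the components of the abelian curvatures is exact. -/
theorem covariantize_compAt_extD (a : ι) (f : Module.Dual K (ConstForm K n)) :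
    C.covariantize (compAt _ f (extD K deg (fieldForm K deg a))) = compAt _ f (C.curv a) := by
  have h := C.covariantize_foldr_eq a f []
  have h0 : multiIndex ([] : List (Fin n)) = 0 := rfl
  have hne : ((deg a + 1 : ℕ) : K) ≠ 0 := Nat.cast_ne_zero.mpr (by omega)
  simp only [List.foldr_nil, h0, Finsupp.coe_zero, Pi.zero_apply, Nat.cast_zero, zero_smul,
    sum_const_zero, add_zero, covIter_zero, List.length_nil, zero_add] at h
  rw [add_comm 1] at h
  exact smul_right_injective _ hne h

end CovariantCurvatures

end Covariantization

/-! ### Leading parts in the number of curvatures -/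

section Covariantization

open MvPolynomial

variable {K : Type*} [Field K] {n : ℕ} {ι : Type*} {deg : ι → ℕ}

variable (K n deg) in
/-- The linear span of the derivatives of the components of the abelian curvatures. -/
def abelianSpan : Submodule K (JetPoly K n deg) :=
  Submodule.span K {x | ∃ (a : ι) (f : Module.Dual K (ConstForm K n)) (l : List (Fin n)),
    x = l.foldr (fun μ y => totalDeriv K deg μ y) (compAt _ f (extD K deg (fieldForm K deg a)))}

theorem isWeightedHomogeneous_abelianSpan {x : JetPoly K n deg} (hx : x ∈ abelianSpan K n deg) :
    x.IsWeightedHomogeneous fieldCount 1 := by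
  rw [← mem_weightedHomogeneousSubmodule]
  refine (Submodule.span_le (p := weightedHomogeneousSubmodule K fieldCount 1)).mpr ?_ hx
  rintro _ ⟨a, f, l, rfl⟩
  have := foldr_totalDeriv_homogeneous (extD_mem_homogeneous
    (fieldForm_mem_homogeneous (K := K) (n := n) (deg := deg) (fun _ => 1) 0 a) f) l
  simpa using this

/-- The part of degree `k` in the fields of the algebra of abelian curvatures is spanned by the
products of `k` derivatives of curvatures. -/
theorem weightedHomogeneousComponent_mem_abelianSpan_pow {x : JetPoly K n deg}
    (hx : x ∈ abelianInv K n deg fun _ => FieldKind.closed) (k : ℕ) :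
    weightedHomogeneousComponent fieldCount k x ∈ abelianSpan K n deg ^ k := by
  classical
  induction hx using Algebra.adjoin_induction generalizing k with
  | mem x hx =>
    obtain ⟨H, ⟨a, ⟨h, -⟩ | ⟨-, rfl⟩⟩, f, l, rfl⟩ := hx
    · cases h
    · have hs : l.foldr (fun μ y => totalDeriv K deg μ y)
          (component K deg f (extD K deg (fieldForm K deg a))) ∈ abelianSpan K n deg :=
        Submodule.subset_span ⟨a, f, l, rfl⟩
      rw [weightedHomogeneousComponent_of_mem (isWeightedHomogeneous_abelianSpan hs)]
      split_ifs with hk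
      · rw [hk, pow_one]; exact hs
      · exact zero_mem _
  | algebraMap r =>
    have h : (algebraMap K (JetPoly K n deg) r).IsWeightedHomogeneous fieldCount 0 :=
      isWeightedHomogeneous_C _ r
    rw [weightedHomogeneousComponent_of_mem h]
    split_ifs with hk
    · rw [hk, pow_zero]; exact Submodule.mem_one.mpr ⟨r, rfl⟩
    · exact zero_mem _
  | add x y _ _ hx hy => rw [map_add]; exact add_mem (hx k) (hy k)
  | mul x y _ _ hx hy =>
    rw [weightedHomogeneousComponent_mul]
    refine Submodule.sum_mem _ fun p hp => ?_
    rw [← Finset.HasAntidiagonal.mem_antidiagonal.mp hp, pow_add]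
    exact Submodule.mul_mem_mul (hx _) (hy _)

theorem abelianSpan_pow_le (k : ℕ) : abelianSpan K n deg ^ k ≤
    Subalgebra.toSubmodule (abelianInv K n deg fun _ => FieldKind.closed) := by
  have h1 : abelianSpan K n deg ≤
      Subalgebra.toSubmodule (abelianInv K n deg fun _ => FieldKind.closed) := by
    refine Submodule.span_le.mpr ?_
    rintro _ ⟨a, f, l, rfl⟩
    exact foldr_mem_abelianInv rfl f l
  induction k with
  | zero => rw [pow_zero]; exact Submodule.one_le.mpr (one_mem (abelianInv K n deg _))
  | succ k ih =>
    rw [pow_succ, ← (Subalgebra.isIdempotentElem_toSubmodule (abelianInv K n deg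
      fun _ => FieldKind.closed)).eq]
    exact mul_le_mul' ih h1

theorem totalDeriv_mem_orderGE_fieldCount (μ : Fin n) {m : ℤ} {x : JetPoly K n deg}
    (hx : x ∈ orderGE (fun v => (fieldCount v : ℤ)) m) :
    totalDeriv K deg μ x ∈ orderGE (fun v => (fieldCount v : ℤ)) m := by
  rw [← add_zero m]
  refine derivation_mem_orderGE (fun v => ?_) hx
  rw [totalDeriv_X]
  exact X_mem_orderGE (by simp [jetWeight])

variable [Fintype ι] {E : Type*}

namespace CovariantCurvatures

variable {G : FieldRotations K n deg (fun _ => FieldKind.closed) E} (C : CovariantCurvatures G)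

theorem cov_sub_totalDeriv_mem (μ : Fin n) {m : ℤ} {x : JetPoly K n deg}
    (hx : x ∈ orderGE (fun v => (fieldCount v : ℤ)) m) :
    C.cov μ x - totalDeriv K deg μ x ∈ orderGE (fun v => (fieldCount v : ℤ)) (m + 1) := by
  have := derivation_mem_orderGE (D := C.cov μ - totalDeriv K deg μ) (e := 1) (fun v => ?_) hx
  · exact this
  · refine orderGE_mono ?_ (C.cov_lead μ v)
    simp [jetWeight]

theorem cov_mem_orderGE (μ : Fin n) {m : ℤ} {x : JetPoly K n deg}
    (hx : x ∈ orderGE (fun v => (fieldCount v : ℤ)) m) :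
    C.cov μ x ∈ orderGE (fun v => (fieldCount v : ℤ)) m := by
  have h := Submodule.add_mem _ (orderGE_mono (by omega) (C.cov_sub_totalDeriv_mem μ hx))
    (totalDeriv_mem_orderGE_fieldCount μ hx)
  rwa [sub_add_cancel] at h

theorem weightedHomogeneousComponent_cov (μ : Fin n) {k : ℕ} {x : JetPoly K n deg}
    (hx : x ∈ orderGE (fun v => (fieldCount v : ℤ)) k) :
    weightedHomogeneousComponent fieldCount k (C.cov μ x) =
      totalDeriv K deg μ (weightedHomogeneousComponent fieldCount k x) := by
  have h := weightedHomogeneousComponent_eq_zero_of_mem_orderGE (k := k) (by omega)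
    (C.cov_sub_totalDeriv_mem μ hx)
  rw [map_sub, sub_eq_zero] at h
  rw [h]
  exact weightedHomogeneousComponent_totalDeriv (fun _ => 1) 0 μ x k

theorem compAt_curv_mem_orderGE (a : ι) (f : Module.Dual K (ConstForm K n)) :
    compAt _ f (C.curv a) ∈ orderGE (fun v => (fieldCount v : ℤ)) 1 := by
  have h1 : compAt _ f (extD K deg (fieldForm K deg a)) ∈
      orderGE (fun v => (fieldCount v : ℤ)) 1 :=
    mem_orderGE_of_isWeightedHomogeneous (k := 1) (isWeightedHomogeneous_abelianSpan
      (Submodule.subset_span ⟨a, f, [], rfl⟩))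
  have h := Submodule.add_mem _ (orderGE_mono (by omega) (C.curv_lead a f)) h1
  rwa [sub_add_cancel] at h

theorem foldr_cov_lead (a : ι) (f : Module.Dual K (ConstForm K n)) (l : List (Fin n)) :
    l.foldr (fun μ y => C.cov μ y) (compAt _ f (C.curv a)) ∈
        orderGE (fun v => (fieldCount v : ℤ)) 1 ∧
      weightedHomogeneousComponent fieldCount 1
        (l.foldr (fun μ y => C.cov μ y) (compAt _ f (C.curv a))) =
        l.foldr (fun μ y => totalDeriv K deg μ y) (compAt _ f (extD K deg (fieldForm K deg a))) := by
  induction l with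
  | nil =>
    refine ⟨C.compAt_curv_mem_orderGE a f, ?_⟩
    have h := weightedHomogeneousComponent_eq_zero_of_mem_orderGE (k := 1) (by norm_num)
      (C.curv_lead a f)
    rw [map_sub, sub_eq_zero] at h
    rw [List.foldr_nil, List.foldr_nil, h]
    exact weightedHomogeneousComponent_eq_self (isWeightedHomogeneous_abelianSpan
      (Submodule.subset_span ⟨a, f, [], rfl⟩))
  | cons μ l ih =>
    refine ⟨C.cov_mem_orderGE μ ih.1, ?_⟩
    rw [List.foldr_cons, List.foldr_cons, C.weightedHomogeneousComponent_cov μ ih.1, ih.2]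

theorem genSpan_le_orderGE :
    C.genSpan ≤ orderGE (fun v => (fieldCount v : ℤ)) 1 := by
  refine Submodule.span_le.mpr ?_
  rintro _ ⟨a, f, l, rfl⟩
  exact (C.foldr_cov_lead a f l).1

theorem filt_le_orderGE (k : ℕ) : C.filt k ≤ orderGE (fun v => (fieldCount v : ℤ)) k := by
  induction k with
  | zero =>
    intro x _ s _
    rw [weight_intCast]
    positivity
  | succ k ih =>
    rw [filt_succ, Nat.cast_succ, add_comm]
    refine Submodule.mul_le.mpr fun x hx y hy => ?_
    exact mul_mem_orderGE (C.genSpan_le_orderGE hx) (ih hy)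

theorem foldr_cov_weight {x : JetPoly K n deg} {m : ℤ}
    (hx : x ∈ orderGE (fun v => -(totalWeight v : ℤ)) m) (l : List (Fin n)) :
    l.foldr (fun μ y => C.cov μ y) x ∈ orderGE (fun v => -(totalWeight v : ℤ)) (m - l.length) := by
  induction l with
  | nil => simpa using hx
  | cons μ l ih =>
    rw [List.foldr_cons, List.length_cons, Nat.cast_succ, ← sub_sub, sub_eq_add_neg _ (1 : ℤ)]
    exact derivation_mem_orderGE (fun v => C.cov_weight μ v) ih

theorem covVar_mem (a : ι) (T : Finset (Fin n)) (α : Fin n →₀ ℕ) :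
    C.covVar a T α ∈ orderGE (fun v => -(totalWeight v : ℤ)) (-(deg a + α.degree : ℕ)) := by
  refine Submodule.smul_mem _ _ (Submodule.sum_mem _ fun μ _ => ?_)
  by_cases hμ : α μ = 0
  · rw [hμ, Nat.cast_zero, zero_smul]; exact zero_mem _
  · refine Submodule.smul_mem _ _ ?_
    rw [covIter_apply]
    refine orderGE_mono ?_ (C.foldr_cov_weight (C.curv_weight a _) _)
    have h1 : (multiList (α - Finsupp.single μ 1)).length + 1 = α.degree := by
      rw [← degree_multiIndex, multiIndex_multiList]
      conv_rhs => rw [← tsub_add_single hμ, map_add, Finsupp.degree_single]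
    push_cast
    omega

theorem covariantize_mem_weight {m : ℤ} {x : JetPoly K n deg}
    (hx : x ∈ orderGE (fun v => -(totalWeight v : ℤ)) m) :
    C.covariantize x ∈ orderGE (fun v => -(totalWeight v : ℤ)) m := by
  refine algHom_mem_orderGE (fun v => ?_) hx
  rw [X_eq_jetVar, covariantize_jetVar]
  have := C.covVar_mem v.1.1 v.1.2.1 v.2
  simpa [jetWeight] using this

theorem act_foldr_cov (ε : E) (a : ι) (f : Module.Dual K (ConstForm K n)) (l : List (Fin n)) :
    G.act ε (l.foldr (fun μ y => C.cov μ y) (compAt _ f (C.curv a))) =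
      ∑ c, G.coeff ε a c • l.foldr (fun μ y => C.cov μ y) (compAt _ f (C.curv c)) := by
  induction l with
  | nil => exact C.act_curv ε a f
  | cons μ l ih => simp only [List.foldr_cons, C.act_cov, ih, map_sum, Derivation.map_smul]

/-- The covariantization commutes with the rotations. -/
theorem act_covariantize (ε : E) (x : JetPoly K n deg) :
    G.act ε (C.covariantize x) = C.covariantize (G.act ε x) := by
  have hX : ∀ v, G.act ε (C.covariantize (X v)) = C.covariantize (G.act ε (X v)) := by
    intro v
    rw [X_eq_jetVar, G.act_jetVar, covariantize_jetVar, map_sum]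
    simp only [map_smul, covariantize_jetVar, covVar, map_sum, Derivation.map_smul, covIter_apply,
      act_foldr_cov, smul_sum]
    rw [Finset.sum_comm' (t' := Finset.univ) (s' := fun _ => Finset.univ) (by simp)]
    refine sum_congr rfl fun c _ => sum_congr rfl fun μ _ => ?_
    by_cases h : G.coeff ε v.1.1 c = 0
    · simp [h]
    · rw [← G.deg_eq ε _ _ h, smul_comm (G.coeff ε v.1.1 c), smul_comm (G.coeff ε v.1.1 c)]
  induction x using MvPolynomial.induction_on with
  | C c => rw [derivation_C, map_zero, ← algebraMap_eq, AlgHom.commutes, Derivation.map_algebraMap]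
  | add p q hp hq => simp only [map_add, hp, hq]
  | mul_X p v hp => simp only [map_mul, Derivation.leibniz, smul_eq_mul, map_add, hp, hX]

variable [CharZero K]

theorem covariantize_mem_filt_one {x : JetPoly K n deg} (hx : x ∈ abelianSpan K n deg) :
    C.covariantize x ∈ C.filt 1 := by
  refine (Submodule.span_le (p := (C.filt 1).comap C.covariantize.toLinearMap)).mpr ?_ hx
  rintro _ ⟨a, f, l, rfl⟩
  have h := Submodule.add_mem _ (C.filt_succ_le 1 (C.covariantize_foldr_sub_mem a f l))
    (C.genSpan_le_filt (C.gen_mem_genSpan a f l))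
  rwa [sub_add_cancel] at h

theorem covariantize_mem_filt {k : ℕ} {x : JetPoly K n deg} (hx : x ∈ abelianSpan K n deg ^ k) :
    C.covariantize x ∈ C.filt k := by
  induction k generalizing x with
  | zero =>
    rw [pow_zero] at hx
    obtain ⟨c, rfl⟩ := Submodule.mem_one.mp hx
    rw [AlgHom.commutes, filt_zero]
    exact Subalgebra.algebraMap_mem _ c
  | succ k ih =>
    rw [pow_succ] at hx
    induction hx using Submodule.mul_induction_on' with
    | mem_mul_mem x hx y hy =>
      rw [map_mul]
      exact C.mul_mem_filt (ih hx) (C.covariantize_mem_filt_one hy)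
    | add x _ y _ hx hy => rw [map_add]; exact Submodule.add_mem _ hx hy

/-- The covariantization intertwines total and covariant derivatives up to terms with more
curvatures. -/
theorem covariantize_totalDeriv_sub_mem {k : ℕ} {x : JetPoly K n deg}
    (hx : x ∈ abelianSpan K n deg ^ k) (μ : Fin n) :
    C.covariantize (totalDeriv K deg μ x) - C.cov μ (C.covariantize x) ∈ C.filt (k + 1) := by
  have h1 : ∀ x ∈ abelianSpan K n deg,
      C.covariantize (totalDeriv K deg μ x) - C.cov μ (C.covariantize x) ∈ C.filt 2 := by
    intro x hx
    induction hx using Submodule.span_induction with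
    | mem x hx =>
      obtain ⟨a, f, l, rfl⟩ := hx
      have h2 := C.covariantize_foldr_sub_mem a f (μ :: l)
      have h3 := C.cov_mem_filt μ 2 _ (C.covariantize_foldr_sub_mem a f l)
      rw [map_sub] at h3
      have := Submodule.sub_mem _ h2 h3
      rwa [List.foldr_cons, List.foldr_cons, sub_sub_sub_cancel_right] at this
    | zero => simp
    | add x y _ _ hx hy =>
      simp only [map_add, add_sub_add_comm]
      exact Submodule.add_mem _ hx hy
    | smul c x _ hx =>
      simp only [Derivation.map_smul, map_smul, ← smul_sub]
      exact Submodule.smul_mem _ _ hx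
  induction k generalizing x with
  | zero =>
    rw [pow_zero] at hx
    obtain ⟨c, rfl⟩ := Submodule.mem_one.mp hx
    rw [AlgHom.commutes, Derivation.map_algebraMap, Derivation.map_algebraMap, map_zero, sub_zero]
    exact zero_mem _
  | succ k ih =>
    rw [pow_succ] at hx
    induction hx using Submodule.mul_induction_on' with
    | mem_mul_mem x hx y hy =>
      have e : C.covariantize (totalDeriv K deg μ (x * y)) - C.cov μ (C.covariantize (x * y)) =
          C.covariantize x * (C.covariantize (totalDeriv K deg μ y) - C.cov μ (C.covariantize y)) +
          (C.covariantize (totalDeriv K deg μ x) - C.cov μ (C.covariantize x)) *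
            C.covariantize y := by
        simp only [map_mul, Derivation.leibniz, smul_eq_mul, map_add]
        ring
      rw [e]
      exact Submodule.add_mem _
        (C.mul_mem_filt (k := k) (l := 2) (C.covariantize_mem_filt hx) (h1 y hy))
        (C.mul_mem_filt (k := k + 1) (l := 1) (ih hx) (C.covariantize_mem_filt_one hy))
    | add x _ y _ hx hy =>
      simp only [map_add, add_sub_add_comm]
      exact Submodule.add_mem _ hx hy

/-- The leading part of a polynomial in at least `k` covariant curvatures is a polynomial in abelian
curvatures, and its covariantization differs from the given polynomial only by terms with more
curvatures. -/
theorem filt_lead (k : ℕ) : ∀ x ∈ C.filt k,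
    weightedHomogeneousComponent fieldCount k x ∈ abelianSpan K n deg ^ k ∧
      x - C.covariantize (weightedHomogeneousComponent fieldCount k x) ∈ C.filt (k + 1) := by
  classical
  have hpos : ∀ x : JetPoly K n deg, x ∈ orderGE (fun v => (fieldCount v : ℤ)) (0 : ℕ) := by
    intro x s _
    rw [weight_intCast]
    positivity
  induction k with
  | zero =>
    intro x hx
    rw [filt_zero] at hx
    change x ∈ C.alg at hx
    induction hx using Algebra.adjoin_induction with
    | mem x hx =>
      have hxs : x ∈ C.genSpan := Submodule.subset_span hx
      rw [weightedHomogeneousComponent_eq_zero_of_mem_orderGE (by norm_num)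
        (C.genSpan_le_orderGE hxs), map_zero, sub_zero]
      exact ⟨zero_mem _, C.genSpan_le_filt hxs⟩
    | algebraMap r =>
      have h : (algebraMap K (JetPoly K n deg) r).IsWeightedHomogeneous fieldCount 0 :=
        isWeightedHomogeneous_C _ r
      rw [weightedHomogeneousComponent_eq_self h, AlgHom.commutes, sub_self, pow_zero]
      exact ⟨Submodule.mem_one.mpr ⟨r, rfl⟩, zero_mem _⟩
    | add x y _ _ hx hy =>
      simp only [map_add, add_sub_add_comm]
      exact ⟨add_mem hx.1 hy.1, add_mem hx.2 hy.2⟩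
    | mul x y hx' hy' hx hy =>
      have e := weightedHomogeneousComponent_mul_of_mem_orderGE (hpos x) (hpos y)
      rw [add_zero] at e
      rw [e]
      refine ⟨?_, ?_⟩
      · have := Submodule.mul_mem_mul hx.1 hy.1
        rwa [← pow_add] at this
      · set x₀ := weightedHomogeneousComponent fieldCount 0 x
        set y₀ := weightedHomogeneousComponent fieldCount 0 y
        have e2 : x * y - C.covariantize (x₀ * y₀) =
            (x - C.covariantize x₀) * y + C.covariantize x₀ * (y - C.covariantize y₀) := by
          rw [map_mul]; ring
        rw [e2]
        have hy0 : y ∈ C.filt 0 := by rw [filt_zero]; exact hy'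
        exact add_mem (C.mul_mem_filt (k := 1) (l := 0) hx.2 hy0)
          (C.mul_mem_filt (k := 0) (l := 1) (C.covariantize_mem_filt hx.1) hy.2)
  | succ k ih =>
    have h1 : ∀ x ∈ C.genSpan, weightedHomogeneousComponent fieldCount 1 x ∈ abelianSpan K n deg ∧
        x - C.covariantize (weightedHomogeneousComponent fieldCount 1 x) ∈ C.filt 2 := by
      intro x hx
      induction hx using Submodule.span_induction with
      | mem x hx =>
        obtain ⟨a, f, l, rfl⟩ := hx
        rw [(C.foldr_cov_lead a f l).2]
        refine ⟨Submodule.subset_span ⟨a, f, l, rfl⟩, ?_⟩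
        rw [← neg_sub]
        exact Submodule.neg_mem _ (C.covariantize_foldr_sub_mem a f l)
      | zero => simp
      | add x y _ _ hx hy =>
        simp only [map_add, add_sub_add_comm]
        exact ⟨add_mem hx.1 hy.1, add_mem hx.2 hy.2⟩
      | smul c x _ hx =>
        simp only [map_smul, ← smul_sub]
        exact ⟨Submodule.smul_mem _ _ hx.1, Submodule.smul_mem _ _ hx.2⟩
    intro x hx
    rw [filt_succ] at hx
    induction hx using Submodule.mul_induction_on' with
    | mem_mul_mem x hx y hy =>
      have e := weightedHomogeneousComponent_mul_of_mem_orderGE (k := 1) (l := k)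
        (C.genSpan_le_orderGE hx) (C.filt_le_orderGE k hy)
      rw [add_comm 1 k] at e
      rw [e]
      refine ⟨?_, ?_⟩
      · rw [pow_succ']
        exact Submodule.mul_mem_mul (h1 x hx).1 (ih y hy).1
      · set x₀ := weightedHomogeneousComponent fieldCount 1 x
        set y₀ := weightedHomogeneousComponent fieldCount k y
        have e2 : x * y - C.covariantize (x₀ * y₀) =
            (x - C.covariantize x₀) * y + C.covariantize x₀ * (y - C.covariantize y₀) := by
          rw [map_mul]; ring
        rw [e2]
        refine add_mem ?_ ?_
        · have := C.mul_mem_filt (h1 x hx).2 hy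
          rwa [show 2 + k = k + 1 + 1 by omega] at this
        · have := C.mul_mem_filt (C.covariantize_mem_filt_one (h1 x hx).1) (ih y hy).2
          rwa [show 1 + (k + 1) = k + 1 + 1 by omega] at this
    | add x _ y _ hx hy =>
      simp only [map_add, add_sub_add_comm]
      exact ⟨add_mem hx.1 hy.1, add_mem hx.2 hy.2⟩

end CovariantCurvatures

end Covariantization

/-! ### The small algebra -/

section SmallAlgebra

open MvPolynomial

variable {K : Type*} [Field K] {n : ℕ} {ι : Type*} {deg : ι → ℕ}

theorem mul_mem_formsIn {N₁ N₂ N₃ : Submodule K (JetPoly K n deg)}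
    (h : ∀ x ∈ N₁, ∀ y ∈ N₂, x * y ∈ N₃) {ω η : LocalForm K n deg} (hω : ω ∈ FormsIn N₁)
    (hη : η ∈ FormsIn N₂) : ω * η ∈ FormsIn N₃ := by
  rw [← sum_dxSet_tmul_compAt ω, ← sum_dxSet_tmul_compAt η, sum_mul]
  refine Submodule.sum_mem _ fun S _ => ?_
  rw [mul_sum]
  refine Submodule.sum_mem _ fun T _ => ?_
  rw [Algebra.TensorProduct.tmul_mul_tmul]
  exact tmul_mem_formsIn _ (h _ (hω _) _ (hη _))

/-- The forms with coefficients in a subalgebra, as a subalgebra of the local forms. -/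
def formsSubalgebra (I : Subalgebra K (JetPoly K n deg)) : Subalgebra K (LocalForm K n deg) :=
  (FormsIn (Subalgebra.toSubmodule I)).toSubalgebra
    (tmul_mem_formsIn _ (one_mem I))
    fun _ _ hω hη => mul_mem_formsIn (fun _ hx _ hy => I.mul_mem hx hy) hω hη

/-- The action of an algebra homomorphism on the coefficients of forms. -/
def formMap (φ : JetPoly K n deg →ₐ[K] JetPoly K n deg) :
    LocalForm K n deg →ₐ[K] LocalForm K n deg :=
  Algebra.TensorProduct.map (AlgHom.id K _) φ

theorem formMap_tmul (φ : JetPoly K n deg →ₐ[K] JetPoly K n deg) (x : ConstForm K n)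
    (p : JetPoly K n deg) : formMap φ (x ⊗ₜ p) = x ⊗ₜ φ p := rfl

theorem compAt_formMap (φ : JetPoly K n deg →ₐ[K] JetPoly K n deg)
    (f : Module.Dual K (ConstForm K n)) (ω : LocalForm K n deg) :
    compAt _ f (formMap φ ω) = φ (compAt _ f ω) := by
  induction ω using TensorProduct.induction_on with
  | zero => simp
  | tmul x m => rw [formMap_tmul, compAt_tmul, compAt_tmul, map_smul]
  | add x y hx hy => simp only [map_add, hx, hy]

theorem formProj_formMap (φ : JetPoly K n deg →ₐ[K] JetPoly K n deg) (k : ℕ)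
    (ω : LocalForm K n deg) : formProj _ k (formMap φ ω) = formMap φ (formProj _ k ω) := by
  induction ω using TensorProduct.induction_on with
  | zero => simp
  | tmul x m => rfl
  | add x y hx hy => simp only [map_add, hx, hy]

theorem dx_mem_smallAlgebra (μ : Fin n) :
    dx K μ ⊗ₜ[K] (1 : JetPoly K n deg) ∈ smallAlgebra K deg :=
  Algebra.subset_adjoin (Or.inl (Or.inl ⟨μ, rfl⟩))

theorem fieldForm_mem_smallAlgebra (a : ι) :
    (fieldForm K deg a : LocalForm K n deg) ∈ smallAlgebra K deg :=
  Algebra.subset_adjoin (Or.inl (Or.inr ⟨a, rfl⟩))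

theorem extD_fieldForm_mem_smallAlgebra (a : ι) :
    extD K deg (fieldForm K deg a : LocalForm K n deg) ∈ smallAlgebra K deg :=
  Algebra.subset_adjoin (Or.inr ⟨a, rfl⟩)

theorem closedAlgebra_le_smallAlgebra {kind : ι → FieldKind} :
    closedAlgebra K n deg kind ≤ smallAlgebra K deg := by
  refine Algebra.adjoin_le ?_
  rintro _ (⟨μ, rfl⟩ | ⟨a, -, rfl⟩)
  exacts [dx_mem_smallAlgebra μ, extD_fieldForm_mem_smallAlgebra a]

theorem extD_one : extD K deg (1 : LocalForm K n deg) = 0 := by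
  rw [Algebra.TensorProduct.one_def, extD_eq_koszulD, koszulD_tmul]
  refine sum_eq_zero fun μ _ => ?_
  change _ ⊗ₜ totalDeriv K deg μ 1 = _
  rw [Derivation.map_one_eq_zero, TensorProduct.tmul_zero]

theorem extD_tmul_one (x : ConstForm K n) :
    extD K deg (x ⊗ₜ[K] (1 : JetPoly K n deg)) = 0 := by
  rw [extD_eq_koszulD, koszulD_tmul]
  refine sum_eq_zero fun μ _ => ?_
  change _ ⊗ₜ totalDeriv K deg μ 1 = _
  rw [Derivation.map_one_eq_zero, TensorProduct.tmul_zero]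

theorem extD_mem_smallAlgebra [CharZero K] {ω : LocalForm K n deg} (h : ω ∈ smallAlgebra K deg) :
    extD K deg ω ∈ smallAlgebra K deg := by
  induction h using Algebra.adjoin_induction with
  | mem x hx =>
    rcases hx with (⟨μ, rfl⟩ | ⟨a, rfl⟩) | ⟨a, rfl⟩
    · rw [extD_tmul_one]; exact zero_mem _
    · exact extD_fieldForm_mem_smallAlgebra a
    · rw [extD_extD]; exact zero_mem _
  | algebraMap r =>
    rw [Algebra.algebraMap_eq_smul_one, map_smul, extD_one, smul_zero]
    exact zero_mem _
  | add x y _ _ hx hy => rw [map_add]; exact add_mem hx hy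
  | mul x y hx' hy' hx hy =>
    rw [← sum_formProj x, sum_mul, map_sum]
    refine sum_mem fun k _ => ?_
    rw [extD_formProj_mul]
    refine add_mem (mul_mem ?_ hy')
      (Subalgebra.smul_mem _ (mul_mem (formProj_mem_smallAlgebra k hx') hy) _)
    rw [extD_eq_koszulD, ← formProj_succ_koszulD, ← extD_eq_koszulD]
    exact formProj_mem_smallAlgebra _ hx

theorem extD_mem_formsIn {N : Submodule K (JetPoly K n deg)}
    (h : ∀ μ, ∀ x ∈ N, totalDeriv K deg μ x ∈ N) {ω : LocalForm K n deg} (hω : ω ∈ FormsIn N) :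
    extD K deg ω ∈ FormsIn N :=
  koszulD_mem_formsIn (D := totalD K deg) h hω

/-- The excess of derivatives over fields of the given kind of monomials. -/
def excess (sel : ι → Prop) (v : JetVar n deg) : ℤ :=
  open Classical in (v.2.degree : ℤ) - if sel v.1.1 then 1 else 0

theorem jetVar_mem_orderGE {u : JetVar n deg → ℤ} {m : ℤ} {a : ι} {T : Finset (Fin n)}
    {α : Fin n →₀ ℕ} (h : ∀ hT : T.card = deg a, m ≤ u (⟨a, ⟨T, hT⟩⟩, α)) :
    (jetVar a T α : JetPoly K n deg) ∈ orderGE u m := by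
  by_cases hT : T.card = deg a
  · rw [jetVar_of_card hT]; exact X_mem_orderGE (h hT)
  · rw [jetVar, dif_neg hT]; exact zero_mem _

/-- In a product of derivatives of curvatures and free fields there are at least as many derivatives
as fields which are not free. -/
theorem abelianInv_le_orderGE {kind : ι → FieldKind} {sel : ι → Prop}
    (hsel : ∀ a, kind a = .free → ¬sel a) {x : JetPoly K n deg}
    (hx : x ∈ abelianInv K n deg kind) : x ∈ orderGE (excess sel) 0 := by
  classical
  induction hx using Algebra.adjoin_induction with
  | mem x hx =>
    obtain ⟨H, ⟨a, ⟨h, rfl⟩ | ⟨h, rfl⟩⟩, f, l, rfl⟩ := hx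
    · rw [component_eq_compAt, compAt_fieldForm, foldr_totalDeriv_sum]
      refine Submodule.sum_mem _ fun T _ => Submodule.smul_mem _ _ ?_
      rw [foldr_totalDeriv_jetVar]
      refine jetVar_mem_orderGE fun hT => ?_
      simp [excess, hsel a h]
    · rw [component_eq_compAt, foldr_compAt_extD_fieldForm]
      refine Submodule.sum_mem _ fun T _ => Submodule.smul_mem _ _ ?_
      refine jetVar_mem_orderGE fun hT => ?_
      simp only [excess, map_add, Finsupp.degree_single]
      push_cast
      split_ifs <;> omega
  | algebraMap r =>
    rw [Algebra.algebraMap_eq_smul_one]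
    exact Submodule.smul_mem _ _ (one_mem_orderGE _)
  | add x y _ _ hx hy => exact Submodule.add_mem _ hx hy
  | mul x y _ _ hx hy =>
    have := mul_mem_orderGE hx hy
    rwa [add_zero] at this

theorem totalDeriv_mem_orderGE_excess {sel : ι → Prop} (μ : Fin n) {m : ℤ} {x : JetPoly K n deg}
    (hx : x ∈ orderGE (excess sel) m) : totalDeriv K deg μ x ∈ orderGE (excess sel) (m + 1) := by
  refine derivation_mem_orderGE (fun v => ?_) hx
  rw [totalDeriv_X]
  refine X_mem_orderGE ?_
  simp only [excess, map_add, Finsupp.degree_single, Nat.cast_add, Nat.cast_one]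
  omega

theorem extD_mem_orderGE_excess {sel : ι → Prop} {m : ℤ} {ω : LocalForm K n deg}
    (hω : ω ∈ FormsIn (orderGE (excess sel) m)) :
    extD K deg ω ∈ FormsIn (orderGE (excess sel) (m + 1)) := fun f => by
  rw [compAt_extD]
  exact Submodule.sum_mem _ fun μ _ => totalDeriv_mem_orderGE_excess μ (hω _)

/-- In the small algebra there are at most as many derivatives as fields. -/
theorem smallAlgebra_le_orderGE {ω : LocalForm K n deg} (h : ω ∈ smallAlgebra K deg) :
    ω ∈ FormsIn (orderGE (fun v => -excess (fun _ => True) v) 0) := by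
  classical
  induction h using Algebra.adjoin_induction with
  | mem x hx =>
    rcases hx with (⟨μ, rfl⟩ | ⟨a, rfl⟩) | ⟨a, rfl⟩
    · exact tmul_mem_formsIn _ (one_mem_orderGE _)
    · intro f
      rw [compAt_fieldForm]
      refine Submodule.sum_mem _ fun T _ => Submodule.smul_mem _ _
        (jetVar_mem_orderGE fun hT => ?_)
      simp [excess]
    · intro f
      rw [compAt_extD_fieldForm]
      refine Submodule.sum_mem _ fun T _ => Submodule.smul_mem _ _
        (jetVar_mem_orderGE fun hT => ?_)
      simp [excess]
  | algebraMap r =>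
    rw [Algebra.algebraMap_eq_smul_one]
    exact Submodule.smul_mem _ _ (tmul_mem_formsIn _ (one_mem_orderGE _))
  | add x y _ _ hx hy => exact Submodule.add_mem _ hx hy
  | mul x y _ _ hx hy =>
    refine mul_mem_formsIn (fun x hx y hy => ?_) hx hy
    have := mul_mem_orderGE hx hy
    rwa [add_zero] at this

theorem exists_mem_orderGE_neg (u : JetVar n deg → ℕ) (ω : LocalForm K n deg) :
    ∃ m : ℕ, ω ∈ FormsIn (orderGE (fun v => -(u v : ℤ)) (-m)) := by
  obtain ⟨m, hm⟩ := exists_sum_weightProj u ω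
  refine ⟨m, ?_⟩
  rw [← hm m le_rfl]
  refine Submodule.sum_mem _ fun k hk f => ?_
  rw [compAt_weightProj]
  have := Finset.mem_range.mp hk
  exact orderGE_mono (by omega) (mem_orderGE_neg_of_isWeightedHomogeneous
    (weightedHomogeneousComponent_isWeightedHomogeneous _ _))

/-- Reduction of the invariant cohomology to forms without a part of top degree. -/
theorem invariantCohomologyInSmallAlgebra_of [CharZero K] {I : Subalgebra K (JetPoly K n deg)}
    (h₁ : ∀ P ∈ FormsIn (Subalgebra.toSubmodule I), P ∈ belowTop K n _ → extD K deg P = 0 →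
      ∃ Q ∈ FormsIn (Subalgebra.toSubmodule I), ∃ R ∈ FormsIn (Subalgebra.toSubmodule I),
        Q ∈ smallAlgebra K deg ∧ P = Q + extD K deg R)
    (h₂ : ∀ S ∈ FormsIn (Subalgebra.toSubmodule I), S ∈ belowTop K n _ →
      extD K deg S ∈ FormsIn (Subalgebra.toSubmodule I) →
      extD K deg S ∈ smallAlgebra K deg → extD K deg S ∈ belowTop K n _ →
      ∃ S' ∈ FormsIn (Subalgebra.toSubmodule I), S' ∈ smallAlgebra K deg ∧
        extD K deg S = extD K deg S') :
    InvariantCohomologyInSmallAlgebra K deg I := by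
  refine ⟨fun P hP hb => ⟨fun hd => ?_, ?_⟩, ?_⟩
  · rw [mem_formsBelowTop_iff] at hb
    obtain ⟨Q, hQ, R, hR, hQA, e⟩ := h₁ P hP hb hd
    have hdQ : extD K deg Q = 0 := by
      rw [e, map_add, extD_extD, add_zero] at hd
      exact hd
    have hdQ' : extD K deg (Q - formProj _ n Q) = 0 := by
      rw [map_sub, hdQ, extD_eq_koszulD, ← formProj_succ_koszulD, ← extD_eq_koszulD, hdQ, map_zero,
        sub_zero]
    refine ⟨Q - formProj _ n Q, Submodule.sub_mem _ hQ (formProj_mem_formsIn n hQ), ?_⟩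
    cases n with
    | zero =>
      refine ⟨0, zero_mem _, sub_mem hQA (formProj_mem_smallAlgebra _ hQA),
        mem_formsBelowTop_iff.mpr (formProj_sub_self _ _), hdQ', ?_⟩
      rw [map_zero, add_zero, formProj_zero_of_belowTop hb, eq_comm]
      exact formProj_zero_of_belowTop (formProj_sub_self _ _)
    | succ m =>
      refine ⟨R - formProj _ m R, Submodule.sub_mem _ hR (formProj_mem_formsIn m hR),
        sub_mem hQA (formProj_mem_smallAlgebra _ hQA),
        mem_formsBelowTop_iff.mpr (formProj_sub_self _ _), hdQ', ?_⟩
      have h := mem_belowTop.mp hb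
      rw [e, map_add, extD_eq_koszulD, formProj_succ_koszulD] at h
      rw [map_sub, e, extD_eq_koszulD, extD_eq_koszulD]
      rw [sub_add_sub_comm, h, sub_zero]
  · rintro ⟨Q, -, R, -, -, -, hdQ, rfl⟩
    rw [map_add, hdQ, extD_extD, add_zero]
  · rintro Q hQ hQA hQb ⟨S, hS, rfl⟩
    rw [mem_formsBelowTop_iff] at hQb
    cases n with
    | zero => exact ⟨0, zero_mem _, zero_mem _, by
        rw [map_zero, formProj_zero_of_belowTop hQb]⟩
    | succ m =>
      set S₁ := (S - formProj _ m S) - formProj _ (m + 1) (S - formProj _ m S) with hS₁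
      have hS₁I : S₁ ∈ FormsIn (Subalgebra.toSubmodule I) :=
        Submodule.sub_mem _ (Submodule.sub_mem _ hS (formProj_mem_formsIn _ hS))
          (formProj_mem_formsIn _ (Submodule.sub_mem _ hS (formProj_mem_formsIn _ hS)))
      have htop : ∀ ω : LocalForm K (m + 1) deg, formProj _ (m + 1 + 1) ω = 0 := by
        intro ω
        refine form_ext fun f => ?_
        rw [formProj, compAt_map, map_zero]
        have : f ∘ₗ degProj (m + 1 + 1) = 0 :=
          LinearMap.ext fun x => by
            rw [LinearMap.comp_apply, degProj_eq_zero (by omega), map_zero, LinearMap.zero_apply]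
        rw [this, compAt, LinearMap.rTensor_zero, LinearMap.comp_zero, LinearMap.zero_apply,
          LinearMap.id_apply]
      have e : extD K deg S₁ = extD K deg S := by
        rw [hS₁, map_sub, map_sub, extD_eq_koszulD (formProj _ m S), ← formProj_succ_koszulD,
          extD_eq_koszulD (formProj _ (m + 1) _), ← formProj_succ_koszulD, htop, sub_zero,
          ← extD_eq_koszulD, mem_belowTop.mp hQb, sub_zero]
      obtain ⟨S', hS', hS'A, e'⟩ := h₂ S₁ hS₁I (formProj_sub_self _ _) (by rw [e]; exact hQ)
        (by rwa [e]) (by rwa [e])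
      exact ⟨S', hS', hS'A, by rw [← e', e]⟩

end SmallAlgebra

/-! ### The invariant cohomology of covariant curvatures -/

namespace CovariantCurvatures

open MvPolynomial

variable {K : Type*} [Field K] {n : ℕ} {ι : Type*} {deg : ι → ℕ} [Fintype ι]
  {E : Type*} {G : FieldRotations K n deg (fun _ => FieldKind.closed) E}
  (C : CovariantCurvatures G)

theorem mem_abelianSpan_pow {k : ℕ} {x : JetPoly K n deg} (hx : x ∈ abelianPart G k) :
    x ∈ abelianSpan K n deg ^ k := by
  have h := weightedHomogeneousComponent_mem_abelianSpan_pow hx.1.1 k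
  rwa [weightedHomogeneousComponent_eq_self hx.1.2] at h

theorem covariantize_mem_invariants {k : ℕ} {x : JetPoly K n deg} (hx : x ∈ abelianPart G k) :
    C.covariantize x ∈ G.invariants := fun ε => by
  rw [C.act_covariantize, hx.2 ε, map_zero]

theorem totalDeriv_mem_invariants (μ : Fin n) {x : JetPoly K n deg} (hx : x ∈ G.invariants) :
    totalDeriv K deg μ x ∈ G.invariants := fun ε => by
  rw [G.act_totalDeriv, hx ε, map_zero]

variable [CharZero K]

theorem formMap_covariantize_mem {ω : LocalForm K n deg}
    (h : ω ∈ closedAlgebra K n deg fun _ => FieldKind.closed) :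
    formMap C.covariantize ω ∈ smallAlgebra K deg := by
  have hle : closedAlgebra K n deg (fun _ => FieldKind.closed) ≤
      (smallAlgebra K deg).comap (formMap C.covariantize) := by
    refine Algebra.adjoin_le ?_
    rintro _ (⟨μ, rfl⟩ | ⟨a, -, rfl⟩)
    · change formMap C.covariantize _ ∈ smallAlgebra K deg
      rw [formMap_tmul, map_one]
      exact dx_mem_smallAlgebra μ
    · change formMap C.covariantize _ ∈ smallAlgebra K deg
      have e : formMap C.covariantize (extD K deg (fieldForm K deg a)) = C.curv a :=
        form_ext fun f => by rw [compAt_formMap, C.covariantize_compAt_extD]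
      rw [e]
      exact C.curv_mem a
  exact hle h

/-- An invariant form below top degree, with coefficients polynomials in the covariant curvatures,
whose differential lies in the small algebra, is the sum of an invariant form in the small algebra
and the differential of an invariant form. The leading part, in the number of curvatures, is treated
by the result on abelian curvatures, and subtracting the covariantization of its representative
increases the number of curvatures, which is bounded by the weight. -/
theorem exists_small_representative (hdeg : ∀ a, 1 ≤ deg a) (w : ℕ) (j : ℕ) :
    ∀ k : ℕ, w + 1 ≤ k + j → ∀ P : LocalForm K n deg, P ∈ FormsIn (C.filt k) →
      P ∈ FormsIn G.invariants → P ∈ belowTop K n _ →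
      P ∈ FormsIn (orderGE (fun v => -(totalWeight v : ℤ)) (-w)) →
      extD K deg P ∈ smallAlgebra K deg →
      ∃ Q ∈ FormsIn (Subalgebra.toSubmodule C.alg ⊓ G.invariants),
        ∃ R ∈ FormsIn (Subalgebra.toSubmodule C.alg ⊓ G.invariants),
          Q ∈ smallAlgebra K deg ∧ P = Q + extD K deg R := by
  induction j with
  | zero =>
    intro k hk P hP _ _ hPw _
    have hP0 : P = 0 := by
      refine form_ext fun f => ?_
      rw [map_zero]
      refine eq_zero_of_mem_orderGE (fun v => ?_) ?_ (C.filt_le_orderGE k (hP f)) (hPw f)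
      · have := hdeg v.1.1
        simp only [jetWeight]
        push_cast
        omega
      · omega
    exact ⟨0, zero_mem _, 0, zero_mem _, zero_mem _, by rw [hP0, map_zero, add_zero]⟩
  | succ j ih =>
    intro k hk P hP hPinv hPb hPw hdP
    set P₀ := weightProj fieldCount k P with hP₀
    have hP₀mem : P₀ ∈ FormsIn (abelianPart G k) := by
      intro f
      rw [hP₀, compAt_weightProj]
      refine ⟨⟨abelianSpan_pow_le k (C.filt_lead k _ (hP f)).1,
        weightedHomogeneousComponent_isWeightedHomogeneous _ _⟩, fun ε => ?_⟩
      rw [← G.weightedHomogeneousComponent_act (fun _ _ _ => rfl), hPinv f ε, map_zero]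
    have hP₀w : P₀ ∈ FormsIn (orderGE (fun v => -(totalWeight v : ℤ)) (-w)) := by
      intro f
      rw [hP₀, compAt_weightProj]
      exact weightedHomogeneousComponent_mem_orderGE (hPw f) _ _
    -- the differential of the leading part has too many derivatives for the small algebra
    have hdP₀ : extD K deg P₀ = 0 := by
      refine form_ext fun f => ?_
      rw [map_zero]
      have e := weightProj_extD (K := K) (n := n) (deg := deg) (fun _ => 1) 0 k P
      refine eq_zero_of_mem_orderGE (m := 0 + 1) (m' := 0)
        (u := excess fun _ => True)
        (u' := fun v => -excess (fun _ => True) v) (fun v => by simp [excess]) (by norm_num)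
        (extD_mem_orderGE_excess (fun f => abelianInv_le_orderGE (by simp) (hP₀mem f).1.1) f) ?_
      rw [hP₀, ← e, compAt_weightProj]
      exact weightedHomogeneousComponent_mem_orderGE (smallAlgebra_le_orderGE hdP f) _ _
    obtain ⟨Q, hQ, R, hR, hQA, hQb, hQw, hRw, hRt, e⟩ := exists_abelian_representative_of_weight G hdeg
      hP₀mem (map_id_mem_belowTop _ hPb) hdP₀ hP₀w
    have hcov : ∀ ω : LocalForm K n deg, ω ∈ FormsIn (abelianPart G k) →
        formMap C.covariantize ω ∈ FormsIn (C.filt k) ∧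
          formMap C.covariantize ω ∈ FormsIn G.invariants := by
      intro ω hω
      refine ⟨fun f => ?_, fun f => ?_⟩ <;> rw [compAt_formMap]
      · exact C.covariantize_mem_filt (mem_abelianSpan_pow (hω f))
      · exact C.covariantize_mem_invariants (hω f)
    have hweight : ∀ (m : ℤ) (ω : LocalForm K n deg),
        ω ∈ FormsIn (orderGE (fun v => -(totalWeight v : ℤ)) m) →
        formMap C.covariantize ω ∈ FormsIn (orderGE (fun v => -(totalWeight v : ℤ)) m) := by
      intro m ω hω f
      rw [compAt_formMap]
      exact C.covariantize_mem_weight (hω f)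
    set Q' := formMap C.covariantize Q
    set R' := formMap C.covariantize R
    have hdR'inv : extD K deg R' ∈ FormsIn G.invariants :=
      extD_mem_formsIn (fun μ x hx => totalDeriv_mem_invariants μ hx) (hcov R hR).2
    have hdR : ∀ f, C.covariantize (compAt _ f (extD K deg R)) - compAt _ f (extD K deg R') ∈
        C.filt (k + 1) := by
      intro f
      rw [compAt_extD, compAt_extD, map_sum, ← sum_sub_distrib]
      refine Submodule.sum_mem _ fun μ _ => ?_
      have h1 := C.covariantize_totalDeriv_sub_mem (mem_abelianSpan_pow
        (hR (f ∘ₗ LinearMap.mulLeft K (dx K μ)))) μ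
      rw [C.cov_invariant μ _ (C.filt_le_alg k (C.covariantize_mem_filt (mem_abelianSpan_pow
        (hR (f ∘ₗ LinearMap.mulLeft K (dx K μ))))))
        (C.covariantize_mem_invariants (hR (f ∘ₗ LinearMap.mulLeft K (dx K μ))))] at h1
      rwa [compAt_formMap]
    have hnext : P - Q' - extD K deg R' ∈ FormsIn (C.filt (k + 1)) := by
      intro f
      have h1 := (C.filt_lead k _ (hP f)).2
      have h2 := hdR f
      rw [← compAt_weightProj, ← hP₀, e, map_add, map_add] at h1
      have h3 := Submodule.add_mem _ h1 h2
      convert h3 using 1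
      rw [map_sub, map_sub, compAt_formMap]
      ring
    have hnextw : P - Q' - extD K deg R' ∈
        FormsIn (orderGE (fun v => -(totalWeight v : ℤ)) (-w)) := by
      refine Submodule.sub_mem _ (Submodule.sub_mem _ hPw (hweight _ Q hQw)) fun f => ?_
      rw [compAt_extD]
      refine Submodule.sum_mem _ fun μ _ => ?_
      have h1 := derivation_mem_orderGE (D := totalDeriv K deg μ) (e := -1) (fun v => ?_)
        (hweight _ R hRw (f ∘ₗ LinearMap.mulLeft K (dx K μ)))
      · rwa [add_neg_cancel_right] at h1
      · rw [totalDeriv_X]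
        refine X_mem_orderGE ?_
        simp [jetWeight]
        omega
    have hnextb : P - Q' - extD K deg R' ∈ belowTop K n _ := by
      rw [mem_belowTop, map_sub, map_sub, mem_belowTop.mp hPb, formProj_formMap,
        mem_belowTop.mp hQb, map_zero, sub_zero, zero_sub, neg_eq_zero]
      cases n with
      | zero => rw [extD_eq_koszulD, formProj_zero_koszulD]
      | succ m =>
        rw [extD_eq_koszulD, formProj_succ_koszulD, formProj_formMap, hRt m rfl, map_zero, map_zero]
    have hdnext : extD K deg (P - Q' - extD K deg R') ∈ smallAlgebra K deg := by
      rw [map_sub, map_sub, extD_extD, sub_zero]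
      exact sub_mem hdP (extD_mem_smallAlgebra (C.formMap_covariantize_mem hQA))
    obtain ⟨Q₁, hQ₁, R₁, hR₁, hQ₁A, e₁⟩ := ih (k + 1) (by omega) _ hnext
      (Submodule.sub_mem _ (Submodule.sub_mem _ hPinv (hcov Q hQ).2) hdR'inv) hnextb hnextw hdnext
    have hmem : ∀ ω : LocalForm K n deg, ω ∈ FormsIn (abelianPart G k) →
        formMap C.covariantize ω ∈ FormsIn (Subalgebra.toSubmodule C.alg ⊓ G.invariants) :=
      fun ω hω f => ⟨C.filt_le_alg k ((hcov ω hω).1 f), (hcov ω hω).2 f⟩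
    refine ⟨Q' + Q₁, Submodule.add_mem _ (hmem Q hQ) hQ₁, R' + R₁,
      Submodule.add_mem _ (hmem R hR) hR₁, add_mem (C.formMap_covariantize_mem hQA) hQ₁A, ?_⟩
    rw [map_add]
    have : P = (P - Q' - extD K deg R') + Q' + extD K deg R' := by abel
    rw [this, e₁]
    abel

/-- The invariant cohomology of a system of covariant curvatures. -/
theorem invariantCohomology (hdeg : ∀ a, 1 ≤ deg a) {I : Subalgebra K (JetPoly K n deg)}
    (hI : ∀ x, x ∈ I ↔ x ∈ C.alg ∧ x ∈ G.invariants) :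
    InvariantCohomologyInSmallAlgebra K deg I := by
  have hIeq : Subalgebra.toSubmodule I = Subalgebra.toSubmodule C.alg ⊓ G.invariants :=
    Submodule.ext hI
  have key : ∀ P ∈ FormsIn (Subalgebra.toSubmodule I), P ∈ belowTop K n _ →
      extD K deg P ∈ smallAlgebra K deg →
      ∃ Q ∈ FormsIn (Subalgebra.toSubmodule I), ∃ R ∈ FormsIn (Subalgebra.toSubmodule I),
        Q ∈ smallAlgebra K deg ∧ P = Q + extD K deg R := by
    intro P hP hb hd
    obtain ⟨w, hw⟩ := exists_mem_orderGE_neg totalWeight P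
    rw [hIeq] at hP ⊢
    refine C.exists_small_representative hdeg w (w + 1) 0 (by omega) P ?_ (fun f => (hP f).2) hb
      hw hd
    rw [C.filt_zero]
    exact fun f => (hP f).1
  refine invariantCohomologyInSmallAlgebra_of (fun P hP hb hd => key P hP hb ?_)
    fun S hS hb _ hdA _ => ?_
  · rw [hd]; exact zero_mem _
  · obtain ⟨Q, hQ, R, hR, hQA, rfl⟩ := key S hS hb hdA
    exact ⟨Q, hQ, hQA, by rw [map_add, extD_extD, add_zero]⟩

end CovariantCurvatures

/-! ### The model `F = dA`, `H = dB + F^r A` -/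

section Homogeneous

open MvPolynomial

variable {K : Type*} [Field K] {n : ℕ} {ι : Type*} {deg : ι → ℕ}

theorem formProj_mul_of_eq {k l : ℕ} {x y : LocalForm K n deg} (hx : formProj _ k x = x)
    (hy : formProj _ l y = y) : formProj _ (k + l) (x * y) = x * y := by
  classical
  rw [formProj_mul, sum_eq_single (k, l), hx, hy]
  · rintro ⟨i, j⟩ _ hij
    rw [formProj_one_form i x hx, formProj_one_form j y hy]
    by_cases hi : k = i
    · rw [if_neg (c := l = j) fun hj => hij (by rw [hi, hj]), mul_zero]
    · rw [if_neg hi, zero_mul]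
  · exact fun h => absurd (Finset.HasAntidiagonal.mem_antidiagonal.mpr (rfl : k + l = k + l)) h

theorem formProj_pow_of_eq {k : ℕ} {x : LocalForm K n deg} (hx : formProj _ k x = x) (r : ℕ) :
    formProj _ (k * r) (x ^ r) = x ^ r := by
  induction r with
  | zero => rw [mul_zero, pow_zero, formProj_one, if_pos rfl]
  | succ r ih => rw [mul_add, mul_one, pow_succ]; exact formProj_mul_of_eq ih hx

theorem formProj_extD_of_eq {k : ℕ} {x : LocalForm K n deg} (hx : formProj _ k x = x) :
    formProj _ (k + 1) (extD K deg x) = extD K deg x := by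
  rw [extD_eq_koszulD, formProj_succ_koszulD, hx]

theorem mul_mem_homogeneous {w : JetVar n deg → ℕ} {k l : ℕ} {x y : LocalForm K n deg}
    (hx : x ∈ FormsIn (weightedHomogeneousSubmodule K w k))
    (hy : y ∈ FormsIn (weightedHomogeneousSubmodule K w l)) :
    x * y ∈ FormsIn (weightedHomogeneousSubmodule K w (k + l)) :=
  mul_mem_formsIn (fun _ hp _ hq => IsWeightedHomogeneous.mul hp hq) hx hy

theorem pow_mem_homogeneous {w : JetVar n deg → ℕ} {k : ℕ} {x : LocalForm K n deg}
    (hx : x ∈ FormsIn (weightedHomogeneousSubmodule K w k)) (r : ℕ) :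
    x ^ r ∈ FormsIn (weightedHomogeneousSubmodule K w (k * r)) := by
  induction r with
  | zero =>
    rw [pow_zero, mul_zero]
    exact tmul_mem_formsIn _ (isWeightedHomogeneous_one K _)
  | succ r ih => rw [pow_succ, mul_add, mul_one]; exact mul_mem_homogeneous ih hx

theorem extD_pow_eq_zero {k : ℕ} {x : LocalForm K n deg} (hx : formProj _ k x = x)
    (hd : extD K deg x = 0) (r : ℕ) : extD K deg (x ^ r) = 0 := by
  induction r with
  | zero => rw [pow_zero, extD_one]
  | succ r ih => rw [pow_succ, extD_mul (formProj_pow_of_eq hx r), ih, hd, zero_mul, mul_zero,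
      smul_zero, add_zero]

theorem mem_formsIn_of_compAt_curv {cov : Fin n → Derivation K (JetPoly K n deg) (JetPoly K n deg)}
    {curv : ι → LocalForm K n deg} (a : ι) :
    curv a ∈ FormsIn (Submodule.span K (covGens cov curv)) := fun f =>
  Submodule.subset_span ⟨a, f, [], rfl⟩

theorem mem_formsSubalgebra_of_span {s : Set (JetPoly K n deg)} {x : LocalForm K n deg}
    (hx : x ∈ FormsIn (Submodule.span K s)) : x ∈ formsSubalgebra (Algebra.adjoin K s) :=
  formsIn_mono (Submodule.span_le.mpr Algebra.subset_adjoin) hx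

/-- The exterior product of two curvatures with a polynomial in curvatures. -/
theorem mul_mul_mem_covFiltration
    {cov : Fin n → Derivation K (JetPoly K n deg) (JetPoly K n deg)} {curv : ι → LocalForm K n deg}
    {x y z : LocalForm K n deg} (hx : x ∈ FormsIn (Submodule.span K (covGens cov curv)))
    (hy : y ∈ FormsIn (Submodule.span K (covGens cov curv)))
    (hz : z ∈ formsSubalgebra (Algebra.adjoin K (covGens cov curv))) :
    x * y * z ∈ FormsIn (covFiltration cov curv 2) := by
  refine mul_mem_formsIn (fun p hp q hq => Submodule.mul_mem_mul hp hq) ?_ hz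
  rw [pow_two]
  exact mul_mem_formsIn (fun p hp q hq => Submodule.mul_mem_mul hp hq) hx hy

end Homogeneous

section Model2

open MvPolynomial

variable (K : Type*) [Field K] (n r : ℕ)

/-- The empty family of rotations, which imposes no condition of invariance. -/
def noRotations {K : Type*} [Field K] {n : ℕ} {ι : Type*} [Fintype ι] {deg : ι → ℕ}
    {kind : ι → FieldKind} : FieldRotations K n deg kind Empty where
  act := Empty.elim
  coeff := Empty.elim
  act_jetVar ε := ε.elim
  deg_eq ε := ε.elim
  kind_eq ε := ε.elim

theorem formProj_F2 : formProj _ 2 (F2 K n r) = F2 K n r := formProj_extD_fieldForm (0 : Fin 2)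

theorem formProj_F2_pow_mul : formProj _ (2 * r + 1) (F2 K n r ^ r * fieldForm K (deg2 r) 0) =
    F2 K n r ^ r * fieldForm K (deg2 r) 0 :=
  formProj_mul_of_eq (formProj_pow_of_eq (formProj_F2 K n r) r) (formProj_fieldForm (0 : Fin 2))

theorem F2_pow_mul_mem_homogeneous (u : Fin 2 → ℕ) (e : ℕ) :
    F2 K n r ^ r * fieldForm K (deg2 r) 0 ∈
      FormsIn (weightedHomogeneousSubmodule K (jetWeight u e) ((u 0 + e) * r + u 0)) :=
  mul_mem_homogeneous (pow_mem_homogeneous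
    (extD_mem_homogeneous (fieldForm_mem_homogeneous u e 0)) r) (fieldForm_mem_homogeneous u e 0)

variable [CharZero K]

theorem extD_H2 : extD K (deg2 r) (H2 K n r) = F2 K n r ^ r * F2 K n r := by
  have hF : extD K (deg2 r) (F2 K n r) = 0 := extD_extD _
  rw [H2, map_add, extD_extD, zero_add, extD_mul (formProj_pow_of_eq (formProj_F2 K n r) r),
    extD_pow_eq_zero (formProj_F2 K n r) hF, zero_mul, zero_add, pow_mul, neg_one_sq, one_pow,
    one_smul]
  rfl

/-- The curvatures of the second model, with the total derivatives as covariant derivatives. -/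
def covariantCurvatures2 (hr : 1 ≤ r) :
    CovariantCurvatures (noRotations (K := K) (n := n) (deg := deg2 r)) where
  cov := totalDeriv K (deg2 r)
  curv := ![F2 K n r, H2 K n r]
  formProj_curv := by
    rw [Fin.forall_fin_two]
    refine ⟨formProj_F2 K n r, ?_⟩
    change formProj _ (2 * r + 1) (H2 K n r) = H2 K n r
    rw [H2, map_add, formProj_F2_pow_mul]
    congr 1
    exact formProj_extD_fieldForm (1 : Fin 2)
  curv_mem := by
    rw [Fin.forall_fin_two]
    refine ⟨extD_fieldForm_mem_smallAlgebra _, add_mem (extD_fieldForm_mem_smallAlgebra _)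
      (mul_mem (pow_mem (extD_fieldForm_mem_smallAlgebra _) r) (fieldForm_mem_smallAlgebra _))⟩
  curv_lead := by
    rw [Fin.forall_fin_two]
    refine ⟨fun f => ?_, fun f => ?_⟩
    · change compAt _ f (extD _ _ _) - _ ∈ _
      rw [sub_self]
      exact zero_mem _
    · change compAt _ f (H2 K n r) - _ ∈ _
      rw [H2, map_add, add_sub_cancel_left]
      refine orderGE_mono ?_ (mem_orderGE_of_isWeightedHomogeneous
        (F2_pow_mul_mem_homogeneous K n r (fun _ => 1) 0 f))
      push_cast
      omega
  curv_weight := by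
    rw [Fin.forall_fin_two]
    refine ⟨fun f => ?_, fun f => ?_⟩
    · refine orderGE_mono ?_ (mem_orderGE_neg_of_isWeightedHomogeneous
        (extD_mem_homogeneous (fieldForm_mem_homogeneous (deg2 r) 1 0) f))
      push_cast
    · change compAt _ f (H2 K n r) ∈ _
      rw [H2, map_add]
      refine Submodule.add_mem _ (orderGE_mono ?_ (mem_orderGE_neg_of_isWeightedHomogeneous
        (extD_mem_homogeneous (fieldForm_mem_homogeneous (deg2 r) 1 1) f)))
        (orderGE_mono ?_ (mem_orderGE_neg_of_isWeightedHomogeneous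
        (F2_pow_mul_mem_homogeneous K n r (deg2 r) 1 f)))
      · simp
      · simp
  cov_lead μ v := by rw [sub_self]; exact zero_mem _
  cov_weight μ v := by
    rw [totalDeriv_X]
    refine X_mem_orderGE ?_
    simp [jetWeight]
    omega
  bianchi := by
    rw [Fin.forall_fin_two]
    refine ⟨fun f => ?_, fun f => ?_⟩
    · rw [← compAt_extD]
      change compAt _ f (extD _ _ (extD _ _ _)) ∈ _
      rw [extD_extD, map_zero]
      exact zero_mem _
    · rw [← compAt_extD]
      change compAt _ f (extD _ _ (H2 K n r)) ∈ _
      obtain ⟨s, rfl⟩ := Nat.exists_eq_add_of_le' hr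
      rw [extD_H2, ← pow_succ, pow_succ', pow_succ', ← mul_assoc]
      have hF := mem_formsIn_of_compAt_curv (cov := totalDeriv K (deg2 (s + 1)))
        (curv := ![F2 K n (s + 1), H2 K n (s + 1)]) 0
      exact mul_mul_mem_covFiltration hF hF
        (pow_mem (mem_formsSubalgebra_of_span hF) s) f
  cov_comm μ ν x _ := by rw [totalDeriv_comm, sub_self]; exact zero_mem _
  cov_invariant _ _ _ _ := rfl
  act_curv ε := ε.elim
  act_cov ε := ε.elim

/-- The curvatures of a one-form `A` and a `2r`-form `B` with `H = dB + F^r A` are covariant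
curvatures, without rotations. -/
theorem invariantCohomology_inv2 (hr : 1 ≤ r) :
    InvariantCohomologyInSmallAlgebra K (deg2 r) (inv2 K n r) := by
  refine (covariantCurvatures2 K n r hr).invariantCohomology ?_ fun x => ?_
  · rw [Fin.forall_fin_two]
    exact ⟨le_rfl, show 1 ≤ 2 * r by omega⟩
  · have h : inv2 K n r = (covariantCurvatures2 K n r hr).alg := by
      refine congrArg (Algebra.adjoin K) (Set.ext fun x => ⟨?_, ?_⟩)
      · rintro ⟨H, (rfl | rfl), f, l, rfl⟩
        exacts [⟨0, f, l, rfl⟩, ⟨1, f, l, rfl⟩]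
      · rintro ⟨a, f, l, rfl⟩
        refine ⟨_, ?_, f, l, rfl⟩
        revert a
        rw [Fin.forall_fin_two]
        exact ⟨Or.inl rfl, Or.inr rfl⟩
    rw [h]
    exact ⟨fun hx => ⟨hx, fun ε => ε.elim⟩, fun hx => hx.1⟩

end Model2

/-! ### Linear algebra of `su N` -/

section SpecialUnitary

open Complex

variable {N : ℕ} {κ : Type*}

theorem su.comm_coe (X Y : su N) :
    (su.comm X Y : Matrix (Fin N) (Fin N) ℂ) = X.1 * Y.1 - Y.1 * X.1 := rfl

/-- The commutator with a fixed element as a linear map. -/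
def su.commRight (ε : su N) : su N →ₗ[ℝ] su N where
  toFun X := su.comm X ε
  map_add' X Y := Subtype.ext <| by
    simp only [su.comm_coe, Submodule.coe_add, add_mul, mul_add]
    abel
  map_smul' r X := Subtype.ext <| by
    simp only [su.comm_coe, Submodule.coe_smul, smul_mul_assoc, mul_smul_comm, smul_sub,
      RingHom.id_apply]

theorem su.comm_antisymm (X Y : su N) : su.comm X Y = -su.comm Y X :=
  Subtype.ext <| by simp only [su.comm_coe, Submodule.coe_neg, neg_sub]

theorem su.jacobi (X Y Z : su N) :
    su.comm (su.comm X Y) Z - su.comm (su.comm X Z) Y = su.comm X (su.comm Y Z) :=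
  Subtype.ext <| by
    simp only [su.comm_coe, Submodule.coe_sub]
    noncomm_ring

variable (T : Module.Basis κ ℝ (su N))

/-- The matrix of the commutator with `ε` in the basis `T`. -/
def lieMatrix (ε : su N) (a c : κ) : ℂ := ((T.repr (su.comm (T c) ε) a : ℝ) : ℂ)

theorem lieMatrix_antisymm (a c e : κ) : lieMatrix T (T e) a c = -lieMatrix T (T c) a e := by
  rw [lieMatrix, lieMatrix, su.comm_antisymm, map_neg, Finsupp.neg_apply]
  push_cast
  rfl

variable [Fintype κ]

/-- The anti-Hermitian matrices form a real form of the complex matrices, hence a real basis is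
linearly independent over the complex numbers. -/
theorem linearIndependent_su : LinearIndependent ℂ fun a => (T a : Matrix (Fin N) (Fin N) ℂ) := by
  rw [Fintype.linearIndependent_iff]
  intro g hg
  set X : su N := ∑ a, (g a).re • T a with hX
  set Y : su N := ∑ a, (g a).im • T a with hY
  have e1 : X.1 + I • Y.1 = 0 := by
    rw [← hg, hX, hY, Submodule.coe_sum, Submodule.coe_sum, smul_sum,
      ← sum_add_distrib]
    refine sum_congr rfl fun a _ => ?_
    ext i j
    simp only [Submodule.coe_smul, Matrix.add_apply, Matrix.smul_apply, real_smul, smul_eq_mul]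
    conv_rhs => rw [← re_add_im (g a)]
    ring
  have e2 : -X.1 + I • Y.1 = 0 := by
    have h := congrArg Matrix.conjTranspose e1
    rw [Matrix.conjTranspose_add, Matrix.conjTranspose_smul, X.2.1, Y.2.1,
      Matrix.conjTranspose_zero] at h
    simpa using h
  have hX0 : X = 0 := by
    have h : (2 : ℂ) • X.1 = 0 := by
      rw [two_smul]
      calc X.1 + X.1 = (X.1 + I • Y.1) - (-X.1 + I • Y.1) := by abel
        _ = 0 := by rw [e1, e2, sub_zero]
    exact Subtype.ext ((smul_eq_zero.mp h).resolve_left two_ne_zero)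
  have hY0 : Y = 0 := by
    rw [hX0] at e1
    have h : I • Y.1 = 0 := by simpa using e1
    exact Subtype.ext ((smul_eq_zero.mp h).resolve_left I_ne_zero)
  intro a
  have hre := Fintype.linearIndependent_iff.mp T.linearIndependent _ (hX.symm.trans hX0) a
  have him := Fintype.linearIndependent_iff.mp T.linearIndependent _ (hY.symm.trans hY0) a
  exact Complex.ext hre him

/-- The matrix `∑ₐ vₐ T_a` with entries in a complex vector space. -/
def basisMatrix {M : Type*} [AddCommGroup M] [Module ℂ M] (v : κ → M) :
    Matrix (Fin N) (Fin N) M :=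
  Matrix.of fun i j => ∑ a, (T a : Matrix (Fin N) (Fin N) ℂ) i j • v a

theorem basisMatrix_apply {M : Type*} [AddCommGroup M] [Module ℂ M] (v : κ → M) (i j : Fin N) :
    basisMatrix T v i j = ∑ a, (T a : Matrix (Fin N) (Fin N) ℂ) i j • v a := rfl

open Classical in
theorem exists_dual_coeffs : ∃ c : κ → Fin N → Fin N → ℂ, ∀ a b,
    ∑ i, ∑ j, c a i j * (T b : Matrix (Fin N) (Fin N) ℂ) i j = if a = b then 1 else 0 := by
  obtain ⟨g, hg⟩ := LinearMap.exists_leftInverse_of_injective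
    (Fintype.linearCombination ℂ fun a => (T a : Matrix (Fin N) (Fin N) ℂ))
    (LinearMap.ker_eq_bot.mpr (linearIndependent_su T).fintypeLinearCombination_injective)
  refine ⟨fun a i j => g (Matrix.single i j 1) a, fun a b => ?_⟩
  have h := congrFun (LinearMap.congr_fun hg (Pi.single b 1)) a
  rw [LinearMap.comp_apply, Fintype.linearCombination_apply_single, one_smul, LinearMap.id_apply,
    Pi.single_apply] at h
  rw [Matrix.matrix_eq_sum_single (T b).1] at h
  simp only [map_sum, Finset.sum_apply] at h
  rw [← h]
  refine sum_congr rfl fun i _ => sum_congr rfl fun j _ => ?_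
  have e : Matrix.single i j ((T b).1 i j) = (T b).1 i j • Matrix.single i j (1 : ℂ) := by
    rw [Matrix.smul_single, smul_eq_mul, mul_one]
  rw [e, map_smul, Pi.smul_apply, smul_eq_mul, mul_comm]

theorem exists_coeffs_basisMatrix : ∃ c : κ → Fin N → Fin N → ℂ,
    ∀ {M : Type*} [AddCommGroup M] [Module ℂ M] (v : κ → M) (a : κ),
      ∑ i, ∑ j, c a i j • basisMatrix T v i j = v a := by
  obtain ⟨c, hc⟩ := exists_dual_coeffs T
  refine ⟨c, fun v a => ?_⟩
  classical
  simp only [basisMatrix_apply, smul_sum, smul_smul]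
  have e : ∀ i, ∑ j, ∑ b, (c a i j * (T b : Matrix (Fin N) (Fin N) ℂ) i j) • v b =
      ∑ b, ∑ j, (c a i j * (T b : Matrix (Fin N) (Fin N) ℂ) i j) • v b := fun i => sum_comm
  simp only [e]
  rw [sum_comm]
  simp only [← sum_smul, hc, ite_smul, one_smul, zero_smul, Finset.sum_ite_eq,
    Finset.mem_univ, if_true]

theorem basisMatrix_injective {M : Type*} [AddCommGroup M] [Module ℂ M] {v w : κ → M}
    (h : basisMatrix T v = basisMatrix T w) : v = w := by
  obtain ⟨c, hc⟩ := exists_coeffs_basisMatrix T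
  funext a
  rw [← hc v a, h, hc]

theorem basisMatrix_map {M M' : Type*} [AddCommGroup M] [Module ℂ M] [AddCommGroup M']
    [Module ℂ M'] (φ : M →ₗ[ℂ] M') (v : κ → M) :
    (basisMatrix T v).map φ = basisMatrix T fun a => φ (v a) := by
  ext i j
  simp only [Matrix.map_apply, basisMatrix_apply, map_sum, map_smul]

theorem basisMatrix_add {M : Type*} [AddCommGroup M] [Module ℂ M] (v w : κ → M) :
    basisMatrix T (fun a => v a + w a) = basisMatrix T v + basisMatrix T w := by
  ext i j
  simp only [basisMatrix_apply, Matrix.add_apply, smul_add, sum_add_distrib]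

theorem repr_comm (X ε : su N) (a : κ) :
    T.repr (su.comm X ε) a = ∑ c, T.repr (su.comm (T c) ε) a * T.repr X c := by
  have h : su.comm X ε = ∑ c, T.repr X c • su.comm (T c) ε := by
    conv_lhs => rw [← T.sum_repr X]
    exact (map_sum (su.commRight ε) _ _).trans
      (sum_congr rfl fun c _ => map_smul (su.commRight ε) _ _)
  rw [h, map_sum, Finsupp.finsetSum_apply]
  exact sum_congr rfl fun c _ => by
    rw [map_smul, Finsupp.smul_apply, smul_eq_mul, mul_comm]

theorem lieMatrix_mul (ε ε' : su N) (a d : κ) :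
    ∑ c, lieMatrix T ε' a c * lieMatrix T ε c d =
      ((T.repr (su.comm (su.comm (T d) ε) ε') a : ℝ) : ℂ) := by
  rw [repr_comm T (su.comm (T d) ε) ε']
  push_cast
  rfl

theorem lieMatrix_comm (ε ε' : su N) (a d : κ) :
    ∑ c, lieMatrix T ε' a c * lieMatrix T ε c d - ∑ c, lieMatrix T ε a c * lieMatrix T ε' c d =
      lieMatrix T (su.comm ε ε') a d := by
  rw [lieMatrix_mul, lieMatrix_mul, lieMatrix, ← su.jacobi]
  simp

theorem lieMatrix_eq_sum (ε : su N) (a c : κ) :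
    lieMatrix T ε a c = ∑ e, (T.repr ε e : ℂ) * lieMatrix T (T e) a c := by
  have h := repr_comm T ε (T c) a
  rw [lieMatrix, su.comm_antisymm, map_neg, Finsupp.neg_apply, h]
  push_cast
  rw [← sum_neg_distrib]
  refine sum_congr rfl fun e _ => ?_
  rw [lieMatrix, su.comm_antisymm (T c), map_neg, Finsupp.neg_apply]
  push_cast
  ring

theorem sum_lieMatrix (ε : su N) (c : κ) (i j : Fin N) :
    ∑ a, lieMatrix T ε a c * (T a : Matrix (Fin N) (Fin N) ℂ) i j =
      ((T c).1 * ε.1 - ε.1 * (T c).1) i j := by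
  rw [← su.comm_coe, ← T.sum_repr (su.comm (T c) ε), Submodule.coe_sum, Matrix.sum_apply]
  refine sum_congr rfl fun a _ => ?_
  rw [Submodule.coe_smul, Matrix.smul_apply, Complex.real_smul]
  rfl

theorem basisMatrix_lieMatrix {M : Type*} [AddCommGroup M] [Module ℂ M] (ε : su N) (v : κ → M)
    (i j : Fin N) : basisMatrix T (fun a => ∑ c, lieMatrix T ε a c • v c) i j =
      ∑ c, ((T c).1 * ε.1 - ε.1 * (T c).1) i j • v c := by
  simp only [basisMatrix_apply, smul_sum, smul_smul]
  rw [sum_comm]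
  refine sum_congr rfl fun c _ => ?_
  rw [← sum_smul, ← sum_lieMatrix]
  simp only [mul_comm]

variable {R : Type*} [Ring R] [Algebra ℂ R]

theorem basisMatrix_mul_apply (v w : κ → R) (i j : Fin N) :
    (basisMatrix T v * basisMatrix T w) i j = ∑ c, ∑ e, ((T c).1 * (T e).1) i j • (v c * w e) := by
  simp only [Matrix.mul_apply, basisMatrix_apply, Finset.sum_mul_sum, smul_mul_smul_comm,
    sum_smul]
  rw [sum_comm]
  exact sum_congr rfl fun c _ => sum_comm

/-- The commutator with a constant matrix. -/
theorem basisMatrix_comm_const (ε : su N) (v : κ → R) :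
    basisMatrix T v * ε.1.map (algebraMap ℂ R) - ε.1.map (algebraMap ℂ R) * basisMatrix T v =
      basisMatrix T fun a => ∑ c, lieMatrix T ε a c • v c := by
  ext i j
  rw [basisMatrix_lieMatrix, Matrix.sub_apply, Matrix.mul_apply, Matrix.mul_apply]
  simp only [Matrix.map_apply, basisMatrix_apply, mul_sum,
    ← Algebra.commutes, ← Algebra.smul_def, smul_smul, Matrix.sub_apply, Matrix.mul_apply, sub_smul,
    sum_sub_distrib, sum_smul]
  congr 1
  · rw [sum_comm]
    simp only [mul_comm]
  · rw [sum_comm]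

/-- The commutator of matrices whose coefficients commute. -/
theorem basisMatrix_comm {v w : κ → R} (h : ∀ c e, w e * v c = v c * w e) :
    basisMatrix T v * basisMatrix T w - basisMatrix T w * basisMatrix T v =
      basisMatrix T fun a => ∑ e, ∑ c, lieMatrix T (T e) a c • (v c * w e) := by
  ext i j
  have e1 : ∀ e, basisMatrix T (fun a => ∑ c, lieMatrix T (T e) a c • (v c * w e)) i j =
      ∑ c, ((T c).1 * (T e).1 - (T e).1 * (T c).1) i j • (v c * w e) := fun e =>
    basisMatrix_lieMatrix T (T e) (fun c => v c * w e) i j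
  have e2 : basisMatrix T (fun a => ∑ e, ∑ c, lieMatrix T (T e) a c • (v c * w e)) i j =
      ∑ e, basisMatrix T (fun a => ∑ c, lieMatrix T (T e) a c • (v c * w e)) i j := by
    simp only [basisMatrix_apply, smul_sum]
    exact sum_comm
  rw [e2, Matrix.sub_apply, basisMatrix_mul_apply, basisMatrix_mul_apply, sum_comm,
    ← sum_sub_distrib]
  refine sum_congr rfl fun e _ => ?_
  rw [e1, ← sum_sub_distrib]
  refine sum_congr rfl fun c _ => ?_
  rw [h, Matrix.sub_apply, sub_smul]

/-- The square of a matrix whose coefficients anticommute. -/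
theorem basisMatrix_sq {v : κ → R} (h : ∀ c e, v c * v e = -(v e * v c)) :
    basisMatrix T v * basisMatrix T v =
      basisMatrix T fun a => (1 / 2 : ℂ) • ∑ e, ∑ c, lieMatrix T (T e) a c • (v c * v e) := by
  ext i j
  have e2 : basisMatrix T (fun a => (1 / 2 : ℂ) •
      ∑ e, ∑ c, lieMatrix T (T e) a c • (v c * v e)) i j =
      (1 / 2 : ℂ) • ∑ e, basisMatrix T (fun a => ∑ c, lieMatrix T (T e) a c • (v c * v e)) i j := by
    simp only [basisMatrix_apply, smul_sum, smul_comm _ (1 / 2 : ℂ)]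
    exact sum_comm
  have e3 : ∑ e, ∑ c, ((T e).1 * (T c).1) i j • (v c * v e) =
      -∑ e, ∑ c, ((T c).1 * (T e).1) i j • (v c * v e) := by
    rw [sum_comm, ← sum_neg_distrib]
    refine sum_congr rfl fun e _ => ?_
    rw [← sum_neg_distrib]
    refine sum_congr rfl fun c _ => ?_
    rw [h e c, smul_neg]
  rw [e2, basisMatrix_mul_apply, sum_comm]
  simp only [basisMatrix_lieMatrix T _ (fun c => v c * v _), Matrix.sub_apply, sub_smul,
    sum_sub_distrib, e3]
  rw [sub_neg_eq_add, ← two_smul ℂ, smul_smul]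
  norm_num

end SpecialUnitary

/-! ### Gauge fields and their covariant derivatives -/

section FormDerivations

variable {K : Type*} [Field K] {n : ℕ} {ι : Type*} {deg : ι → ℕ}

/-- The action of a derivation on the coefficients of forms. -/
def formDer (D : Derivation K (JetPoly K n deg) (JetPoly K n deg)) :
    LocalForm K n deg →ₗ[K] LocalForm K n deg := TensorProduct.map LinearMap.id D.toLinearMap

theorem formDer_tmul (D : Derivation K (JetPoly K n deg) (JetPoly K n deg)) (x : ConstForm K n)
    (p : JetPoly K n deg) : formDer D (x ⊗ₜ p) = x ⊗ₜ D p := rfl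

theorem compAt_formDer (D : Derivation K (JetPoly K n deg) (JetPoly K n deg))
    (f : Module.Dual K (ConstForm K n)) (ω : LocalForm K n deg) :
    compAt _ f (formDer D ω) = D (compAt _ f ω) := by
  rw [formDer, compAt_map]
  rfl

theorem formDer_mul (D : Derivation K (JetPoly K n deg) (JetPoly K n deg))
    (ω η : LocalForm K n deg) : formDer D (ω * η) = formDer D ω * η + ω * formDer D η := by
  induction ω using TensorProduct.induction_on with
  | zero => simp
  | add ω ω' h h' => simp only [add_mul, map_add, h, h']; abel
  | tmul x p =>
    induction η using TensorProduct.induction_on with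
    | zero => simp
    | add η η' h h' => simp only [mul_add, map_add, h, h']; abel
    | tmul y q =>
      rw [Algebra.TensorProduct.tmul_mul_tmul, formDer_tmul, formDer_tmul, formDer_tmul,
        Algebra.TensorProduct.tmul_mul_tmul, Algebra.TensorProduct.tmul_mul_tmul,
        Derivation.leibniz, smul_eq_mul, smul_eq_mul, ← TensorProduct.tmul_add]
      rw [add_comm, mul_comm q]

theorem formDer_extD {D : Derivation K (JetPoly K n deg) (JetPoly K n deg)}
    (hD : ∀ μ x, D (totalDeriv K deg μ x) = totalDeriv K deg μ (D x)) (ω : LocalForm K n deg) :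
    formDer D (extD K deg ω) = extD K deg (formDer D ω) := by
  refine form_ext fun f => ?_
  rw [compAt_formDer, compAt_extD, compAt_extD, map_sum]
  exact sum_congr rfl fun μ _ => by rw [hD, compAt_formDer]

theorem formDer_one (D : Derivation K (JetPoly K n deg) (JetPoly K n deg)) :
    formDer D 1 = 0 := by
  rw [Algebra.TensorProduct.one_def, formDer_tmul, Derivation.map_one_eq_zero,
    TensorProduct.tmul_zero]

theorem dx_tmul_mul_comm (μ : Fin n) (p : JetPoly K n deg) {l : ℕ} {y : LocalForm K n deg}
    (hy : formProj _ l y = y) :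
    dx K μ ⊗ₜ[K] p * y = (-1 : K) ^ l • (y * dx K μ ⊗ₜ[K] p) := by
  rw [← hy]
  clear hy
  induction y using TensorProduct.induction_on with
  | zero => simp
  | add y y' h h' => simp only [map_add, mul_add, add_mul, h, h', smul_add]
  | tmul x q =>
    rw [formProj, TensorProduct.map_tmul, Algebra.TensorProduct.tmul_mul_tmul,
      Algebra.TensorProduct.tmul_mul_tmul, dx_mul_comm_degProj, TensorProduct.smul_tmul', mul_comm]

variable {m : Type*} [Fintype m]

theorem map_formDer_mul (D : Derivation K (JetPoly K n deg) (JetPoly K n deg))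
    (X Y : Matrix m m (LocalForm K n deg)) :
    (X * Y).map (formDer D) = X.map (formDer D) * Y + X * Y.map (formDer D) := by
  ext i j
  simp only [Matrix.map_apply, Matrix.mul_apply, Matrix.add_apply, map_sum, formDer_mul,
    sum_add_distrib]

theorem map_extD_mul {k : ℕ} {X : Matrix m m (LocalForm K n deg)}
    (hX : ∀ i j, formProj _ k (X i j) = X i j) (Y : Matrix m m (LocalForm K n deg)) :
    (X * Y).map (extD K deg) = X.map (extD K deg) * Y + (-1 : K) ^ k • (X * Y.map (extD K deg)) := by
  ext i j
  simp only [Matrix.map_apply, Matrix.mul_apply, Matrix.add_apply, Matrix.smul_apply, map_sum,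
    extD_mul (hX _ _), sum_add_distrib, smul_sum]

theorem formProj_matrix_mul {k l : ℕ} {X Y : Matrix m m (LocalForm K n deg)}
    (hX : ∀ i j, formProj _ k (X i j) = X i j) (hY : ∀ i j, formProj _ l (Y i j) = Y i j) (i j : m) :
    formProj _ (k + l) ((X * Y) i j) = (X * Y) i j := by
  rw [Matrix.mul_apply, map_sum]
  exact sum_congr rfl fun s _ => formProj_mul_of_eq (hX _ _) (hY _ _)

theorem matrix_mul_mem_homogeneous {w : JetVar n deg → ℕ} {k l : ℕ}
    {X Y : Matrix m m (LocalForm K n deg)}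
    (hX : ∀ i j, X i j ∈ FormsIn (MvPolynomial.weightedHomogeneousSubmodule K w k))
    (hY : ∀ i j, Y i j ∈ FormsIn (MvPolynomial.weightedHomogeneousSubmodule K w l)) (i j : m) :
    (X * Y) i j ∈ FormsIn (MvPolynomial.weightedHomogeneousSubmodule K w (k + l)) := by
  rw [Matrix.mul_apply]
  exact Submodule.sum_mem _ fun s _ => mul_mem_homogeneous (hX _ _) (hY _ _)

theorem trace_mem_formsIn {N : Submodule K (JetPoly K n deg)} {X : Matrix m m (LocalForm K n deg)}
    (hX : ∀ i j, X i j ∈ FormsIn N) : X.trace ∈ FormsIn N :=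
  Submodule.sum_mem _ fun i _ => hX i i

/-- Graded cyclicity of the trace. -/
theorem trace_mul_comm_of {k : K} {X Y : Matrix m m (LocalForm K n deg)}
    (h : ∀ i j i' j', X i j * Y i' j' = k • (Y i' j' * X i j)) :
    (X * Y).trace = k • (Y * X).trace := by
  simp only [Matrix.trace, Matrix.diag_apply, Matrix.mul_apply, h, smul_sum]
  rw [sum_comm]

theorem trace_comm_const (X : Matrix m m (LocalForm K n deg)) (ε : Matrix m m K) :
    (X * ε.map (algebraMap K (LocalForm K n deg)) -
      ε.map (algebraMap K (LocalForm K n deg)) * X).trace = 0 := by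
  rw [Matrix.trace_sub, trace_mul_comm_of (k := (1 : K)), one_smul, sub_self]
  intro i j i' j'
  rw [one_smul, Matrix.map_apply, Algebra.commutes]

end FormDerivations

section Model4

open MvPolynomial

variable {n N : ℕ} {κ : Type*}

/-- The component of the gauge field `A^a` along `dx^μ`. -/
def potential (a : κ) (μ : Fin n) : JetPoly ℂ n (deg4 κ) := jetVar (Sum.inl a) {μ} 0

theorem potential_eq_X (a : κ) (μ : Fin n) : (potential a μ : JetPoly ℂ n (deg4 κ)) =
    X (⟨Sum.inl a, ⟨{μ}, Finset.card_singleton μ⟩⟩, 0) := jetVar_of_card _ _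

theorem fieldForm_inl (a : κ) :
    fieldForm ℂ (deg4 κ) (Sum.inl a) = ∑ μ : Fin n, dx ℂ μ ⊗ₜ[ℂ] potential a μ := by
  rw [fieldForm_eq_sum, eq_comm]
  refine Fintype.sum_of_injective (fun μ : Fin n => {μ}) Finset.singleton_injective
    (fun μ => dx ℂ μ ⊗ₜ[ℂ] potential a μ) _ (fun S hS => ?_)
    fun μ => ?_
  · rw [jetVar, dif_neg, TensorProduct.tmul_zero]
    intro h
    obtain ⟨μ, rfl⟩ := Finset.card_eq_one.mp h
    exact hS ⟨μ, rfl⟩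
  · simp [dxSet, potential]

/-- Gauge fields are one-forms, which commute with forms of even degree and anticommute with forms
of odd degree. -/
theorem fieldForm_inl_mul_comm (a : κ) {l : ℕ} {y : LocalForm ℂ n (deg4 κ)}
    (hy : formProj _ l y = y) : fieldForm ℂ (deg4 κ) (Sum.inl a) * y =
      (-1 : ℂ) ^ l • (y * fieldForm ℂ (deg4 κ) (Sum.inl a)) := by
  rw [fieldForm_inl, sum_mul, mul_sum, smul_sum]
  exact sum_congr rfl fun μ _ => dx_tmul_mul_comm μ _ hy

variable [Fintype κ] (T : Module.Basis κ ℝ (su N))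

variable (n) in
/-- The constant gauge transformations. -/
def gaugeRotations :
    FieldRotations ℂ n (deg4 κ) (fun _ => FieldKind.closed) (su N) where
  act := adjointAction T n
  coeff ε := Sum.elim (fun a => Sum.elim (fun c => lieMatrix T ε a c) fun _ => 0) fun _ _ => 0
  act_jetVar ε a S α := by
    by_cases hS : S.card = deg4 κ a
    · rw [jetVar_of_card hS, adjointAction, mkDerivation_X, Fintype.sum_sum_type]
      rcases a with a | a
      · simp only [Sum.elim_inl, Sum.elim_inr, zero_smul, sum_const_zero, add_zero]
        refine sum_congr rfl fun c _ => ?_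
        rw [jetVar_of_card (a := Sum.inl c) hS]
        rfl
      · simp
    · rw [jetVar, dif_neg hS, map_zero, eq_comm]
      refine sum_eq_zero fun c _ => ?_
      rcases a with a | a
      · rcases c with c | c
        · rw [jetVar, dif_neg (by exact hS), smul_zero]
        · simp
      · simp
  deg_eq ε a c h := by
    rcases a with a | a <;> rcases c with c | c <;> simp_all
  kind_eq _ _ _ _ := rfl

theorem sum_gaugeRotations_coeff {M : Type*} [AddCommGroup M] [Module ℂ M] (ε : su N) (a : κ)
    (x : κ ⊕ Unit → M) : ∑ c, (gaugeRotations n T).coeff ε (Sum.inl a) c • x c =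
      ∑ c, lieMatrix T ε a c • x (Sum.inl c) := by
  rw [Fintype.sum_sum_type]
  simp [gaugeRotations]

theorem sum_gaugeRotations_coeff_inr {M : Type*} [AddCommGroup M] [Module ℂ M] (ε : su N) (b : Unit)
    (x : κ ⊕ Unit → M) : ∑ c, (gaugeRotations n T).coeff ε (Sum.inr b) c • x c = 0 := by
  simp [gaugeRotations]

theorem adjointAction_jetVar_inl (ε : su N) (a : κ) (S : Finset (Fin n)) (α : Fin n →₀ ℕ) :
    adjointAction T n ε (jetVar (Sum.inl a) S α) =
      ∑ c, lieMatrix T ε a c • jetVar (Sum.inl c) S α :=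
  ((gaugeRotations n T).act_jetVar ε _ S α).trans
    (sum_gaugeRotations_coeff T ε a fun c => jetVar c S α)

theorem adjointAction_jetVar_inr (ε : su N) (b : Unit) (S : Finset (Fin n)) (α : Fin n →₀ ℕ) :
    adjointAction T n ε (jetVar (Sum.inr b) S α) = 0 :=
  ((gaugeRotations n T).act_jetVar ε _ S α).trans
    (sum_gaugeRotations_coeff_inr T ε b fun c => jetVar c S α)

theorem adjointAction_totalDeriv (ε : su N) (μ : Fin n) (x : JetPoly ℂ n (deg4 κ)) :
    adjointAction T n ε (totalDeriv ℂ (deg4 κ) μ x) =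
      totalDeriv ℂ (deg4 κ) μ (adjointAction T n ε x) :=
  (gaugeRotations n T).act_totalDeriv ε μ x

/-- The constant gauge transformations represent the Lie algebra. -/
theorem adjointAction_comm (ε ε' : su N) (x : JetPoly ℂ n (deg4 κ)) :
    adjointAction T n ε (adjointAction T n ε' x) - adjointAction T n ε' (adjointAction T n ε x) =
      adjointAction T n (su.comm ε ε') x := by
  have h : ⁅adjointAction T n ε, adjointAction T n ε'⁆ = adjointAction T n (su.comm ε ε') := by
    refine derivation_ext fun v => ?_
    rw [Derivation.commutator_apply, X_eq_jetVar]
    obtain ⟨⟨a | a, S⟩, α⟩ := v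
    · simp only [adjointAction_jetVar_inl, map_sum, Derivation.map_smul, smul_sum, smul_smul]
      rw [sum_comm, sum_comm (γ := κ) (f := fun c d =>
        (lieMatrix T ε a c * lieMatrix T ε' c d) • (jetVar (Sum.inl d) S.1 α : JetPoly ℂ n (deg4 κ))),
        ← sum_sub_distrib]
      refine sum_congr rfl fun d _ => ?_
      rw [← sum_smul, ← sum_smul, ← sub_smul, lieMatrix_comm]
    · simp only [adjointAction_jetVar_inr, map_zero, sub_zero]
  have := Derivation.congr_fun h x
  rwa [Derivation.commutator_apply] at this

theorem adjointAction_eq_sum (ε : su N) (x : JetPoly ℂ n (deg4 κ)) :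
    adjointAction T n ε x = ∑ e, (T.repr ε e : ℂ) • adjointAction T n (T e) x := by
  have h : adjointAction T n ε = ∑ e, (T.repr ε e : ℂ) • adjointAction T n (T e) := by
    refine derivation_ext fun v => ?_
    rw [derivation_sum_apply, X_eq_jetVar]
    obtain ⟨⟨a | a, S⟩, α⟩ := v
    · simp only [Derivation.smul_apply, adjointAction_jetVar_inl, smul_sum, smul_smul]
      rw [sum_comm]
      refine sum_congr rfl fun c _ => ?_
      rw [← sum_smul, ← lieMatrix_eq_sum]
    · simp only [Derivation.smul_apply, adjointAction_jetVar_inr, smul_zero, sum_const_zero]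
  rw [h, derivation_sum_apply]
  rfl

theorem gaugePotential_eq (μ : Fin n) :
    gaugePotential T μ = basisMatrix T fun a => potential a μ := by
  simp only [potential_eq_X]
  rfl

/-- The covariant derivative `∂_μ - ∑ₑ A^e_μ ad T_e`. -/
def gaugeCov (μ : Fin n) : Derivation ℂ (JetPoly ℂ n (deg4 κ)) (JetPoly ℂ n (deg4 κ)) :=
  totalDeriv ℂ (deg4 κ) μ - ∑ e, potential e μ • adjointAction T n (T e)

theorem gaugeCov_apply (μ : Fin n) (x : JetPoly ℂ n (deg4 κ)) :
    gaugeCov T μ x = totalDeriv ℂ (deg4 κ) μ x - ∑ e, potential e μ * adjointAction T n (T e) x := by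
  rw [gaugeCov, Derivation.sub_apply, derivation_sum_apply]
  rfl

theorem adjointAction_potential (ε : su N) (a : κ) (μ : Fin n) :
    adjointAction T n ε (potential a μ) = ∑ c, lieMatrix T ε a c • potential c μ :=
  adjointAction_jetVar_inl T ε a _ _

/-- Covariant derivatives commute with constant gauge transformations. -/
theorem adjointAction_gaugeCov (ε : su N) (μ : Fin n) (x : JetPoly ℂ n (deg4 κ)) :
    adjointAction T n ε (gaugeCov T μ x) = gaugeCov T μ (adjointAction T n ε x) := by
  rw [gaugeCov_apply, gaugeCov_apply, map_sub, adjointAction_totalDeriv, map_sum]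
  congr 1
  simp only [Derivation.leibniz, smul_eq_mul, sum_add_distrib, adjointAction_potential,
    mul_sum]
  have h : ∀ c, potential c μ * adjointAction T n (T c) (adjointAction T n ε x) =
      potential c μ * adjointAction T n ε (adjointAction T n (T c) x) +
      potential c μ * adjointAction T n (su.comm (T c) ε) x := fun c => by
    rw [← mul_add, ← adjointAction_comm, add_sub_cancel]
  simp only [h, sum_add_distrib]
  congr 1
  rw [sum_comm]
  refine sum_congr rfl fun c _ => ?_
  rw [adjointAction_eq_sum, mul_sum]
  refine sum_congr rfl fun e _ => ?_
  rw [lieMatrix, mul_smul_comm, mul_smul_comm, mul_comm]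

/-- The commutator of covariant derivatives, in terms of the curvature. -/
theorem gaugeCov_comm (μ ν : Fin n) (x : JetPoly ℂ n (deg4 κ)) :
    gaugeCov T μ (gaugeCov T ν x) - gaugeCov T ν (gaugeCov T μ x) =
      -∑ e, (gaugeCov T μ (potential e ν) - totalDeriv ℂ (deg4 κ) ν (potential e μ)) *
        adjointAction T n (T e) x := by
  conv_lhs => rw [gaugeCov_apply T ν x, gaugeCov_apply T ν (gaugeCov T μ x), map_sub, map_sum]
  simp only [Derivation.leibniz, smul_eq_mul, adjointAction_gaugeCov, sum_add_distrib]
  have h : gaugeCov T μ (totalDeriv ℂ (deg4 κ) ν x) - totalDeriv ℂ (deg4 κ) ν (gaugeCov T μ x) =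
      ∑ e, totalDeriv ℂ (deg4 κ) ν (potential e μ) * adjointAction T n (T e) x := by
    rw [gaugeCov_apply, gaugeCov_apply, map_sub, map_sum, totalDeriv_comm]
    simp only [Derivation.leibniz, smul_eq_mul, adjointAction_totalDeriv, sum_add_distrib]
    rw [sub_sub_sub_cancel_left, add_sub_cancel_left]
    exact sum_congr rfl fun e _ => mul_comm _ _
  rw [← sum_neg_distrib]
  simp only [sub_mul, neg_sub, sum_sub_distrib]
  rw [← h]
  have h2 : ∑ e, adjointAction T n (T e) x * gaugeCov T μ (potential e ν) =
      ∑ e, gaugeCov T μ (potential e ν) * adjointAction T n (T e) x :=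
    sum_congr rfl fun e _ => mul_comm _ _
  rw [h2]
  abel

end Model4

/-! ### Yang-Mills curvature and Chern-Simons form -/

section Homogeneous

variable {K : Type*} [Field K] {n : ℕ} {ι : Type*} {deg : ι → ℕ} {k : ℕ}

theorem neg_one_smul_form (x : LocalForm K n deg) : (-1 : K) • x = -x :=
  neg_one_smul K x

theorem formProj_add_of_eq {x y : LocalForm K n deg} (hx : formProj _ k x = x)
    (hy : formProj _ k y = y) : formProj _ k (x + y) = x + y := by
  rw [map_add, hx, hy]

theorem formProj_smul_of_eq (c : K) {x : LocalForm K n deg} (hx : formProj _ k x = x) :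
    formProj _ k (c • x) = c • x := by
  rw [map_smul, hx]

theorem formProj_sum_of_eq {J : Type*} [Fintype J] {x : J → LocalForm K n deg}
    (hx : ∀ j, formProj _ k (x j) = x j) : formProj _ k (∑ j, x j) = ∑ j, x j := by
  rw [map_sum]
  exact sum_congr rfl fun j _ => hx j

end Homogeneous

section YangMillsCurvature

open MvPolynomial

variable {n N : ℕ} {κ : Type*}

theorem map_extD_extD (X : Matrix (Fin N) (Fin N) (LocalForm ℂ n (deg4 κ))) :
    (X.map (extD ℂ (deg4 κ))).map (extD ℂ (deg4 κ)) = 0 :=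
  Matrix.ext fun i j => extD_extD (X i j)

theorem extD_trace (X : Matrix (Fin N) (Fin N) (LocalForm ℂ n (deg4 κ))) :
    extD ℂ (deg4 κ) X.trace = (X.map (extD ℂ (deg4 κ))).trace :=
  map_sum _ _ _

theorem extD_mul_algebraMap (x : LocalForm ℂ n (deg4 κ)) (c : ℂ) :
    extD ℂ (deg4 κ) (x * algebraMap ℂ _ c) = extD ℂ (deg4 κ) x * algebraMap ℂ _ c := by
  rw [← Algebra.commutes, ← Algebra.commutes, ← Algebra.smul_def, ← Algebra.smul_def, map_smul]

variable [Fintype κ] (T : Module.Basis κ ℝ (su N))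

variable (n) in
/-- The curvature `dA^a + ½ f_{ce}^a A^c A^e` of the gauge fields. -/
def fieldStrength (a : κ) : LocalForm ℂ n (deg4 κ) :=
  extD ℂ (deg4 κ) (fieldForm ℂ (deg4 κ) (Sum.inl a)) + (1 / 2 : ℂ) • ∑ e, ∑ c,
    lieMatrix T (T e) a c •
      (fieldForm ℂ (deg4 κ) (Sum.inl c) * fieldForm ℂ (deg4 κ) (Sum.inl e))

theorem A4_eq : A4 n T = basisMatrix T fun a => fieldForm ℂ (deg4 κ) (Sum.inl a) := rfl

theorem map_extD_A4 : (A4 n T).map (extD ℂ (deg4 κ)) =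
    basisMatrix T fun a => extD ℂ (deg4 κ) (fieldForm ℂ (deg4 κ) (Sum.inl a)) :=
  basisMatrix_map T _ _

theorem F4_eq : F4 n T = basisMatrix T (fieldStrength n T) := by
  rw [F4, map_extD_A4, A4_eq, basisMatrix_sq T, ← basisMatrix_add]
  · rfl
  · intro c e
    rw [fieldForm_inl_mul_comm (l := 1) c (formProj_fieldForm (Sum.inl e)), pow_one]
    exact neg_one_smul_form _

theorem formProj_A4 (i j : Fin N) : formProj _ 1 (A4 n T i j) = A4 n T i j := by
  rw [A4_eq, basisMatrix_apply, map_sum]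
  refine sum_congr rfl fun a _ => ?_
  rw [map_smul]
  congr 1
  exact formProj_fieldForm (Sum.inl a : κ ⊕ Unit)

theorem formProj_map_extD_A4 (i j : Fin N) :
    formProj _ 2 ((A4 n T).map (extD ℂ (deg4 κ)) i j) = (A4 n T).map (extD ℂ (deg4 κ)) i j :=
  formProj_extD_of_eq (formProj_A4 T i j)

theorem A4_mul_comm (i j : Fin N) {l : ℕ} {y : LocalForm ℂ n (deg4 κ)}
    (hy : formProj _ l y = y) : A4 n T i j * y = (-1 : ℂ) ^ l • (y * A4 n T i j) := by
  simp only [A4_eq, basisMatrix_apply, sum_mul, mul_sum, smul_sum,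
    smul_mul_assoc, mul_smul_comm, fieldForm_inl_mul_comm _ hy, smul_comm _ ((-1 : ℂ) ^ l)]

theorem trace_A4_mul {l : ℕ} (hl : Odd l)
    {Y : Matrix (Fin N) (Fin N) (LocalForm ℂ n (deg4 κ))}
    (hY : ∀ i j, formProj _ l (Y i j) = Y i j) :
    (A4 n T * Y).trace = -(Y * A4 n T).trace := by
  rw [trace_mul_comm_of fun i j i' j' => A4_mul_comm T i j (hY i' j'), hl.neg_one_pow]
  exact neg_one_smul_form _

theorem map_extD_A4_sq : (A4 n T * A4 n T).map (extD ℂ (deg4 κ)) =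
    (A4 n T).map (extD ℂ (deg4 κ)) * A4 n T - A4 n T * (A4 n T).map (extD ℂ (deg4 κ)) := by
  rw [map_extD_mul (formProj_A4 T), pow_one, sub_eq_add_neg]
  refine congrArg _ (Matrix.ext fun i j => ?_)
  exact neg_one_smul_form _

/-- The Bianchi identity `dF = F A - A F`. -/
theorem map_extD_F4 : (F4 n T).map (extD ℂ (deg4 κ)) = F4 n T * A4 n T - A4 n T * F4 n T := by
  have h : (F4 n T).map (extD ℂ (deg4 κ)) =
      ((A4 n T).map (extD ℂ (deg4 κ))).map (extD ℂ (deg4 κ)) +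
        (A4 n T * A4 n T).map (extD ℂ (deg4 κ)) := by
    rw [F4]
    exact Matrix.map_add _ (map_add _) _ _
  rw [h, map_extD_extD, zero_add, map_extD_A4_sq, F4, add_mul, mul_add, mul_assoc]
  abel

/-- The exterior derivative of the Chern-Simons form. -/
theorem extD_chernSimons :
    extD ℂ (deg4 κ) (chernSimons n T) = (1 / 2 : ℂ) • (F4 n T * F4 n T).trace := by
  set A := A4 n T with hA
  set D := A.map (extD ℂ (deg4 κ)) with hD
  have hA1 := formProj_A4 (n := n) T
  have hD2 := formProj_map_extD_A4 (n := n) T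
  have h1 : (A * D).map (extD ℂ (deg4 κ)) = D * D := by
    rw [map_extD_mul hA1, map_extD_extD, mul_zero, smul_zero, add_zero]
  have h2 : (A * A * A).map (extD ℂ (deg4 κ)) = (D * A - A * D) * A + A * A * D := by
    rw [map_extD_mul (formProj_matrix_mul hA1 hA1), map_extD_A4_sq]
    norm_num
    rfl
  have t1 : (A * (D * A)).trace = -(D * A * A).trace :=
     trace_A4_mul T (by decide) (formProj_matrix_mul hD2 hA1)
  have t2 : (A * (A * D)).trace = -(A * D * A).trace :=
     trace_A4_mul T (by decide) (formProj_matrix_mul hA1 hD2)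
  have t3 : (A * (A * A * A)).trace = -(A * A * A * A).trace :=
     trace_A4_mul T (by decide) (formProj_matrix_mul (formProj_matrix_mul hA1 hA1) hA1)
  have t4 : (A * A * A * A).trace = 0 := by
    have h : (2 : ℂ) • (A * A * A * A).trace = 0 := by
      rw [two_smul]
      nth_rewrite 1 [show A * A * A * A = A * (A * A * A) by noncomm_ring]
      rw [t3, neg_add_cancel]
    exact (smul_eq_zero.mp h).resolve_left two_ne_zero
  have e : (A * D + (2 / 3 : ℂ) • (A * A * A)).map (extD ℂ (deg4 κ)) =
      (A * D).map (extD ℂ (deg4 κ)) + (2 / 3 : ℂ) • (A * A * A).map (extD ℂ (deg4 κ)) := by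
    ext i j
    simp only [Matrix.map_apply, Matrix.add_apply, Matrix.smul_apply, map_add, map_smul]
  have hF : F4 n T * F4 n T = D * D + D * A * A + A * (A * D) + A * A * A * A := by
    rw [F4]
    simp only [add_mul, mul_add, mul_assoc]
    abel
  rw [chernSimons, map_smul, extD_trace, e, h1, h2, hF]
  congr 1
  have h3 : (D * A - A * D) * A + A * A * D = D * A * A - A * (D * A) + A * (A * D) := by
    simp only [sub_mul, mul_assoc]
  rw [h3]
  have t5 : (A * D * A).trace = -(D * A * A).trace := by rw [mul_assoc, t1]
  simp only [Matrix.trace_add, Matrix.trace_sub, Matrix.trace_smul, t1, t2, t4, t5]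
  module

theorem formDer_fieldForm_inl (ε : su N) (a : κ) :
    formDer (adjointAction T n ε) (fieldForm ℂ (deg4 κ) (Sum.inl a)) =
      ∑ c, lieMatrix T ε a c • fieldForm ℂ (deg4 κ) (Sum.inl c) := by
  simp only [fieldForm_inl, map_sum, formDer_tmul, adjointAction_potential, TensorProduct.tmul_sum,
    TensorProduct.tmul_smul, smul_sum]
  exact sum_comm

theorem formDer_fieldForm_inr (ε : su N) (b : Unit) :
    formDer (adjointAction T n ε) (fieldForm ℂ (deg4 κ) (Sum.inr b)) = 0 := by
  simp only [fieldForm_eq_sum, map_sum, formDer_tmul, adjointAction_jetVar_inr,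
    TensorProduct.tmul_zero, sum_const_zero]

/-- The matrices of forms which transform in the adjoint representation under the constant gauge
transformation `ε`. -/
def IsAdjoint (ε : su N) (X : Matrix (Fin N) (Fin N) (LocalForm ℂ n (deg4 κ))) : Prop :=
  X.map (formDer (adjointAction T n ε)) =
    X * ε.1.map (algebraMap ℂ (LocalForm ℂ n (deg4 κ))) -
      ε.1.map (algebraMap ℂ (LocalForm ℂ n (deg4 κ))) * X

variable {T}

theorem IsAdjoint.mul {ε : su N} {X Y : Matrix (Fin N) (Fin N) (LocalForm ℂ n (deg4 κ))}
    (hX : IsAdjoint T ε X) (hY : IsAdjoint T ε Y) : IsAdjoint T ε (X * Y) := by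
  rw [IsAdjoint, map_formDer_mul, hX, hY]
  simp only [sub_mul, mul_sub, mul_assoc]
  abel

theorem IsAdjoint.add {ε : su N} {X Y : Matrix (Fin N) (Fin N) (LocalForm ℂ n (deg4 κ))}
    (hX : IsAdjoint T ε X) (hY : IsAdjoint T ε Y) : IsAdjoint T ε (X + Y) := by
  rw [IsAdjoint, Matrix.map_add _ (map_add _), hX, hY, add_mul, mul_add]
  abel

theorem IsAdjoint.smul {ε : su N} {X : Matrix (Fin N) (Fin N) (LocalForm ℂ n (deg4 κ))}
    (hX : IsAdjoint T ε X) (c : ℂ) : IsAdjoint T ε (c • X) := by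
  have h : (c • X).map (formDer (adjointAction T n ε)) =
      c • X.map (formDer (adjointAction T n ε)) :=
    Matrix.ext fun i j => map_smul (formDer (adjointAction T n ε)) c (X i j)
  rw [IsAdjoint, h, hX, smul_sub, Matrix.smul_mul, Matrix.mul_smul]

theorem IsAdjoint.map_extD {ε : su N} {X : Matrix (Fin N) (Fin N) (LocalForm ℂ n (deg4 κ))}
    (hX : IsAdjoint T ε X) : IsAdjoint T ε (X.map (extD ℂ (deg4 κ))) := by
  have h1 : (X.map (extD ℂ (deg4 κ))).map (formDer (adjointAction T n ε)) =
      (X.map (formDer (adjointAction T n ε))).map (extD ℂ (deg4 κ)) :=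
    Matrix.ext fun i j => formDer_extD (adjointAction_totalDeriv T ε) _
  rw [IsAdjoint, h1, hX]
  ext i j
  simp only [Matrix.map_apply, Matrix.sub_apply, Matrix.mul_apply, map_sub, map_sum,
    extD_mul_algebraMap, Algebra.commutes]

theorem IsAdjoint.formDer_trace {ε : su N} {X : Matrix (Fin N) (Fin N) (LocalForm ℂ n (deg4 κ))}
    (hX : IsAdjoint T ε X) : formDer (adjointAction T n ε) X.trace = 0 := by
  have h : formDer (adjointAction T n ε) X.trace =
      (X.map (formDer (adjointAction T n ε))).trace := map_sum _ _ _
  rw [h, hX, trace_comm_const]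

variable (T)

theorem isAdjoint_A4 (ε : su N) : IsAdjoint T ε (A4 n T) := by
  rw [IsAdjoint, A4_eq, basisMatrix_comm_const, basisMatrix_map]
  simp only [formDer_fieldForm_inl]

theorem isAdjoint_F4 (ε : su N) : IsAdjoint T ε (F4 n T) :=
  (isAdjoint_A4 T ε).map_extD.add ((isAdjoint_A4 T ε).mul (isAdjoint_A4 T ε))

theorem formDer_fieldStrength (ε : su N) (a : κ) :
    formDer (adjointAction T n ε) (fieldStrength n T a) =
      ∑ c, lieMatrix T ε a c • fieldStrength n T c := by
  have h := isAdjoint_F4 (n := n) T ε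
  rw [IsAdjoint, F4_eq, basisMatrix_comm_const, basisMatrix_map] at h
  exact congrFun (basisMatrix_injective T h) a

theorem formDer_H4 (ε : su N) : formDer (adjointAction T n ε) (H4 n T) = 0 := by
  have hA := isAdjoint_A4 (n := n) T ε
  have h : formDer (adjointAction T n ε) (chernSimons n T) = 0 := by
    rw [chernSimons, map_smul]
    have := ((hA.mul hA.map_extD).add (((hA.mul hA).mul hA).smul (2 / 3 : ℂ))).formDer_trace
    rw [this, smul_zero]
  rw [H4, map_add, formDer_extD (adjointAction_totalDeriv T ε), formDer_fieldForm_inr, map_zero,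
    zero_add, h]

theorem formProj_fieldStrength (a : κ) :
    formProj _ (1 + 1) (fieldStrength n T a) = fieldStrength n T a := by
  have hA : ∀ a : κ, formProj _ 1 (fieldForm ℂ (deg4 κ) (Sum.inl a) : LocalForm ℂ n (deg4 κ)) =
      fieldForm ℂ (deg4 κ) (Sum.inl a) := fun a =>
    formProj_fieldForm (Sum.inl a : κ ⊕ Unit)
  rw [fieldStrength]
  refine formProj_add_of_eq ?_ ?_
  · exact formProj_extD_of_eq (hA a)
  · refine formProj_smul_of_eq _ ?_
    refine formProj_sum_of_eq fun e => ?_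
    refine formProj_sum_of_eq fun c => ?_
    refine formProj_smul_of_eq _ ?_
    exact formProj_mul_of_eq (hA c) (hA e)

/-- The Bianchi identity in components. -/
theorem extD_fieldStrength (a : κ) : extD ℂ (deg4 κ) (fieldStrength n T a) =
    ∑ e, fieldForm ℂ (deg4 κ) (Sum.inl e) *
      formDer (adjointAction T n (T e)) (fieldStrength n T a) := by
  have hF := formProj_fieldStrength (n := n) T
  have hcomm : ∀ c e, fieldForm ℂ (deg4 κ) (Sum.inl e) * fieldStrength n T c =
      fieldStrength n T c * fieldForm ℂ (deg4 κ) (Sum.inl e) := fun c e => by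
    rw [fieldForm_inl_mul_comm e (hF c), neg_one_sq, one_smul]
  have h := map_extD_F4 (n := n) T
  rw [F4_eq, A4_eq, basisMatrix_comm T hcomm, basisMatrix_map] at h
  refine (congrFun (basisMatrix_injective T h) a).trans (sum_congr rfl fun e _ => ?_)
  rw [formDer_fieldStrength, mul_sum]
  exact sum_congr rfl fun c _ => by rw [mul_smul_comm, hcomm]

end YangMillsCurvature

/-! ### The Yang-Mills model -/

section YangMills

open MvPolynomial

variable {n N : ℕ} {κ : Type*}

theorem compAt_dx_tmul_mul {K : Type*} [Field K] {ι : Type*} {deg : ι → ℕ}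
    (f : Module.Dual K (ConstForm K n)) (μ : Fin n) (p : JetPoly K n deg) (η : LocalForm K n deg) :
    compAt _ f (dx K μ ⊗ₜ[K] p * η) = p * compAt _ (f ∘ₗ LinearMap.mulLeft K (dx K μ)) η := by
  induction η using TensorProduct.induction_on with
  | zero => simp
  | add η η' h h' => simp only [mul_add, map_add, h, h']
  | tmul x q =>
    rw [Algebra.TensorProduct.tmul_mul_tmul, compAt_tmul, compAt_tmul, mul_smul_comm]
    rfl

/-- The functional which takes the component of a form along `dx^μ dx^ν`. -/
def pairCoord (μ ν : Fin n) : Module.Dual ℂ (ConstForm ℂ n) :=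
  (dxBasis ℂ n).coord ∅ ∘ₗ contract ν ∘ₗ contract μ

theorem pairCoord_dx_dx (μ ν l r : Fin n) : pairCoord μ ν (dx ℂ l * dx ℂ r) =
    (if μ = l then 1 else 0) * (if ν = r then 1 else 0) -
      (if ν = l then 1 else 0) * (if μ = r then 1 else 0) := by
  have h1 : ∀ x : ConstForm ℂ n, (dxBasis ℂ n).coord ∅ (dx ℂ l * contract ν x) = 0 := by
    intro x
    have e : (dxBasis ℂ n).coord ∅ ∘ₗ degProj 0 = (dxBasis ℂ n).coord ∅ := by
      refine constForm_linearMap_ext fun S => ?_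
      rw [LinearMap.comp_apply, degProj_dxSet]
      split_ifs with hS
      · rfl
      · rw [map_zero, coord_dxSet, if_neg]
        rintro rfl
        exact hS rfl
    rw [← e, LinearMap.comp_apply, degProj_zero_dx_mul, map_zero]
  have h2 : ∀ μ r : Fin n, contract μ (dx ℂ r) = if μ = r then (1 : ConstForm ℂ n) else 0 := by
    intro μ r
    have := contract_dx_mul (K := ℂ) μ r 1
    rwa [mul_one, contract_one, mul_zero, sub_zero] at this
  have h3 : (dxBasis ℂ n).coord ∅ (1 : ConstForm ℂ n) = 1 := by
    have h : dxSet ℂ (∅ : Finset (Fin n)) = 1 := by simp [dxSet]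
    rw [← h, coord_dxSet, if_pos rfl]
  rw [pairCoord, LinearMap.comp_apply, LinearMap.comp_apply, contract_dx_mul, map_sub,
    contract_dx_mul, h2 μ r]
  simp only [map_sub, h1, sub_zero]
  congr 1
  · split_ifs <;> simp_all
  · split_ifs <;> simp_all

theorem compAt_pairCoord_extD (μ ν : Fin n) (a : κ) :
    compAt _ (pairCoord μ ν) (extD ℂ (deg4 κ) (fieldForm ℂ (deg4 κ) (Sum.inl a))) =
      totalDeriv ℂ (deg4 κ) μ (potential a ν) - totalDeriv ℂ (deg4 κ) ν (potential a μ) := by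
  simp only [compAt_extD, fieldForm_inl, map_sum, compAt_tmul, LinearMap.comp_apply,
    LinearMap.mulLeft_apply, pairCoord_dx_dx, sub_smul, mul_smul, ite_smul, one_smul, zero_smul,
    map_sub, apply_ite (totalDeriv ℂ (deg4 κ) _), map_zero, sum_sub_distrib]
  simp

theorem compAt_pairCoord_mul (μ ν : Fin n) (c e : κ) :
    compAt _ (pairCoord μ ν) (fieldForm ℂ (deg4 κ) (Sum.inl c) * fieldForm ℂ (deg4 κ) (Sum.inl e)) =
      potential c μ * potential e ν - potential c ν * potential e μ := by
  rw [fieldForm_inl c, sum_mul, map_sum]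
  simp only [compAt_dx_tmul_mul, fieldForm_inl, map_sum, compAt_tmul, LinearMap.comp_apply,
    LinearMap.mulLeft_apply, pairCoord_dx_dx, sub_smul, mul_smul, sum_sub_distrib, ite_smul,
    one_smul, zero_smul, mul_sub]
  simp

theorem matrix_mul_mem_smallAlgebra {X Y : Matrix (Fin N) (Fin N) (LocalForm ℂ n (deg4 κ))}
    (hX : ∀ i j, X i j ∈ smallAlgebra ℂ (deg4 κ)) (hY : ∀ i j, Y i j ∈ smallAlgebra ℂ (deg4 κ))
    (i j : Fin N) : (X * Y) i j ∈ smallAlgebra ℂ (deg4 κ) := by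
  rw [Matrix.mul_apply]
  exact sum_mem fun s _ => mul_mem (hX _ _) (hY _ _)

variable [Fintype κ] (T : Module.Basis κ ℝ (su N))

theorem gaugeCov_potential (μ ν : Fin n) (a : κ) :
    gaugeCov T μ (potential a ν) = totalDeriv ℂ (deg4 κ) μ (potential a ν) +
      ∑ e, ∑ c, lieMatrix T (T e) a c • (potential c μ * potential e ν) := by
  rw [gaugeCov_apply, sub_eq_add_neg, ← sum_neg_distrib, sum_comm]
  congr 1
  refine sum_congr rfl fun e _ => ?_
  rw [adjointAction_potential, mul_sum, ← sum_neg_distrib]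
  refine sum_congr rfl fun c _ => ?_
  rw [lieMatrix_antisymm, mul_smul_comm, neg_smul]
  rw [neg_neg]

theorem compAt_pairCoord_fieldStrength (μ ν : Fin n) (a : κ) :
    compAt _ (pairCoord μ ν) (fieldStrength n T a) =
      gaugeCov T μ (potential a ν) - totalDeriv ℂ (deg4 κ) ν (potential a μ) := by
  have h : ∑ e, ∑ c, lieMatrix T (T e) a c • (potential c ν * potential e μ) =
      -∑ e, ∑ c, lieMatrix T (T e) a c •
        (potential c μ * potential e ν : JetPoly ℂ n (deg4 κ)) := by
    rw [sum_comm, ← sum_neg_distrib]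
    refine sum_congr rfl fun e _ => ?_
    rw [← sum_neg_distrib]
    refine sum_congr rfl fun c _ => ?_
    rw [lieMatrix_antisymm, neg_smul, mul_comm]
  rw [fieldStrength, map_add, compAt_pairCoord_extD, gaugeCov_potential]
  simp only [map_smul, map_sum, compAt_pairCoord_mul, smul_sub, sum_sub_distrib, h]
  rw [← smul_sub, sub_neg_eq_add, ← two_smul ℂ, smul_smul]
  norm_num
  abel

/-- The curvatures of the gauge fields and of the two-form. -/
def gaugeCurv : κ ⊕ Unit → LocalForm ℂ n (deg4 κ) :=
  Sum.elim (fieldStrength n T) fun _ => H4 n T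

theorem sum_gaugeCov_compAt (f : Module.Dual ℂ (ConstForm ℂ n)) (ω : LocalForm ℂ n (deg4 κ)) :
    ∑ ν, gaugeCov T ν (compAt _ (f ∘ₗ LinearMap.mulLeft ℂ (dx ℂ ν)) ω) =
      compAt _ f (extD ℂ (deg4 κ) ω - ∑ e, fieldForm ℂ (deg4 κ) (Sum.inl e) *
        formDer (adjointAction T n (T e)) ω) := by
  simp only [gaugeCov_apply, sum_sub_distrib, map_sub, compAt_extD, map_sum, fieldForm_inl,
    sum_mul, compAt_dx_tmul_mul, compAt_formDer]
  rw [sum_comm]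

theorem adjointAction_foldr_gaugeCov (ε : su N) (a : κ ⊕ Unit) (f : Module.Dual ℂ (ConstForm ℂ n))
    (l : List (Fin n)) :
    adjointAction T n ε (l.foldr (fun μ y => gaugeCov T μ y) (compAt _ f (gaugeCurv T a))) =
      ∑ c, (gaugeRotations n T).coeff ε a c •
        l.foldr (fun μ y => gaugeCov T μ y) (compAt _ f (gaugeCurv T c)) := by
  induction l with
  | nil =>
    simp only [List.foldr_nil]
    rw [← compAt_formDer]
    rcases a with a | a
    · rw [sum_gaugeRotations_coeff]
      change compAt _ f (formDer _ (fieldStrength n T a)) = _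
      rw [formDer_fieldStrength, map_sum]
      simp only [map_smul]
      rfl
    · rw [sum_gaugeRotations_coeff_inr]
      change compAt _ f (formDer _ (H4 n T)) = _
      rw [formDer_H4, map_zero]
  | cons μ l ih => simp only [List.foldr_cons, adjointAction_gaugeCov, ih, map_sum,
      Derivation.map_smul]

theorem basisMatrix_mem {M : Type*} [AddCommGroup M] [Module ℂ M] {S : Submodule ℂ M} {v : κ → M}
    (h : ∀ a, v a ∈ S) (i j : Fin N) : basisMatrix T v i j ∈ S :=
  Submodule.sum_mem _ fun a _ => Submodule.smul_mem _ _ (h a)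

theorem A4_mem_homogeneous (u : κ ⊕ Unit → ℕ) (e k : ℕ) (hu : ∀ a, u (Sum.inl a) = k)
    (i j : Fin N) :
    A4 n T i j ∈ FormsIn (weightedHomogeneousSubmodule ℂ (jetWeight u e) k) := by
  refine basisMatrix_mem T (fun a => ?_) i j
  rw [← hu a]
  exact fieldForm_mem_homogeneous u e _

theorem chernSimons_mem {S : Submodule ℂ (JetPoly ℂ n (deg4 κ))} (u : κ ⊕ Unit → ℕ) (e k : ℕ)
    (hu : ∀ a, u (Sum.inl a) = k)
    (h₁ : weightedHomogeneousSubmodule ℂ (jetWeight u e) (k + (k + e)) ≤ S)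
    (h₂ : weightedHomogeneousSubmodule ℂ (jetWeight u e) (k + k + k) ≤ S) :
    chernSimons n T ∈ FormsIn S := by
  have hA := A4_mem_homogeneous (n := n) T u e k hu
  have hD : ∀ i j, (A4 n T).map (extD ℂ (deg4 κ)) i j ∈
      FormsIn (weightedHomogeneousSubmodule ℂ (jetWeight u e) (k + e)) :=
    fun i j => extD_mem_homogeneous (hA i j)
  rw [chernSimons]
  refine Submodule.smul_mem _ _ (trace_mem_formsIn fun i j => Submodule.add_mem _
    (formsIn_mono h₁ (matrix_mul_mem_homogeneous hA hD i j)) (Submodule.smul_mem _ _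
      (formsIn_mono h₂ (matrix_mul_mem_homogeneous (matrix_mul_mem_homogeneous hA hA) hA i j))))

theorem fieldStrength_sub_mem {S : Submodule ℂ (JetPoly ℂ n (deg4 κ))} (u : κ ⊕ Unit → ℕ) (e k : ℕ)
    (hu : ∀ a, u (Sum.inl a) = k) (a : κ)
    (h : weightedHomogeneousSubmodule ℂ (jetWeight u e) (k + k) ≤ S) :
    fieldStrength n T a - extD ℂ (deg4 κ) (fieldForm ℂ (deg4 κ) (Sum.inl a)) ∈ FormsIn S := by
  rw [fieldStrength, add_sub_cancel_left]
  refine Submodule.smul_mem _ _ (Submodule.sum_mem _ fun e' _ =>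
    Submodule.sum_mem _ fun c _ => Submodule.smul_mem _ _ (formsIn_mono h ?_))
  have hA : ∀ a, fieldForm ℂ (deg4 κ) (Sum.inl a) ∈
      FormsIn (weightedHomogeneousSubmodule ℂ (jetWeight (n := n) (deg := deg4 κ) u e) k) :=
    fun a => by
      rw [← hu a]
      exact fieldForm_mem_homogeneous u _ _
  exact mul_mem_homogeneous (hA c) (hA e')

theorem A4_mem_smallAlgebra (i j : Fin N) : A4 n T i j ∈ smallAlgebra ℂ (deg4 κ) :=
  basisMatrix_mem T (S := Subalgebra.toSubmodule (smallAlgebra ℂ (deg4 κ)))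
    (fun _ => fieldForm_mem_smallAlgebra _) i j

theorem chernSimons_mem_smallAlgebra : chernSimons n T ∈ smallAlgebra ℂ (deg4 κ) := by
  have hA := A4_mem_smallAlgebra (n := n) T
  rw [chernSimons]
  exact Subalgebra.smul_mem _ (sum_mem fun i _ => add_mem
    (matrix_mul_mem_smallAlgebra hA (fun i j => extD_mem_smallAlgebra (hA i j)) i i)
    (Subalgebra.smul_mem _ (matrix_mul_mem_smallAlgebra (matrix_mul_mem_smallAlgebra hA hA) hA i i)
      _)) _

theorem formProj_chernSimons : formProj _ (1 + 1 + 1) (chernSimons n T) = chernSimons n T := by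
  have hA := formProj_A4 (n := n) T
  have hD : ∀ i j, formProj _ (1 + 1) ((A4 n T).map (extD ℂ (deg4 κ)) i j) =
      (A4 n T).map (extD ℂ (deg4 κ)) i j := fun i j => formProj_extD_of_eq (hA i j)
  rw [chernSimons]
  refine formProj_smul_of_eq _ (formProj_sum_of_eq fun i => ?_)
  refine formProj_add_of_eq ?_ (formProj_smul_of_eq _ ?_)
  · rw [add_assoc]
    exact formProj_matrix_mul hA hD i i
  · exact formProj_matrix_mul (formProj_matrix_mul hA hA) hA i i

theorem isWeightedHomogeneous_adjointAction_X (ε : su N) (v : JetVar n (deg4 κ)) :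
    (adjointAction T n ε (X v)).IsWeightedHomogeneous (jetWeight (deg4 κ) 1)
      (jetWeight (deg4 κ) 1 v) := by
  rw [X_eq_jetVar]
  obtain ⟨⟨a | a, S⟩, α⟩ := v
  · rw [adjointAction_jetVar_inl]
    exact IsWeightedHomogeneous.sum _ _ _ fun c _ => (weightedHomogeneousSubmodule ℂ _ _).smul_mem _
      (isWeightedHomogeneous_jetVar (deg4 κ) 1 (Sum.inl c) _ _)
  · rw [adjointAction_jetVar_inr]
    exact isWeightedHomogeneous_zero _ _ _

theorem isWeightedHomogeneous_adjointAction_X_fieldCount (ε : su N) (v : JetVar n (deg4 κ)) :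
    (adjointAction T n ε (X v)).IsWeightedHomogeneous fieldCount 1 := by
  rw [X_eq_jetVar]
  obtain ⟨⟨a | a, S⟩, α⟩ := v
  · rw [adjointAction_jetVar_inl]
    refine IsWeightedHomogeneous.sum _ _ _ fun c _ =>
      (weightedHomogeneousSubmodule ℂ _ _).smul_mem _ ?_
    simpa using isWeightedHomogeneous_jetVar (K := ℂ) (deg := deg4 κ) (fun _ => 1) 0 (Sum.inl c) S.1 α
  · rw [adjointAction_jetVar_inr]
    exact isWeightedHomogeneous_zero _ _ _

theorem adjointAction_mem_span (ε : su N) {x : JetPoly ℂ n (deg4 κ)}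
    (hx : x ∈ covGens (gaugeCov T) (gaugeCurv T)) :
    adjointAction T n ε x ∈ Submodule.span ℂ (covGens (gaugeCov T) (gaugeCurv T)) := by
  obtain ⟨a, f, l, rfl⟩ := hx
  rw [adjointAction_foldr_gaugeCov]
  exact Submodule.sum_mem _ fun c _ => Submodule.smul_mem _ _ (Submodule.subset_span ⟨c, f, l, rfl⟩)

/-- The curvatures and covariant derivatives of the Yang-Mills model. -/
def gaugeCovariantCurvatures : CovariantCurvatures (gaugeRotations n T) where
  cov := gaugeCov T
  curv := gaugeCurv T
  formProj_curv := by
    rintro (a | a)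
    · exact formProj_fieldStrength T a
    · change formProj _ (2 + 1) (H4 n T) = H4 n T
      rw [H4]
      exact formProj_add_of_eq (formProj_extD_fieldForm (Sum.inr () : κ ⊕ Unit))
        (formProj_chernSimons T)
  curv_mem := by
    rintro (a | a)
    · refine add_mem (extD_fieldForm_mem_smallAlgebra _) (Subalgebra.smul_mem _
        (sum_mem fun e _ => sum_mem fun c _ => ?_) _)
      exact Subalgebra.smul_mem _
        (mul_mem (fieldForm_mem_smallAlgebra _) (fieldForm_mem_smallAlgebra _)) _
    · exact add_mem (extD_fieldForm_mem_smallAlgebra _) (chernSimons_mem_smallAlgebra T)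
  curv_lead := by
    have h : ∀ k : ℕ, 2 ≤ k → weightedHomogeneousSubmodule ℂ (fieldCount (n := n) (deg := deg4 κ)) k ≤
        orderGE (fun v => (fieldCount v : ℤ)) 2 := fun k hk x hx =>
      orderGE_mono (by exact_mod_cast hk) (mem_orderGE_of_isWeightedHomogeneous hx)
    rintro (a | a) f
    · rw [← map_sub]
      exact fieldStrength_sub_mem T (fun _ => 1) 0 1 (fun _ => rfl) a (h _ le_rfl) f
    · rw [← map_sub]
      have := chernSimons_mem (n := n) T (fun _ => 1) 0 1 (fun _ => rfl) (h _ (by norm_num))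
        (h _ (by norm_num)) f
      change compAt _ f (H4 n T - _) ∈ _
      rwa [H4, add_sub_cancel_left]
  curv_weight := by
    have h : ∀ k : ℕ, weightedHomogeneousSubmodule ℂ (totalWeight (n := n) (deg := deg4 κ)) k ≤
        orderGE (fun v => -(totalWeight v : ℤ)) (-k) := fun k x hx =>
      mem_orderGE_neg_of_isWeightedHomogeneous hx
    rintro (a | a) f
    · have h1 := fieldStrength_sub_mem (n := n) T (deg4 κ) 1 1 (fun _ => rfl) a (h _) f
      have h2 := h _ (extD_mem_homogeneous (K := ℂ) (n := n)
        (fieldForm_mem_homogeneous (deg4 κ) 1 (Sum.inl a)) f)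
      rw [map_sub] at h1
      have h3 := Submodule.add_mem _ h1 h2
      rwa [sub_add_cancel] at h3
    · have h1 := chernSimons_mem (n := n) T (deg4 κ) 1 1 (fun _ => rfl) (h 3) (h 3) f
      have h2 := h _ (extD_mem_homogeneous (K := ℂ) (n := n)
        (fieldForm_mem_homogeneous (deg4 κ) 1 (Sum.inr ())) f)
      change compAt _ f (H4 n T) ∈ _
      rw [H4, map_add]
      exact Submodule.add_mem _ h2 h1
  cov_lead μ v := by
    rw [gaugeCov_apply, sub_sub_cancel_left]
    refine Submodule.neg_mem _ (Submodule.sum_mem _ fun e _ => ?_)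
    exact mul_mem_orderGE (m := 1) (m' := 1)
      (jetVar_mem_orderGE fun _ => by simp [jetWeight])
      (mem_orderGE_of_isWeightedHomogeneous
        (isWeightedHomogeneous_adjointAction_X_fieldCount T _ v))
  cov_weight μ v := by
    rw [gaugeCov_apply]
    refine Submodule.sub_mem _ ?_ (Submodule.sum_mem _ fun e _ => ?_)
    · rw [totalDeriv_X]
      refine X_mem_orderGE ?_
      simp [jetWeight]
      omega
    · rw [sub_eq_add_neg, add_comm]
      exact mul_mem_orderGE (jetVar_mem_orderGE fun _ => by simp [jetWeight])
        (mem_orderGE_neg_of_isWeightedHomogeneous (isWeightedHomogeneous_adjointAction_X T _ v))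
  bianchi := by
    rintro (a | a) f
    · rw [sum_gaugeCov_compAt]
      change compAt _ f (extD _ _ (fieldStrength n T a) -
        ∑ e, _ * formDer _ (fieldStrength n T a)) ∈ _
      rw [extD_fieldStrength, sub_self, map_zero]
      exact zero_mem _
    · rw [sum_gaugeCov_compAt]
      have h : extD ℂ (deg4 κ) (H4 n T) = (1 / 2 : ℂ) • (F4 n T * F4 n T).trace := by
        rw [H4, map_add, extD_extD, zero_add, extD_chernSimons]
      have h2 : gaugeCurv T (Sum.inr a) = H4 n T := rfl
      simp only [h2, formDer_H4, mul_zero, sum_const_zero, sub_zero, h]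
      have hF : ∀ i j, F4 n T i j ∈
          FormsIn (Submodule.span ℂ (covGens (gaugeCov T) (gaugeCurv T))) := fun i j => by
        rw [F4_eq]
        exact basisMatrix_mem T (fun a => mem_formsIn_of_compAt_curv (Sum.inl a)) i j
      refine Submodule.smul_mem _ _ (trace_mem_formsIn fun i j => ?_) f
      rw [Matrix.mul_apply]
      refine Submodule.sum_mem _ fun s _ => ?_
      rw [← mul_one (F4 n T i s * F4 n T s j)]
      exact mul_mul_mem_covFiltration (hF i s) (hF s j) (one_mem _)
  cov_comm μ ν x hx := by
    rw [gaugeCov_comm]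
    refine Submodule.neg_mem _ (Submodule.sum_mem _ fun e _ => ?_)
    rw [← compAt_pairCoord_fieldStrength, ← mul_one (_ * _)]
    refine Submodule.mul_mem_mul ?_ (one_mem (Algebra.adjoin ℂ _))
    rw [pow_two]
    exact Submodule.mul_mem_mul (Submodule.subset_span ⟨Sum.inl e, pairCoord μ ν, [], rfl⟩)
      (adjointAction_mem_span T _ hx)
  cov_invariant μ x _ hx := by
    rw [gaugeCov_apply, sum_eq_zero, sub_zero]
    intro e _
    rw [show adjointAction T n (T e) x = 0 from hx (T e), mul_zero]
  act_curv ε a f := adjointAction_foldr_gaugeCov T ε a f []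
  act_cov ε μ x := adjointAction_gaugeCov T ε μ x

theorem foldr_covDeriv_eq (f : Module.Dual ℂ (ConstForm ℂ n)) (l : List (Fin n)) :
    l.foldr (fun μ Y => covDeriv T μ Y) ((F4 n T).map (component ℂ (deg4 κ) f)) =
      basisMatrix T fun a => l.foldr (fun μ y => gaugeCov T μ y)
        (compAt _ f (fieldStrength n T a)) := by
  induction l with
  | nil =>
    rw [List.foldr_nil, F4_eq]
    exact basisMatrix_map T _ _
  | cons μ l ih =>
    rw [List.foldr_cons, ih, covDeriv, gaugePotential_eq, basisMatrix_comm T fun c e => mul_comm _ _]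
    have h1 := basisMatrix_map T (totalDeriv ℂ (deg4 κ) μ).toLinearMap fun a =>
      l.foldr (fun μ y => gaugeCov T μ y) (compAt _ f (fieldStrength n T a))
    refine (congrArg (· + _) h1).trans ?_
    rw [← basisMatrix_add]
    congr 1
    funext a
    rw [List.foldr_cons, gaugeCov_apply, sub_eq_add_neg, ← sum_neg_distrib, sum_comm]
    refine congrArg (_ + ·) (sum_congr rfl fun e _ => ?_)
    have h2 := adjointAction_foldr_gaugeCov T (T e) (Sum.inl a) f l
    rw [sum_gaugeRotations_coeff] at h2
    change adjointAction T n (T e) (l.foldr _ (compAt _ f (fieldStrength n T a))) = _ at h2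
    rw [h2, mul_sum, ← sum_neg_distrib]
    refine sum_congr rfl fun c _ => ?_
    rw [lieMatrix_antisymm, neg_smul, mul_smul_comm]
    rfl

theorem foldr_gaugeCov_H4 (f : Module.Dual ℂ (ConstForm ℂ n)) (l : List (Fin n)) :
    l.foldr (fun μ y => gaugeCov T μ y) (compAt _ f (H4 n T)) =
      l.foldr (fun μ y => totalDeriv ℂ (deg4 κ) μ y) (component ℂ (deg4 κ) f (H4 n T)) := by
  induction l with
  | nil => rfl
  | cons μ l ih =>
    rw [List.foldr_cons, List.foldr_cons, ← ih, gaugeCov_apply, sum_eq_zero, sub_zero]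
    intro e _
    have h := adjointAction_foldr_gaugeCov T (T e) (Sum.inr ()) f l
    rw [sum_gaugeRotations_coeff_inr] at h
    exact (congrArg _ h).trans (mul_zero _)

/-- The polynomials in the curvatures and their covariant derivatives. -/
theorem curvatureAlgebra4_eq : curvatureAlgebra4 n T = (gaugeCovariantCurvatures T).alg := by
  apply le_antisymm
  · refine sup_le (Algebra.adjoin_le ?_) (Algebra.adjoin_le ?_)
    · rintro _ ⟨f, l, i, j, rfl⟩
      rw [foldr_covDeriv_eq]
      exact basisMatrix_mem T (S := Subalgebra.toSubmodule (gaugeCovariantCurvatures T).alg)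
        (fun a => Algebra.subset_adjoin ⟨Sum.inl a, f, l, rfl⟩) i j
    · rintro _ ⟨H, rfl, f, l, rfl⟩
      rw [← foldr_gaugeCov_H4]
      exact Algebra.subset_adjoin ⟨Sum.inr (), f, l, rfl⟩
  · refine Algebra.adjoin_le ?_
    rintro _ ⟨a | a, f, l, rfl⟩
    · obtain ⟨c, hc⟩ := exists_coeffs_basisMatrix T
      have e := hc (fun a => l.foldr (fun μ y => gaugeCov T μ y)
        (compAt _ f (fieldStrength n T a))) a
      rw [← foldr_covDeriv_eq] at e
      refine (congrArg (· ∈ curvatureAlgebra4 n T) e).mp (sum_mem fun i _ => sum_mem fun j _ =>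
        Subalgebra.smul_mem _ ((le_sup_left : _ ≤ curvatureAlgebra4 n T)
          (Algebra.subset_adjoin ⟨f, l, i, j, rfl⟩)) _)
    · have e := foldr_gaugeCov_H4 T f l
      refine (congrArg (· ∈ curvatureAlgebra4 n T) e).mpr ((le_sup_right : _ ≤ curvatureAlgebra4 n T)
        (Algebra.subset_adjoin ⟨_, rfl, f, l, rfl⟩))

/-- The curvatures of the Yang-Mills fields and of the two-form are covariant curvatures, the rotations
being the constant gauge transformations. -/
theorem invariantCohomology_inv4 :
    InvariantCohomologyInSmallAlgebra ℂ (deg4 κ) (inv4 n T) := by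
  refine (gaugeCovariantCurvatures T).invariantCohomology ?_ fun x => ?_
  · rintro (a | a)
    exacts [le_rfl, one_le_two]
  · rw [← curvatureAlgebra4_eq]
    rfl

end YangMills

/-! ### Abelian invariants with one free field -/

section FreeField

open MvPolynomial

variable {K : Type*} [Field K] {n : ℕ} {ι : Type*} {deg : ι → ℕ}

theorem degProj_mul_comm (k q : ℕ) (x y : ConstForm K n) :
    degProj k x * degProj q y = (-1 : K) ^ (k * q) • (degProj q y * degProj k x) := by
  induction y using constForm_induction generalizing q with
  | one =>
    rw [degProj_one]
    split_ifs with h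
    · simp [h]
    · simp
  | add y z hy hz => simp only [map_add, mul_add, add_mul, hy, hz, smul_add]
  | smul c y hy => rw [map_smul, mul_smul_comm, smul_mul_assoc, hy, smul_comm]
  | dx_mul μ y hy =>
    cases q with
    | zero => simp [degProj_zero_dx_mul]
    | succ q =>
      have h : degProj k x * dx K μ = (-1 : K) ^ k • (dx K μ * degProj k x) := by
        rw [dx_mul_comm_degProj, smul_smul, ← mul_pow, neg_one_mul, neg_neg, one_pow, one_smul]
      rw [degProj_succ_dx_mul, ← mul_assoc, h, smul_mul_assoc, mul_assoc, hy, mul_smul_comm,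
        smul_smul, ← pow_add, mul_assoc, mul_add, mul_one, add_comm]

theorem mul_comm_of_formProj {k q : ℕ} {ω η : LocalForm K n deg} (hω : formProj _ k ω = ω)
    (hη : formProj _ q η = η) : ω * η = (-1 : K) ^ (k * q) • (η * ω) := by
  rw [← hω, ← hη]
  clear hω hη
  induction ω using TensorProduct.induction_on with
  | zero => simp
  | add ω ω' h h' => simp only [map_add, mul_add, add_mul, h, h', smul_add]
  | tmul x p =>
    induction η using TensorProduct.induction_on with
    | zero => simp
    | add η η' h h' => simp only [map_add, mul_add, add_mul, h, h', smul_add]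
    | tmul y r =>
      rw [formProj, formProj, TensorProduct.map_tmul, TensorProduct.map_tmul,
        Algebra.TensorProduct.tmul_mul_tmul, Algebra.TensorProduct.tmul_mul_tmul,
        degProj_mul_comm, TensorProduct.smul_tmul', mul_comm (LinearMap.id p)]

/-- Forms in the small algebra may be moved past forms of degree `q`. -/
theorem exists_mul_comm (q : ℕ) {ω : LocalForm K n deg} (hω : ω ∈ smallAlgebra K deg) :
    ∃ ω' ∈ smallAlgebra K deg, ∀ η : LocalForm K n deg, formProj _ q η = η →
      ω * η = η * ω' := by
  refine ⟨∑ k ∈ Finset.range (n + 1), (-1 : K) ^ (k * q) • formProj _ k ω,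
    sum_mem fun k _ => Subalgebra.smul_mem _ (formProj_mem_smallAlgebra k hω) _, fun η hη => ?_⟩
  conv_lhs => rw [← sum_formProj ω]
  rw [sum_mul, mul_sum]
  refine sum_congr rfl fun k _ => ?_
  rw [mul_smul_comm]
  exact mul_comm_of_formProj (by rw [formProj_formProj, if_pos rfl]) hη

theorem formProj_formDer (D : Derivation K (JetPoly K n deg) (JetPoly K n deg)) (k : ℕ)
    (ω : LocalForm K n deg) : formProj _ k (formDer D ω) = formDer D (formProj _ k ω) := by
  rw [formProj, formDer, map_map_apply, map_map_apply]
  rfl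

/-- Forms `ω` in the small algebra have partial derivatives with respect to the form `B` and its
differential which are again in the small algebra. -/
theorem exists_partial_derivatives (b : ι) {ω : LocalForm K n deg} (hω : ω ∈ smallAlgebra K deg) :
    ∃ β ∈ smallAlgebra K deg, ∃ γ ∈ smallAlgebra K deg,
      ∀ D : Derivation K (JetPoly K n deg) (JetPoly K n deg),
        (∀ a, a ≠ b → formDer D (fieldForm K deg a) = 0 ∧
          formDer D (extD K deg (fieldForm K deg a)) = 0) →
        formDer D ω = formDer D (fieldForm K deg b) * β +
          formDer D (extD K deg (fieldForm K deg b)) * γ := by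
  classical
  induction hω using Algebra.adjoin_induction with
  | mem x hx =>
    rcases hx with (⟨μ, rfl⟩ | ⟨a, rfl⟩) | ⟨a, rfl⟩
    · refine ⟨0, zero_mem _, 0, zero_mem _, fun D _ => ?_⟩
      rw [formDer_tmul, Derivation.map_one_eq_zero, TensorProduct.tmul_zero]
      simp
    · by_cases h : a = b
      · subst h
        exact ⟨1, one_mem _, 0, zero_mem _, fun D _ => by rw [mul_one, mul_zero, add_zero]⟩
      · exact ⟨0, zero_mem _, 0, zero_mem _, fun D hD => by
          rw [(hD a h).1, mul_zero, mul_zero, add_zero]⟩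
    · by_cases h : a = b
      · subst h
        exact ⟨0, zero_mem _, 1, one_mem _, fun D _ => by rw [mul_one, mul_zero, zero_add]⟩
      · exact ⟨0, zero_mem _, 0, zero_mem _, fun D hD => by
          rw [(hD a h).2, mul_zero, mul_zero, add_zero]⟩
  | algebraMap r =>
    refine ⟨0, zero_mem _, 0, zero_mem _, fun D _ => ?_⟩
    rw [Algebra.algebraMap_eq_smul_one, map_smul, formDer_one]
    simp
  | add x y _ _ hx hy =>
    obtain ⟨β, hβ, γ, hγ, h⟩ := hx
    obtain ⟨β', hβ', γ', hγ', h'⟩ := hy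
    exact ⟨β + β', add_mem hβ hβ', γ + γ', add_mem hγ hγ', fun D hD => by
      rw [map_add, h D hD, h' D hD]; noncomm_ring⟩
  | mul x y hxA hyA hx hy =>
    obtain ⟨β, hβ, γ, hγ, h⟩ := hx
    obtain ⟨β', hβ', γ', hγ', h'⟩ := hy
    obtain ⟨x₀, hx₀, e₀⟩ := exists_mul_comm (deg b) hxA
    obtain ⟨x₁, hx₁, e₁⟩ := exists_mul_comm (deg b + 1) hxA
    refine ⟨β * y + x₀ * β', add_mem (mul_mem hβ hyA) (mul_mem hx₀ hβ'), γ * y + x₁ * γ',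
      add_mem (mul_mem hγ hyA) (mul_mem hx₁ hγ'), fun D hD => ?_⟩
    rw [formDer_mul, h D hD, h' D hD, mul_add x, ← mul_assoc x, ← mul_assoc x,
      e₀ _ (by rw [formProj_formDer, formProj_fieldForm]),
      e₁ _ (by rw [formProj_formDer, formProj_extD_fieldForm])]
    noncomm_ring

/-- A form of degree `k` has coefficients in `N` if all its products with constant forms of degree
`q ≤ n - k` have. -/
theorem mem_formsIn_of_degProj_mul [CharZero K] {N : Submodule K (JetPoly K n deg)} {k : ℕ}
    {ω : LocalForm K n deg} (hω : formProj _ k ω = ω) (q : ℕ) (hk : k + q ≤ n)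
    (h : ∀ s : ConstForm K n, (degProj q s ⊗ₜ[K] (1 : JetPoly K n deg)) * ω ∈ FormsIn N) :
    ω ∈ FormsIn N := by
  induction q with
  | zero =>
    have h1 := h 1
    rwa [degProj_one, if_pos rfl, ← Algebra.TensorProduct.one_def, one_mul] at h1
  | succ q ih =>
    refine ih (by omega) fun s => ?_
    set η := (degProj q s ⊗ₜ[K] (1 : JetPoly K n deg)) * ω with hη
    have hdeg : formProj _ (q + k) η = η := formProj_mul_of_eq
      (by rw [formProj, TensorProduct.map_tmul, degProj_degProj, if_pos rfl]; rfl) hω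
    have hmem : ∀ μ, (dx K μ ⊗ₜ[K] (1 : JetPoly K n deg)) * η ∈ FormsIn N := fun μ => by
      have h1 := h (dx K μ * s)
      rwa [degProj_succ_dx_mul, ← one_mul (1 : JetPoly K n deg),
        ← Algebra.TensorProduct.tmul_mul_tmul, mul_assoc] at h1
    have hsum : ∑ μ, TensorProduct.map (contract μ) LinearMap.id
        ((dx K μ ⊗ₜ[K] (1 : JetPoly K n deg)) * η) = ((n : K) - (q + k : ℕ)) • η := by
      rw [← hdeg]
      generalize η = η
      induction η using TensorProduct.induction_on with
      | zero => simp
      | add x y hx hy => simp only [map_add, mul_add, sum_add_distrib, hx, hy, smul_add]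
      | tmul x p =>
        simp only [formProj, TensorProduct.map_tmul, Algebra.TensorProduct.tmul_mul_tmul,
          contract_dx_mul, if_true, one_mul, LinearMap.id_apply, TensorProduct.sub_tmul,
          sum_sub_distrib, Finset.sum_const, Finset.card_univ, Fintype.card_fin]
        rw [← TensorProduct.sum_tmul, ← numberOp_apply, numberOp_degProj, ← TensorProduct.smul_tmul',
          ← Nat.cast_smul_eq_nsmul K n]
        exact (sub_smul _ _ _).symm
    have hne : (n : K) - (q + k : ℕ) ≠ 0 := by
      rw [sub_ne_zero]
      exact_mod_cast (by omega : n ≠ q + k)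
    rw [← inv_smul_smul₀ hne η, ← hsum]
    exact Submodule.smul_mem _ _ (Submodule.sum_mem _ fun μ _ =>
      map_mem_formsIn _ (fun _ hm => hm) (hmem μ))

theorem formProj_mul_left {q : ℕ} {x : LocalForm K n deg} (hx : formProj _ q x = x) (k : ℕ)
    (ω : LocalForm K n deg) : formProj _ (q + k) (x * ω) = x * formProj _ k ω := by
  conv_lhs => rw [← sum_formProj ω, mul_sum, map_sum]
  conv_rhs => rw [← sum_formProj ω, map_sum, mul_sum]
  refine sum_congr rfl fun j _ => ?_
  have hj : formProj (JetPoly K n deg) j (formProj _ j ω) = formProj _ j ω := by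
    rw [formProj_formProj, if_pos rfl]
  rw [formProj_one_form _ _ (formProj_mul_of_eq hx hj), formProj_one_form _ _ hj]
  by_cases h : j = k
  · rw [if_pos (by omega), if_pos h]
  · rw [if_neg (by omega), if_neg h, mul_zero]

theorem formProj_mul_left_of_lt {q k : ℕ} {x : LocalForm K n deg} (hx : formProj _ q x = x)
    (hk : k < q) (ω : LocalForm K n deg) : formProj _ k (x * ω) = 0 := by
  rw [← sum_formProj ω, mul_sum, map_sum]
  refine sum_eq_zero fun j _ => ?_
  rw [formProj_one_form _ _ (formProj_mul_of_eq hx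
    (by rw [formProj_formProj, if_pos rfl] : formProj _ j (formProj _ j ω) = formProj _ j ω)),
    if_neg (by omega)]

theorem formProj_mem_of_dx_mul [CharZero K] {N : Submodule K (JetPoly K n deg)} {k p : ℕ}
    {ω : LocalForm K n deg} (hk : k + (p + 1) ≤ n)
    (h : ∀ μ (s : ConstForm K n),
      ((dx K μ * degProj p s) ⊗ₜ[K] (1 : JetPoly K n deg)) * ω ∈ FormsIn N) :
    formProj _ k ω ∈ FormsIn N := by
  refine mem_formsIn_of_degProj_mul (by rw [formProj_formProj, if_pos rfl]) (p + 1) hk fun s => ?_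
  rw [← formProj_mul_left (q := p + 1)
    (by rw [formProj, TensorProduct.map_tmul, degProj_degProj, if_pos rfl]; rfl)]
  refine formProj_mem_formsIn _ ?_
  induction s using constForm_induction with
  | one => rw [degProj_one, if_neg (by omega), TensorProduct.zero_tmul, zero_mul]; exact zero_mem _
  | add x y hx hy =>
    rw [map_add, TensorProduct.add_tmul, add_mul]
    exact Submodule.add_mem _ hx hy
  | smul c x hx =>
    rw [map_smul, ← TensorProduct.smul_tmul', smul_mul_assoc]
    exact Submodule.smul_mem _ _ hx
  | dx_mul μ x _ => rw [degProj_succ_dx_mul]; exact h μ x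

/-- The derivative with respect to the derivatives `∂^α` of the components of the field `b` along
the constant form `s`. -/
def jetDer (b : ι) (s : ConstForm K n) (α : Fin n →₀ ℕ) :
    Derivation K (JetPoly K n deg) (JetPoly K n deg) :=
  (Finsupp.lapply (R := JetPoly K n deg) α).compDer (polarAt b s)

theorem jetDer_apply (b : ι) (s : ConstForm K n) (α : Fin n →₀ ℕ) (x : JetPoly K n deg) :
    jetDer b s α x = polarAt b s x α := rfl

theorem jetD_apply_zero (μ : Fin n) (y : JetModule n (JetPoly K n deg)) :
    jetD (totalD K deg) μ y 0 = totalDeriv K deg μ (y 0) := by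
  classical
  induction y using jetModule_induction with
  | add x y hx hy => simp only [map_add, Finsupp.add_apply, hx, hy]
  | single α m =>
    rw [jetD_single, Finsupp.add_apply, Finsupp.single_apply, if_neg (by simp), zero_add,
      Finsupp.single_apply, Finsupp.single_apply]
    split_ifs
    · rfl
    · rw [map_zero]

theorem jetD_apply_single (μ ν : Fin n) (y : JetModule n (JetPoly K n deg)) :
    jetD (totalD K deg) μ y (Finsupp.single ν 1) =
      (if μ = ν then y 0 else 0) + totalDeriv K deg μ (y (Finsupp.single ν 1)) := by
  classical
  induction y using jetModule_induction with
  | add x y hx hy => simp only [map_add, Finsupp.add_apply, hx, hy]; split_ifs <;> abel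
  | single α m =>
    rw [jetD_single, Finsupp.add_apply]
    congr 1
    · by_cases hα : α = 0
      · subst hα
        rw [zero_add, Finsupp.single_eq_same, Finsupp.single_apply]
        simp only [Finsupp.single_left_inj one_ne_zero]
      · rw [Finsupp.single_apply, if_neg, Finsupp.single_apply, if_neg hα, ite_self]
        intro h
        have := congrArg Finsupp.degree h
        rw [map_add, Finsupp.degree_single, Finsupp.degree_single] at this
        exact hα ((Finsupp.degree_eq_zero_iff α).mp (by omega))
    · rw [Finsupp.single_apply, Finsupp.single_apply]
      split_ifs
      · rfl
      · rw [map_zero]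

theorem formDer_jetDer_zero_extD (b : ι) (s : ConstForm K n) (ω : LocalForm K n deg) :
    formDer (jetDer b s 0) (extD K deg ω) = extD K deg (formDer (jetDer b s 0) ω) :=
  formDer_extD (fun μ x => by
    rw [jetDer_apply, polarAt_totalDeriv, jetD_apply_zero, jetDer_apply]) ω

theorem formDer_jetDer_single_extD (b : ι) (s : ConstForm K n) (ν : Fin n)
    (ω : LocalForm K n deg) :
    formDer (jetDer b s (Finsupp.single ν 1)) (extD K deg ω) =
      (dx K ν ⊗ₜ[K] (1 : JetPoly K n deg)) * formDer (jetDer b s 0) ω +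
        extD K deg (formDer (jetDer b s (Finsupp.single ν 1)) ω) := by
  induction ω using TensorProduct.induction_on with
  | zero => simp
  | add x y hx hy => simp only [map_add, mul_add, hx, hy]; abel
  | tmul x p =>
    simp only [extD_eq_koszulD, koszulD_tmul, map_sum, formDer_tmul, jetDer_apply,
      Derivation.coeFn_coe, polarAt_totalDeriv, jetD_apply_single, TensorProduct.tmul_add,
      sum_add_distrib, Algebra.TensorProduct.tmul_mul_tmul, one_mul]
    congr 1
    rw [sum_eq_single ν]
    · rw [if_pos rfl]
    · intro μ _ h; rw [if_neg h, TensorProduct.tmul_zero]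
    · simp

theorem formDer_jetDer_fieldForm (b : ι) (s : ConstForm K n) (α : Fin n →₀ ℕ) :
    formDer (jetDer b s α) (fieldForm K deg b) =
      if α = 0 then degProj (deg b) s ⊗ₜ[K] (1 : JetPoly K n deg) else 0 := by
  classical
  refine form_ext fun f => ?_
  rw [compAt_formDer, jetDer_apply, polarAt_compAt_fieldForm, Finsupp.smul_apply,
    Finsupp.single_apply]
  by_cases h : α = 0
  · rw [if_pos h.symm, if_pos h, compAt_tmul]
  · rw [if_neg (Ne.symm h), if_neg h, map_zero, smul_zero]

theorem formDer_jetDer_fieldForm_of_ne {a b : ι} (h : a ≠ b) (s : ConstForm K n)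
    (α : Fin n →₀ ℕ) : formDer (jetDer b s α) (fieldForm K deg a) = 0 := by
  refine form_ext fun f => ?_
  rw [compAt_formDer, jetDer_apply, polarAt_compAt_fieldForm_of_ne h, map_zero]
  rfl

/-- The weight counting the field `b`. -/
def countWeight (b : ι) : JetVar n deg → ℕ :=
  open Classical in jetWeight (fun a => if a = b then 1 else 0) 0

/-- The derivation counting the field `b`. -/
def countDer (b : ι) : Derivation K (JetPoly K n deg) (JetPoly K n deg) :=
  mkDerivation K fun v => (countWeight b v : K) • (X v : JetPoly K n deg)

theorem formDer_countDer {b : ι} {m : ℕ} {ω : LocalForm K n deg}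
    (h : ω ∈ FormsIn (weightedHomogeneousSubmodule K (countWeight b) m)) :
    formDer (countDer b) ω = (m : K) • ω := by
  refine form_ext fun f => ?_
  rw [compAt_formDer, map_smul]
  exact mkDerivation_weight_smul (h f)

/-- An abelian invariant form of positive degree in the field `b`, closed and in the small algebra,
is the differential of such a form if its form degree is smaller than `n`: if `β` and `γ` are its
partial derivatives with respect to `B` and `dB`, then it is a multiple of `d(Bγ)`, up to the
product of `B` with a form which vanishes in degrees below `n - deg b`. -/
theorem exists_smallAlgebra_primitive [CharZero K] {kind : ι → FieldKind} {b : ι}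
    (hb : kind b = .free) {m : ℕ} (hm : m ≠ 0) {ω : LocalForm K n deg}
    (hI : ω ∈ FormsIn (Subalgebra.toSubmodule (abelianInv K n deg kind)))
    (hA : ω ∈ smallAlgebra K deg) (hbelow : ω ∈ belowTop K n _) (hclosed : extD K deg ω = 0)
    (hω : ω ∈ FormsIn (weightedHomogeneousSubmodule K (countWeight b) m)) :
    ∃ η ∈ FormsIn (Subalgebra.toSubmodule (abelianInv K n deg kind)),
      η ∈ smallAlgebra K deg ∧ ω = extD K deg η := by
  classical
  set B : LocalForm K n deg := fieldForm K deg b with hB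
  obtain ⟨β, hβ, γ, hγ, h⟩ := exists_partial_derivatives b hA
  have hBdeg : formProj _ (deg b) B = B := formProj_fieldForm b
  have hxdeg : ∀ s : ConstForm K n, formProj (JetPoly K n deg) (deg b)
      (degProj (deg b) s ⊗ₜ[K] (1 : JetPoly K n deg)) = degProj (deg b) s ⊗ₜ[K] 1 := fun s => by
    rw [formProj, TensorProduct.map_tmul, degProj_degProj, if_pos rfl]; rfl
  have h0 : ∀ s, formDer (jetDer b s 0) ω =
      (degProj (deg b) s ⊗ₜ[K] (1 : JetPoly K n deg)) * β := fun s => by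
    rw [h _ fun a ha => ⟨formDer_jetDer_fieldForm_of_ne ha _ _, by
      rw [formDer_jetDer_zero_extD, formDer_jetDer_fieldForm_of_ne ha, map_zero]⟩,
      formDer_jetDer_zero_extD, formDer_jetDer_fieldForm, if_pos rfl, extD_tmul_one, zero_mul,
      add_zero]
  have h1 : ∀ μ s, formDer (jetDer b s (Finsupp.single μ 1)) ω =
      ((dx K μ * degProj (deg b) s) ⊗ₜ[K] (1 : JetPoly K n deg)) * γ := fun μ s => by
    rw [h _ fun a ha => ⟨formDer_jetDer_fieldForm_of_ne ha _ _, by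
      rw [formDer_jetDer_single_extD, formDer_jetDer_fieldForm_of_ne ha,
        formDer_jetDer_fieldForm_of_ne ha, map_zero, mul_zero, add_zero]⟩,
      formDer_jetDer_single_extD, formDer_jetDer_fieldForm, formDer_jetDer_fieldForm, if_pos rfl,
      if_neg (by simp), zero_mul, zero_add, map_zero, add_zero,
      Algebra.TensorProduct.tmul_mul_tmul, one_mul]
  set ε := β - (-1 : K) ^ deg b • extD K deg γ with hε
  have hEuler : (m : K) • ω = B * ε + extD K deg (B * γ) := by
    have hcount : ∀ a, formDer (countDer b) (fieldForm K deg a : LocalForm K n deg) =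
        ((if a = b then 1 else 0 : ℕ) : K) • fieldForm K deg a :=
      fun a => formDer_countDer (fieldForm_mem_homogeneous _ 0 a)
    have hcount' : ∀ a, formDer (countDer b) (extD K deg (fieldForm K deg a : LocalForm K n deg)) =
        ((if a = b then 1 else 0 : ℕ) : K) • extD K deg (fieldForm K deg a) :=
      fun a => formDer_countDer (extD_mem_homogeneous (fieldForm_mem_homogeneous _ 0 a))
    rw [← formDer_countDer hω, h _ fun a ha => by
      rw [hcount, hcount', if_neg ha, Nat.cast_zero, zero_smul, zero_smul]; exact ⟨rfl, rfl⟩,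
      hcount, hcount', if_pos rfl, Nat.cast_one, one_smul, one_smul, extD_mul hBdeg, hε, mul_sub,
      mul_smul_comm]
    abel
  have hε0 : ∀ k, k + (deg b + 1) ≤ n → formProj _ k ε = 0 := by
    intro k hk
    refine form_ext fun f => ?_
    rw [map_zero]
    refine (Submodule.mem_bot K).mp (formProj_mem_of_dx_mul hk (fun μ s => ?_) f)
    have h2 := formDer_jetDer_single_extD b s μ ω
    rw [hclosed, map_zero, h0, h1, extD_mul (k := deg b + 1)
      (by rw [formProj, TensorProduct.map_tmul, degProj_succ_dx_mul, degProj_degProj, if_pos rfl]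
          rfl), extD_tmul_one, zero_mul, zero_add, ← mul_assoc,
      Algebra.TensorProduct.tmul_mul_tmul, one_mul, pow_succ', mul_smul, neg_one_smul_form,
      ← sub_eq_add_neg] at h2
    rw [hε, mul_sub, mul_smul_comm, ← h2]
    exact zero_mem _
  have hγI : ∀ k, k + (deg b + 1) ≤ n →
      formProj _ k γ ∈ FormsIn (Subalgebra.toSubmodule (abelianInv K n deg kind)) := by
    intro k hk
    refine formProj_mem_of_dx_mul hk fun μ s f => ?_
    rw [← h1, compAt_formDer]
    exact polarAt_mem_jetsIn b s (hI f) _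
  have hBI : B ∈ FormsIn (Subalgebra.toSubmodule (abelianInv K n deg kind)) := fun f => by
    rw [hB, compAt_fieldForm]
    exact Submodule.sum_mem _ fun T _ => Submodule.smul_mem _ _ (jetVar_mem_abelianInv hb T 0)
  cases n with
  | zero => exact ⟨0, zero_mem _, zero_mem _, by
      rw [formProj_zero_of_belowTop hbelow, map_zero]⟩
  | succ N =>
    have hBε : ∀ j < N + 1, formProj _ j (B * ε) = 0 := by
      intro j hj
      by_cases hjb : j < deg b
      · exact formProj_mul_left_of_lt hBdeg hjb ε
      · obtain ⟨k, rfl⟩ := Nat.exists_eq_add_of_le (not_lt.mp hjb)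
        rw [formProj_mul_left hBdeg, hε0 k (by omega), mul_zero]
    refine ⟨(m : K)⁻¹ • ∑ j ∈ Finset.range N, formProj _ j (B * γ),
      Submodule.smul_mem _ _ (Submodule.sum_mem _ fun j hj => ?_),
      Subalgebra.smul_mem _ (sum_mem fun j _ => formProj_mem_smallAlgebra j
        (mul_mem (fieldForm_mem_smallAlgebra b) hγ)) _, ?_⟩
    · have := Finset.mem_range.mp hj
      by_cases hjb : j < deg b
      · rw [formProj_mul_left_of_lt hBdeg hjb]; exact zero_mem _
      · obtain ⟨k, rfl⟩ := Nat.exists_eq_add_of_le (not_lt.mp hjb)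
        rw [formProj_mul_left hBdeg]
        exact mul_mem_formsIn (fun _ hx _ hy => (abelianInv K _ deg kind).mul_mem hx hy) hBI (hγI k (by omega))
    · have hm' : (m : K) ≠ 0 := Nat.cast_ne_zero.mpr hm
      rw [map_smul, eq_inv_smul_iff₀ hm', map_sum]
      conv_lhs => rw [← sum_formProj_of_mem_belowTop hbelow]
      rw [smul_sum, Finset.sum_range_succ', ← map_smul, hEuler, map_add,
        hBε 0 (by omega), extD_eq_koszulD, formProj_zero_koszulD, add_zero, add_zero]
      refine sum_congr rfl fun j hj => ?_
      have := Finset.mem_range.mp hj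
      rw [← map_smul, hEuler, map_add, hBε (j + 1) (by omega), zero_add, extD_eq_koszulD,
        formProj_succ_koszulD, extD_eq_koszulD]

theorem mem_orderGE_add {σ : Type*} {u u' : σ → ℤ} {m m' : ℤ} {x : MvPolynomial σ K}
    (h : x ∈ orderGE u m) (h' : x ∈ orderGE u' m') :
    x ∈ orderGE (fun v => u v + u' v) (m + m') := fun s hs => by
  have e : Finsupp.weight (fun v => u v + u' v) s = Finsupp.weight u s + Finsupp.weight u' s := by
    simp only [Finsupp.weight_apply, Finsupp.sum, smul_add, sum_add_distrib]
  rw [e]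
  exact add_le_add (h s hs) (h' s hs)

/-- The invariant cohomology of abelian curvatures, if there is exactly one free field. -/
theorem invariantCohomology_abelianInv [Fintype ι] [CharZero K] {kind : ι → FieldKind}
    (hdeg : ∀ a, 1 ≤ deg a) {b : ι} (hb : ∀ a, kind a = .free ↔ a = b) :
    InvariantCohomologyInSmallAlgebra K deg (abelianInv K n deg kind) := by
  classical
  have hcomp : ∀ (u : ι → ℕ) (k : ℕ) (ω : LocalForm K n deg),
      ω ∈ FormsIn (Subalgebra.toSubmodule (abelianInv K n deg kind)) →
      weightProj (jetWeight u 0) k ω ∈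
        FormsIn (Subalgebra.toSubmodule (abelianInv K n deg kind)) := fun u k ω hω =>
    map_mem_formsIn _ (fun x hx => weightedHomogeneousComponent_mem_abelianInv u 0 k hx) hω
  have hhom : ∀ (w : JetVar n deg → ℕ) (k : ℕ) (ω : LocalForm K n deg),
      weightProj w k ω ∈ FormsIn (weightedHomogeneousSubmodule K w k) := fun w k ω f => by
    rw [compAt_weightProj]
    exact weightedHomogeneousComponent_isWeightedHomogeneous _ _
  refine invariantCohomologyInSmallAlgebra_of (fun P hP hbelow hclosed => ?_)
    fun S hS hSb hdSI hdSA hdSb => ?_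
  · have key : ∀ k, ∃ Q ∈ FormsIn (Subalgebra.toSubmodule (abelianInv K n deg kind)),
        ∃ R ∈ FormsIn (Subalgebra.toSubmodule (abelianInv K n deg kind)),
          Q ∈ smallAlgebra K deg ∧ weightProj fieldCount k P = Q + extD K deg R := by
      intro k
      have hPk : weightProj fieldCount k P ∈
          FormsIn (abelianPart (noRotations : FieldRotations K n deg kind Empty) k) :=
        fun f => ⟨⟨hcomp _ k P hP f, hhom _ k P f⟩, fun ε => ε.elim⟩
      obtain ⟨Q, hQ, R, hR, hQA, -, -, e⟩ := exists_abelian_representative_of_form noRotations hdeg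
        hPk (map_id_mem_belowTop _ hbelow) (by
          have := weightProj_extD (fun _ => 1) 0 k P
          rw [hclosed, map_zero] at this
          exact this.symm)
      exact ⟨Q, fun f => (hQ f).1.1, R, fun f => (hR f).1.1, closedAlgebra_le_smallAlgebra hQA, e⟩
    choose Q hQ R hR hQA e using key
    obtain ⟨C, hC⟩ := exists_sum_weightProj fieldCount P
    refine ⟨∑ k ∈ Finset.range C, Q k, Submodule.sum_mem _ fun k _ => hQ k,
      ∑ k ∈ Finset.range C, R k, Submodule.sum_mem _ fun k _ => hR k, sum_mem fun k _ => hQA k, ?_⟩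
    rw [map_sum, ← sum_add_distrib, ← hC C le_rfl]
    exact sum_congr rfl fun k _ => e k
  · have key : ∀ k, ∃ S' ∈ FormsIn (Subalgebra.toSubmodule (abelianInv K n deg kind)),
        S' ∈ smallAlgebra K deg ∧
          weightProj (countWeight b) k (extD K deg S) = extD K deg S' := by
      intro k
      have hd := weightProj_extD (fun a => if a = b then 1 else 0) 0 k S
      change weightProj (countWeight b) k (extD K deg S) =
        extD K deg (weightProj (countWeight b) k S) at hd
      have hA : weightProj (countWeight b) k (extD K deg S) ∈ smallAlgebra K deg :=
        weightProj_mem_smallAlgebra _ 0 k hdSA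
      by_cases hk : k = 0
      · -- without the free field, the differential of an invariant has too many derivatives for the
        -- small algebra
        subst hk
        refine ⟨0, zero_mem _, zero_mem _, ?_⟩
        rw [map_zero]
        refine form_ext fun f => ?_
        rw [map_zero]
        have h1 : weightProj (countWeight b) 0 (extD K deg S) ∈
            FormsIn (orderGE (excess fun a => a ≠ b) (0 + 1)) := by
          rw [hd]
          exact extD_mem_orderGE_excess fun f => abelianInv_le_orderGE
            (fun a ha => by rw [(hb a).mp ha]; simp) (hcomp _ 0 S hS f)
        refine eq_zero_of_mem_orderGE (fun v => ?_) (by norm_num) (mem_orderGE_add (h1 f)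
          (mem_orderGE_neg_of_isWeightedHomogeneous (hhom (countWeight b) 0 _ f)))
          (smallAlgebra_le_orderGE hA f)
        by_cases h : v.1.1 = b
        · simp only [excess, countWeight, jetWeight, h]
          simp
          omega
        · simp [excess, countWeight, jetWeight, h]
      · exact exists_smallAlgebra_primitive ((hb b).mpr rfl) hk (hcomp _ k _ hdSI) hA
          (map_id_mem_belowTop _ hdSb) (by rw [hd, extD_extD]) (hhom _ k _)
    choose S' hS' hSA' e using key
    obtain ⟨C, hC⟩ := exists_sum_weightProj (countWeight b) (extD K deg S)
    refine ⟨∑ k ∈ Finset.range C, S' k, Submodule.sum_mem _ fun k _ => hS' k,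
      sum_mem fun k _ => hSA' k, ?_⟩
    rw [map_sum, ← hC C le_rfl]
    exact sum_congr rfl fun k _ => e k

end FreeField

/-! ### Substitution of fields and the models with a shift symmetry -/

section Substitution

open MvPolynomial

variable {K : Type*} [Field K] {n : ℕ} {ι : Type*} {deg : ι → ℕ}

/-- The substitution of the form `β a` for the field `a`: the algebra homomorphism commuting with
the total derivatives which maps the components of the fields to those of the forms `β a`. -/
def substField (β : ι → LocalForm K n deg) : JetPoly K n deg →ₐ[K] JetPoly K n deg :=
  aeval fun v => (multiList v.2).foldr (fun μ y => totalDeriv K deg μ y)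
    (compAt _ ((dxBasis K n).coord v.1.2.1) (β v.1.1))

theorem substField_X (β : ι → LocalForm K n deg) (v : JetVar n deg) :
    substField β (X v) = (multiList v.2).foldr (fun μ y => totalDeriv K deg μ y)
      (compAt _ ((dxBasis K n).coord v.1.2.1) (β v.1.1)) := aeval_X _ _

theorem foldr_totalDeriv_multiIndex (l : List (Fin n)) (x : JetPoly K n deg) :
    (multiList (multiIndex l)).foldr (fun μ y => totalDeriv K deg μ y) x =
      l.foldr (fun μ y => totalDeriv K deg μ y) x := by
  rw [← sub_eq_zero, ← Submodule.mem_bot K]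
  refine foldr_perm_congr (D := fun μ => (totalDeriv K deg μ).toLinearMap) (N := ⊤)
    (fun _ _ _ => trivial) (fun μ x hx => ?_) (fun μ ν x _ => ?_)
    (perm_of_multiIndex_eq (multiIndex_multiList _)) trivial
  · rw [(Submodule.mem_bot K).mp hx, map_zero]; exact zero_mem _
  · rw [Submodule.mem_bot, sub_eq_zero]; exact totalDeriv_comm μ ν x

theorem substField_totalDeriv (β : ι → LocalForm K n deg) (μ : Fin n) (x : JetPoly K n deg) :
    substField β (totalDeriv K deg μ x) = totalDeriv K deg μ (substField β x) := by
  induction x using MvPolynomial.induction_on with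
  | C c => rw [derivation_C, map_zero, algHom_C]; exact (Derivation.map_algebraMap _ _).symm
  | add p q hp hq => simp only [map_add, hp, hq]
  | mul_X p v hp =>
    have hX : substField β (totalDeriv K deg μ (X v)) =
        totalDeriv K deg μ (substField β (X v : JetPoly K n deg)) := by
      rw [totalDeriv_X, substField_X, substField_X]
      have h : multiIndex (μ :: multiList v.2) = v.2 + Finsupp.single μ 1 := by
        rw [multiIndex_cons, multiIndex_multiList, add_comm]
      rw [← h, foldr_totalDeriv_multiIndex, List.foldr_cons]
    simp only [Derivation.leibniz, smul_eq_mul, map_add, map_mul, hX, hp]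

theorem substField_foldr (β : ι → LocalForm K n deg) (l : List (Fin n)) (x : JetPoly K n deg) :
    substField β (l.foldr (fun μ y => totalDeriv K deg μ y) x) =
      l.foldr (fun μ y => totalDeriv K deg μ y) (substField β x) := by
  induction l with
  | nil => rfl
  | cons μ l ih => rw [List.foldr_cons, List.foldr_cons, substField_totalDeriv, ih]

theorem formMap_substField_extD (β : ι → LocalForm K n deg) (ω : LocalForm K n deg) :
    formMap (substField β) (extD K deg ω) = extD K deg (formMap (substField β) ω) := by
  refine form_ext fun f => ?_
  rw [compAt_formMap, compAt_extD, compAt_extD, map_sum]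
  exact sum_congr rfl fun μ _ => by rw [substField_totalDeriv, compAt_formMap]

theorem formMap_substField_fieldForm {β : ι → LocalForm K n deg} {a : ι}
    (hβ : formProj _ (deg a) (β a) = β a) :
    formMap (substField β) (fieldForm K deg a) = β a := by
  have hlist : multiList (0 : Fin n →₀ ℕ) = [] :=
    (perm_of_multiIndex_eq (l' := []) (multiIndex_multiList 0)).eq_nil
  conv_rhs => rw [← hβ, ← sum_dxSet_tmul_compAt (β a), map_sum]
  rw [fieldForm_eq_sum, map_sum]
  refine sum_congr rfl fun T _ => ?_
  rw [formMap_tmul, formProj, TensorProduct.map_tmul, degProj_dxSet]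
  by_cases hT : T.card = deg a
  · rw [jetVar_of_card hT, if_pos hT, substField_X, hlist]
    rfl
  · rw [jetVar, dif_neg hT, if_neg hT, map_zero, TensorProduct.tmul_zero, TensorProduct.zero_tmul]

theorem substField_substField {β β' : ι → LocalForm K n deg}
    (h : ∀ a, formMap (substField β') (β a) = fieldForm K deg a) (x : JetPoly K n deg) :
    substField β' (substField β x) = x := by
  have e : (substField β').comp (substField β) = AlgHom.id K _ := by
    refine algHom_ext fun v => ?_
    rw [AlgHom.comp_apply, AlgHom.id_apply, substField_X, substField_foldr, ← compAt_formMap, h, compAt_fieldForm, sum_eq_single v.1.2.1,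
      coord_dxSet, if_pos rfl, one_smul, foldr_totalDeriv_jetVar, multiIndex_multiList, zero_add,
      X_eq_jetVar]
    · intro T _ hT
      rw [coord_dxSet, if_neg hT, zero_smul]
    · simp
  exact DFunLike.congr_fun e x

theorem formMap_substField_mem_smallAlgebra {β : ι → LocalForm K n deg}
    (hdeg : ∀ a, formProj _ (deg a) (β a) = β a) (hβ : ∀ a, β a ∈ smallAlgebra K deg) [CharZero K]
    {ω : LocalForm K n deg} (h : ω ∈ smallAlgebra K deg) :
    formMap (substField β) ω ∈ smallAlgebra K deg := by
  have hle : smallAlgebra K deg ≤ (smallAlgebra K deg).comap (formMap (substField β)) := by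
    refine Algebra.adjoin_le ?_
    rintro _ ((⟨μ, rfl⟩ | ⟨a, rfl⟩) | ⟨a, rfl⟩) <;>
      change formMap (substField β) _ ∈ smallAlgebra K deg
    · rw [formMap_tmul, map_one]; exact dx_mem_smallAlgebra μ
    · rw [formMap_substField_fieldForm (hdeg a)]; exact hβ a
    · rw [formMap_substField_extD, formMap_substField_fieldForm (hdeg a)]
      exact extD_mem_smallAlgebra (hβ a)
  exact hle h

theorem mem_formsIn_of_curv {curv : Set (LocalForm K n deg)} {H : LocalForm K n deg}
    (hH : H ∈ curv) : H ∈ FormsIn (Subalgebra.toSubmodule (curvatureAlgebra K deg curv)) :=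
  fun f => Algebra.subset_adjoin ⟨H, hH, f, [], rfl⟩

theorem substField_mem_curvatureAlgebra {β : ι → LocalForm K n deg}
    {curv curv' : Set (LocalForm K n deg)}
    (h : ∀ H ∈ curv, formMap (substField β) H ∈
      FormsIn (Subalgebra.toSubmodule (curvatureAlgebra K deg curv')))
    {x : JetPoly K n deg} (hx : x ∈ curvatureAlgebra K deg curv) :
    substField β x ∈ curvatureAlgebra K deg curv' := by
  have hle : curvatureAlgebra K deg curv ≤ (curvatureAlgebra K deg curv').comap (substField β) := by
    refine Algebra.adjoin_le ?_
    rintro _ ⟨H, hH, f, l, rfl⟩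
    change substField β _ ∈ curvatureAlgebra K deg curv'
    rw [component_eq_compAt, substField_foldr, ← compAt_formMap]
    induction l with
    | nil => exact h H hH f
    | cons μ l ih => exact totalDeriv_mem_curvatureAlgebra μ ih
  exact hle hx

/-- The invariant cohomology is unaffected by an invertible substitution of fields under which the
curvatures of two models correspond. -/
theorem invariantCohomology_of_substField [CharZero K] {curv curv' : Set (LocalForm K n deg)}
    {β β' : ι → LocalForm K n deg} (hdeg : ∀ a, formProj _ (deg a) (β a) = β a)
    (hdeg' : ∀ a, formProj _ (deg a) (β' a) = β' a) (hβ : ∀ a, β a ∈ smallAlgebra K deg)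
    (hβ' : ∀ a, β' a ∈ smallAlgebra K deg)
    (hinv : ∀ a, formMap (substField β') (β a) = fieldForm K deg a)
    (hcurv : ∀ H ∈ curv, formMap (substField β) H ∈
      FormsIn (Subalgebra.toSubmodule (curvatureAlgebra K deg curv')))
    (hcurv' : ∀ H ∈ curv', formMap (substField β') H ∈
      FormsIn (Subalgebra.toSubmodule (curvatureAlgebra K deg curv)))
    (h : InvariantCohomologyInSmallAlgebra K deg (curvatureAlgebra K deg curv')) :
    InvariantCohomologyInSmallAlgebra K deg (curvatureAlgebra K deg curv) := by
  have hleft : ∀ ω : LocalForm K n deg, formMap (substField β') (formMap (substField β) ω) = ω :=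
    fun ω => form_ext fun f => by
      rw [compAt_formMap, compAt_formMap, substField_substField hinv]
  have hI : ∀ ω ∈ formsWithCoeffs K deg (curvatureAlgebra K deg curv),
      formMap (substField β) ω ∈ formsWithCoeffs K deg (curvatureAlgebra K deg curv') :=
    fun ω hω f => by
      rw [component_eq_compAt, compAt_formMap]
      exact substField_mem_curvatureAlgebra hcurv (hω f)
  have hI' : ∀ ω ∈ formsWithCoeffs K deg (curvatureAlgebra K deg curv'),
      formMap (substField β') ω ∈ formsWithCoeffs K deg (curvatureAlgebra K deg curv) :=
    fun ω hω f => by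
      rw [component_eq_compAt, compAt_formMap]
      exact substField_mem_curvatureAlgebra hcurv' (hω f)
  have hb : ∀ (φ : JetPoly K n deg →ₐ[K] JetPoly K n deg) (ω : LocalForm K n deg),
      ω ∈ formsBelowTop K deg → formMap φ ω ∈ formsBelowTop K deg := fun φ ω hω => by
    rw [mem_formsBelowTop_iff, mem_belowTop] at hω ⊢
    rw [formProj_formMap, hω, map_zero]
  refine ⟨fun P hP hPb => ⟨fun hd => ?_, ?_⟩, ?_⟩
  · obtain ⟨Q, hQ, R, hR, hQA, hQb, hdQ, e⟩ := (h.1 _ (hI P hP) (hb _ P hPb)).mp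
      (by rw [← formMap_substField_extD, hd, map_zero])
    refine ⟨_, hI' Q hQ, _, hI' R hR, formMap_substField_mem_smallAlgebra hdeg' hβ' hQA,
      hb _ Q hQb, by rw [← formMap_substField_extD, hdQ, map_zero], ?_⟩
    rw [← formMap_substField_extD, ← map_add, ← e, hleft]
  · rintro ⟨Q, -, R, -, -, -, hdQ, rfl⟩
    rw [map_add, hdQ, extD_extD, add_zero]
  · rintro Q hQ hQA hQb ⟨S, hS, rfl⟩
    obtain ⟨S', hS', hSA', e⟩ := h.2 _ (hI _ hQ)
      (formMap_substField_mem_smallAlgebra hdeg hβ hQA) (hb _ _ hQb)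
      ⟨_, hI S hS, formMap_substField_extD β S⟩
    exact ⟨_, hI' S' hS', formMap_substField_mem_smallAlgebra hdeg' hβ' hSA', by
      rw [← formMap_substField_extD, ← e, hleft]⟩

end Substitution

section FirstModel

variable (K : Type*) [Field K] (n p : ℕ)

/-- The substitution `B ↦ B + c dA` in the first model. -/
def shift1 (c : K) : Fin 2 → LocalForm K n (deg1 p) :=
  ![fieldForm K (deg1 p) 0, fieldForm K (deg1 p) 1 + c • extD K (deg1 p) (fieldForm K (deg1 p) 0)]

variable {K n p}

theorem formProj_shift1 (c : K) (a : Fin 2) :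
    formProj _ (deg1 p a) (shift1 K n p c a) = shift1 K n p c a := by
  fin_cases a
  · exact formProj_fieldForm (0 : Fin 2)
  · exact formProj_add_of_eq (formProj_fieldForm (1 : Fin 2))
      (formProj_smul_of_eq c (formProj_extD_fieldForm (0 : Fin 2)))

theorem shift1_mem (c : K) (a : Fin 2) : shift1 K n p c a ∈ smallAlgebra K (deg1 p) := by
  fin_cases a
  · exact fieldForm_mem_smallAlgebra (0 : Fin 2)
  · exact add_mem (fieldForm_mem_smallAlgebra (1 : Fin 2))
      (Subalgebra.smul_mem _ (extD_fieldForm_mem_smallAlgebra (0 : Fin 2)) c)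

theorem formMap_shift1 (c : K) (a : Fin 2) :
    formMap (substField (shift1 K n p c)) (fieldForm K (deg1 p) a) = shift1 K n p c a :=
  formMap_substField_fieldForm (formProj_shift1 c a)

theorem formMap_shift1_one (c e : K) :
    formMap (substField (shift1 K n p c))
        (fieldForm K (deg1 p) 1 + e • extD K (deg1 p) (fieldForm K (deg1 p) 0)) =
      fieldForm K (deg1 p) 1 + (c + e) • extD K (deg1 p) (fieldForm K (deg1 p) 0) := by
  rw [map_add, map_smul, formMap_substField_extD, formMap_shift1, formMap_shift1, add_smul,
    ← add_assoc]
  rfl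

/-- The shift of `B` turns the first model into abelian curvatures `B` and `dB`. -/
theorem invariantCohomology_inv1 [CharZero K] (hp : 1 ≤ p) :
    InvariantCohomologyInSmallAlgebra K (deg1 p) (inv1 K n p) := by
  refine invariantCohomology_of_substField (β := shift1 K n p (-1)) (β' := shift1 K n p 1)
    (curv' := abelianCurvatures K n (deg1 p) ![.absent, .free]) (formProj_shift1 _)
    (formProj_shift1 _) (shift1_mem _) (shift1_mem _) (fun a => ?_) ?_ ?_
    (invariantCohomology_abelianInv (b := 1) (fun a => ?_) fun a => ?_)
  · fin_cases a
    · exact formMap_shift1 _ 0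
    · refine (formMap_shift1_one _ _).trans ?_
      rw [add_neg_cancel, zero_smul, add_zero]
      rfl
  · have hB : fieldForm K (deg1 p) 1 ∈ FormsIn (Subalgebra.toSubmodule
        (curvatureAlgebra K (n := n) (deg1 p)
          (abelianCurvatures K n (deg1 p) ![.absent, .free]))) :=
      mem_formsIn_of_curv ⟨1, Or.inl ⟨rfl, rfl⟩⟩
    rintro _ (rfl | rfl)
    · have e := formMap_shift1_one (K := K) (n := n) (p := p) (-1) 1
      rw [neg_add_cancel, zero_smul, add_zero, one_smul, add_comm] at e
      rw [F1, e]
      exact hB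
    · rw [H1, formMap_substField_extD, formMap_shift1]
      change extD K (deg1 p) (fieldForm K (deg1 p) 1 +
        (-1 : K) • extD K (deg1 p) (fieldForm K (deg1 p) 0)) ∈ _
      rw [map_add, map_smul, extD_extD, smul_zero, add_zero]
      exact extD_mem_formsIn (fun μ x hx => totalDeriv_mem_curvatureAlgebra μ hx) hB
  · rintro _ ⟨a, ha⟩
    fin_cases a
    · rcases ha with ⟨h, -⟩ | ⟨h, -⟩ <;> cases h
    · rcases ha with ⟨-, rfl⟩ | ⟨h, -⟩
      · have e : formMap (substField (shift1 K n p 1)) (fieldForm K (deg1 p) 1) = F1 K n p := by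
          rw [formMap_shift1, F1, add_comm]
          change _ + (1 : K) • _ = _
          rw [one_smul]
        exact e ▸ mem_formsIn_of_curv (Or.inl rfl)
      · cases h
  · fin_cases a
    · exact hp
    · exact Nat.le_add_left 1 p
  · fin_cases a <;> simp

end FirstModel

section ThirdModel

variable (K : Type*) [Field K] (n : ℕ)

/-- The substitution `B ↦ B + c dA`, `C ↦ C - c AB - ½ A dA` in the third model. -/
def shift3 (c : K) : Fin 3 → LocalForm K n deg3 :=
  ![fieldForm K deg3 0, fieldForm K deg3 1 + c • extD K deg3 (fieldForm K deg3 0),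
    fieldForm K deg3 2 - c • (fieldForm K deg3 0 * fieldForm K deg3 1) -
      (1 / 2 : K) • (fieldForm K deg3 0 * extD K deg3 (fieldForm K deg3 0))]

variable {K n}

theorem extD_A3_mul (x : LocalForm K n deg3) : extD K deg3 (fieldForm K deg3 0 * x) =
    extD K deg3 (fieldForm K deg3 0) * x - fieldForm K deg3 0 * extD K deg3 x := by
  have h0 : formProj _ 1 (fieldForm K deg3 0 : LocalForm K n deg3) = fieldForm K deg3 0 :=
    formProj_fieldForm (0 : Fin 3)
  rw [extD_mul h0, pow_one, neg_one_smul_form, ← sub_eq_add_neg]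

theorem B3_mul_extD_A3 : (fieldForm K deg3 1 * extD K deg3 (fieldForm K deg3 0) :
    LocalForm K n deg3) = extD K deg3 (fieldForm K deg3 0) * fieldForm K deg3 1 := by
  have h0 : formProj _ 2 (extD K deg3 (fieldForm K deg3 0) : LocalForm K n deg3) =
    extD K deg3 (fieldForm K deg3 0) := formProj_extD_fieldForm (0 : Fin 3)
  have h1 : formProj _ 2 (fieldForm K deg3 1 : LocalForm K n deg3) = fieldForm K deg3 1 :=
    formProj_fieldForm (1 : Fin 3)
  rw [mul_comm_of_formProj h1 h0, Even.neg_one_pow ⟨2, rfl⟩, one_smul]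

theorem formProj_shift3 (c : K) (a : Fin 3) :
    formProj _ (deg3 a) (shift3 K n c a) = shift3 K n c a := by
  have h0 : formProj _ 1 (fieldForm K deg3 0 : LocalForm K n deg3) = fieldForm K deg3 0 :=
    formProj_fieldForm (0 : Fin 3)
  have h1 : formProj _ 2 (fieldForm K deg3 1 : LocalForm K n deg3) = fieldForm K deg3 1 :=
    formProj_fieldForm (1 : Fin 3)
  have h2 : formProj _ 3 (fieldForm K deg3 2 : LocalForm K n deg3) = fieldForm K deg3 2 :=
    formProj_fieldForm (2 : Fin 3)
  fin_cases a
  · exact h0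
  · exact formProj_add_of_eq h1 (formProj_smul_of_eq c (formProj_extD_of_eq h0))
  · change formProj _ 3 (_ - _ - _) = _
    rw [map_sub, map_sub, h2, formProj_smul_of_eq c (formProj_mul_of_eq h0 h1),
      formProj_smul_of_eq _ (formProj_mul_of_eq h0 (formProj_extD_of_eq h0))]
    rfl

theorem shift3_mem (c : K) (a : Fin 3) : shift3 K n c a ∈ smallAlgebra K deg3 := by
  have h := fun a : Fin 3 => fieldForm_mem_smallAlgebra (K := K) (n := n) (deg := deg3) a
  have h' := extD_fieldForm_mem_smallAlgebra (K := K) (n := n) (deg := deg3) 0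
  fin_cases a
  · exact h 0
  · exact add_mem (h 1) (Subalgebra.smul_mem _ h' c)
  · exact sub_mem (sub_mem (h 2) (Subalgebra.smul_mem _ (mul_mem (h 0) (h 1)) c))
      (Subalgebra.smul_mem _ (mul_mem (h 0) h') _)

theorem formMap_shift3 (c : K) (a : Fin 3) :
    formMap (substField (shift3 K n c)) (fieldForm K deg3 a) = shift3 K n c a :=
  formMap_substField_fieldForm (formProj_shift3 c a)

theorem formMap_shift3_shift3 [CharZero K] (c : K) (hc : c * c = 1) (a : Fin 3) :
    formMap (substField (shift3 K n (-c))) (shift3 K n c a) = fieldForm K deg3 a := by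
  fin_cases a
  · exact formMap_shift3 _ 0
  · change formMap (substField (shift3 K n (-c))) (fieldForm K deg3 1 + c • extD K deg3 (fieldForm K deg3 0)) = _
    rw [map_add, map_smul, formMap_substField_extD, formMap_shift3, formMap_shift3]
    change _ + (-c) • _ + c • extD K deg3 (fieldForm K deg3 0) = fieldForm K deg3 1
    rw [add_assoc, ← add_smul, neg_add_cancel, zero_smul, add_zero]
  · change formMap (substField (shift3 K n (-c))) (fieldForm K deg3 2 - c • (fieldForm K deg3 0 * fieldForm K deg3 1) -
      (1 / 2 : K) • (fieldForm K deg3 0 * extD K deg3 (fieldForm K deg3 0))) = fieldForm K deg3 2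
    simp only [map_sub, map_smul, map_mul, formMap_substField_extD, formMap_shift3]
    change (_ - (-c) • _ - (1 / 2 : K) • _) - c • (fieldForm K deg3 0 * (_ + (-c) • _)) -
      (1 / 2 : K) • (fieldForm K deg3 0 * extD K deg3 (fieldForm K deg3 0)) = fieldForm K deg3 2
    have aux : ∀ (V : Type _) [AddCommGroup V] [Module K V] (C u v : V),
        C - (-c) • u - (1 / 2 : K) • v - c • (u + (-c) • v) - (1 / 2 : K) • v = C := by
      intro V _ _ C u v
      match_scalars
      · ring
      · ring
      · linear_combination hc
    rw [mul_add, mul_smul_comm]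
    exact aux _ _ _ _

/-- The shift of the fields turns the third model into the abelian curvatures `B`, `dB` and `dC`. -/
theorem invariantCohomology_inv3 [CharZero K] : InvariantCohomologyInSmallAlgebra K deg3 (inv3 K n) := by
  have hc : (-1 : K) * -1 = 1 := by ring
  have hinv := formMap_shift3_shift3 (n := n) (-1 : K) hc
  rw [neg_neg] at hinv
  set A : LocalForm K n deg3 := fieldForm K deg3 0 with hA
  set B : LocalForm K n deg3 := fieldForm K deg3 1 with hB
  set C : LocalForm K n deg3 := fieldForm K deg3 2 with hC
  have hdAB : extD K deg3 (A * B) = extD K deg3 A * B - A * extD K deg3 B := extD_A3_mul B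
  have hdAA : extD K deg3 (A * extD K deg3 A) = extD K deg3 A * extD K deg3 A := by
    rw [hA, extD_A3_mul, extD_extD, mul_zero, sub_zero]
  have hcomm : B * extD K deg3 A = extD K deg3 A * B := B3_mul_extD_A3
  have hdC : ∀ c : K, extD K deg3 (C - c • (A * B) - (1 / 2 : K) • (A * extD K deg3 A)) =
      extD K deg3 C - c • (extD K deg3 A * B - A * extD K deg3 B) -
        (1 / 2 : K) • (extD K deg3 A * extD K deg3 A) := fun c => by
    rw [map_sub, map_sub, map_smul, map_smul, hdAB, hdAA]
  have hdB : ∀ c : K, extD K deg3 (B + c • extD K deg3 A) = extD K deg3 B := fun c => by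
    rw [map_add, map_smul, extD_extD, smul_zero, add_zero]
  have e0 : ∀ c : K, formMap (substField (shift3 K n c)) A = A := fun c => formMap_shift3 c 0
  have e1 : ∀ c : K, formMap (substField (shift3 K n c)) B = B + c • extD K deg3 A :=
    fun c => formMap_shift3 c 1
  have e2 : ∀ c : K, formMap (substField (shift3 K n c)) C =
      C - c • (A * B) - (1 / 2 : K) • (A * extD K deg3 A) := fun c => formMap_shift3 c 2
  refine invariantCohomology_of_substField (β := shift3 K n (-1)) (β' := shift3 K n 1)
    (curv' := abelianCurvatures K n deg3 ![.absent, .free, .closed]) (formProj_shift3 _)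
    (formProj_shift3 _) (shift3_mem _) (shift3_mem _) hinv ?_ ?_
    (invariantCohomology_abelianInv (b := 1) (fun a => ?_) fun a => ?_)
  · have mB : B ∈ FormsIn (Subalgebra.toSubmodule (curvatureAlgebra K (n := n) deg3
        (abelianCurvatures K n deg3 ![.absent, .free, .closed]))) :=
      mem_formsIn_of_curv ⟨1, Or.inl ⟨rfl, rfl⟩⟩
    have mC : extD K deg3 C ∈ FormsIn (Subalgebra.toSubmodule (curvatureAlgebra K (n := n) deg3
        (abelianCurvatures K n deg3 ![.absent, .free, .closed]))) :=
      mem_formsIn_of_curv ⟨2, Or.inr ⟨rfl, rfl⟩⟩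
    rintro _ (rfl | rfl | rfl)
    · rw [F3, map_add, formMap_substField_extD, e0, e1, neg_one_smul_form, add_neg_cancel_comm_assoc]
      exact mB
    · rw [H3, formMap_substField_extD, e1, hdB]
      exact extD_mem_formsIn (fun μ x hx => totalDeriv_mem_curvatureAlgebra μ hx) mB
    · have e : formMap (substField (shift3 K n (-1))) (G3 K n) =
          extD K deg3 C + (1 / 2 : K) • (B * B) := by
        rw [G3, map_add, map_add, map_mul, map_smul, map_pow, formMap_substField_extD,
          formMap_substField_extD, e0, e1, e2, hdC, hdB, neg_one_smul_form, neg_one_smul_form,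
          ← sub_eq_add_neg, pow_two, sub_mul, mul_sub, mul_sub, hcomm]
        have aux : ∀ (V : Type _) [AddCommGroup V] [Module K V] (C u v w x : V),
            C - -(u - v) - (1 / 2 : K) • w + v + (1 / 2 : K) • (x - u - (u - w)) =
              C + (1 / 2 : K) • x := by
          intro V _ _ C u v w x
          match_scalars <;> ring
        exact aux _ _ _ _ _ _
      rw [e]
      exact Submodule.add_mem _ mC (Submodule.smul_mem _ _
        (mul_mem_formsIn (fun _ hx _ hy => Subalgebra.mul_mem _ hx hy) mB mB))
  · have mF : F3 K n ∈ FormsIn (Subalgebra.toSubmodule (inv3 K n)) :=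
      mem_formsIn_of_curv (Or.inl rfl)
    have mG : G3 K n ∈ FormsIn (Subalgebra.toSubmodule (inv3 K n)) :=
      mem_formsIn_of_curv (Or.inr (Or.inr rfl))
    rintro _ ⟨a, ha⟩
    fin_cases a
    · rcases ha with ⟨h, -⟩ | ⟨h, -⟩ <;> cases h
    · rcases ha with ⟨-, rfl⟩ | ⟨h, -⟩
      · have e : formMap (substField (shift3 K n 1)) B = F3 K n := by
          rw [e1, one_smul, F3, add_comm]
        exact (congrArg (· ∈ FormsIn _) e).mpr mF
      · cases h
    · rcases ha with ⟨h, -⟩ | ⟨-, rfl⟩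
      · cases h
      · have e : formMap (substField (shift3 K n 1)) (extD K deg3 C) =
            G3 K n - (1 / 2 : K) • (F3 K n * F3 K n) := by
          rw [formMap_substField_extD, e2, hdC, one_smul, G3, F3, ← hA, ← hB, ← hC, pow_two,
            add_mul, mul_add, mul_add, hcomm]
          have aux : ∀ (V : Type _) [AddCommGroup V] [Module K V] (C u v w x : V),
              C - (u - v) - (1 / 2 : K) • w =
                C + v + (1 / 2 : K) • x - (1 / 2 : K) • (w + u + (u + x)) := by
            intro V _ _ C u v w x
            match_scalars <;> ring
          exact aux _ _ _ _ _ _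
        refine (congrArg (· ∈ FormsIn _) e).mpr (Submodule.sub_mem _ mG (Submodule.smul_mem _ _
          (mul_mem_formsIn (fun _ hx _ hy => Subalgebra.mul_mem _ hx hy) mF mF)))
  · fin_cases a <;> simp
  · fin_cases a <;> simp

end ThirdModel

end ChaplineManton

end

theorem theorem5p2 (n : ℕ) :
    (∀ (K : Type*) [Field K] [CharZero K],
      (∀ p : ℕ, 1 ≤ p →
        ChaplineManton.InvariantCohomologyInSmallAlgebra K (ChaplineManton.deg1 p)
          (ChaplineManton.inv1 K n p)) ∧
      (∀ r : ℕ, 1 ≤ r →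
        ChaplineManton.InvariantCohomologyInSmallAlgebra K (ChaplineManton.deg2 r)
          (ChaplineManton.inv2 K n r)) ∧
      ChaplineManton.InvariantCohomologyInSmallAlgebra K ChaplineManton.deg3
        (ChaplineManton.inv3 K n)) ∧
    (∀ (N : ℕ), 2 ≤ N → ∀ (κ : Type*) [Fintype κ] (T : Module.Basis κ ℝ (ChaplineManton.su N)),
      ChaplineManton.InvariantCohomologyInSmallAlgebra ℂ (ChaplineManton.deg4 κ)
        (ChaplineManton.inv4 n T)) := by
  refine ⟨fun K _ _ => ⟨fun p hp => ChaplineManton.invariantCohomology_inv1 hp,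
    fun r hr => ChaplineManton.invariantCohomology_inv2 K n r hr,
    ChaplineManton.invariantCohomology_inv3⟩,
    fun N _ κ _ T => ChaplineManton.invariantCohomology_inv4 T⟩
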